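/- Let $n\ge 1$ and let $V(x)=\sum_{j\ge1}\frac{t_j}{j}x^j$ be a real polynomial. For real numbers $\mu_1<\dots<\mu_{2n}$ put $\mathcal D=\bigcup_{i=1}^n[\mu_{2i-1},\mu_{2i}]$ and let $\tilde y(p)=\sqrt{\prod_{\alpha=1}^{2n}(p-\mu_\alpha)}$ be the branch that is holomorphic on $\mathbb C\setminus\mathcal D$ with $\tilde y(p)\sim p^n$ at infinity. Let $$M(p)=\oint_{C_\infty}\frac{d\omega}{2\pi i}\frac{V'(\omega)}{(\omega-p)\tilde y(\omega)},\qquad M^{(k)}_\alpha=\oint_{C_{\mathcal D}}\frac{d\omega}{2\pi i}\frac{V'(\omega)}{(\omega-\mu_\alpha)^k\tilde y(\omega)}\quad(M_\alpha^{(1)}=M(\mu_\alpha)),$$ $y=M\tilde y$ and $W_0=\frac12(V'-y)$. We call $(V,\mu)$ a planar $n$-cut solution of the Hermitian one-matrix model if $$\frac12\oint_{C_{\mathcal D}}\frac{d\omega}{2\pi i}\frac{\omega^kV'(\omega)}{\tilde y(\omega)}=\delta_{k,n},\qquad k=0,\dots,n,$$ i.e. $W_0(p)=\frac1p+O(p^{-2})$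 at infinity; its planar eigenvalue density on $\mathcal D$ is $\rho(\lambda)=\frac1{2\pi}\operatorname{Im}y(\lambda+i0)$, and its filling fractions are $S_j=\oint_{A_j}\frac{d\omega}{4\pi i}\,y(\omega)$, $j=1,\dots,n-1$, where the cycle $A_j$ encircles the $j$-th cut. Assume throughout that $M(\mu_\alpha)\ne0$ for all $\alpha$. For a quantity $\Phi$ attached to planar solutions, $d\Phi/dt_j$ denotes the derivative along the planar solution when $t_j$ varies and all other couplings and all filling fractions $S_1,\dots,S_{n-1}$ are held fixed, and $$\frac{d\Phi}{dV}(p)=-\sum_{j\ge1}\frac{j}{p^{j+1}}\frac{d\Phi}{dt_j},\qquad |p|>\max_\alpha|\mu_\alpha| ,$$ is the loop insertion operator. A genus-one loop mean at $(V,\mu)$ is a holomorphic function $W_1$ on $\mathbb C\setminus\mathcal D$ with $W_1(p)=O(p^{-2})$ at infinity such that, for $|p|>\max_\alpha|\mu_\alpha|$, the genus-one loop equation $$\oint_{C_{\mathcal D}}\frac{d\omega}{2\pi i}\frac{V'(\omega)}{p-\omega}W_1(\omega)-2W_0(p)W_1(p)=\frac{dW_0(p)}{dV}(p)$$ holds (the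 contour $C_{\mathcal D}$ encircles $\mathcal D$ but not $p$) and such that $W_1(p)$ is, as a function of $p$, a finite linear combination of the total derivatives $\frac{d\mu_\alpha}{dV}(p)$ and $\frac{dM_\alpha^{(k)}}{dV}(p)$, $k\ge1$. A function $G$ of planar solutions is a genus-one free energy if $\frac{dG}{dV}(p)$ exists and is a genus-one loop mean. Let $$F_1=-\frac1{24}\log\Big(\prod_{\alpha=1}^{2n}M(\mu_\alpha)\cdot\Delta^4\cdot(\det Q)^{12}\Big),\quad \Delta=\prod_{\alpha<\beta}(\mu_\alpha-\mu_\beta),\quad Q_{j,i}=\oint_{A_j}\frac{\lambda^{i-1}}{\tilde y(\lambda)}\,d\lambda,\quad i,j=1,\dots,n-1,$$ with $\log$ the principal branch. Then: (a) The argument of the logarithm is a nonzero real number, and it is positive if $\rho\ge0$ on $\mathcal D$. (b) There is exactly one genus-one loop mean $W_1$ at $(V,\mu)$, and $F_1$ is a genus-one free energy: $W_1(p)=\frac{dF_1}{dV}(p)$ for $|p|>\max_\alpha|\mu_\alpha|$. The derivatives $dF_1/dt_j$ exist, and in particular the planar solution can be continued in each $t_j$ at fixed filling fractions. (c) $F_1$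 is unique up to a term independent of the couplings: if $G$ is a genus-one free energy at every point of a continuous one-parameter family of planar solutions (with $M(\mu_\alpha)\neq0$) through $(V,\mu)$ along which a single $t_j$ runs over an open interval and the other couplings and the filling fractions are fixed, then $G-F_1$ is constant along that family. -/

import Mathlib

/-!
The planar `n`-cut solution of the Hermitian one-matrix model with polynomial potential `V`,
the loop insertion operator at fixed filling fractions, and the genus-one loop equation.
The number of cuts is `n = g + 1`, so that `g = n - 1` is the genus of the spectral curve.
Branch points are indexed from `0`: the cuts are `[μ 0, μ 1], [μ 2, μ 3], …`.
-/

open scoped Topology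
open Filter

noncomputable section

namespace MultiCut

/-- The `2 n` branch points. -/
abbrev BranchPoints (g : ℕ) : Type := Fin (2 * (g + 1)) → ℝ

/-- Left end of the `i`-th cut. -/
def lo {g : ℕ} (μ : BranchPoints g) (i : Fin (g + 1)) : ℝ := μ ⟨2 * i.val, by omega⟩

/-- Right end of the `i`-th cut. -/
def hi {g : ℕ} (μ : BranchPoints g) (i : Fin (g + 1)) : ℝ := μ ⟨2 * i.val + 1, by omega⟩

/-- The union of the cuts, as a subset of the real line. -/
def support {g : ℕ} (μ : BranchPoints g) : Set ℝ := ⋃ i, Set.Icc (lo μ i) (hi μ i)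

/-- The complement of the cuts in the complex plane. -/
def offCuts {g : ℕ} (μ : BranchPoints g) : Set ℂ := ((fun x : ℝ => (x : ℂ)) '' support μ)ᶜ

/-- The branch of `√((z - a) (z - b))` that is holomorphic off `[a, b]` and `∼ z` at infinity.
On the open interval it takes the boundary value from the upper half plane. -/
def cutSqrt (a b : ℝ) (z : ℂ) : ℂ := (z - a) * ((z - b) / (z - a)) ^ (1 / 2 : ℂ)

/-- `ỹ(z) = √(∏ (z - μ_α))`, holomorphic off the cuts and `∼ z ^ n` at infinity. -/
def ytilde {g : ℕ} (μ : BranchPoints g) (z : ℂ) : ℂ := ∏ i, cutSqrt (lo μ i) (hi μ i) z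

/-- `V'(z)` at a complex point. -/
def dV (V : Polynomial ℝ) (z : ℂ) : ℂ := Polynomial.aeval z (Polynomial.derivative V)

/-- `∮ dω/(2πi) V'(ω) / ((ω - p) ^ k ỹ(ω))` over a circle around the origin that encloses
`p` and all the cuts. -/
def momentFn {g : ℕ} (V : Polynomial ℝ) (μ : BranchPoints g) (k : ℕ) (p : ℂ) : ℂ :=
  (2 * (Real.pi : ℂ) * Complex.I)⁻¹ *
    ∮ ω in C(0, 1 + ‖p‖ + ∑ α, |μ α|), dV V ω / ((ω - p) ^ k * ytilde μ ω)

/-- The polynomial `M(p) = ∮_{C_∞} dω/(2πi) V'(ω) / ((ω - p) ỹ(ω))`. -/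
def M {g : ℕ} (V : Polynomial ℝ) (μ : BranchPoints g) (p : ℂ) : ℂ := momentFn V μ 1 p

/-- The moments `M_α^{(k)} = ∮_{C_D} dω/(2πi) V'(ω) / ((ω - μ_α) ^ k ỹ(ω))`. In particular
`M_α^{(1)} = M(μ_α)`. -/
def moment {g : ℕ} (V : Polynomial ℝ) (μ : BranchPoints g) (α : Fin (2 * (g + 1))) (k : ℕ) : ℂ :=
  momentFn V μ k (μ α)

/-- `y = M ỹ`. -/
def y {g : ℕ} (V : Polynomial ℝ) (μ : BranchPoints g) (p : ℂ) : ℂ := M V μ p * ytilde μ p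

/-- The planar loop mean `W₀ = (V' - y) / 2`. -/
def W0 {g : ℕ} (V : Polynomial ℝ) (μ : BranchPoints g) (p : ℂ) : ℂ := (dV V p - y V μ p) / 2

/-- The planar eigenvalue density `ρ = Im y(x + i0) / (2π)` on the cuts. -/
def density {g : ℕ} (V : Polynomial ℝ) (μ : BranchPoints g) (x : ℝ) : ℝ :=
  (y V μ x).im / (2 * Real.pi)

/-- `μ` are the branch points of a planar `n`-cut solution for `V`: they are distinct, increasing,
and satisfy `½ ∮ dω/(2πi) ω ^ k V'(ω) / ỹ(ω) = δ_{k,n}` for `0 ≤ k ≤ n`, which says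
`W₀(p) = 1/p + O(1/p²)` at infinity. -/
def IsPlanarSolution {g : ℕ} (V : Polynomial ℝ) (μ : BranchPoints g) : Prop :=
  StrictMono μ ∧ ∀ k : ℕ, k ≤ g + 1 →
    (1 / 2 : ℂ) * ((2 * (Real.pi : ℂ) * Complex.I)⁻¹ *
      ∮ ω in C(0, 1 + ∑ α, |μ α|), ω ^ k * dV V ω / ytilde μ ω) = if k = g + 1 then 1 else 0

/-- A solution is regular when `M` vanishes at no branch point. -/
def IsRegular {g : ℕ} (V : Polynomial ℝ) (μ : BranchPoints g) : Prop :=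
  ∀ α, M V μ (μ α) ≠ 0

/-- A point of the real line just left of the `j`-th cut, in the adjacent gap. -/
def leftPoint {g : ℕ} (μ : BranchPoints g) (j : Fin g) : ℝ :=
  if h : j.val = 0 then lo μ 0 - 1
  else (hi μ ⟨j.val - 1, by omega⟩ + lo μ j.castSucc) / 2

/-- A point of the real line just right of the `j`-th cut, in the adjacent gap. -/
def rightPoint {g : ℕ} (μ : BranchPoints g) (j : Fin g) : ℝ :=
  (hi μ j.castSucc + lo μ j.succ) / 2

/-- The counterclockwise integral over the boundary of the rectangle `[l, r] × [-1, 1]`. -/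
def rectIntegral (l r : ℝ) (f : ℂ → ℂ) : ℂ :=
  (∫ x in l..r, f (x - Complex.I)) - (∫ x in l..r, f (x + Complex.I))
    + Complex.I * (∫ t in (-1 : ℝ)..1, f (r + t * Complex.I))
    - Complex.I * (∫ t in (-1 : ℝ)..1, f (l + t * Complex.I))

/-- `∮_{A_j} f`, where the cycle `A_j` encircles the `j`-th cut and no other one, for the first
`n - 1` cuts. -/
def aPeriod {g : ℕ} (μ : BranchPoints g) (j : Fin g) (f : ℂ → ℂ) : ℂ :=
  rectIntegral (leftPoint μ j) (rightPoint μ j) f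

/-- The filling fractions (occupation numbers) `S_j = ∮_{A_j} y / (4πi)`. -/
def filling {g : ℕ} (V : Polynomial ℝ) (μ : BranchPoints g) (j : Fin g) : ℂ :=
  (4 * (Real.pi : ℂ) * Complex.I)⁻¹ * aPeriod μ j (y V μ)

/-- The potential with the coupling `t_j` shifted by `ε`, for `V(x) = ∑ t_j x ^ j / j`. -/
def shift (V : Polynomial ℝ) (j : ℕ) (ε : ℝ) : Polynomial ℝ :=
  V + Polynomial.monomial j (ε / j)

/-- `γ` follows the planar solution when `t_j` varies near its value in `V`, all other couplings
and all the filling fractions being held fixed. -/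
def IsDeformation {g : ℕ} (V : Polynomial ℝ) (μ : BranchPoints g) (j : ℕ)
    (γ : ℝ → BranchPoints g) : Prop :=
  γ 0 = μ ∧ ContinuousAt γ 0 ∧
    ∀ᶠ ε in 𝓝 (0 : ℝ), IsPlanarSolution (shift V j ε) (γ ε) ∧
      ∀ i, filling (shift V j ε) (γ ε) i = filling V μ i

/-- `dΦ/dt_j = d` at the planar solution `(V, μ)`, at fixed filling fractions, for a quantity `Φ`
attached to planar solutions. Existence of the deformation is part of the assertion. -/
def HasCouplingDeriv {g : ℕ} (Φ : Polynomial ℝ → BranchPoints g → ℂ)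
    (V : Polynomial ℝ) (μ : BranchPoints g) (j : ℕ) (d : ℂ) : Prop :=
  (∃ γ, IsDeformation V μ j γ) ∧
    ∀ γ, IsDeformation V μ j γ → HasDerivAt (fun ε : ℝ => Φ (shift V j ε) (γ ε)) d 0

/-- `(dΦ/dV)(p) = w` at `(V, μ)`, for the loop insertion operator
`d/dV(p) = - ∑_{j ≥ 1} j p^{-j-1} d/dt_j` at fixed filling fractions. -/
def HasLoopInsertion {g : ℕ} (Φ : Polynomial ℝ → BranchPoints g → ℂ)
    (V : Polynomial ℝ) (μ : BranchPoints g) (p w : ℂ) : Prop :=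
  ∃ d : ℕ → ℂ, (∀ j, 1 ≤ j → HasCouplingDeriv Φ V μ j (d j)) ∧
    HasSum (fun j : ℕ => -((j : ℂ) / p ^ (j + 1) * d j)) w

/-- `(K̂ f)(p) = ∮_{C_D} dω/(2πi) V'(ω) f(ω) / (p - ω)`, over the circle of radius `r`. -/
def loopOp (V : Polynomial ℝ) (r : ℝ) (f : ℂ → ℂ) (p : ℂ) : ℂ :=
  (2 * (Real.pi : ℂ) * Complex.I)⁻¹ * ∮ ω in C(0, r), dV V ω / (p - ω) * f ω

/-- `W` is the genus-one loop mean `W₁` at the planar solution `(V, μ)`. -/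
structure IsGenusOneLoopMean {g : ℕ} (V : Polynomial ℝ) (μ : BranchPoints g) (W : ℂ → ℂ) :
    Prop where
  /-- `W` is holomorphic off the cuts. -/
  holo : DifferentiableOn ℂ W (offCuts μ)
  /-- `W(p) = O(1/p²)` at infinity. -/
  decay : W =O[Bornology.cobounded ℂ] fun p => 1 / p ^ 2
  /-- The genus-one loop equation `(K̂ - 2 W₀(p)) W(p) = dW₀(p)/dV(p)`; the circle of radius `r`
  encloses the cuts but not `p`. -/
  loop : ∀ (p : ℂ) (r : ℝ), (∀ α, |μ α| < r) → r < ‖p‖ →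
    HasLoopInsertion (fun V' μ' => W0 V' μ' p) V μ p (loopOp V r W p - 2 * W0 V μ p * W p)
  /-- As a function of `p`, `W(p)` is a finite linear combination of the total derivatives
  `dμ_α/dV(p)` and `dM_α^{(k)}/dV(p)`, `k ≥ 1`. -/
  total : ∃ (k : ℕ) (a : Fin (2 * (g + 1)) → ℂ) (b : Fin (2 * (g + 1)) → Fin k → ℂ),
    ∀ p : ℂ, (∀ α, |μ α| < ‖p‖) →
      HasLoopInsertion (fun V' μ' => (∑ α, a α * (μ' α : ℂ)) +
        ∑ α, ∑ l, b α l * moment V' μ' α (l.val + 1)) V μ p (W p)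

/-- `G` is, at `(V, μ)`, a genus-one free energy: `dG/dV(p)` is the genus-one loop mean. -/
def IsGenusOneFreeEnergyAt {g : ℕ} (G : Polynomial ℝ → BranchPoints g → ℂ)
    (V : Polynomial ℝ) (μ : BranchPoints g) : Prop :=
  ∃ W : ℂ → ℂ, IsGenusOneLoopMean V μ W ∧
    ∀ p : ℂ, (∀ α, |μ α| < ‖p‖) → HasLoopInsertion G V μ p (W p)

/-- The Vandermonde product `Δ = ∏_{α < β} (μ_α - μ_β)`. -/
def vdm {g : ℕ} (μ : BranchPoints g) : ℂ := ∏ α, ∏ β ∈ Finset.Ioi α, ((μ α : ℂ) - (μ β : ℂ))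

/-- The matrix `Q_{j,i} = ∮_{A_j} λ^{i-1} / ỹ(λ) dλ`, `1 ≤ i, j ≤ n - 1` (indices from `0` here). -/
def Q {g : ℕ} (μ : BranchPoints g) : Matrix (Fin g) (Fin g) ℂ :=
  Matrix.of fun j i => aPeriod μ j fun z => z ^ i.val / ytilde μ z

/-- `∏_α M(μ_α) · Δ ^ 4 · (det Q) ^ 12`. -/
def logArg {g : ℕ} (V : Polynomial ℝ) (μ : BranchPoints g) : ℂ :=
  (∏ α, M V μ (μ α)) * vdm μ ^ 4 * (Q μ).det ^ 12

/-- `F₁ = -(1/24) log (∏_α M(μ_α) · Δ ^ 4 · (det Q) ^ 12)`. -/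
def F1 {g : ℕ} (V : Polynomial ℝ) (μ : BranchPoints g) : ℂ :=
  -(1 / 24 : ℂ) * Complex.log (logArg V μ)

end MultiCut

end

/-! Write `T = ytilde ^ 2`. Along a coupling `t_j` at fixed filling fractions the variation of `y`
has the form `h / ytilde` with a polynomial `h`. The planar equations force `h / ytilde = z ^ (j -
1) + O(z ^ (-2))`, and the fixed filling fractions force the `A`-periods of `h / ytilde` to vanish.
A polynomial of degree less than `g` with zero periods is zero (`det_Q_ne_zero`, `eq_zero_of_per`),
so `h = hpoly (j - 1)`, which depends on the branch points only. At a branch point moving with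
velocity `v_α` one has `h(μ_α) = -(1/2) M(μ_α) T'(μ_α) v_α`. As `M(μ_α) ≠ 0`, the linearized planar
system is injective, and the implicit function theorem yields the deformation and its velocity
(`exists_velocity`).

Hence every derivative of a combination of branch points and moments is a functional `h ↦ res (h
λ)`, whose symbol `λ = O(1/z)` is rational with poles at the branch points only. Summing over `j`,
the loop insertion of such a functional is `meanOf λ`, the derivative of `ytilde * (λ - corr)`. Here
`corr` combines Cauchy transforms of densities on the cuts and accounts for the removal of the
periods (`hasSum_res_hpoly`). In the same way `dW0(p)/dV(p)` is the explicit function `W00`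
(`hasSum_W00`).

Existence: the logarithmic derivatives of `M(μ_α)`, `Δ` and `det Q` combine into values and first
derivatives of `h` at the branch points (`F1_variation_eq`), so the symbol `lamF` of `F1` has double
poles. The loop equation says that `M ytilde W - W00` is the polynomial part of `V' W`. The
coefficients of `lamF` are those for which all poles of `M ytilde W - W00` cancel (`T_sq_dvd_loop`),
and the remaining polynomial is identified by its growth at infinity (`loop_meanOf_lamF`).

Uniqueness: two loop means differ by `meanOf λ` with `λ` rational and `M ytilde (meanOf λ)` a
polynomial. A pole of order `m` in `λ` would survive with the nonzero factor `1/2 - m`, so `λ` is a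
polynomial that is `O(1/z)`, hence zero (`symbol_eq_zero`). For free energies, comparing Laurent
coefficients in `1/p` gives `dG/dt_j = dF1/dt_j` for each `j`, and the difference is constant along
a family.

Sign: `det Q` is `I ^ g` times a nonzero real number, and a nonnegative density makes `M` take the
same sign at both ends of each cut (`Mpoly_lo_mul_hi_pos`). -/

noncomputable section

namespace MultiCut

open Complex Polynomial

variable {g : ℕ}

/-! ### Contour integrals and growth orders of functions holomorphic outside a disc -/

/-- The normalized integral over the circle of radius `r` around the origin. -/
def res (r : ℝ) (f : ℂ → ℂ) : ℂ := (2 * (Real.pi : ℂ) * Complex.I)⁻¹ * ∮ z in C(0, r), f z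

/-- `f` is holomorphic outside the closed disc of radius `ρ`. -/
def Ext (ρ : ℝ) (f : ℂ → ℂ) : Prop := DifferentiableOn ℂ f {z | ρ < ‖z‖}

/-- `f = O(z ^ k)` at infinity. -/
def Gro (k : ℤ) (f : ℂ → ℂ) : Prop := f =O[Bornology.cobounded ℂ] fun z => z ^ k

theorem eventually_lt_norm (R : ℝ) : ∀ᶠ z in Bornology.cobounded ℂ, R < ‖z‖ :=
  (tendsto_norm_cobounded_atTop (E := ℂ)).eventually (eventually_gt_atTop R)

theorem eventually_ne_zero_cobounded : ∀ᶠ z in Bornology.cobounded ℂ, z ≠ 0 :=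
  (eventually_lt_norm 0).mono fun _ hz => norm_pos_iff.1 hz

theorem Gro.of_bound {k : ℤ} {f : ℂ → ℂ} (C R : ℝ) (h : ∀ z, R < ‖z‖ → ‖f z‖ ≤ C * ‖z‖ ^ k) :
    Gro k f :=
  Asymptotics.IsBigO.of_bound C ((eventually_lt_norm R).mono fun z hz => by
    rw [norm_zpow]; exact h z hz)

theorem Gro.exists_bound {k : ℤ} {f : ℂ → ℂ} (h : Gro k f) :
    ∃ C R : ℝ, 0 < C ∧ 0 < R ∧ ∀ z, R < ‖z‖ → ‖f z‖ ≤ C * ‖z‖ ^ k := by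
  obtain ⟨C, hC, hb⟩ := h.exists_pos
  have hb' := hb.bound
  rw [(Metric.hasBasis_cobounded_compl_closedBall (0 : ℂ)).eventually_iff] at hb'
  obtain ⟨R, -, hR⟩ := hb'
  refine ⟨C, max R 1, hC, by positivity, fun z hz => ?_⟩
  have := hR (x := z) (by
    simp only [Set.mem_compl_iff, Metric.mem_closedBall, dist_zero_right, not_le]
    exact (le_max_left _ _).trans_lt hz)
  rwa [norm_zpow] at this

theorem Gro.mono {k l : ℤ} {f : ℂ → ℂ} (h : Gro k f) (hkl : k ≤ l) : Gro l f := by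
  refine h.trans (Gro.of_bound 1 1 fun z hz => ?_)
  rw [norm_zpow, one_mul]
  exact zpow_le_zpow_right₀ hz.le hkl

theorem Gro.add {k : ℤ} {f g : ℂ → ℂ} (hf : Gro k f) (hg : Gro k g) :
    Gro k (fun z => f z + g z) := Asymptotics.IsBigO.add hf hg

theorem Gro.sub {k : ℤ} {f g : ℂ → ℂ} (hf : Gro k f) (hg : Gro k g) :
    Gro k (fun z => f z - g z) := Asymptotics.IsBigO.sub hf hg

theorem Gro.neg {k : ℤ} {f : ℂ → ℂ} (hf : Gro k f) : Gro k (fun z => -f z) :=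
  Asymptotics.IsBigO.neg_left hf

theorem Gro.const_mul {k : ℤ} {f : ℂ → ℂ} (c : ℂ) (hf : Gro k f) :
    Gro k (fun z => c * f z) := Asymptotics.IsBigO.const_mul_left hf c

theorem Gro.mul {k l m : ℤ} {f g : ℂ → ℂ} (hf : Gro k f) (hg : Gro l g) (h : m = k + l) :
    Gro m (fun z => f z * g z) := by
  refine (Asymptotics.IsBigO.mul hf hg).congr' EventuallyEq.rfl ?_
  filter_upwards [eventually_ne_zero_cobounded] with z hz
  rw [h, zpow_add₀ hz]

theorem Gro.sum {ι : Type*} {s : Finset ι} {k : ℤ} {f : ι → ℂ → ℂ} (h : ∀ i ∈ s, Gro k (f i)) :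
    Gro k (fun z => ∑ i ∈ s, f i z) := Asymptotics.IsBigO.fun_sum h

theorem Gro.congr {k : ℤ} {f g : ℂ → ℂ} (R : ℝ) (hf : Gro k f)
    (h : ∀ z, R < ‖z‖ → f z = g z) : Gro k g :=
  Asymptotics.IsBigO.congr' hf ((eventually_lt_norm R).mono h) EventuallyEq.rfl

theorem gro_const (c : ℂ) : Gro 0 fun _ => c :=
  Gro.of_bound ‖c‖ 0 fun z _ => by simp

theorem gro_zpow (k : ℤ) : Gro k fun z => z ^ k := Asymptotics.isBigO_refl _ _

theorem gro_pow (k : ℕ) : Gro k fun z => z ^ k := by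
  simpa using gro_zpow (k : ℤ)

theorem gro_inv_sub (a : ℂ) : Gro (-1) fun z => (z - a)⁻¹ := by
  refine Gro.of_bound 2 (2 * ‖a‖) fun z hz => ?_
  have h1 : ‖z‖ / 2 ≤ ‖z - a‖ := by
    have := norm_sub_norm_le z a
    linarith
  have h0 : 0 < ‖z‖ := by linarith [norm_nonneg a]
  rw [norm_inv, zpow_neg_one, ← div_eq_mul_inv, inv_le_comm₀ (by linarith) (by positivity)]
  simpa using h1

theorem gro_inv_sub_pow (a : ℂ) (k : ℕ) : Gro (-k) fun z => ((z - a) ^ k)⁻¹ := by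
  induction k with
  | zero => simpa using gro_const 1
  | succ k ih =>
    refine ((ih.mul (gro_inv_sub a) (m := -((k + 1 : ℕ) : ℤ)) (by push_cast; ring))).congr 0 ?_
    intro z _
    rw [pow_succ, mul_inv]

theorem gro_eval (P : ℂ[X]) {d : ℤ} (h : P = 0 ∨ (P.natDegree : ℤ) ≤ d) :
    Gro d fun z => P.eval z := by
  rcases h with rfl | h
  · exact Gro.of_bound 0 0 (by simp)
  simp only [eval_eq_sum_range]
  refine Gro.sum fun i hi => Gro.const_mul _ ((gro_pow i).mono ?_)
  have := Finset.mem_range.1 hi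
  omega

theorem Ext.mono {ρ ρ' : ℝ} {f : ℂ → ℂ} (h : Ext ρ f) (hρ : ρ ≤ ρ') : Ext ρ' f :=
  DifferentiableOn.mono h fun _ hz => lt_of_le_of_lt hρ hz

theorem isOpen_ext (ρ : ℝ) : IsOpen {z : ℂ | ρ < ‖z‖} := isOpen_lt continuous_const continuous_norm

theorem Ext.differentiableAt {ρ : ℝ} {f : ℂ → ℂ} (h : Ext ρ f) {z : ℂ} (hz : ρ < ‖z‖) :
    DifferentiableAt ℂ f z :=
  DifferentiableOn.differentiableAt h ((isOpen_ext ρ).mem_nhds hz)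

theorem Ext.of_at {ρ : ℝ} {f : ℂ → ℂ} (h : ∀ z, ρ < ‖z‖ → DifferentiableAt ℂ f z) : Ext ρ f :=
  fun z hz => (h z hz).differentiableWithinAt

theorem Ext.deriv {ρ : ℝ} {f : ℂ → ℂ} (h : Ext ρ f) : Ext ρ (deriv f) :=
  DifferentiableOn.deriv h (isOpen_ext ρ)

theorem Ext.add {ρ : ℝ} {f g : ℂ → ℂ} (hf : Ext ρ f) (hg : Ext ρ g) :
    Ext ρ (fun z => f z + g z) := DifferentiableOn.add hf hg

theorem Ext.sub {ρ : ℝ} {f g : ℂ → ℂ} (hf : Ext ρ f) (hg : Ext ρ g) :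
    Ext ρ (fun z => f z - g z) := DifferentiableOn.sub hf hg

theorem Ext.mul {ρ : ℝ} {f g : ℂ → ℂ} (hf : Ext ρ f) (hg : Ext ρ g) :
    Ext ρ (fun z => f z * g z) := DifferentiableOn.mul hf hg

theorem Ext.const_mul {ρ : ℝ} {f : ℂ → ℂ} (c : ℂ) (hf : Ext ρ f) :
    Ext ρ (fun z => c * f z) := DifferentiableOn.const_mul hf c

theorem Ext.sum {ι : Type*} {s : Finset ι} {ρ : ℝ} {f : ι → ℂ → ℂ} (h : ∀ i ∈ s, Ext ρ (f i)) :
    Ext ρ (fun z => ∑ i ∈ s, f i z) := DifferentiableOn.fun_sum h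

theorem ext_of_differentiable {ρ : ℝ} {f : ℂ → ℂ} (h : Differentiable ℂ f) : Ext ρ f :=
  h.differentiableOn

theorem ext_eval (ρ : ℝ) (P : ℂ[X]) : Ext ρ fun z => P.eval z :=
  ext_of_differentiable P.differentiable

theorem ext_inv_sub_pow {ρ : ℝ} {a : ℂ} (ha : ‖a‖ ≤ ρ) (k : ℕ) : Ext ρ fun z => ((z - a) ^ k)⁻¹ := by
  refine Ext.of_at fun z hz => ?_
  have : z - a ≠ 0 := sub_ne_zero.2 (by rintro rfl; linarith)
  have h2 : (z - a) ^ k ≠ 0 := pow_ne_zero _ this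
  fun_prop (disch := assumption)

theorem ext_inv_sub {ρ : ℝ} {a : ℂ} (ha : ‖a‖ ≤ ρ) : Ext ρ fun z => (z - a)⁻¹ := by
  simpa using ext_inv_sub_pow ha 1

theorem Ext.continuousOn_sphere {ρ r : ℝ} {f : ℂ → ℂ} (h : Ext ρ f) (hr : ρ < r) :
    ContinuousOn f (Metric.sphere 0 r) :=
  DifferentiableOn.continuousOn (DifferentiableOn.mono h fun z hz => by
    simp only [mem_sphere_iff_norm, sub_zero] at hz
    simpa [hz] using hr)

theorem res_congr {r : ℝ} (h0 : 0 ≤ r) {f g : ℂ → ℂ} (h : ∀ z, ‖z‖ = r → f z = g z) :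
    res r f = res r g := by
  unfold res
  rw [circleIntegral.integral_congr h0 fun z hz => h z (by simpa using hz)]

theorem res_add {r : ℝ} {f g : ℂ → ℂ} (h0 : 0 ≤ r) (hf : ContinuousOn f (Metric.sphere 0 r))
    (hg : ContinuousOn g (Metric.sphere 0 r)) :
    res r (fun z => f z + g z) = res r f + res r g := by
  unfold res
  rw [circleIntegral.integral_add (hf.circleIntegrable h0) (hg.circleIntegrable h0), mul_add]

theorem res_sub {r : ℝ} {f g : ℂ → ℂ} (h0 : 0 ≤ r) (hf : ContinuousOn f (Metric.sphere 0 r))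
    (hg : ContinuousOn g (Metric.sphere 0 r)) :
    res r (fun z => f z - g z) = res r f - res r g := by
  unfold res
  rw [circleIntegral.integral_sub (hf.circleIntegrable h0) (hg.circleIntegrable h0), mul_sub]

theorem res_const_mul (r : ℝ) (c : ℂ) (f : ℂ → ℂ) : res r (fun z => c * f z) = c * res r f := by
  unfold res
  rw [circleIntegral.integral_const_mul]; ring

theorem res_neg (r : ℝ) (f : ℂ → ℂ) : res r (fun z => -f z) = -res r f := by
  simpa using res_const_mul r (-1) f

theorem res_sum {ι : Type*} {s : Finset ι} {r : ℝ} {f : ι → ℂ → ℂ} (h0 : 0 ≤ r)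
    (hf : ∀ i ∈ s, ContinuousOn (f i) (Metric.sphere 0 r)) :
    res r (fun z => ∑ i ∈ s, f i z) = ∑ i ∈ s, res r (f i) := by
  unfold res
  rw [circleIntegral.integral_fun_sum fun i hi => (hf i hi).circleIntegrable h0, Finset.mul_sum]

theorem norm_res_le {r C : ℝ} (h0 : 0 ≤ r) {f : ℂ → ℂ} (h : ∀ z, ‖z‖ = r → ‖f z‖ ≤ C) :
    ‖res r f‖ ≤ r * C :=
  circleIntegral.norm_two_pi_i_inv_smul_integral_le_of_norm_le_const h0
    fun z hz => h z (by simpa using hz)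

theorem res_eq_of_ext {ρ r R : ℝ} {f : ℂ → ℂ} (hf : Ext ρ f) (h0 : 0 ≤ ρ) (hr : ρ < r)
    (hR : ρ < R) : res r f = res R f := by
  wlog hrR : r ≤ R generalizing r R
  · exact (this hR hr (le_of_not_ge hrR)).symm
  unfold res
  rw [← Complex.circleIntegral_eq_of_differentiable_on_annulus_off_countable (h0.trans_lt hr) hrR
    (s := ∅) (by simp)]
  · refine DifferentiableOn.continuousOn (DifferentiableOn.mono hf fun z hz => ?_)
    simp only [Set.mem_sdiff, Metric.mem_ball, dist_zero_right, not_lt] at hz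
    exact hr.trans_le hz.2
  · intro z hz
    simp only [Set.mem_sdiff, Metric.mem_closedBall, dist_zero_right, not_le] at hz
    exact hf.differentiableAt (hr.trans hz.1.2)

/-- The circle is pushed to infinity, where length times the bound `C / S ^ 2` tends to zero. -/
theorem res_eq_zero_of_gro {ρ r : ℝ} {f : ℂ → ℂ} (hf : Ext ρ f) (hg : Gro (-2) f) (h0 : 0 ≤ ρ)
    (hr : ρ < r) : res r f = 0 := by
  obtain ⟨C, R, hC, hR, hb⟩ := hg.exists_bound
  rw [← norm_eq_zero]
  refine le_antisymm (le_of_forall_pos_le_add fun ε hε => ?_) (norm_nonneg _)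
  -- The radius lies beyond both thresholds, and `S ≥ C / ε` makes the bound `C / S` at most `ε`.
  set S := max (max (r + 1) (R + 1)) (C / ε) with hS
  have hS1 : r + 1 ≤ S := (le_max_left _ _).trans (le_max_left _ _)
  have hS2 : R + 1 ≤ S := (le_max_right _ _).trans (le_max_left _ _)
  have hS3 : C / ε ≤ S := le_max_right _ _
  have hS0 : 0 < S := by linarith
  rw [res_eq_of_ext hf h0 hr (R := S) (by linarith)]
  refine (norm_res_le (C := C * S ^ (-2 : ℤ)) hS0.le fun z hz => ?_).trans ?_
  · rw [← hz]; exact hb z (by rw [hz]; linarith)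
  · rw [zero_add]
    have : S * (C * S ^ (-2 : ℤ)) = C / S := by
      rw [zpow_neg]; norm_cast; field_simp
    rw [this, div_le_iff₀ hS0]
    rw [div_le_iff₀ hε] at hS3
    linarith

theorem res_eq_zero_of_differentiable {r : ℝ} {f : ℂ → ℂ} (h0 : 0 ≤ r)
    (h : ∀ z, ‖z‖ ≤ r → DifferentiableAt ℂ f z) : res r f = 0 := by
  unfold res
  rw [Complex.circleIntegral_eq_zero_of_differentiable_on_off_countable h0 (s := ∅) (by simp),
    mul_zero]
  · intro z hz
    exact (h z (by simpa using hz)).continuousAt.continuousWithinAt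
  · intro z hz
    simp only [Set.sdiff_empty, Metric.mem_ball, dist_zero_right] at hz
    exact h z hz.le

theorem res_inv_sub {r : ℝ} {a : ℂ} (ha : ‖a‖ < r) : res r (fun z => (z - a)⁻¹) = 1 := by
  unfold res
  rw [circleIntegral.integral_sub_inv_of_mem_ball (by simpa using ha), inv_mul_cancel₀]
  simp [Real.pi_ne_zero]

theorem res_inv_sub_outer {r : ℝ} {p : ℂ} (h0 : 0 ≤ r) (hp : r < ‖p‖) {Q : ℂ[X]} (k : ℕ) :
    res r (fun z => Q.eval z / (p - z) ^ k) = 0 := by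
  refine res_eq_zero_of_differentiable h0 fun z hz => ?_
  have : p - z ≠ 0 := sub_ne_zero.2 (by rintro rfl; linarith)
  have h2 : (p - z) ^ k ≠ 0 := pow_ne_zero _ this
  have h3 := Q.differentiable z
  fun_prop (disch := assumption)

/-! ### Cauchy formulas in the exterior of a disc -/

theorem Ext.dslope {ρ : ℝ} {w : ℂ → ℂ} (hw : Ext ρ w) {p : ℂ} (hp : ρ < ‖p‖) :
    Ext ρ (dslope w p) :=
  (Complex.differentiableOn_dslope ((isOpen_ext ρ).mem_nhds hp)).2 hw

theorem Gro.dslope {w : ℂ → ℂ} (hw : Gro (-1) w) (p : ℂ) : Gro (-1) (dslope w p) := by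
  have h1 : Gro (-1) fun z => (z - p)⁻¹ * (w z - w p) :=
    (gro_inv_sub p).mul ((hw.mono (by norm_num)).sub (gro_const (w p))) (by norm_num)
  refine h1.congr ‖p‖ fun z hz => ?_
  rw [dslope_of_ne _ (by rintro rfl; linarith), slope_def_field, div_eq_inv_mul]

/-- Cauchy's formula for the exterior of a disc. -/
theorem exterior_cauchy {ρ r : ℝ} {w : ℂ → ℂ} {p : ℂ} (hw : Ext ρ w) (hg : Gro (-1) w)
    (h0 : 0 ≤ ρ) (hr : ρ < r) (hp : r < ‖p‖) : res r (fun z => w z / (p - z)) = w p := by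
  have hr0 : 0 ≤ r := h0.trans hr.le
  -- The quotient `dslope w p` has no singularity at `p`, so its integrals over the circle of radius
  -- `r` and over a circle beyond `p` agree. On the small circle the term `w p / (z - p)` integrates
  -- to zero; on the large one `w z / (z - p) = O(z ^ (-2))` does.
  have hu := hw.dslope (hr.trans hp)
  have hR : ‖p‖ < ‖p‖ + 1 := by linarith
  have e1 := res_eq_of_ext hu h0 hr (R := ‖p‖ + 1) (by linarith)
  have key : ∀ z, z ≠ p → dslope w p z = w z * (z - p)⁻¹ - w p * (z - p)⁻¹ := fun z hz => by
    rw [dslope_of_ne _ hz, slope_def_field]; ring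
  have E : Ext ‖p‖ fun z => w z * (z - p)⁻¹ := (hw.mono (by linarith)).mul (ext_inv_sub le_rfl)
  have e2 : res (‖p‖ + 1) (dslope w p) = -w p := by
    rw [res_congr (g := fun z => w z * (z - p)⁻¹ - w p * (z - p)⁻¹) (by positivity)
      (fun z hz => key z (by rintro rfl; linarith)), res_sub (by positivity)
      (E.continuousOn_sphere hR) (((ext_inv_sub le_rfl).const_mul _).continuousOn_sphere hR),
      res_const_mul, res_inv_sub hR,
      res_eq_zero_of_gro E (hg.mul (gro_inv_sub p) (by norm_num)) (norm_nonneg _) hR]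
    ring
  have hne : ∀ z : ℂ, ‖z‖ = r → z - p ≠ 0 := fun z hz =>
    sub_ne_zero.2 (by rintro rfl; linarith)
  have cinv : ContinuousOn (fun z : ℂ => (z - p)⁻¹) (Metric.sphere 0 r) := by
    refine ContinuousOn.inv₀ (by fun_prop) fun z hz => hne z (by simpa using hz)
  have e3 : res r (dslope w p) = -res r (fun z => w z / (p - z)) := by
    rw [res_congr (g := fun z => w z * (z - p)⁻¹ - w p * (z - p)⁻¹) hr0
      (fun z hz => key z (by rintro rfl; linarith)), res_sub hr0
      (ContinuousOn.fun_mul (hw.continuousOn_sphere hr) cinv) (by fun_prop), res_const_mul,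
      ← res_neg]
    have : res r (fun z => (z - p)⁻¹) = 0 := by
      have := res_inv_sub_outer hr0 hp (Q := C (-1)) 1
      rw [← this]
      refine res_congr hr0 fun z hz => ?_
      rw [← neg_sub z p, pow_one, eval_C, neg_div_neg_eq, one_div]
    rw [this, mul_zero, sub_zero]
    refine res_congr hr0 fun z hz => ?_
    rw [← neg_sub z p, div_neg, neg_neg, div_eq_mul_inv]
  rw [e2, e3] at e1
  exact neg_inj.1 e1

/-- This is `exterior_cauchy` for `dslope w p`, whose value at `p` is the derivative. The constant
`w p` contributes nothing, since `1 / (p - z) ^ 2` is holomorphic within the circle. -/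
theorem exterior_cauchy_deriv {ρ r : ℝ} {w : ℂ → ℂ} {p : ℂ} (hw : Ext ρ w) (hg : Gro (-1) w)
    (h0 : 0 ≤ ρ) (hr : ρ < r) (hp : r < ‖p‖) :
    res r (fun z => -w z / (p - z) ^ 2) = deriv w p := by
  have hr0 : 0 ≤ r := h0.trans hr.le
  rw [← dslope_same w p, ← exterior_cauchy (hw.dslope (hr.trans hp)) (hg.dslope p) h0 hr hp]
  have hne : ∀ z : ℂ, ‖z‖ = r → p - z ≠ 0 := fun z hz =>
    sub_ne_zero.2 (by rintro rfl; linarith)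
  have cinv : ContinuousOn (fun z : ℂ => ((p - z) ^ 2)⁻¹) (Metric.sphere 0 r) := by
    refine ContinuousOn.inv₀ (by fun_prop) fun z hz => pow_ne_zero _ (hne z (by simpa using hz))
  have h1 := res_inv_sub_outer hr0 hp (Q := C (w p)) 2
  rw [← add_zero (res r fun z => -w z / (p - z) ^ 2), ← h1, ← res_add hr0]
  · refine res_congr hr0 fun z hz => ?_
    have := hne z hz
    rw [dslope_of_ne _ (by rintro rfl; simp at this), slope_def_field, eval_C, ← neg_sub p z]
    field_simp
    ring
  · have := hw.continuousOn_sphere hr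
    simp only [div_eq_mul_inv]
    fun_prop
  · simp only [div_eq_mul_inv, eval_C]
    fun_prop

/-- From `w z = w p + (z - p) * dslope w p z` the second derivative at `p` is twice the first
derivative of `dslope w p`, to which the previous formula applies. -/
theorem exterior_cauchy_deriv_deriv {ρ r : ℝ} {w : ℂ → ℂ} {p : ℂ} (hw : Ext ρ w)
    (hg : Gro (-1) w) (h0 : 0 ≤ ρ) (hr : ρ < r) (hp : r < ‖p‖) :
    res r (fun z => w z / (p - z) ^ 3) = deriv (deriv w) p / 2 := by
  have hr0 : 0 ≤ r := h0.trans hr.le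
  have hu := hw.dslope (hr.trans hp)
  have hne : ∀ z : ℂ, ‖z‖ = r → p - z ≠ 0 := fun z hz =>
    sub_ne_zero.2 (by rintro rfl; linarith)
  have cinv : ∀ k : ℕ, ContinuousOn (fun z : ℂ => ((p - z) ^ k)⁻¹) (Metric.sphere 0 r) := fun k => by
    refine ContinuousOn.inv₀ (by fun_prop) fun z hz => pow_ne_zero _ (hne z (by simpa using hz))
  have hww : ∀ z, w z = w p + (z - p) * dslope w p z := fun z => by
    have := sub_smul_dslope w p z
    rw [smul_eq_mul] at this
    rw [this]; ring
  have e1 : deriv (deriv w) p = 2 * deriv (dslope w p) p := by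
    have h1 : deriv w =ᶠ[𝓝 p] fun z => dslope w p z + (z - p) * deriv (dslope w p) z := by
      filter_upwards [(isOpen_ext ρ).mem_nhds (hr.trans hp)] with z hz
      have h2 : HasDerivAt (fun z => w p + (z - p) * dslope w p z)
          (1 * dslope w p z + (z - p) * deriv (dslope w p) z) z :=
        (((hasDerivAt_id z).sub_const p).mul (hu.differentiableAt hz).hasDerivAt).const_add _
      rw [one_mul] at h2
      rw [← h2.deriv]
      exact congrArg (fun f => deriv f z) (funext hww)
    rw [h1.deriv_eq]
    have h3 : HasDerivAt (fun z => dslope w p z + (z - p) * deriv (dslope w p) z)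
        (deriv (dslope w p) p + (1 * deriv (dslope w p) p + (p - p) *
          deriv (deriv (dslope w p)) p)) p :=
      (hu.differentiableAt (hr.trans hp)).hasDerivAt.add
        (((hasDerivAt_id p).sub_const p).mul (hu.deriv.differentiableAt (hr.trans hp)).hasDerivAt)
    rw [h3.deriv]; ring
  have h1 := res_inv_sub_outer hr0 hp (Q := C (w p)) 3
  rw [e1, mul_div_cancel_left₀ _ two_ne_zero,
    ← exterior_cauchy_deriv hu (hg.dslope p) h0 hr hp, ← add_zero (res r fun z => -_ / _), ← h1,
    ← res_add hr0]
  · refine res_congr hr0 fun z hz => ?_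
    have := hne z hz
    rw [eval_C]
    nth_rewrite 1 [hww z]
    rw [← neg_sub p z]
    field_simp
    ring
  · have := hu.continuousOn_sphere hr
    have := cinv 2
    simp only [div_eq_mul_inv]
    fun_prop
  · have := cinv 3
    simp only [div_eq_mul_inv, eval_C]
    fun_prop

theorem gro_res_div {r : ℝ} (h0 : 0 < r) {F : ℂ → ℂ} (hF : ContinuousOn F (Metric.sphere 0 r)) :
    Gro (-1) fun p => res r (fun z => F z / (p - z)) := by
  obtain ⟨C, hC⟩ := (isCompact_sphere (0 : ℂ) r).exists_bound_of_continuousOn hF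
  refine Gro.of_bound (r * (C * 2)) (2 * r) fun p hp => ?_
  have hp0 : 0 < ‖p‖ := by linarith
  rw [mul_assoc]
  refine norm_res_le h0.le fun z hz => ?_
  have h1 : ‖p‖ / 2 ≤ ‖p - z‖ := by
    have := norm_sub_norm_le p z
    linarith
  have hC' := hC z (by simpa using hz)
  rw [norm_div, div_le_iff₀ (by linarith), zpow_neg_one]
  have : C * 2 * ‖p‖⁻¹ * (‖p‖ / 2) = C := by field_simp
  calc ‖F z‖ ≤ C := hC'
    _ = C * 2 * ‖p‖⁻¹ * (‖p‖ / 2) := this.symm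
    _ ≤ _ := by
      have : 0 ≤ C := (norm_nonneg _).trans hC'
      gcongr

/-- In the finite geometric expansion of `1 / (p - z)` in powers of `z / p`, the vanishing moments
kill the first `K` terms and the remainder carries the factor `p ^ (-K)`. -/
theorem gro_res_div_of_moments {r : ℝ} (h0 : 0 < r) {F : ℂ → ℂ}
    (hF : ContinuousOn F (Metric.sphere 0 r)) (K : ℕ)
    (hm : ∀ k < K, res r (fun z => z ^ k * F z) = 0) :
    Gro (-1 - K) fun p => res r (fun z => F z / (p - z)) := by
  have h1 := (gro_zpow (-K)).mul (gro_res_div h0 ((continuousOn_id.pow K).mul hF))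
    (m := -1 - K) (by ring)
  refine h1.congr r fun p hp => ?_
  have hp0 : p ≠ 0 := norm_pos_iff.1 (by linarith)
  have hne : ∀ z : ℂ, ‖z‖ = r → p - z ≠ 0 := fun z hz =>
    sub_ne_zero.2 (by rintro rfl; linarith)
  have cinv : ContinuousOn (fun z : ℂ => (p - z)⁻¹) (Metric.sphere 0 r) := by
    refine ContinuousOn.inv₀ (by fun_prop) fun z hz => hne z (by simpa using hz)
  have h2 : res r (fun z => ∑ k ∈ Finset.range K, (p ^ (k + 1))⁻¹ * (z ^ k * F z)) = 0 := by
    rw [res_sum h0.le]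
    · refine Finset.sum_eq_zero fun k hk => ?_
      rw [res_const_mul, hm k (Finset.mem_range.1 hk), mul_zero]
    · exact fun k _ => continuousOn_const.mul ((continuousOn_id.pow k).mul hF)
  rw [← res_const_mul, ← add_zero (res r fun z => _ * _), ← h2, ← res_add h0.le]
  · refine res_congr h0.le fun z hz => ?_
    have := hne z hz
    have hg : ∀ K : ℕ, p ^ (-K : ℤ) * ((z ^ K * F z) / (p - z)) +
        ∑ k ∈ Finset.range K, (p ^ (k + 1))⁻¹ * (z ^ k * F z) = F z / (p - z) := by
      intro K
      induction K with
      | zero => simp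
      | succ K ih =>
        rw [← ih, Finset.sum_range_succ, zpow_neg, zpow_neg, zpow_natCast, zpow_natCast]
        field_simp
        ring
    exact hg K
  · simp only [div_eq_mul_inv, Pi.mul_apply, Pi.pow_apply, id]
    fun_prop
  · exact continuousOn_finsetSum _ fun k _ => continuousOn_const.mul ((continuousOn_id.pow k).mul hF)

/-! ### Polynomial parts at infinity -/

/-- The polynomial part of `P / X ^ (i + 1)`. -/
def quo (i : ℕ) (P : ℂ[X]) : ℂ[X] := Polynomial.divX^[i + 1] P

theorem coeff_quo (i m : ℕ) (P : ℂ[X]) : (quo i P).coeff m = P.coeff (m + i + 1) := by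
  have : ∀ (k : ℕ) (P : ℂ[X]) (m : ℕ), (Polynomial.divX^[k] P).coeff m = P.coeff (m + k) := by
    intro k
    induction k with
    | zero => intro P m; rfl
    | succ k ih => intro P m; rw [Function.iterate_succ_apply, ih, coeff_divX, add_assoc]
  exact this (i + 1) P m

theorem quo_quo (i l : ℕ) (P : ℂ[X]) : quo i (quo l P) = quo (i + l + 1) P := by
  ext m
  rw [coeff_quo, coeff_quo, coeff_quo]
  congr 1
  ring

theorem quo_add (i : ℕ) (P R : ℂ[X]) : quo i (P + R) = quo i P + quo i R := by
  ext m; simp [coeff_quo]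

theorem quo_C_mul (i : ℕ) (a : ℂ) (P : ℂ[X]) : quo i (C a * P) = C a * quo i P := by
  ext m; simp [coeff_quo]

theorem quo_eq_zero {i : ℕ} {P : ℂ[X]} (h : P.natDegree ≤ i) : quo i P = 0 := by
  ext m
  rw [coeff_quo, coeff_zero]
  exact coeff_eq_zero_of_natDegree_lt (by omega)

/-- Horner's scheme for the difference quotient. It is what relates the Cauchy kernel `1 / (x - z)`
to the coefficients of polynomial parts. -/
theorem eval_sub_eval_eq_quo (x z : ℂ) (N : ℕ) (P : ℂ[X]) (h : P.natDegree ≤ N) :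
    P.eval x - P.eval z = (x - z) * ∑ i ∈ Finset.range N, x ^ i * (quo i P).eval z := by
  induction N generalizing P with
  | zero =>
    rw [eq_C_of_natDegree_le_zero h]; simp
  | succ N ih =>
    have hd := divX_mul_X_add P
    have := ih P.divX (by rw [natDegree_divX_eq_natDegree_tsub_one]; omega)
    have e : ∀ t : ℂ, P.eval t = P.divX.eval t * t + P.coeff 0 := fun t => by
      conv_lhs => rw [← hd]
      simp
    have e2 : ∀ i, quo (i + 1) P = quo i P.divX := fun i => by
      unfold quo
      rw [Function.iterate_succ_apply]
    rw [Finset.sum_range_succ', e x, e z]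
    simp only [e2, pow_zero, one_mul, pow_succ']
    have e3 : quo 0 P = P.divX := rfl
    rw [e3]
    simp only [mul_assoc]
    rw [← Finset.mul_sum]
    linear_combination x * this

/-- The polynomial part at infinity of `P φ`. -/
def polPart (r : ℝ) (φ : ℂ → ℂ) (P : ℂ[X]) : ℂ[X] :=
  ∑ i ∈ Finset.range P.natDegree, C (res r fun z => (quo i P).eval z * φ z) * X ^ i

theorem coeff_polPart (r : ℝ) (φ : ℂ → ℂ) (P : ℂ[X]) (i : ℕ) :
    (polPart r φ P).coeff i = res r fun z => (quo i P).eval z * φ z := by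
  unfold polPart
  simp only [finsetSum_coeff, coeff_C_mul_X_pow, Finset.sum_ite_eq, Finset.mem_range]
  split_ifs with h
  · rfl
  · rw [quo_eq_zero (not_lt.1 h)]
    simp [res, circleIntegral]

theorem polPart_add {r : ℝ} (h0 : 0 ≤ r) {φ : ℂ → ℂ} (hφ : ContinuousOn φ (Metric.sphere 0 r))
    (P R : ℂ[X]) : polPart r φ (P + R) = polPart r φ P + polPart r φ R := by
  ext i
  rw [coeff_add, coeff_polPart, coeff_polPart, coeff_polPart, quo_add]
  simp only [eval_add, add_mul]
  exact res_add h0 (((quo i P).continuous.continuousOn).mul hφ)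
    (((quo i R).continuous.continuousOn).mul hφ)

theorem polPart_C_mul (r : ℝ) (φ : ℂ → ℂ) (a : ℂ) (P : ℂ[X]) :
    polPart r φ (C a * P) = C a * polPart r φ P := by
  ext i
  rw [coeff_C_mul, coeff_polPart, coeff_polPart, quo_C_mul]
  simp only [eval_mul, eval_C, mul_assoc]
  exact res_const_mul _ _ _

theorem polPart_quo (r : ℝ) (φ : ℂ → ℂ) (l : ℕ) (P : ℂ[X]) :
    polPart r φ (quo l P) = quo l (polPart r φ P) := by
  ext i
  rw [coeff_quo, coeff_polPart, coeff_polPart, quo_quo]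

/-- With `φ p` written by the exterior Cauchy formula, `(P(p) - P(z)) / (p - z)` is exactly the
kernel that produces `polPart`; what remains is `P(z) φ(z) / (p - z)`. -/
theorem polPart_remainder {ρ r : ℝ} {φ : ℂ → ℂ} {p : ℂ} (hφ : Ext ρ φ) (hg : Gro (-1) φ)
    (h0 : 0 ≤ ρ) (hr : ρ < r) (hp : r < ‖p‖) (P : ℂ[X]) :
    P.eval p * φ p - (polPart r φ P).eval p = res r fun z => P.eval z * φ z / (p - z) := by
  have hr0 : 0 ≤ r := h0.trans hr.le
  have hφc := hφ.continuousOn_sphere hr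
  have hne : ∀ z : ℂ, ‖z‖ = r → p - z ≠ 0 := fun z hz =>
    sub_ne_zero.2 (by rintro rfl; linarith)
  have cinv : ContinuousOn (fun z : ℂ => (p - z)⁻¹) (Metric.sphere 0 r) := by
    refine ContinuousOn.inv₀ (by fun_prop) fun z hz => hne z (by simpa using hz)
  rw [← exterior_cauchy hφ hg h0 hr hp, ← res_const_mul]
  have e : (polPart r φ P).eval p = res r fun z => ∑ i ∈ Finset.range P.natDegree,
      p ^ i * ((quo i P).eval z * φ z) := by
    rw [res_sum hr0]
    · simp only [polPart, eval_finsetSum, eval_mul, eval_C, eval_pow, eval_X, res_const_mul]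
      exact Finset.sum_congr rfl fun _ _ => mul_comm _ _
    · exact fun i _ => continuousOn_const.mul ((quo i P).continuous.continuousOn.mul hφc)
  rw [e, ← res_sub hr0]
  · refine res_congr hr0 fun z hz => ?_
    have := eval_sub_eval_eq_quo p z P.natDegree P le_rfl
    have h2 := hne z hz
    simp only [← mul_assoc]
    rw [← Finset.sum_mul]
    field_simp
    linear_combination φ z * this
  · simp only [div_eq_mul_inv]
    exact continuousOn_const.mul (hφc.mul cinv)
  · exact continuousOn_finsetSum _ fun i _ =>
      continuousOn_const.mul ((quo i P).continuous.continuousOn.mul hφc)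

theorem gro_polPart_remainder {ρ r : ℝ} {φ : ℂ → ℂ} (hφ : Ext ρ φ) (hg : Gro (-1) φ)
    (h0 : 0 ≤ ρ) (hr : ρ < r) (P : ℂ[X]) (K : ℕ)
    (hm : ∀ k < K, res r (fun z => z ^ k * (P.eval z * φ z)) = 0) :
    Gro (-1 - K) fun p => P.eval p * φ p - (polPart r φ P).eval p :=
  (gro_res_div_of_moments (h0.trans_lt hr)
    (P.continuous.continuousOn.mul (hφ.continuousOn_sphere hr)) K hm).congr r
    fun _ hp => (polPart_remainder hφ hg h0 hr hp P).symm

/-- In the Taylor expansion of `P` about `a` only the term of exponent `-1` has a nonzero integral,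
wherever `a` lies inside the circle. -/
theorem res_eval_div_pow {r : ℝ} {a : ℂ} (ha : ‖a‖ < r) (P : ℂ[X]) (l : ℕ) :
    res r (fun z => P.eval z * ((z - a) ^ (l + 1))⁻¹) = (hasseDeriv l P).eval a := by
  have hr0 : 0 ≤ r := (norm_nonneg a).trans ha.le
  have hz : ∀ n : ℤ, res r (fun z => (z - a) ^ n) = if n = -1 then 1 else 0 := fun n => by
    split_ifs with h
    · simpa [h] using res_inv_sub ha
    · simp [res, circleIntegral.integral_sub_zpow_of_ne h]
  have hne : ∀ z : ℂ, ‖z‖ = r → z - a ≠ 0 := fun z hz =>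
    sub_ne_zero.2 (by rintro rfl; linarith)
  have hT : ∀ z, P.eval z = ∑ i ∈ Finset.range ((taylor a P).natDegree + 1),
      (taylor a P).coeff i * (z - a) ^ i := fun z => by
    rw [← eval_eq_sum_range, taylor_eval_sub]
  rw [res_congr hr0 (g := fun z => ∑ i ∈ Finset.range ((taylor a P).natDegree + 1),
    (taylor a P).coeff i * (z - a) ^ ((i : ℤ) - (l + 1 : ℕ))), res_sum hr0]
  · simp only [res_const_mul, hz]
    rw [← taylor_coeff]
    rw [Finset.sum_eq_single l]
    · rw [if_pos (by push_cast; ring), mul_one]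
    · intro b _ hb
      rw [if_neg (by push_cast; omega), mul_zero]
    · intro h
      rw [coeff_eq_zero_of_natDegree_lt (by simpa using h), zero_mul]
  · intro i _
    refine continuousOn_const.mul (ContinuousOn.zpow₀ (by fun_prop) _ fun z hz => Or.inl (hne z ?_))
    simpa using hz
  · intro z hz
    rw [hT z, Finset.sum_mul]
    refine Finset.sum_congr rfl fun i _ => ?_
    rw [zpow_sub₀ (hne z hz), zpow_natCast, zpow_natCast]
    ring

theorem coeff_eq_res {r : ℝ} (h0 : 0 < r) (P : ℂ[X]) (i : ℕ) :
    P.coeff i = res r (fun z => P.eval z * (z ^ (i + 1))⁻¹) := by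
  have := res_eval_div_pow (r := r) (a := 0) (by simpa using h0) P i
  simp only [sub_zero] at this
  rw [this, ← taylor_coeff]
  simp

/-- A form of Liouville's theorem: the coefficient is the residue of `P / z ^ (i + 1)`, which is
`O(z ^ (-2))`. -/
theorem coeff_eq_zero_of_gro {P : ℂ[X]} {d : ℤ} (h : Gro d fun z => P.eval z) {i : ℕ}
    (hi : d < i) : P.coeff i = 0 := by
  rw [coeff_eq_res zero_lt_one]
  refine res_eq_zero_of_gro (ρ := 0) ?_ ?_ le_rfl zero_lt_one
  · simpa using (ext_eval 0 P).mul (ext_inv_sub_pow (a := 0) (by simp) (i + 1))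
  · have := h.mul (gro_inv_sub_pow 0 (i + 1)) rfl
    simp only [sub_zero] at this
    exact this.mono (by push_cast; omega)

theorem degree_lt_of_gro {P : ℂ[X]} {d : ℕ} (h : Gro (d - 1) fun z => P.eval z) :
    P.degree < d := by
  rw [degree_lt_iff_coeff_zero]
  intro m hm
  exact coeff_eq_zero_of_gro h (by omega)

theorem eq_zero_of_gro_neg {P : ℂ[X]} (h : Gro (-1) fun z => P.eval z) : P = 0 := by
  have := degree_lt_of_gro (d := 0) (by simpa using h)
  simpa [degree_eq_bot] using this

theorem gro_eval_of_degree_lt {P : ℂ[X]} {d : ℕ} (h : P.degree < d) :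
    Gro (d - 1) fun z => P.eval z := by
  refine gro_eval P ?_
  by_cases hP : P = 0
  · exact Or.inl hP
  · refine Or.inr ?_
    have := (natDegree_lt_iff_degree_lt hP).2 h
    omega

/-! ### Laurent series at infinity -/

theorem Gro.of_hasSum {ρ : ℝ} {c : ℕ → ℂ} {W : ℂ → ℂ} (m : ℕ)
    (h : ∀ p : ℂ, ρ < ‖p‖ → HasSum (fun j => c j * (p ^ j)⁻¹) (W p)) (hc : ∀ j < m, c j = 0) :
    Gro (-m) W := by
  set R : ℝ := |ρ| + 1 with hR
  have hR0 : 0 < R := by positivity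
  have hs := (h (R : ℂ) (by
    rw [Complex.norm_real, Real.norm_of_nonneg hR0.le, hR]; linarith [le_abs_self ρ])).summable
  obtain ⟨C, hC⟩ := hs.tendsto_atTop_zero.norm.bddAbove_range
  -- Convergence at the single point `R` bounds all coefficients; beyond `2 * R` the tail is then
  -- dominated by a geometric series of ratio `1 / 2`.
  have hC' : ∀ j, ‖c j‖ ≤ C * R ^ j := fun j => by
    have := hC ⟨j, rfl⟩
    simp only [norm_mul, norm_inv, norm_pow, Complex.norm_real, Real.norm_of_nonneg hR0.le] at this
    rwa [← div_eq_mul_inv, div_le_iff₀ (by positivity)] at this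
  have hC0 : 0 ≤ C := by simpa using (norm_nonneg _).trans (hC' 0)
  refine Gro.of_bound (C * R ^ m * 2 ^ m * 2) (2 * R) fun p hp => ?_
  have hp0 : 0 < ‖p‖ := by linarith
  have hsum := h p (by linarith [le_abs_self ρ])
  have hb : ∀ j, ‖c j * (p ^ j)⁻¹‖ ≤ C * (R / ‖p‖) ^ m * 2 ^ m * (1 / 2) ^ j := fun j => by
    by_cases hj : j < m
    · rw [hc j hj, zero_mul, norm_zero]; positivity
    · obtain ⟨k, rfl⟩ := Nat.exists_eq_add_of_le (not_lt.1 hj)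
      rw [norm_mul, norm_inv, norm_pow]
      have ht : R / ‖p‖ ≤ 1 / 2 := by
        rw [div_le_iff₀ hp0]; linarith
      calc ‖c (m + k)‖ * (‖p‖ ^ (m + k))⁻¹ ≤ C * R ^ (m + k) * (‖p‖ ^ (m + k))⁻¹ := by
            gcongr; exact hC' _
        _ = C * (R / ‖p‖) ^ m * (R / ‖p‖) ^ k := by
            rw [div_pow, div_pow, pow_add, pow_add]; field_simp
        _ ≤ C * (R / ‖p‖) ^ m * (1 / 2) ^ k := by gcongr
        _ = _ := by
          rw [pow_add, one_div, inv_pow, inv_pow]; field_simp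
  have hgeo := (hasSum_geometric_two).mul_left (C * (R / ‖p‖) ^ m * 2 ^ m)
  have := hsum.norm_le_of_bounded hgeo hb
  refine this.trans (le_of_eq ?_)
  rw [div_pow, zpow_neg, zpow_natCast]
  field_simp

/-- Once the lower coefficients vanish, `c m / p ^ m` is minus a tail of order `p ^ (-m - 1)`, so
the constant `c m` is `O(1/p)`. This is how single coupling derivatives are read off from a loop
insertion. -/
theorem coeff_eq_zero_of_hasSum {ρ : ℝ} {c : ℕ → ℂ}
    (h : ∀ p : ℂ, ρ < ‖p‖ → HasSum (fun j => c j * (p ^ j)⁻¹) 0) (m : ℕ) : c m = 0 := by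
  induction m using Nat.strong_induction_on with
  | _ m ih =>
    have h1 : ∀ p : ℂ, ρ < ‖p‖ → HasSum (fun j => (if j = m then 0 else c j) * (p ^ j)⁻¹)
        (-(c m * (p ^ m)⁻¹)) := fun p hp => by
      have := (h p hp).update m 0
      rw [zero_sub, add_zero] at this
      refine this.congr_fun fun j => ?_
      by_cases hj : j = m <;> simp [hj]
    have h2 := Gro.of_hasSum (m + 1) h1 (fun j hj => by
      by_cases hj' : j = m
      · simp [hj']
      · simp [hj', ih j (by omega)])
    have h3 : Gro (-1) fun z => (C (c m)).eval z := by
      refine ((h2.neg.mul (gro_pow m) (m := -1) (by push_cast; ring))).congr 0 fun z hz => ?_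
      have : z ≠ 0 := norm_pos_iff.1 hz
      rw [eval_C]; field_simp
    simpa using eq_zero_of_gro_neg h3

/-- The series `∑ j z ^ (j - 1) / p ^ (j + 1)` is `1 / (p - z) ^ 2`, so on coupling derivatives that
are moments of `F` the loop insertion operator acts as a double-pole kernel. The truncated exponent
at `j = 0` is harmless because of the factor `j`. -/
theorem hasSum_res {r : ℝ} (h0 : 0 < r) {F : ℂ → ℂ} (hF : ContinuousOn F (Metric.sphere 0 r))
    {p : ℂ} (hp : r < ‖p‖) :
    HasSum (fun j : ℕ => -((j : ℂ) / p ^ (j + 1) * res r (fun z => z ^ (j - 1) * F z)))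
      (res r fun z => -F z / (p - z) ^ 2) := by
  obtain ⟨C, hC⟩ := (isCompact_sphere (0 : ℂ) r).exists_bound_of_continuousOn hF
  have hp0 : p ≠ 0 := norm_pos_iff.1 (by linarith)
  have hpn : 0 < ‖p‖ := by linarith
  have hFc : Continuous fun θ : ℝ => F (circleMap 0 r θ) :=
    hF.comp_continuous (continuous_circleMap 0 r) fun θ => circleMap_mem_sphere _ h0.le _
  have hgeo : Summable fun j : ℕ => (j : ℝ) * (r / ‖p‖) ^ j := by
    refine (hasSum_coe_mul_geometric_of_norm_lt_one (𝕜 := ℝ) ?_).summable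
    rw [Real.norm_of_nonneg (by positivity), div_lt_one hpn]; exact hp
  have key : HasSum (fun j : ℕ => ∮ z in C(0, r), -((j : ℂ) / p ^ (j + 1) * (z ^ (j - 1) * F z)))
      (∮ z in C(0, r), -F z / (p - z) ^ 2) := by
    unfold circleIntegral
    refine intervalIntegral.hasSum_integral_of_dominated_convergence
      (bound := fun j _ => (j : ℝ) * (r / ‖p‖) ^ j * (C / ‖p‖)) ?_ ?_ ?_ ?_ ?_
    · intro j
      refine Continuous.aestronglyMeasurable ?_
      have := continuous_circleMap 0 r
      simp only [deriv_circleMap, smul_eq_mul]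
      exact ((this.mul continuous_const).mul (continuous_const.mul ((this.pow _).mul hFc)).neg)
    · intro j
      refine Eventually.of_forall fun θ _ => ?_
      have hz : ‖circleMap 0 r θ‖ = r := by simp [abs_of_pos h0]
      have hFz := hC (circleMap 0 r θ) (circleMap_mem_sphere _ h0.le _)
      rcases j with _ | j
      · simp
      rw [deriv_circleMap, smul_eq_mul, norm_mul, norm_mul, norm_neg, norm_mul, norm_mul, norm_div,
        norm_pow, norm_pow, hz, Complex.norm_I, Complex.norm_natCast, Nat.add_sub_cancel]
      calc r * 1 * (((j + 1 : ℕ) : ℝ) / ‖p‖ ^ (j + 1 + 1) * (r ^ j * ‖F (circleMap 0 r θ)‖))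
          ≤ r * 1 * (((j + 1 : ℕ) : ℝ) / ‖p‖ ^ (j + 1 + 1) * (r ^ j * C)) := by gcongr
        _ = _ := by rw [div_pow, pow_succ r, pow_succ ‖p‖ (j + 1)]; field_simp
    · exact Eventually.of_forall fun θ _ => hgeo.mul_right _
    · exact intervalIntegrable_const
    · refine Eventually.of_forall fun θ _ => ?_
      have hz : ‖circleMap 0 r θ‖ = r := by simp [abs_of_pos h0]
      set z := circleMap 0 r θ
      have hz0 : z ≠ 0 := norm_pos_iff.1 (by linarith)
      have hpz : p - z ≠ 0 := sub_ne_zero.2 (by rintro rfl; linarith)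
      have h1 := hasSum_coe_mul_geometric_of_norm_lt_one (r := z / p) (by
        rw [norm_div, div_lt_one hpn, hz]; exact hp)
      have h2 : HasSum (fun j : ℕ => -((j : ℂ) / p ^ (j + 1) * (z ^ (j - 1) * F z)))
          (-F z / (p - z) ^ 2) := by
        have e1 : -F z / (p - z) ^ 2 = -(F z / (z * p)) * (z / p / (1 - z / p) ^ 2) := by
          have : 1 - z / p = (p - z) / p := by field_simp
          rw [this]
          field_simp
        rw [e1]
        refine (h1.mul_left (-(F z / (z * p)))).congr_fun fun j => ?_
        rcases j with _ | j
        · simp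
        · rw [Nat.add_sub_cancel, div_pow, pow_succ z j]
          field_simp
          ring
      exact h2.const_smul (deriv (circleMap 0 r) θ)
  have := key.mul_left (2 * (Real.pi : ℂ) * Complex.I)⁻¹
  refine this.congr_fun fun j => ?_
  have e := res_const_mul r (-((j : ℂ) / p ^ (j + 1))) (fun z => z ^ (j - 1) * F z)
  rw [← neg_mul, ← e]
  simp only [neg_mul]
  rfl

/-! ### Square roots attached to single cuts -/

theorem prod_branchPoints {M : Type*} [CommMonoid M] {g : ℕ} (F : Fin (2 * (g + 1)) → M) :
    ∏ α, F α = ∏ i : Fin (g + 1), F ⟨2 * i.val, by omega⟩ * F ⟨2 * i.val + 1, by omega⟩ := by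
  have e := Fintype.prod_equiv (finProdFinEquiv.trans (finCongr (mul_comm (g + 1) 2)))
    (fun x => F ((finProdFinEquiv.trans (finCongr (mul_comm (g + 1) 2))) x)) F (fun _ => rfl)
  rw [← e, Fintype.prod_prod_type]
  refine Finset.prod_congr rfl fun i _ => ?_
  rw [Fin.prod_univ_two]
  congr 2 <;> ext <;> simp [finProdFinEquiv]
  ring

theorem sum_branchPoints {M : Type*} [AddCommMonoid M] {g : ℕ} (F : Fin (2 * (g + 1)) → M) :
    ∑ α, F α = ∑ i : Fin (g + 1), (F ⟨2 * i.val, by omega⟩ + F ⟨2 * i.val + 1, by omega⟩) :=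
  prod_branchPoints (M := Multiplicative M) F

theorem forall_branchPoints {g : ℕ} (P : Fin (2 * (g + 1)) → Prop) :
    (∀ α, P α) ↔ ∀ i : Fin (g + 1), P ⟨2 * i.val, by omega⟩ ∧ P ⟨2 * i.val + 1, by omega⟩ := by
  refine ⟨fun h i => ⟨h _, h _⟩, fun h α => ?_⟩
  have h1 := h ⟨α.val / 2, by omega⟩
  rcases Nat.even_or_odd α.val with ⟨k, hk⟩ | ⟨k, hk⟩
  · have : (⟨2 * (α.val / 2), by omega⟩ : Fin (2 * (g + 1))) = α := by ext; simp; omega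
    rw [← this]; exact h1.1
  · have : (⟨2 * (α.val / 2) + 1, by omega⟩ : Fin (2 * (g + 1))) = α := by ext; simp; omega
    rw [← this]; exact h1.2

/-- The Möbius map `(z - b) / (z - a)` carries the cut onto the nonpositive axis together with
infinity; at `z = a` the junk value of the division is `0`, also outside the slit plane. So the
principal square root is holomorphic exactly off the cut. -/
theorem mem_slitPlane_div_iff {a b : ℝ} (hab : a ≤ b) {z : ℂ} :
    (z - b) / (z - a) ∈ slitPlane ↔ ∀ x ∈ Set.Icc a b, (x : ℂ) ≠ z := by
  constructor
  · rintro h x hx rfl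
    have : ((x : ℂ) - b) / (x - a) = ((x - b) / (x - a) : ℝ) := by push_cast; rfl
    rw [this, mem_slitPlane_iff] at h
    simp only [ofReal_re, ofReal_im, ne_eq, not_true_eq_false, or_false] at h
    exact absurd h (not_lt.2 (div_nonpos_of_nonpos_of_nonneg (by linarith [hx.2])
      (by linarith [hx.1])))
  · intro h
    by_contra hc
    rw [mem_slitPlane_iff, not_or, not_lt, not_not] at hc
    set t := -((z - b) / (z - a)).re with ht
    have hq : (z - b) / (z - a) = -(t : ℂ) := by
      apply Complex.ext <;> simp [ht, hc.2]
    have ht0 : 0 ≤ t := by rw [ht]; linarith [hc.1]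
    have hza : z - a ≠ 0 := sub_ne_zero.2 (h a ⟨le_rfl, hab⟩).symm
    rw [div_eq_iff hza] at hq
    have h1t : (1 + t : ℝ) ≠ 0 := by positivity
    -- The solution of `(z - b) / (z - a) = -t`, a convex combination of the end points.
    refine h ((b + t * a) / (1 + t)) ⟨?_, ?_⟩ ?_
    · rw [le_div_iff₀ (by positivity)]; linarith
    · rw [div_le_iff₀ (by positivity)]; nlinarith
    · have h1t' : (1 + t : ℂ) ≠ 0 := by exact_mod_cast h1t
      push_cast
      rw [div_eq_iff h1t']
      linear_combination -hq

theorem cutSqrt_sq (a b : ℝ) (z : ℂ) : cutSqrt a b z ^ 2 = (z - a) * (z - b) := by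
  unfold cutSqrt
  rw [mul_pow, ← cpow_nat_mul]
  norm_num
  by_cases h : z - a = 0
  · rw [h]; simp
  · field_simp

theorem cutSqrt_ne_zero {a b : ℝ} (hab : a ≤ b) {z : ℂ} (hz : ∀ x ∈ Set.Icc a b, (x : ℂ) ≠ z) :
    cutSqrt a b z ≠ 0 := by
  intro h
  have := cutSqrt_sq a b z
  rw [h, zero_pow two_ne_zero, eq_comm, mul_eq_zero, sub_eq_zero, sub_eq_zero] at this
  rcases this with h | h
  · exact hz a ⟨le_rfl, hab⟩ h.symm
  · exact hz b ⟨hab, le_rfl⟩ h.symm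

theorem differentiableAt_cutSqrt {a b : ℝ} (hab : a ≤ b) {z : ℂ}
    (hz : ∀ x ∈ Set.Icc a b, (x : ℂ) ≠ z) : DifferentiableAt ℂ (cutSqrt a b) z := by
  have h1 := (mem_slitPlane_div_iff hab).2 hz
  have hza : z - a ≠ 0 := sub_ne_zero.2 (hz a ⟨le_rfl, hab⟩).symm
  unfold cutSqrt
  refine DifferentiableAt.mul (by fun_prop) (DifferentiableAt.cpow ?_ (by fun_prop) h1)
  fun_prop (disch := assumption)

theorem cutSqrt_conj {a b : ℝ} (hab : a ≤ b) {z : ℂ} (hz : ∀ x ∈ Set.Icc a b, (x : ℂ) ≠ z) :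
    cutSqrt a b (starRingEnd ℂ z) = starRingEnd ℂ (cutSqrt a b z) := by
  have h1 := (mem_slitPlane_div_iff hab).2 hz
  unfold cutSqrt
  have e : (starRingEnd ℂ z - b) / (starRingEnd ℂ z - a) = starRingEnd ℂ ((z - b) / (z - a)) := by
    simp
  have e2 : starRingEnd ℂ (1 / 2 : ℂ) = 1 / 2 := by
    rw [map_div₀, map_one, map_ofNat]
  rw [e, conj_cpow _ _ (slitPlane_arg_ne_pi h1), e2]
  simp only [map_mul, map_sub, conj_ofReal]

theorem continuousAt_cutSqrt {X : Type*} [TopologicalSpace X] {A B : X → ℝ} {Z : X → ℂ} {x : X}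
    (hA : ContinuousAt A x) (hB : ContinuousAt B x) (hZ : ContinuousAt Z x) (hab : A x ≤ B x)
    (hz : ∀ s ∈ Set.Icc (A x) (B x), (s : ℂ) ≠ Z x) :
    ContinuousAt (fun x => cutSqrt (A x) (B x) (Z x)) x ∧
      ∀ᶠ x' in 𝓝 x, (Z x' - B x') / (Z x' - A x') ∈ slitPlane := by
  have h1 := (mem_slitPlane_div_iff hab).2 hz
  have hza : Z x - A x ≠ 0 := sub_ne_zero.2 (hz (A x) ⟨le_rfl, hab⟩).symm
  have hA' : ContinuousAt (fun x => (A x : ℂ)) x := continuous_ofReal.continuousAt.comp hA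
  have hB' : ContinuousAt (fun x => (B x : ℂ)) x := continuous_ofReal.continuousAt.comp hB
  have h2 : ContinuousAt (fun x => (Z x - B x) / (Z x - A x)) x :=
    (hZ.sub hB').div (hZ.sub hA') hza
  refine ⟨?_, h2.eventually (isOpen_slitPlane.mem_nhds h1)⟩
  unfold cutSqrt
  exact (hZ.sub hA').mul (h2.cpow continuousAt_const h1)

/-! ### Logarithmic derivatives in the branch points -/

section LogDeriv

variable {E : Type*} [NormedAddCommGroup E] [NormedSpace ℝ E]

/-- `ℓ` is the logarithmic derivative of `f` at `x`. -/
def HasLogFDerivAt (f : E → ℂ) (ℓ : E →L[ℝ] ℂ) (x : E) : Prop := HasFDerivAt f (f x • ℓ) x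

theorem HasLogFDerivAt.mul {f₁ f₂ : E → ℂ} {ℓ₁ ℓ₂ : E →L[ℝ] ℂ} {x : E}
    (h₁ : HasLogFDerivAt f₁ ℓ₁ x) (h₂ : HasLogFDerivAt f₂ ℓ₂ x) :
    HasLogFDerivAt (fun x => f₁ x * f₂ x) (ℓ₁ + ℓ₂) x := by
  refine (HasFDerivAt.fun_mul h₁ h₂).congr_fderiv ?_
  ext v; simp; ring

theorem HasLogFDerivAt.prod {ι : Type*} (s : Finset ι) {f : ι → E → ℂ} {ℓ : ι → E →L[ℝ] ℂ} {x : E}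
    (h : ∀ i ∈ s, HasLogFDerivAt (f i) (ℓ i) x) :
    HasLogFDerivAt (fun x => ∏ i ∈ s, f i x) (∑ i ∈ s, ℓ i) x := by
  classical
  induction s using Finset.induction_on with
  | empty =>
    simp only [Finset.prod_empty, Finset.sum_empty]
    unfold HasLogFDerivAt
    rw [smul_zero]; exact hasFDerivAt_const _ _
  | insert a s ha ih =>
    simp only [Finset.prod_insert ha, Finset.sum_insert ha]
    exact (h a (by simp)).mul (ih fun i hi => h i (by simp [hi]))

theorem HasLogFDerivAt.zpow {f : E → ℂ} {ℓ : E →L[ℝ] ℂ} {x : E} (h : HasLogFDerivAt f ℓ x)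
    (h0 : f x ≠ 0) (s : ℤ) : HasLogFDerivAt (fun x => f x ^ s) ((s : ℂ) • ℓ) x := by
  refine ((hasDerivAt_zpow s (f x) (Or.inl h0)).comp_hasFDerivAt x h).congr_fderiv ?_
  ext v
  simp only [smul_apply, smul_eq_mul]
  rw [zpow_sub_one₀ h0]
  field_simp

/-- Logarithmic derivatives add: that of `z - A` plus half of that of `(z - B) / (z - A)`. -/
theorem hasLogFDerivAt_cutSqrt {A B : E → ℝ} {A' B' : E →L[ℝ] ℝ} {x : E} {z : ℂ}
    (hA : HasFDerivAt A A' x) (hB : HasFDerivAt B B' x) (hab : A x ≤ B x)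
    (hz : ∀ s ∈ Set.Icc (A x) (B x), (s : ℂ) ≠ z) :
    HasLogFDerivAt (fun x => cutSqrt (A x) (B x) z)
      ((-(1 / 2) / (z - A x)) • (ofRealCLM.comp A') + (-(1 / 2) / (z - B x)) • (ofRealCLM.comp B')) x := by
  have h1 := (mem_slitPlane_div_iff hab).2 hz
  have hza : z - A x ≠ 0 := sub_ne_zero.2 (hz (A x) ⟨le_rfl, hab⟩).symm
  have hzb : z - B x ≠ 0 := sub_ne_zero.2 (hz (B x) ⟨hab, le_rfl⟩).symm
  have hA1 : HasFDerivAt (fun x => z - (A x : ℂ)) (-(ofRealCLM.comp A')) x :=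
    (ofRealCLM.hasFDerivAt.comp x hA).const_sub z
  have hB1 : HasFDerivAt (fun x => z - (B x : ℂ)) (-(ofRealCLM.comp B')) x :=
    (ofRealCLM.hasFDerivAt.comp x hB).const_sub z
  have hAl : HasLogFDerivAt (fun x => z - (A x : ℂ)) ((-1 / (z - A x)) • (ofRealCLM.comp A')) x := by
    refine hA1.congr_fderiv ?_
    ext v; simp; field_simp
  have hBl : HasLogFDerivAt (fun x => z - (B x : ℂ)) ((-1 / (z - B x)) • (ofRealCLM.comp B')) x := by
    refine hB1.congr_fderiv ?_
    ext v; simp; field_simp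
  have hq := hBl.mul (hAl.zpow hza (-1))
  have hq' : (z - (B x : ℂ)) * (z - A x) ^ (-1 : ℤ) ∈ slitPlane := by
    rwa [zpow_neg_one, ← div_eq_mul_inv]
  have hc : HasLogFDerivAt (fun x => ((z - (B x : ℂ)) * (z - A x) ^ (-1 : ℤ)) ^ (1 / 2 : ℂ))
      ((1 / 2 : ℂ) • ((-1 / (z - B x)) • (ofRealCLM.comp B') +
        ((-1 : ℤ) : ℂ) • (-1 / (z - A x)) • (ofRealCLM.comp A'))) x := by
    have h3 := ((hasDerivAt_id ((z - (B x : ℂ)) * (z - A x) ^ (-1 : ℤ))).cpow_const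
      (c := (1 / 2 : ℂ)) hq').comp_hasFDerivAt x hq
    refine HasFDerivAt.congr_fderiv h3 ?_
    have hne := slitPlane_ne_zero hq'
    ext v
    simp only [smul_apply, smul_eq_mul, id, cpow_sub _ _ hne, cpow_one, mul_one]
    field_simp
  have hm := hAl.mul hc
  have hl : ((-1 / (z - A x)) • (ofRealCLM.comp A') +
      (1 / 2 : ℂ) • ((-1 / (z - B x)) • (ofRealCLM.comp B') +
        ((-1 : ℤ) : ℂ) • (-1 / (z - A x)) • (ofRealCLM.comp A')) : E →L[ℝ] ℂ) =
      ((-(1 / 2) / (z - A x)) • (ofRealCLM.comp A') +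
        (-(1 / 2) / (z - B x)) • (ofRealCLM.comp B')) := by
    ext v
    simp
    ring
  rw [hl] at hm
  refine HasFDerivAt.congr_of_eventuallyEq (f := fun x => (z - (A x : ℂ)) *
    ((z - (B x : ℂ)) * (z - A x) ^ (-1 : ℤ)) ^ (1 / 2 : ℂ)) ?_ ?_
  · refine HasFDerivAt.congr_fderiv hm ?_
    simp only [cutSqrt, zpow_neg_one, ← div_eq_mul_inv]
  · refine Eventually.of_forall fun x => ?_
    simp only [cutSqrt, zpow_neg_one, ← div_eq_mul_inv]

end LogDeriv

/-! ### The hyperelliptic curve `ytilde ^ 2 = T` -/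

/-- The polynomial `∏ (X - μ_α)`. -/
def T (μ : BranchPoints g) : ℂ[X] := ∏ α, (X - C (μ α : ℂ))

theorem lo_le_hi {μ : BranchPoints g} (hμ : StrictMono μ) (i : Fin (g + 1)) : lo μ i < hi μ i :=
  hμ (by simp [Fin.lt_def])

theorem mem_offCuts {μ : BranchPoints g} {z : ℂ} :
    z ∈ offCuts μ ↔ ∀ i, ∀ x ∈ Set.Icc (lo μ i) (hi μ i), (x : ℂ) ≠ z := by
  simp only [offCuts, support, Set.mem_compl_iff, Set.mem_image, Set.mem_iUnion]
  push Not
  exact ⟨fun h i x hx => h x ⟨i, hx⟩, fun h x ⟨i, hx⟩ => h i x hx⟩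

theorem mem_offCuts_iff {μ : BranchPoints g} (hμ : StrictMono μ) {z : ℂ} :
    z ∈ offCuts μ ↔ ∀ i, (z - hi μ i) / (z - lo μ i) ∈ slitPlane := by
  rw [mem_offCuts]
  exact forall_congr' fun i => (mem_slitPlane_div_iff (lo_le_hi hμ i).le).symm

theorem mem_offCuts_of_norm {μ : BranchPoints g} {z : ℂ} (h : ∀ α, |μ α| < ‖z‖) :
    z ∈ offCuts μ := by
  rw [mem_offCuts]
  rintro i x ⟨h1, h2⟩ rfl
  have ha := h ⟨2 * i.val, by omega⟩
  have hb := h ⟨2 * i.val + 1, by omega⟩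
  rw [Complex.norm_real, Real.norm_eq_abs] at ha hb
  unfold lo at h1
  unfold hi at h2
  have := abs_le_max_abs_abs h1 h2
  rcases max_choice (|μ ⟨2 * i.val, by omega⟩|) (|μ ⟨2 * i.val + 1, by omega⟩|) with h | h <;>
    rw [h] at this <;> linarith

theorem branch_not_mem_offCuts {μ : BranchPoints g} (hμ : StrictMono μ) (α : Fin (2 * (g + 1))) :
    (μ α : ℂ) ∉ offCuts μ := by
  rw [mem_offCuts]
  push Not
  revert α
  rw [forall_branchPoints]
  exact fun i => ⟨⟨i, _, ⟨le_rfl, (lo_le_hi hμ i).le⟩, rfl⟩, ⟨i, _, ⟨(lo_le_hi hμ i).le, le_rfl⟩, rfl⟩⟩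

theorem sub_ne_zero_of_mem_offCuts {μ : BranchPoints g} (hμ : StrictMono μ) {z : ℂ}
    (hz : z ∈ offCuts μ) (α : Fin (2 * (g + 1))) : z - μ α ≠ 0 :=
  sub_ne_zero.2 fun h => branch_not_mem_offCuts hμ α (h ▸ hz)

theorem isOpen_offCuts (μ : BranchPoints g) : IsOpen (offCuts μ) := by
  unfold offCuts support
  refine (IsCompact.image ?_ continuous_ofReal).isClosed.isOpen_compl
  exact isCompact_iUnion fun i => isCompact_Icc

theorem eval_T (μ : BranchPoints g) (z : ℂ) : (T μ).eval z = ∏ α, (z - μ α) := by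
  simp [T, eval_prod]

theorem ytilde_sq (μ : BranchPoints g) (z : ℂ) : ytilde μ z ^ 2 = (T μ).eval z := by
  rw [eval_T, prod_branchPoints, ytilde, ← Finset.prod_pow]
  exact Finset.prod_congr rfl fun i _ => cutSqrt_sq _ _ _

theorem ytilde_ne_zero {μ : BranchPoints g} (hμ : StrictMono μ) {z : ℂ} (hz : z ∈ offCuts μ) :
    ytilde μ z ≠ 0 :=
  Finset.prod_ne_zero_iff.2 fun i _ => cutSqrt_ne_zero (lo_le_hi hμ i).le (mem_offCuts.1 hz i)

theorem eval_T_ne_zero {μ : BranchPoints g} (hμ : StrictMono μ) {z : ℂ} (hz : z ∈ offCuts μ) :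
    (T μ).eval z ≠ 0 := by
  rw [← ytilde_sq]; exact pow_ne_zero _ (ytilde_ne_zero hμ hz)

theorem differentiableAt_ytilde {μ : BranchPoints g} (hμ : StrictMono μ) {z : ℂ}
    (hz : z ∈ offCuts μ) : DifferentiableAt ℂ (ytilde μ) z := by
  unfold ytilde
  exact DifferentiableAt.fun_finsetProd fun i _ =>
    differentiableAt_cutSqrt (lo_le_hi hμ i).le (mem_offCuts.1 hz i)

theorem hasDerivAt_ytilde {μ : BranchPoints g} (hμ : StrictMono μ) {z : ℂ} (hz : z ∈ offCuts μ) :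
    HasDerivAt (ytilde μ) ((derivative (T μ)).eval z / (2 * ytilde μ z)) z := by
  have h1 := (differentiableAt_ytilde hμ hz).hasDerivAt
  have h2 := h1.pow 2
  have h3 : HasDerivAt (ytilde μ ^ 2) ((derivative (T μ)).eval z) z := by
    have : ytilde μ ^ 2 = fun z => (T μ).eval z := funext fun z => ytilde_sq μ z
    rw [this]; exact (T μ).hasDerivAt z
  have h4 := h2.unique h3
  have h5 := ytilde_ne_zero hμ hz
  have h6 : (derivative (T μ)).eval z / (2 * ytilde μ z) = deriv (ytilde μ) z := by
    rw [← h4]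
    field_simp
    norm_num
    ring
  rwa [h6]

theorem ytilde_conj {μ : BranchPoints g} (hμ : StrictMono μ) {z : ℂ} (hz : z ∈ offCuts μ) :
    ytilde μ (starRingEnd ℂ z) = starRingEnd ℂ (ytilde μ z) := by
  unfold ytilde
  rw [map_prod]
  exact Finset.prod_congr rfl fun i _ => cutSqrt_conj (lo_le_hi hμ i).le (mem_offCuts.1 hz i)

theorem ext_ytilde {μ : BranchPoints g} (hμ : StrictMono μ) {ρ : ℝ} (hρ : ∀ α, |μ α| ≤ ρ) :
    Ext ρ (ytilde μ) :=
  Ext.of_at fun _ hz => differentiableAt_ytilde hμ (mem_offCuts_of_norm fun α => (hρ α).trans_lt hz)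

theorem ext_ytilde_inv {μ : BranchPoints g} (hμ : StrictMono μ) {ρ : ℝ} (hρ : ∀ α, |μ α| ≤ ρ) :
    Ext ρ (fun z => (ytilde μ z)⁻¹) :=
  Ext.of_at fun _ hz => by
    have h := mem_offCuts_of_norm fun α => (hρ α).trans_lt hz
    exact (differentiableAt_ytilde hμ h).inv (ytilde_ne_zero hμ h)

/-- Allows the growth of `ytilde` and its inverse to be read off from the polynomial `T`, without
reference to branches. -/
theorem Gro.of_sq {k : ℤ} {f : ℂ → ℂ} (h : Gro (2 * k) fun z => f z ^ 2) : Gro k f := by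
  obtain ⟨C, R, hC, hR, hb⟩ := h.exists_bound
  refine Gro.of_bound (√C) R fun z hz => ?_
  have h1 := hb z hz
  rw [norm_pow] at h1
  refine le_of_sq_le_sq ?_ (by positivity)
  rw [mul_pow, Real.sq_sqrt hC.le]
  refine h1.trans (le_of_eq ?_)
  rw [mul_comm 2 k, zpow_mul]
  norm_cast

theorem Gro.prod {ι : Type*} {s : Finset ι} {k : ℤ} {f : ι → ℂ → ℂ} (h : ∀ i ∈ s, Gro k (f i)) :
    Gro (s.card * k) (fun z => ∏ i ∈ s, f i z) := by
  classical
  induction s using Finset.induction_on with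
  | empty => simpa using gro_const 1
  | insert a s ha ih =>
    simp only [Finset.prod_insert ha, Finset.card_insert_of_notMem ha]
    exact (h a (by simp)).mul (ih fun i hi => h i (by simp [hi])) (by push_cast; ring)

theorem gro_ytilde (μ : BranchPoints g) : Gro (g + 1) (ytilde μ) := by
  refine Gro.of_sq ?_
  simp only [ytilde_sq, eval_T]
  have := Gro.prod (s := Finset.univ) (k := 1) (f := fun α z => z - (μ α : ℂ)) fun α _ => by
    simpa using ((gro_pow 1).sub ((gro_const (μ α : ℂ)).mono (by norm_num)))
  simpa using this

theorem gro_ytilde_inv (μ : BranchPoints g) : Gro (-(g + 1)) (fun z => (ytilde μ z)⁻¹) := by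
  refine Gro.of_sq ?_
  simp only [inv_pow, ytilde_sq, eval_T, ← Finset.prod_inv_distrib]
  have := Gro.prod (s := Finset.univ) (k := -1) (f := fun α z => (z - (μ α : ℂ))⁻¹) fun α _ =>
    gro_inv_sub _
  refine (this.congr 0 fun z _ => by simp).mono (le_of_eq ?_)
  simp; ring

theorem hasLogFDerivAt_ytilde {μ : BranchPoints g} (hμ : StrictMono μ) {z : ℂ}
    (hz : z ∈ offCuts μ) :
    HasLogFDerivAt (fun μ' : BranchPoints g => ytilde μ' z)
      (∑ α, (-(1 / 2) / (z - μ α)) • (ofRealCLM.comp (ContinuousLinearMap.proj α))) μ := by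
  rw [sum_branchPoints]
  unfold ytilde
  refine HasLogFDerivAt.prod _ fun i _ => ?_
  exact hasLogFDerivAt_cutSqrt (A := fun μ' => lo μ' i) (B := fun μ' => hi μ' i)
    (ContinuousLinearMap.proj (R := ℝ) (φ := fun _ => ℝ) _).hasFDerivAt
    (ContinuousLinearMap.proj (R := ℝ) (φ := fun _ => ℝ) _).hasFDerivAt
    (lo_le_hi hμ i).le (mem_offCuts.1 hz i)

theorem eventually_strictMono {μ : BranchPoints g} (hμ : StrictMono μ) :
    ∀ᶠ μ' in 𝓝 μ, StrictMono (μ' : BranchPoints g) := by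
  have : ∀ᶠ μ' : BranchPoints g in 𝓝 μ, ∀ α β, α < β → μ' α < μ' β := by
    rw [eventually_all]
    intro α
    rw [eventually_all]
    intro β
    by_cases h : α < β
    · simp only [h, true_imp_iff]
      exact (continuous_apply α).continuousAt.eventually_lt (continuous_apply β).continuousAt (hμ h)
    · simp [h]
  exact this.mono fun μ' h α β => h α β

theorem continuousAt_ytilde {μ : BranchPoints g} (hμ : StrictMono μ) {z : ℂ} (hz : z ∈ offCuts μ) :
    ContinuousAt (fun q : BranchPoints g × ℂ => ytilde q.1 q.2) (μ, z) := by
  unfold ytilde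
  refine tendsto_finsetProd _ fun i _ => ?_
  exact (continuousAt_cutSqrt (A := fun q : BranchPoints g × ℂ => lo q.1 i)
    (B := fun q => hi q.1 i) (Z := fun q => q.2)
    (by unfold lo; fun_prop) (by unfold hi; fun_prop) (by fun_prop) (lo_le_hi hμ i).le
    (mem_offCuts.1 hz i)).1

theorem eventually_mem_offCuts {μ : BranchPoints g} (hμ : StrictMono μ) {z : ℂ}
    (hz : z ∈ offCuts μ) :
    ∀ᶠ q : BranchPoints g × ℂ in 𝓝 (μ, z), StrictMono q.1 ∧ q.2 ∈ offCuts q.1 := by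
  have h1 : ∀ᶠ q : BranchPoints g × ℂ in 𝓝 (μ, z), StrictMono q.1 :=
    continuousAt_fst.eventually (eventually_strictMono hμ)
  have h2 : ∀ᶠ q : BranchPoints g × ℂ in 𝓝 (μ, z),
      ∀ i, (q.2 - hi q.1 i) / (q.2 - lo q.1 i) ∈ slitPlane := by
    rw [eventually_all]
    exact fun i => (continuousAt_cutSqrt (A := fun q : BranchPoints g × ℂ => lo q.1 i)
      (B := fun q => hi q.1 i) (Z := fun q => q.2)
      (by unfold lo; fun_prop) (by unfold hi; fun_prop) (by fun_prop) (lo_le_hi hμ i).le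
      (mem_offCuts.1 hz i)).2
  filter_upwards [h1, h2] with q hq1 hq2
  exact ⟨hq1, (mem_offCuts_iff hq1).2 hq2⟩

/-! ### Differentiation under the integral sign -/

theorem continuousOn_section {X F : Type*} [TopologicalSpace X] [TopologicalSpace F] (u : X → ℝ → F)
    (x : X) {S : Set ℝ} (hu : ∀ t ∈ S, ContinuousAt (fun q : X × ℝ => u q.1 q.2) (x, t)) :
    ContinuousOn (u x) S := fun t ht =>
  (ContinuousAt.comp (f := fun t => (x, t)) (hu t ht) (by fun_prop)).continuousWithinAt

theorem aestronglyMeasurable_uIoc {F : Type*} [NormedAddCommGroup F] {a b : ℝ} (u : ℝ → F)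
    (hu : ContinuousOn u (Set.uIcc a b)) :
    MeasureTheory.AEStronglyMeasurable u (MeasureTheory.volume.restrict (Set.uIoc a b)) :=
  (hu.mono Set.uIoc_subset_uIcc).aestronglyMeasurable measurableSet_uIoc

/-- Compactness of the interval turns joint continuity into a uniform bound `C + 1` on the
derivatives near `x₀`. The derivative of the integral is then continuous, which gives the strict
differentiability that the implicit function theorem needs. -/
theorem hasStrictFDerivAt_intervalIntegral {E : Type*} [NormedAddCommGroup E] [NormedSpace ℝ E]
    {f : E → ℝ → ℂ} {f' : E → ℝ → E →L[ℝ] ℂ} {x₀ : E} {a b : ℝ}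
    (h : ∀ t ∈ Set.uIcc a b, ∀ᶠ q : E × ℝ in 𝓝 (x₀, t),
      HasFDerivAt (fun x => f x q.2) (f' q.1 q.2) q.1 ∧
      ContinuousAt (fun q : E × ℝ => f q.1 q.2) q ∧
      ContinuousAt (fun q : E × ℝ => f' q.1 q.2) q) :
    HasStrictFDerivAt (fun x => ∫ t in a..b, f x t) (∫ t in a..b, f' x₀ t) x₀ ∧
      IntervalIntegrable (f' x₀) MeasureTheory.volume a b := by
  have hK : IsCompact (Set.uIcc a b) := isCompact_uIcc
  obtain ⟨C, hC⟩ : ∃ C, ∀ t ∈ Set.uIcc a b, ‖f' x₀ t‖ ≤ C := by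
    refine hK.exists_bound_of_continuousOn fun t ht => ?_
    have := (h t ht).self_of_nhds.2.2
    exact (ContinuousAt.comp (f := fun t => (x₀, t)) this (by fun_prop)).continuousWithinAt
  have h1 : ∀ᶠ x in 𝓝 x₀, ∀ t ∈ Set.uIcc a b, (HasFDerivAt (fun x => f x t) (f' x t) x ∧
      ContinuousAt (fun q : E × ℝ => f q.1 q.2) (x, t) ∧
      ContinuousAt (fun q : E × ℝ => f' q.1 q.2) (x, t)) ∧ ‖f' x t‖ < C + 1 := by
    refine hK.eventually_forall_of_forall_eventually fun t ht => ?_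
    have h2 := (h t ht).self_of_nhds.2.2.norm.eventually
      (gt_mem_nhds (show ‖f' x₀ t‖ < C + 1 by linarith [hC t ht]))
    exact (h t ht).and h2
  have hx₀ := h1.self_of_nhds
  refine ⟨?_, (continuousOn_section f' x₀ fun t ht => (hx₀ t ht).1.2.2).intervalIntegrable⟩
  refine hasStrictFDerivAt_of_hasFDerivAt_of_continuousAt (f' := fun x => ∫ t in a..b, f' x t) ?_ ?_
  · filter_upwards [h1.eventually_nhds] with x hx
    have hxx := hx.self_of_nhds
    refine (intervalIntegral.hasFDerivAt_integral_of_dominated_of_fderiv_le (𝕜 := ℝ)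
      (bound := fun _ => C + 1) hx ?_ ?_ ?_ ?_ ?_ ?_)
    · exact hx.mono fun y hy => aestronglyMeasurable_uIoc _ (continuousOn_section f y fun t ht => (hy t ht).1.2.1)
    · exact (continuousOn_section f x fun t ht => (hxx t ht).1.2.1).intervalIntegrable
    · exact aestronglyMeasurable_uIoc _ (continuousOn_section f' x fun t ht => (hxx t ht).1.2.2)
    · exact Eventually.of_forall fun t ht y hy => (hy t (Set.uIoc_subset_uIcc ht)).2.le
    · exact intervalIntegrable_const
    · exact Eventually.of_forall fun t ht y hy => (hy t (Set.uIoc_subset_uIcc ht)).1.1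
  · refine intervalIntegral.continuousAt_of_dominated_interval (bound := fun _ => C + 1) ?_ ?_ ?_ ?_
    · exact h1.mono fun y hy => aestronglyMeasurable_uIoc _ (continuousOn_section f' y fun t ht => (hy t ht).1.2.2)
    · exact h1.mono fun y hy => Eventually.of_forall fun t ht =>
        (hy t (Set.uIoc_subset_uIcc ht)).2.le
    · exact intervalIntegrable_const
    · refine Eventually.of_forall fun t ht => ?_
      exact ContinuousAt.comp (f := fun x => (x, t)) (hx₀ t (Set.uIoc_subset_uIcc ht)).1.2.2
        (by fun_prop)

/-- The variation of `ytilde ^ s` in the direction `v`, divided by `ytilde ^ s`. -/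
def logVar (μ : BranchPoints g) (v : BranchPoints g) (z : ℂ) : ℂ :=
  ∑ α, (v α : ℂ) * (z - μ α)⁻¹

/-- The exponent `s = 1` serves for periods of `y`, and `s = -1` for planar moments and for the
entries of `Q`. -/
theorem hasStrictFDerivAt_ytilde_integral {μ : BranchPoints g} (hμ : StrictMono μ) (s : ℤ)
    {a b : ℝ} {z φ : ℝ → ℂ} (hz : Continuous z) (hφ : Continuous φ)
    (hoff : ∀ t ∈ Set.uIcc a b, z t ∈ offCuts μ) :
    ∃ D : BranchPoints g →L[ℝ] ℂ,
      HasStrictFDerivAt (fun μ' : BranchPoints g => ∫ t in a..b, φ t * ytilde μ' (z t) ^ s) D μ ∧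
      ∀ v, D v = ∫ t in a..b, φ t * (-(s / 2) * ytilde μ (z t) ^ s * logVar μ v (z t)) := by
  let ℓ : BranchPoints g → ℝ → BranchPoints g →L[ℝ] ℂ := fun μ' t =>
    φ t • (ytilde μ' (z t) ^ s) • ((s : ℂ) • ∑ α, (-(1 / 2) / (z t - μ' α)) •
      (ofRealCLM.comp (ContinuousLinearMap.proj (R := ℝ) (φ := fun _ : Fin (2 * (g + 1)) => ℝ) α)))
  have key := hasStrictFDerivAt_intervalIntegral (f := fun μ' t => φ t * ytilde μ' (z t) ^ s)
    (f' := ℓ) (x₀ := μ) (a := a) (b := b) ?_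
  · refine ⟨_, key.1, fun v => ?_⟩
    rw [ContinuousLinearMap.intervalIntegral_apply key.2]
    refine intervalIntegral.integral_congr fun t _ => ?_
    simp only [ℓ, smul_apply, sum_apply, smul_eq_mul,
      ContinuousLinearMap.comp_apply, ContinuousLinearMap.proj_apply, ofRealCLM_apply, logVar]
    rw [Finset.mul_sum, Finset.mul_sum, Finset.mul_sum, Finset.mul_sum, Finset.mul_sum]
    refine Finset.sum_congr rfl fun α _ => ?_
    ring
  · intro t ht
    have hc : ContinuousAt (fun q : BranchPoints g × ℝ => (q.1, z q.2)) (μ, t) := by fun_prop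
    filter_upwards [hc.eventually (eventually_mem_offCuts hμ (hoff t ht))] with q hq
    obtain ⟨hq1, hq2⟩ := hq
    have hq0 := ytilde_ne_zero hq1 hq2
    have hcy : ContinuousAt (fun q : BranchPoints g × ℝ => ytilde q.1 (z q.2) ^ s) q := by
      refine ContinuousAt.zpow₀ ?_ s (Or.inl hq0)
      exact ContinuousAt.comp (f := fun q : BranchPoints g × ℝ => (q.1, z q.2))
        (continuousAt_ytilde hq1 hq2) (by fun_prop)
    refine ⟨?_, ?_, ?_⟩
    · exact HasFDerivAt.const_mul ((hasLogFDerivAt_ytilde hq1 hq2).zpow hq0 s) (φ q.2)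
    · exact (hφ.continuousAt.comp continuousAt_snd).mul hcy
    · have hα : ∀ α, ContinuousAt (fun q : BranchPoints g × ℝ => (-(1 / 2) / (z q.2 - q.1 α)) •
          (ofRealCLM.comp (ContinuousLinearMap.proj (R := ℝ)
            (φ := fun _ : Fin (2 * (g + 1)) => ℝ) α))) q := fun α => by
        have hd : ContinuousAt (fun q : BranchPoints g × ℝ => -(1 / 2) / (z q.2 - q.1 α)) q := by
          refine ContinuousAt.div continuousAt_const ?_ (sub_ne_zero_of_mem_offCuts hq1 hq2 α)
          fun_prop
        exact hd.smul (continuousAt_const (y := ofRealCLM.comp (ContinuousLinearMap.proj (R := ℝ)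
          (φ := fun _ : Fin (2 * (g + 1)) => ℝ) α)))
      have hsum : ContinuousAt (fun q : BranchPoints g × ℝ => ∑ α, (-(1 / 2) / (z q.2 - q.1 α)) •
          (ofRealCLM.comp (ContinuousLinearMap.proj (R := ℝ)
            (φ := fun _ : Fin (2 * (g + 1)) => ℝ) α))) q := by
        unfold ContinuousAt
        exact tendsto_finsetSum Finset.univ fun α _ => (hα α).tendsto
      exact ContinuousAt.smul (hφ.continuousAt.comp continuousAt_snd)
        (hcy.smul (ContinuousAt.const_smul hsum (s : ℂ)))

theorem hasStrictFDerivAt_res {μ : BranchPoints g} (hμ : StrictMono μ) (s : ℤ) {r : ℝ}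
    (hr : ∀ α, |μ α| < r) {F : ℂ → ℂ} (hF : Continuous F) :
    ∃ D : BranchPoints g →L[ℝ] ℂ,
      HasStrictFDerivAt (fun μ' : BranchPoints g => res r fun z => F z * ytilde μ' z ^ s) D μ ∧
      ∀ v, D v = res r fun z => F z * (-(s / 2) * ytilde μ z ^ s * logVar μ v z) := by
  have hr0 : 0 < r := (abs_nonneg _).trans_lt (hr ⟨0, by omega⟩)
  obtain ⟨D, h1, h2⟩ := hasStrictFDerivAt_ytilde_integral hμ s (a := 0) (b := 2 * Real.pi)
    (z := circleMap 0 r) (φ := fun t => deriv (circleMap 0 r) t * F (circleMap 0 r t))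
    (continuous_circleMap 0 r)
    (by
      simp only [deriv_circleMap]
      exact ((continuous_circleMap 0 r).mul continuous_const).mul
        (hF.comp (continuous_circleMap 0 r)))
    (fun t _ => mem_offCuts_of_norm fun α => by simpa [abs_of_pos hr0] using hr α)
  refine ⟨(2 * (Real.pi : ℂ) * Complex.I)⁻¹ • D, ?_, fun v => ?_⟩
  · refine (h1.const_smul (2 * (Real.pi : ℂ) * Complex.I)⁻¹).congr_of_eventuallyEq ?_
    refine Eventually.of_forall fun μ' => ?_
    simp only [res, circleIntegral, smul_eq_mul, mul_assoc, Pi.smul_apply]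
  · simp only [smul_apply, h2, res, circleIntegral, smul_eq_mul, mul_assoc]

/-! ### Polynomial parts of `P / ytilde` and the polynomial `M` -/

theorem abs_lt_rad (μ : BranchPoints g) (α : Fin (2 * (g + 1))) : |μ α| < 1 + ∑ β, |μ β| := by
  have := Finset.single_le_sum (f := fun β => |μ β|) (fun β _ => abs_nonneg (μ β))
    (Finset.mem_univ α)
  linarith

theorem exists_inner_radius {μ : BranchPoints g} {r : ℝ} (hr : ∀ α, |μ α| < r) :
    ∃ ρ, 0 ≤ ρ ∧ (∀ α, |μ α| ≤ ρ) ∧ ρ < r := by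
  obtain ⟨α, -, h⟩ := Finset.exists_max_image Finset.univ (fun α => |μ α|) ⟨⟨0, by omega⟩, by simp⟩
  exact ⟨|μ α|, abs_nonneg _, fun β => h β (by simp), hr α⟩

/-- The polynomial part at infinity of `P / ytilde`. -/
def pol (μ : BranchPoints g) (P : ℂ[X]) : ℂ[X] :=
  polPart (1 + ∑ β, |μ β|) (fun z => (ytilde μ z)⁻¹) P

theorem polPart_eq_of_ext {ρ r R : ℝ} {φ : ℂ → ℂ} (hφ : Ext ρ φ) (h0 : 0 ≤ ρ) (hr : ρ < r)
    (hR : ρ < R) (P : ℂ[X]) : polPart r φ P = polPart R φ P := by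
  ext i
  rw [coeff_polPart, coeff_polPart]
  exact res_eq_of_ext ((ext_eval ρ _).mul hφ) h0 hr hR

theorem pol_eq_polPart {μ : BranchPoints g} (hμ : StrictMono μ) {r : ℝ} (hr : ∀ α, |μ α| < r)
    (P : ℂ[X]) : pol μ P = polPart r (fun z => (ytilde μ z)⁻¹) P := by
  obtain ⟨ρ, h0, h1, h2⟩ := exists_inner_radius (r := min r (1 + ∑ β, |μ β|))
    fun α => lt_min (hr α) (abs_lt_rad μ α)
  exact polPart_eq_of_ext (ext_ytilde_inv hμ h1) h0 (h2.trans_le (min_le_right _ _))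
    (h2.trans_le (min_le_left _ _)) P

theorem gro_ytilde_inv_one (μ : BranchPoints g) : Gro (-1) (fun z => (ytilde μ z)⁻¹) :=
  (gro_ytilde_inv μ).mono (by omega)

theorem continuousOn_ytilde_inv {μ : BranchPoints g} (hμ : StrictMono μ) {r : ℝ}
    (hr : ∀ α, |μ α| < r) : ContinuousOn (fun z => (ytilde μ z)⁻¹) (Metric.sphere 0 r) := by
  obtain ⟨ρ, h0, h1, h2⟩ := exists_inner_radius hr
  exact (ext_ytilde_inv hμ h1).continuousOn_sphere h2

theorem rad_pos (μ : BranchPoints g) : 0 < 1 + ∑ β, |μ β| := by positivity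

theorem pol_add {μ : BranchPoints g} (hμ : StrictMono μ) (P R : ℂ[X]) :
    pol μ (P + R) = pol μ P + pol μ R :=
  polPart_add (rad_pos μ).le (continuousOn_ytilde_inv hμ (abs_lt_rad μ)) P R

theorem pol_C_mul (μ : BranchPoints g) (a : ℂ) (P : ℂ[X]) : pol μ (C a * P) = C a * pol μ P :=
  polPart_C_mul _ _ a P

theorem pol_quo (μ : BranchPoints g) (l : ℕ) (P : ℂ[X]) : pol μ (quo l P) = quo l (pol μ P) :=
  polPart_quo _ _ l P

theorem gro_pol_remainder {μ : BranchPoints g} (hμ : StrictMono μ) (P : ℂ[X]) (K : ℕ)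
    (hm : ∀ k < K, res (1 + ∑ β, |μ β|) (fun z => z ^ k * (P.eval z * (ytilde μ z)⁻¹)) = 0) :
    Gro (-1 - K) fun p => P.eval p * (ytilde μ p)⁻¹ - (pol μ P).eval p := by
  obtain ⟨ρ, h0, h1, h2⟩ := exists_inner_radius (abs_lt_rad μ)
  exact gro_polPart_remainder (ext_ytilde_inv hμ h1) (gro_ytilde_inv_one μ) h0 h2 P K hm

theorem gro_pol_remainder_one {μ : BranchPoints g} (hμ : StrictMono μ) (P : ℂ[X]) :
    Gro (-1) fun p => P.eval p * (ytilde μ p)⁻¹ - (pol μ P).eval p := by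
  simpa using gro_pol_remainder hμ P 0 (by simp)

theorem ext_pol_remainder {μ : BranchPoints g} (hμ : StrictMono μ) {ρ : ℝ} (hρ : ∀ α, |μ α| ≤ ρ)
    (P : ℂ[X]) : Ext ρ fun p => P.eval p * (ytilde μ p)⁻¹ - (pol μ P).eval p :=
  ((ext_eval ρ P).mul (ext_ytilde_inv hμ hρ)).sub (ext_eval ρ _)

/-- A functional represented by an exterior function `λ = O(1/z)` acts on the polynomial part of
`P / ytilde` through `P λ / ytilde`. -/
theorem res_pol_mul {μ : BranchPoints g} (hμ : StrictMono μ) {ρ r : ℝ} (h0 : 0 ≤ ρ)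
    (hρ : ∀ α, |μ α| ≤ ρ) (hr : ρ < r) {lam : ℂ → ℂ} (hl : Ext ρ lam) (hg : Gro (-1) lam)
    (P : ℂ[X]) :
    res r (fun z => (pol μ P).eval z * lam z) =
      res r (fun z => P.eval z * (ytilde μ z)⁻¹ * lam z) := by
  -- The difference between `P / ytilde` and its polynomial part is `O(1/z)`, so its product with
  -- `lam` is `O(z ^ (-2))` and integrates to zero.
  have h1 := res_eq_zero_of_gro ((ext_pol_remainder hμ hρ P).mul hl)
    ((gro_pol_remainder_one hμ P).mul hg (by norm_num)) h0 hr
  simp only [sub_mul] at h1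
  rw [res_sub (h0.trans hr.le)] at h1
  · exact (sub_eq_zero.1 h1).symm
  · exact (((ext_eval ρ P).mul (ext_ytilde_inv hμ hρ)).mul hl).continuousOn_sphere hr
  · exact ((ext_eval ρ _).mul hl).continuousOn_sphere hr

/-- Applied with the symbol `1 / (z - a) ^ (l + 1)`, `res_pol_mul` identifies the moments with
Taylor coefficients of `M`. The inner disc has to contain `a` as well as the branch points. -/
theorem hasseDeriv_pol {μ : BranchPoints g} (hμ : StrictMono μ) {r : ℝ}
    (hr : ∀ α, |μ α| < r) {a : ℂ} (ha : ‖a‖ < r) (P : ℂ[X]) (l : ℕ) :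
    res r (fun z => P.eval z * (ytilde μ z)⁻¹ * ((z - a) ^ (l + 1))⁻¹) =
      (hasseDeriv l (pol μ P)).eval a := by
  obtain ⟨ρ, h0, h1, h2⟩ := exists_inner_radius hr
  have h3 : ∀ α, |μ α| ≤ max ρ ‖a‖ := fun α => (h1 α).trans (le_max_left _ _)
  rw [← res_eval_div_pow ha, res_pol_mul hμ (h0.trans (le_max_left _ _)) h3 (max_lt h2 ha)
    (ext_inv_sub_pow (le_max_right _ _) _)
    ((gro_inv_sub_pow a (l + 1)).mono (by push_cast; omega))]

/-- The complex polynomial `V'`. -/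
def dVpoly (V : ℝ[X]) : ℂ[X] := (derivative V).map (algebraMap ℝ ℂ)

theorem dV_eq (V : ℝ[X]) (z : ℂ) : dV V z = (dVpoly V).eval z := by
  rw [dV, dVpoly, aeval_def, eval_map]

/-- `M` as a polynomial. -/
def Mpoly (V : ℝ[X]) (μ : BranchPoints g) : ℂ[X] := pol μ (dVpoly V)

theorem momentFn_eq {V : ℝ[X]} {μ : BranchPoints g} (hμ : StrictMono μ) (k : ℕ) (p : ℂ) :
    momentFn V μ (k + 1) p = (hasseDeriv k (Mpoly V μ)).eval p := by
  have hs : 0 ≤ ∑ β, |μ β| := Finset.sum_nonneg fun β _ => abs_nonneg _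
  rw [Mpoly, ← hasseDeriv_pol hμ (r := 1 + ‖p‖ + ∑ α, |μ α|)
    (fun α => (abs_lt_rad μ α).trans_le (by linarith [norm_nonneg p])) (by linarith)]
  unfold momentFn res
  simp only [dV_eq]
  congr 2
  funext z
  rw [div_eq_mul_inv, mul_inv]; ring

theorem M_eq {V : ℝ[X]} {μ : BranchPoints g} (hμ : StrictMono μ) (p : ℂ) :
    M V μ p = (Mpoly V μ).eval p := by
  rw [M, momentFn_eq hμ 0 p, hasseDeriv_zero, LinearMap.id_apply]

theorem moment_eq {V : ℝ[X]} {μ : BranchPoints g} (hμ : StrictMono μ) (k : ℕ)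
    (α : Fin (2 * (g + 1))) :
    moment V μ α (k + 1) = (hasseDeriv k (Mpoly V μ)).eval (μ α : ℂ) := momentFn_eq hμ k _

theorem monic_T (μ : BranchPoints g) : (T μ).Monic := monic_prod_of_monic _ _ fun _ _ => monic_X_sub_C _

theorem degree_T (μ : BranchPoints g) : (T μ).natDegree = 2 * (g + 1) := by
  rw [T, natDegree_prod_of_monic _ _ fun _ _ => monic_X_sub_C _]
  simp

theorem eval_T_branch (μ : BranchPoints g) (α : Fin (2 * (g + 1))) : (T μ).eval (μ α : ℂ) = 0 := by
  rw [eval_T]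
  exact Finset.prod_eq_zero (Finset.mem_univ α) (sub_self _)

theorem T_mul_inv {μ : BranchPoints g} (hμ : StrictMono μ) {z : ℂ} (hz : z ∈ offCuts μ) :
    (T μ).eval z * (ytilde μ z)⁻¹ = ytilde μ z := by
  rw [← ytilde_sq, pow_two, mul_inv_cancel_right₀ (ytilde_ne_zero hμ hz)]

/-- The polynomial part of `z ^ j ytilde`. -/
def epoly (μ : BranchPoints g) (j : ℕ) : ℂ[X] := pol μ (X ^ j * T μ)

theorem gro_epoly {μ : BranchPoints g} (hμ : StrictMono μ) (j : ℕ) :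
    Gro (-1) fun p => p ^ j * ytilde μ p - (epoly μ j).eval p := by
  refine (gro_pol_remainder_one hμ (X ^ j * T μ)).congr (1 + ∑ β, |μ β|) fun z hz => ?_
  rw [eval_mul, mul_assoc, T_mul_inv hμ (mem_offCuts_of_norm fun α => (abs_lt_rad μ α).trans hz)]
  simp [epoly]

/-- `epoly μ 0` has degree at most `g + 1`, and `quo l` lowers the degree by `l + 1 ≥ 2`. These
quotients are therefore unchanged when a polynomial is replaced by the one of degree less than `g`
with the same periods. -/
theorem degree_quo_epoly {μ : BranchPoints g} (hμ : StrictMono μ) {l : ℕ} (hl : 1 ≤ l) :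
    (quo l (epoly μ 0)).degree < g := by
  have h1 : Gro (g + 1) fun p => (epoly μ 0).eval p := by
    refine ((gro_ytilde μ).sub ((gro_epoly hμ 0).mono (by omega))).congr 0 fun z _ => ?_
    simp
  rw [degree_lt_iff_coeff_zero]
  intro m hm
  rw [coeff_quo]
  exact coeff_eq_zero_of_gro h1 (by push_cast; omega)

/-! ### Reality -/

/-- All coefficients are real. -/
def IsRealPoly (P : ℂ[X]) : Prop := ∀ i, starRingEnd ℂ (P.coeff i) = P.coeff i

theorem IsRealPoly.eval_conj {P : ℂ[X]} (h : IsRealPoly P) (z : ℂ) :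
    P.eval (starRingEnd ℂ z) = starRingEnd ℂ (P.eval z) := by
  rw [eval_eq_sum_range, eval_eq_sum_range, map_sum]
  simp [h _]

theorem IsRealPoly.eval_ofReal {P : ℂ[X]} (h : IsRealPoly P) (x : ℝ) :
    ((P.eval (x : ℂ)).re : ℂ) = P.eval (x : ℂ) := by
  rw [← conj_eq_iff_re, ← h.eval_conj, conj_ofReal]

theorem IsRealPoly.quo {P : ℂ[X]} (h : IsRealPoly P) (i : ℕ) : IsRealPoly (quo i P) := fun m => by
  rw [coeff_quo, h]

theorem IsRealPoly.mul {P R : ℂ[X]} (h : IsRealPoly P) (h' : IsRealPoly R) :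
    IsRealPoly (P * R) := fun m => by
  simp only [coeff_mul, map_sum, map_mul, h _, h' _]

theorem isRealPoly_dVpoly (V : ℝ[X]) : IsRealPoly (dVpoly V) := fun m => by
  simp [dVpoly, coeff_map]

theorem isRealPoly_T (μ : BranchPoints g) : IsRealPoly (T μ) := by
  have : T μ = (∏ α, (X - C (μ α)) : ℝ[X]).map (algebraMap ℝ ℂ) := by
    simp [T, Polynomial.map_prod]
  intro i
  rw [this, coeff_map]
  simp

/-- Conjugation reflects the circle, `θ ↦ 2π - θ`, and after cancelling `I` against `2πi` the
parametrized integral has a real prefactor. -/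
theorem res_conj {r : ℝ} {f : ℂ → ℂ}
    (h : ∀ z, ‖z‖ = |r| → f (starRingEnd ℂ z) = starRingEnd ℂ (f z)) :
    starRingEnd ℂ (res r f) = res r f := by
  have e : res r f = (2 * (Real.pi : ℂ))⁻¹ *
      ∫ θ in (0 : ℝ)..2 * Real.pi, circleMap 0 r θ * f (circleMap 0 r θ) := by
    unfold res circleIntegral
    simp only [deriv_circleMap, smul_eq_mul]
    have : ∀ θ : ℝ, circleMap 0 r θ * I * f (circleMap 0 r θ) =
        I * (circleMap 0 r θ * f (circleMap 0 r θ)) := fun θ => by ring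
    simp only [this, intervalIntegral.integral_const_mul]
    rw [mul_inv, mul_assoc, inv_mul_cancel_left₀ I_ne_zero]
  have hc : ∀ θ : ℝ, circleMap 0 r (2 * Real.pi - θ) = starRingEnd ℂ (circleMap 0 r θ) := fun θ => by
    simp only [circleMap, zero_add, map_mul, conj_ofReal, ← exp_conj, conj_I]
    congr 1
    rw [Complex.exp_eq_exp_iff_exists_int]
    exact ⟨1, by push_cast; ring⟩
  have hn : ∀ θ : ℝ, ‖circleMap 0 r θ‖ = |r| := fun θ => by simp
  have e2 : starRingEnd ℂ (∫ θ in (0 : ℝ)..2 * Real.pi, circleMap 0 r θ * f (circleMap 0 r θ)) =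
      ∫ θ in (0 : ℝ)..2 * Real.pi, circleMap 0 r θ * f (circleMap 0 r θ) := by
    rw [← intervalIntegral.intervalIntegral_conj]
    have e3 := intervalIntegral.integral_comp_sub_left (a := 0) (b := 2 * Real.pi)
      (fun θ => circleMap 0 r θ * f (circleMap 0 r θ)) (2 * Real.pi)
    rw [sub_self, sub_zero] at e3
    rw [← e3]
    refine intervalIntegral.integral_congr fun θ _ => ?_
    simp only [map_mul, hc, h _ (hn θ)]
  rw [e, map_mul, e2, map_inv₀, map_mul, conj_ofReal, map_ofNat]

theorem IsRealPoly.pol {μ : BranchPoints g} (hμ : StrictMono μ) {P : ℂ[X]} (h : IsRealPoly P) :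
    IsRealPoly (pol μ P) := fun i => by
  rw [MultiCut.pol, coeff_polPart]
  refine res_conj fun z hz => ?_
  rw [(h.quo i).eval_conj, ytilde_conj hμ (mem_offCuts_of_norm fun α => ?_)]
  · simp
  · rw [hz, abs_of_pos (rad_pos μ)]; exact abs_lt_rad μ α

theorem isRealPoly_Mpoly {μ : BranchPoints g} (hμ : StrictMono μ) (V : ℝ[X]) :
    IsRealPoly (Mpoly V μ) := (isRealPoly_dVpoly V).pol hμ

/-- The planar moments `res (z ^ k V' / ytilde)`. -/
def planarMoment (V : ℝ[X]) (μ : BranchPoints g) (k : ℕ) : ℂ :=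
  res (1 + ∑ β, |μ β|) fun z => z ^ k * ((dVpoly V).eval z * (ytilde μ z)⁻¹)

theorem planarMoment_eq_res {V : ℝ[X]} {μ : BranchPoints g} (hμ : StrictMono μ) (k : ℕ) {r : ℝ}
    (hr : ∀ α, |μ α| < r) :
    planarMoment V μ k = res r fun z => z ^ k * ((dVpoly V).eval z * (ytilde μ z)⁻¹) := by
  obtain ⟨ρ, h0, h1, h2⟩ := exists_inner_radius (r := min r (1 + ∑ β, |μ β|))
    fun α => lt_min (hr α) (abs_lt_rad μ α)
  have := ((ext_eval ρ (X ^ k)).mul ((ext_eval ρ (dVpoly V)).mul (ext_ytilde_inv hμ h1)))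
  simp only [eval_pow, eval_X] at this
  exact res_eq_of_ext this h0 (h2.trans_le (min_le_right _ _)) (h2.trans_le (min_le_left _ _))

theorem isPlanarSolution_iff {V : ℝ[X]} {μ : BranchPoints g} :
    IsPlanarSolution V μ ↔ StrictMono μ ∧
      ∀ k ≤ g + 1, planarMoment V μ k = if k = g + 1 then 2 else 0 := by
  unfold IsPlanarSolution planarMoment res
  refine and_congr_right fun hμ => forall_congr' fun k => imp_congr_right fun hk => ?_
  simp only [dV_eq, div_eq_mul_inv, mul_assoc]
  constructor
  · intro h
    rw [← mul_right_inj' (show (1 * 2⁻¹ : ℂ) ≠ 0 by norm_num), mul_assoc, h]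
    split_ifs <;> norm_num
  · intro h
    rw [h]
    split_ifs <;> norm_num

theorem planarMoment_real {V : ℝ[X]} {μ : BranchPoints g} (hμ : StrictMono μ) (k : ℕ) :
    ((planarMoment V μ k).re : ℂ) = planarMoment V μ k := by
  rw [← conj_eq_iff_re]
  refine res_conj fun z hz => ?_
  rw [(isRealPoly_dVpoly V).eval_conj, ytilde_conj hμ (mem_offCuts_of_norm fun α => ?_)]
  · simp
  · rw [hz, abs_of_pos (rad_pos μ)]; exact abs_lt_rad μ α

/-! ### The arcsine law -/

/-- The point of `[a, b]` at angle `θ`. -/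
def node (a b θ : ℝ) : ℝ := (a + b) / 2 + (b - a) / 2 * Real.cos θ

theorem node_mem {a b : ℝ} (hab : a ≤ b) (θ : ℝ) : node a b θ ∈ Set.Icc a b := by
  have h1 := Real.neg_one_le_cos θ
  have h2 := Real.cos_le_one θ
  unfold node
  constructor <;> nlinarith

theorem continuous_node (a b : ℝ) : Continuous (node a b) := by unfold node; fun_prop

theorem re_cpow_half_pos {w : ℂ} (hw : w ∈ slitPlane) : 0 < (w ^ (1 / 2 : ℂ)).re := by
  rw [cpow_def_of_ne_zero (slitPlane_ne_zero hw), exp_re]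
  refine mul_pos (Real.exp_pos _) (Real.cos_pos_of_mem_Ioo ?_)
  have h1 := (mem_slitPlane_iff_arg.1 hw).1
  have h2 := neg_pi_lt_arg w
  have h3 := lt_of_le_of_ne (arg_le_pi w) h1
  have : (Complex.log w * (1 / 2)).im = arg w / 2 := by
    rw [show (1 / 2 : ℂ) = ((1 / 2 : ℝ) : ℂ) by push_cast; rfl, im_mul_ofReal, log_im]; ring
  rw [this]
  constructor <;> linarith

/-- The arcsine law: `1 / √((z - a)(z - b))` is a mean of Cauchy kernels. -/
theorem integral_inv_sub_node {a b : ℝ} (hab : a < b) {z : ℂ}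
    (hz : ∀ x ∈ Set.Icc a b, (x : ℂ) ≠ z) :
    ∫ θ in (0 : ℝ)..2 * Real.pi, (z - node a b θ)⁻¹ = 2 * Real.pi / cutSqrt a b z := by
  have h1 := (mem_slitPlane_div_iff hab.le).2 hz
  have hza : z - a ≠ 0 := sub_ne_zero.2 (hz a ⟨le_rfl, hab.le⟩).symm
  have hu := re_cpow_half_pos h1
  have hu2 : (((z - b) / (z - a)) ^ (1 / 2 : ℂ)) ^ 2 = (z - b) / (z - a) := by
    rw [← cpow_nat_mul]; norm_num
  have hcut : cutSqrt a b z = (z - a) * ((z - b) / (z - a)) ^ (1 / 2 : ℂ) := rfl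
  set u := ((z - b) / (z - a)) ^ (1 / 2 : ℂ) with hudef
  have hba : ((b : ℂ) - a) ≠ 0 := by
    rw [← ofReal_sub, ofReal_ne_zero]; linarith
  have huz : u ^ 2 * (z - a) = z - b := by rw [hu2, div_mul_cancel₀ _ hza]
  have hz1 : (1 - u ^ 2) * (z - a) = b - a := by linear_combination -huz
  have hu0 : u ≠ 0 := by rintro h; rw [h] at hu; simp at hu
  have h1p : 1 + u ≠ 0 := by
    intro h; have := congrArg Complex.re h; simp at this; linarith
  have h1u2 : 1 - u ^ 2 ≠ 0 := by
    intro h; rw [h, zero_mul] at hz1; exact hba hz1.symm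
  have h1m : 1 - u ≠ 0 := by
    intro h; apply h1u2; linear_combination (1 + u) * h
  have hnorm : ‖1 - u‖ < ‖1 + u‖ := by
    refine lt_of_pow_lt_pow_left₀ 2 (norm_nonneg _) ?_
    rw [← normSq_eq_norm_sq, ← normSq_eq_norm_sq, normSq_apply, normSq_apply]
    simp
    nlinarith
  -- With `w = exp (iθ)`, `z - node a b θ` is a quadratic polynomial in `w` divided by `w`. Its
  -- roots are `w₁` and `w₂ = 1 / w₁`, and the positive real part of `u` places `w₁` inside the unit
  -- circle.
  set w₁ := (1 - u) / (1 + u) with hw₁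
  set w₂ := (1 + u) / (1 - u) with hw₂
  have hn1 : ‖w₁‖ < 1 := by
    rw [hw₁, norm_div, div_lt_one (norm_pos_iff.2 h1p)]; exact hnorm
  have hn2 : 1 < ‖w₂‖ := by
    rw [hw₂, norm_div, one_lt_div (norm_pos_iff.2 h1m)]; exact hnorm
  have hG : DifferentiableOn ℂ (fun w => -4 / ((b - a) * I) * (w - w₂)⁻¹) (Metric.closedBall 0 1) := by
    intro w hw
    have : w - w₂ ≠ 0 := sub_ne_zero.2 (by
      rintro rfl
      simp only [Metric.mem_closedBall, dist_zero_right] at hw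
      linarith)
    exact (by fun_prop (disch := assumption) : DifferentiableAt ℂ _ w).differentiableWithinAt
  -- Cauchy's formula: the only pole inside the unit disc is `w₁`.
  have key := hG.circleIntegral_sub_inv_smul (w := w₁) (by simpa using hn1)
  have e : ∀ θ : ℝ, (z - node a b θ)⁻¹ = deriv (circleMap 0 1) θ • ((circleMap 0 1 θ - w₁)⁻¹ •
      (-4 / ((b - a) * I) * (circleMap 0 1 θ - w₂)⁻¹)) := fun θ => by
    set w := circleMap 0 1 θ with hw
    have hwn : ‖w‖ = 1 := by simp [hw]
    have hw0 : w ≠ 0 := norm_pos_iff.1 (by rw [hwn]; exact one_pos)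
    have hww1 : w - w₁ ≠ 0 := sub_ne_zero.2 (by rintro h; rw [← h] at hn1; linarith)
    have hww2 : w - w₂ ≠ 0 := sub_ne_zero.2 (by rintro h; rw [← h] at hn2; linarith)
    have hcos : Complex.cos (θ : ℂ) = (w + w⁻¹) / 2 := by
      rw [Complex.cos, hw]
      simp only [circleMap, ofReal_one, one_mul, zero_add, neg_mul, exp_neg]
    have hnode : z - node a b θ = -((b - a) / 4) * ((w - w₁) * (w - w₂)) / w := by
      unfold node
      push_cast
      rw [hcos]
      have hs : (w₁ + w₂) * (1 - u ^ 2) = 2 * (1 + u ^ 2) := by rw [hw₁, hw₂]; field_simp; ring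
      have hp : w₁ * w₂ = 1 := by rw [hw₁, hw₂]; field_simp
      have hs' : (w₁ + w₂) * (b - a) = 4 * z - 2 * (a + b) := by
        have : (w₁ + w₂) * (1 - u ^ 2) * (z - a) = 2 * (1 + u ^ 2) * (z - a) := by rw [hs]
        linear_combination this - (w₁ + w₂) * hz1 - 2 * hz1 + 4 * hz1 +
          (0 : ℂ) * huz + 4 * huz
      have hwi : w * w⁻¹ = 1 := mul_inv_cancel₀ hw0
      clear_value w₁ w₂
      rw [eq_div_iff hw0]
      linear_combination (-w / 4) * hs' + ((b - a) / 4) * hp - ((b - a) / 4) * hwi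
    rw [hnode, deriv_circleMap, smul_eq_mul, smul_eq_mul, ← hw]
    field_simp
  rw [show (∫ θ in (0 : ℝ)..2 * Real.pi, (z - node a b θ)⁻¹) = ∮ w in C(0, 1), (w - w₁)⁻¹ •
      (-4 / ((b - a) * I) * (w - w₂)⁻¹) from intervalIntegral.integral_congr fun θ _ => e θ, key,
    hcut, smul_eq_mul]
  have hd : w₁ - w₂ = -4 * u / (1 - u ^ 2) := by
    have : (1 - u ^ 2) = (1 - u) * (1 + u) := by ring
    rw [hw₁, hw₂, this]; field_simp; ring
  rw [hd, ← hz1]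
  have hI := I_ne_zero
  field_simp

/-! ### Rectangular contours and their collapse onto a cut -/

/-- Coefficients of the four sides of a rectangle. -/
def sideCoeff : Fin 4 → ℂ := ![1, -1, I, -I]

/-- Lower ends of the parameters of the sides. -/
def sideLeft (l : ℝ) : Fin 4 → ℝ := ![l, l, -1, -1]

/-- Upper ends of the parameters of the sides. -/
def sideRight (r : ℝ) : Fin 4 → ℝ := ![r, r, 1, 1]

/-- Parametrizations of the sides. -/
def side (l r : ℝ) : Fin 4 → ℝ → ℂ :=
  ![fun x => x - I, fun x => x + I, fun t => r + t * I, fun t => l + t * I]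

theorem rectIntegral_eq_sum (l r : ℝ) (f : ℂ → ℂ) :
    rectIntegral l r f = ∑ i, sideCoeff i * ∫ t in sideLeft l i..sideRight r i, f (side l r i t) := by
  rw [Fin.sum_univ_four]
  simp [rectIntegral, sideCoeff, sideLeft, sideRight, side]
  ring

theorem continuous_side (l r : ℝ) (i : Fin 4) : Continuous (side l r i) := by
  fin_cases i <;> simp [side] <;> fun_prop

/-- The boundary of the rectangle. -/
def rectBoundary (l r : ℝ) : Set ℂ :=
  {z | z.re ∈ Set.Icc l r ∧ z.im ∈ Set.Icc (-1) 1 ∧ (z.re = l ∨ z.re = r ∨ z.im ≠ 0)}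

theorem side_mem {l r : ℝ} (hlr : l ≤ r) (i : Fin 4) {t : ℝ}
    (ht : t ∈ Set.uIcc (sideLeft l i) (sideRight r i)) : side l r i t ∈ rectBoundary l r := by
  fin_cases i <;> simp [side, sideLeft, sideRight, rectBoundary, Set.uIcc_of_le hlr] at * <;>
    simp [hlr, ht]

theorem rect_congr {l r : ℝ} (hlr : l ≤ r) {f f' : ℂ → ℂ}
    (h : ∀ z ∈ rectBoundary l r, f z = f' z) : rectIntegral l r f = rectIntegral l r f' := by
  rw [rectIntegral_eq_sum, rectIntegral_eq_sum]
  refine Finset.sum_congr rfl fun i _ => congrArg _ (intervalIntegral.integral_congr fun t ht => ?_)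
  exact h _ (side_mem hlr i ht)

theorem continuousOn_side {l r : ℝ} (hlr : l ≤ r) (i : Fin 4) {f : ℂ → ℂ}
    (hf : ContinuousOn f (rectBoundary l r)) :
    ContinuousOn (fun t => f (side l r i t)) (Set.uIcc (sideLeft l i) (sideRight r i)) :=
  hf.comp (continuous_side l r i).continuousOn fun _ ht => side_mem hlr i ht

theorem rect_add {l r : ℝ} (hlr : l ≤ r) {f f' : ℂ → ℂ} (hf : ContinuousOn f (rectBoundary l r))
    (hf' : ContinuousOn f' (rectBoundary l r)) :
    rectIntegral l r (fun z => f z + f' z) = rectIntegral l r f + rectIntegral l r f' := by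
  simp only [rectIntegral_eq_sum]
  rw [← Finset.sum_add_distrib]
  refine Finset.sum_congr rfl fun i _ => ?_
  rw [intervalIntegral.integral_add (continuousOn_side hlr i hf).intervalIntegrable
    (continuousOn_side hlr i hf').intervalIntegrable, mul_add]

theorem rect_const_mul (l r : ℝ) (c : ℂ) (f : ℂ → ℂ) :
    rectIntegral l r (fun z => c * f z) = c * rectIntegral l r f := by
  simp only [rectIntegral_eq_sum, intervalIntegral.integral_const_mul]
  rw [Finset.mul_sum]
  exact Finset.sum_congr rfl fun i _ => by ring

theorem rect_sum {ι : Type*} {l r : ℝ} (hlr : l ≤ r) {s : Finset ι} {f : ι → ℂ → ℂ}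
    (hf : ∀ i ∈ s, ContinuousOn (f i) (rectBoundary l r)) :
    rectIntegral l r (fun z => ∑ i ∈ s, f i z) = ∑ i ∈ s, rectIntegral l r (f i) := by
  classical
  induction s using Finset.induction_on with
  | empty => simp [rectIntegral]
  | insert a s ha ih =>
    simp only [Finset.sum_insert ha]
    rw [rect_add hlr (hf a (by simp))
      (continuousOn_finsetSum _ fun i hi => hf i (by simp [hi])), ih fun i hi => hf i (by simp [hi])]

theorem rect_eq_zero {l r : ℝ} (hlr : l ≤ r) {f : ℂ → ℂ}
    (hf : DifferentiableOn ℂ f (Set.Icc l r ×ℂ Set.Icc (-1) 1)) : rectIntegral l r f = 0 := by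
  have := Complex.integral_boundary_rect_eq_zero_of_differentiableOn f (l - I) (r + I) (by
    simpa [Set.uIcc_of_le hlr] using hf)
  simp only [sub_re, ofReal_re, I_re, sub_zero, add_re, add_zero, sub_im, ofReal_im, I_im, zero_sub,
    add_im, zero_add, ofReal_neg, ofReal_one, neg_mul, one_mul, smul_eq_mul] at this
  unfold rectIntegral
  simpa only [← sub_eq_add_neg] using this

/-- The integral of a derivative over the boundary of a rectangle vanishes. -/
theorem rect_deriv {l r : ℝ} (hlr : l ≤ r) {f f' : ℂ → ℂ}
    (hf : ∀ z ∈ rectBoundary l r, HasDerivAt f (f' z) z)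
    (hc : ContinuousOn f' (rectBoundary l r)) : rectIntegral l r f' = 0 := by
  have h : ∀ i, ∀ d : ℂ, (∀ t : ℝ, HasDerivAt (side l r i) d t) →
      d * ∫ t in sideLeft l i..sideRight r i, f' (side l r i t) =
        f (side l r i (sideRight r i)) - f (side l r i (sideLeft l i)) := fun i d hd => by
    rw [← intervalIntegral.integral_const_mul]
    refine intervalIntegral.integral_eq_sub_of_hasDerivAt (f := fun t => f (side l r i t)) ?_ ?_
    · intro t ht
      have := (hf _ (side_mem hlr i ht)).comp t (hd t)
      rwa [mul_comm] at this
    · exact (continuousOn_const.mul (continuousOn_side hlr i hc)).intervalIntegrable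
  have d1 : ∀ t : ℝ, HasDerivAt (fun x : ℝ => (x : ℂ)) 1 t := fun t => (hasDerivAt_id t).ofReal_comp
  have h0 := h 0 1 fun t => (d1 t).sub_const I
  have h1 := h 1 1 fun t => (d1 t).add_const I
  have d2 : ∀ (c : ℂ) (t : ℝ), HasDerivAt (fun x : ℝ => c + (x : ℂ) * I) I t := fun c t => by
    have := ((d1 t).mul_const I).const_add c
    rwa [one_mul] at this
  have h2 := h 2 I (d2 r)
  have h3 := h 3 I (d2 l)
  simp [side, sideLeft, sideRight] at h0 h1 h2 h3
  unfold rectIntegral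
  rw [h0, h1, h2, h3]
  simp only [← sub_eq_add_neg]
  ring

/-- The logarithm is a primitive on the bottom, top and right sides. The left side crosses its
branch cut, so `log (-(z - s))` is used there, and the jumps `±πi` at the two corners add up to
`2πi`. -/
theorem rect_inv_sub {l r s : ℝ} (hl : l < s) (hr : s < r) :
    rectIntegral l r (fun z => (z - s)⁻¹) = 2 * Real.pi * I := by
  have F : ∀ (c d e : ℂ) (A B : ℝ), (∀ t ∈ Set.uIcc A B, c + t * d ∈ slitPlane) →
      d * ∫ t in A..B, (c + t * d)⁻¹ = Complex.log (c + B * d) - Complex.log (c + A * d) := by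
    intro c d e A B h
    rw [← intervalIntegral.integral_const_mul]
    have d1 : ∀ t : ℝ, HasDerivAt (fun x : ℝ => (x : ℂ)) 1 t :=
      fun t => (hasDerivAt_id t).ofReal_comp
    refine intervalIntegral.integral_eq_sub_of_hasDerivAt
      (f := fun t : ℝ => Complex.log (c + t * d)) ?_ ?_
    · intro t ht
      have h1 : HasDerivAt (fun t : ℝ => c + t * d) d t := by
        simpa using ((d1 t).mul_const d).const_add c
      have := (Complex.hasDerivAt_log (h t ht)).comp t h1
      rwa [mul_comm] at this
    · refine ContinuousOn.intervalIntegrable fun t ht => ?_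
      have := slitPlane_ne_zero (h t ht)
      exact (by fun_prop (disch := assumption) :
        ContinuousAt (fun t : ℝ => d * (c + t * d)⁻¹) t).continuousWithinAt
  have h0 := F (-I - s) 1 0 l r fun t _ => by simp [mem_slitPlane_iff]
  have h1 := F (I - s) 1 0 l r fun t _ => by simp [mem_slitPlane_iff]
  have h2 := F (r - s) I 0 (-1) 1 fun t _ => by
    left; simp; linarith
  have h3 := F (s - l) (-I) 0 (-1) 1 fun t _ => by
    left; simp; linarith
  have e3 : ∀ t : ℝ, (s - l + t * -I : ℂ)⁻¹ = -(l + t * I - s)⁻¹ := fun t => by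
    rw [← inv_neg]; congr 1; ring
  simp only [e3, intervalIntegral.integral_neg] at h3
  have n1 : Complex.log (-(l - s + I)) = Complex.log (l - s + I) - Real.pi * I := by
    have := arg_neg_eq_arg_sub_pi_of_im_pos (x := (l - s + I : ℂ)) (by simp)
    rw [Complex.log, Complex.log, norm_neg, this]
    push_cast; ring
  have n2 : Complex.log (-(l - s - I)) = Complex.log (l - s - I) + Real.pi * I := by
    have := arg_neg_eq_arg_add_pi_of_im_neg (x := (l - s - I : ℂ)) (by simp)
    rw [Complex.log, Complex.log, norm_neg, this]
    push_cast; ring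
  have a1 : (s - l + ((1 : ℝ) : ℂ) * -I : ℂ) = -(l - s + I) := by push_cast; ring
  have a2 : (s - l + ((-1 : ℝ) : ℂ) * -I : ℂ) = -(l - s - I) := by push_cast; ring
  rw [a1, a2, n1, n2] at h3
  unfold rectIntegral
  have i0 : ∀ x : ℝ, (x - I - s : ℂ)⁻¹ = (-I - s + x * 1)⁻¹ := fun x => by congr 1; ring
  have i1 : ∀ x : ℝ, (x + I - s : ℂ)⁻¹ = (I - s + x * 1)⁻¹ := fun x => by congr 1; ring
  have i2 : ∀ x : ℝ, (r + x * I - s : ℂ)⁻¹ = (r - s + x * I)⁻¹ := fun x => by congr 1; ring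
  simp only [i0, i1, i2]
  rw [one_mul] at h0 h1
  rw [h0, h1, h2]
  rw [mul_neg, neg_mul, neg_neg] at h3
  rw [h3]
  have b0 : (-I - s + r * 1 : ℂ) = r - s - I := by ring
  have b1 : (-I - s + l * 1 : ℂ) = l - s - I := by ring
  have b2 : (I - s + r * 1 : ℂ) = r - s + I := by ring
  have b3 : (I - s + l * 1 : ℂ) = l - s + I := by ring
  have b4 : (r - s + ((1 : ℝ) : ℂ) * I : ℂ) = r - s + I := by push_cast; ring
  have b5 : (r - s + ((-1 : ℝ) : ℂ) * I : ℂ) = r - s - I := by push_cast; ring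
  rw [b0, b1, b2, b3, b4, b5]
  ring

theorem rect_cauchy {l r s : ℝ} (hl : l < s) (hr : s < r) {G : ℂ → ℂ}
    (hG : DifferentiableOn ℂ G (Set.Icc l r ×ℂ Set.Icc (-1) 1)) :
    rectIntegral l r (fun z => G z * (z - s)⁻¹) = 2 * Real.pi * I * G s := by
  have hlr : l ≤ r := (hl.trans hr).le
  have hS : Set.Icc l r ×ℂ Set.Icc (-1) 1 ∈ 𝓝 (s : ℂ) :=
    Filter.mem_of_superset ((isOpen_Ioo (a := l) (b := r)).reProdIm (isOpen_Ioo (a := -1) (b := 1))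
      |>.mem_nhds (by simp [mem_reProdIm, hl, hr])) fun z hz => by
      simp only [mem_reProdIm, Set.mem_Ioo, Set.mem_Icc] at hz ⊢
      exact ⟨⟨hz.1.1.le, hz.1.2.le⟩, hz.2.1.le, hz.2.2.le⟩
  have h1 := (Complex.differentiableOn_dslope hS).2 hG
  have hne : ∀ z ∈ rectBoundary l r, z - s ≠ 0 := by
    rintro z ⟨-, -, h⟩ h0
    rw [sub_eq_zero] at h0
    subst h0
    simp at h
    rcases h with h | h <;> linarith
  have hsub : rectBoundary l r ⊆ Set.Icc l r ×ℂ Set.Icc (-1) 1 := fun z hz => ⟨hz.1, hz.2.1⟩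
  have cinv : ContinuousOn (fun z : ℂ => G s * (z - s)⁻¹) (rectBoundary l r) := fun z hz => by
    have := hne z hz
    exact (by fun_prop (disch := assumption) : ContinuousAt _ z).continuousWithinAt
  rw [rect_congr hlr (f' := fun z => dslope G s z + G s * (z - s)⁻¹), rect_add hlr
    (h1.continuousOn.mono hsub) cinv, rect_eq_zero hlr h1, rect_const_mul, rect_inv_sub hl hr]
  · ring
  · intro z hz
    have := hne z hz
    rw [dslope_of_ne _ (sub_ne_zero.1 this), slope_def_field]
    field_simp
    ring

/-- A contour integral around a cut collapses onto the cut. -/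
theorem rect_div_cutSqrt {l r a b : ℝ} (hab : a < b) (hl : l < a) (hr : b < r) {G : ℂ → ℂ}
    (hG : DifferentiableOn ℂ G (Set.Icc l r ×ℂ Set.Icc (-1) 1)) :
    rectIntegral l r (fun z => G z / cutSqrt a b z) =
      I * ∫ θ in (0 : ℝ)..2 * Real.pi, G (node a b θ) := by
  have hlr : l ≤ r := by linarith
  have hpi : (2 * (Real.pi : ℂ)) ≠ 0 := by simp [Real.pi_ne_zero]
  have hoff : ∀ z ∈ rectBoundary l r, ∀ x ∈ Set.Icc a b, (x : ℂ) ≠ z := by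
    rintro z ⟨-, -, h⟩ x hx rfl
    simp at h
    rcases h with h | h <;> linarith [hx.1, hx.2]
  have hsub : rectBoundary l r ⊆ Set.Icc l r ×ℂ Set.Icc (-1) 1 := fun z hz => ⟨hz.1, hz.2.1⟩
  -- The arcsine law replaces `1 / cutSqrt` by a mean of Cauchy kernels; after Fubini, Cauchy's
  -- formula applies at every node.
  have h1 : rectIntegral l r (fun z => G z / cutSqrt a b z) = (2 * (Real.pi : ℂ))⁻¹ *
      rectIntegral l r (fun z => ∫ θ in (0 : ℝ)..2 * Real.pi, G z * (z - node a b θ)⁻¹) := by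
    rw [← rect_const_mul]
    refine rect_congr hlr fun z hz => ?_
    rw [intervalIntegral.integral_const_mul, integral_inv_sub_node hab (hoff z hz)]
    field_simp
  have h2 : rectIntegral l r (fun z => ∫ θ in (0 : ℝ)..2 * Real.pi, G z * (z - node a b θ)⁻¹) =
      ∫ θ in (0 : ℝ)..2 * Real.pi, rectIntegral l r (fun z => G z * (z - node a b θ)⁻¹) := by
    simp only [rectIntegral_eq_sum]
    have hcont : ∀ i, ContinuousOn (fun q : ℝ × ℝ => G (side l r i q.1) *
        (side l r i q.1 - node a b q.2)⁻¹)
        (Set.uIcc (sideLeft l i) (sideRight r i) ×ˢ Set.uIcc 0 (2 * Real.pi)) := fun i => by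
      refine ContinuousOn.mul ?_ (ContinuousOn.inv₀ ?_ ?_)
      · exact (hG.continuousOn.mono hsub).comp
          ((continuous_side l r i).comp continuous_fst).continuousOn
          fun q hq => side_mem hlr i hq.1
      · exact (((continuous_side l r i).comp continuous_fst).sub (continuous_ofReal.comp
          ((continuous_node a b).comp continuous_snd))).continuousOn
      · exact fun q hq => sub_ne_zero.2
          (hoff _ (side_mem hlr i hq.1) _ (node_mem hab.le q.2)).symm
    have hint : ∀ i, MeasureTheory.IntegrableOn (fun q : ℝ × ℝ => G (side l r i q.1) *
        (side l r i q.1 - node a b q.2)⁻¹)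
        (Set.uIoc (sideLeft l i) (sideRight r i) ×ˢ Set.uIoc 0 (2 * Real.pi)) := fun i =>
      ((hcont i).integrableOn_compact (isCompact_uIcc.prod isCompact_uIcc)).mono_set
        (Set.prod_mono Set.uIoc_subset_uIcc Set.uIoc_subset_uIcc)
    rw [intervalIntegral.integral_finsetSum]
    · refine Finset.sum_congr rfl fun i _ => ?_
      rw [intervalIntegral.integral_const_mul,
        MeasureTheory.intervalIntegral_intervalIntegral_swap]
      exact hint i
    · intro i _
      refine IntervalIntegrable.const_mul ?_ _
      have := hint i
      rw [MeasureTheory.IntegrableOn, MeasureTheory.Measure.volume_eq_prod,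
        ← MeasureTheory.Measure.prod_restrict] at this
      have := this.integral_prod_right
      simp only [intervalIntegral.intervalIntegral_eq_integral_uIoc]
      rw [intervalIntegrable_iff]
      exact this.smul _
  rw [h1, h2]
  have h3 : ∀ θ, rectIntegral l r (fun z => G z * (z - node a b θ)⁻¹) =
      2 * Real.pi * I * G (node a b θ) := fun θ =>
    rect_cauchy (hl.trans_le (node_mem hab.le θ).1) ((node_mem hab.le θ).2.trans_lt hr) hG
  simp only [h3, intervalIntegral.integral_const_mul]
  field_simp

/-! ### Cauchy transforms of densities on a cut -/

theorem sub_node_ne_zero {a b : ℝ} (hab : a ≤ b) {p : ℂ} (hp : ∀ x ∈ Set.Icc a b, (x : ℂ) ≠ p)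
    (θ : ℝ) : p - node a b θ ≠ 0 := sub_ne_zero.2 (hp _ (node_mem hab θ)).symm

theorem continuous_ofReal_node (a b : ℝ) : Continuous fun θ => (node a b θ : ℂ) :=
  continuous_ofReal.comp (continuous_node a b)

/-- The Cauchy transform of the measure `w dθ` on the interval `[a, b]`. -/
def cauchyTr (a b : ℝ) (w : ℝ → ℂ) (p : ℂ) : ℂ :=
  ∫ θ in (0 : ℝ)..2 * Real.pi, w θ * (p - node a b θ)⁻¹

theorem continuous_cauchy_kernel {a b : ℝ} (hab : a ≤ b) {w : ℝ → ℂ} (hw : Continuous w) {p : ℂ}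
    (hp : ∀ x ∈ Set.Icc a b, (x : ℂ) ≠ p) (k : ℕ) :
    Continuous fun θ => w θ * ((p - node a b θ) ^ k)⁻¹ :=
  hw.mul (((continuous_const.sub (continuous_ofReal_node a b)).pow k).inv₀ fun θ =>
    pow_ne_zero _ (sub_node_ne_zero hab hp θ))

theorem hasDerivAt_cauchyTr {a b : ℝ} (hab : a ≤ b) {w : ℝ → ℂ} (hw : Continuous w) {p : ℂ}
    (hp : ∀ x ∈ Set.Icc a b, (x : ℂ) ≠ p) :
    HasDerivAt (cauchyTr a b w)
      (∫ θ in (0 : ℝ)..2 * Real.pi, w θ * -((p - node a b θ) ^ 2)⁻¹) p := by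
  set S : Set ℂ := (fun x : ℝ => (x : ℂ)) '' Set.Icc a b with hS
  have hSc : IsClosed S := (isCompact_Icc.image continuous_ofReal).isClosed
  have hpS : p ∈ Sᶜ := by
    rintro ⟨x, hx, h⟩; exact hp x hx h
  obtain ⟨δ, hδ, hb⟩ := Metric.isOpen_iff.1 hSc.isOpen_compl p hpS
  have hoff : ∀ q ∈ Metric.ball p (δ / 2), ∀ θ, δ / 2 ≤ ‖q - node a b θ‖ := by
    intro q hq θ
    by_contra! h
    have : (node a b θ : ℂ) ∈ Metric.ball p δ := by
      rw [Metric.mem_ball, dist_eq_norm] at hq ⊢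
      calc ‖(node a b θ : ℂ) - p‖ = ‖(q - p) - (q - node a b θ)‖ := by congr 1; ring
        _ ≤ ‖q - p‖ + ‖q - node a b θ‖ := norm_sub_le _ _
        _ < δ := by linarith
    exact hb this ⟨_, node_mem hab θ, rfl⟩
  have hne : ∀ q ∈ Metric.ball p (δ / 2), ∀ θ, q - node a b θ ≠ 0 := fun q hq θ => by
    have := hoff q hq θ
    exact norm_pos_iff.1 (by linarith)
  have hcont : ∀ q ∈ Metric.ball p (δ / 2), ∀ k : ℕ,
      Continuous fun θ => w θ * ((q - node a b θ) ^ k)⁻¹ := fun q hq k =>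
    hw.mul (((continuous_const.sub (continuous_ofReal_node a b)).pow k).inv₀ fun θ =>
      pow_ne_zero _ (hne q hq θ))
  refine (intervalIntegral.hasDerivAt_integral_of_dominated_loc_of_deriv_le
    (𝕜 := ℂ) (μ := MeasureTheory.volume) (s := Metric.ball p (δ / 2))
    (F := fun (q : ℂ) (θ : ℝ) => w θ * (q - node a b θ)⁻¹)
    (F' := fun (q : ℂ) (θ : ℝ) => w θ * -((q - node a b θ) ^ 2)⁻¹)
    (bound := fun θ => ‖w θ‖ * ((δ / 2) ^ 2)⁻¹) (Metric.ball_mem_nhds p (half_pos hδ)) ?_ ?_ ?_ ?_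
    ?_ ?_).2
  · filter_upwards [Metric.ball_mem_nhds p (half_pos hδ)] with q hq
    simpa using (hcont q hq 1).aestronglyMeasurable
  · simpa using (hcont p (Metric.mem_ball_self (half_pos hδ)) 1).intervalIntegrable 0 (2 * Real.pi)
  · have := (hcont p (Metric.mem_ball_self (half_pos hδ)) 2).fun_neg
    simpa only [mul_neg] using this.aestronglyMeasurable
  · refine Eventually.of_forall fun θ _ q hq => ?_
    rw [norm_mul, norm_neg, norm_inv, norm_pow]
    have := hoff q hq θ
    gcongr
  · exact (hw.norm.mul continuous_const).intervalIntegrable _ _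
  · refine Eventually.of_forall fun θ _ q hq => ?_
    have h1 : HasDerivAt (fun q : ℂ => q - node a b θ) 1 q := (hasDerivAt_id q).sub_const _
    have h2 := (h1.fun_inv (hne q hq θ)).const_mul (w θ)
    rwa [neg_div, one_div] at h2

/-- From `p / (p - q) = 1 + q / (p - q)`. This recursion exposes the moments of the density one at a
time. -/
theorem mul_cauchyTr {a b : ℝ} (hab : a ≤ b) {w : ℝ → ℂ} (hw : Continuous w) {p : ℂ}
    (hp : ∀ x ∈ Set.Icc a b, (x : ℂ) ≠ p) :
    p * cauchyTr a b w p = (∫ θ in (0 : ℝ)..2 * Real.pi, w θ) +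
      cauchyTr a b (fun θ => w θ * node a b θ) p := by
  unfold cauchyTr
  rw [← intervalIntegral.integral_const_mul, ← intervalIntegral.integral_add]
  · refine intervalIntegral.integral_congr fun θ _ => ?_
    have := sub_node_ne_zero hab hp θ
    field_simp
    ring
  · exact hw.intervalIntegrable _ _
  · simpa using (continuous_cauchy_kernel hab (hw.mul (continuous_ofReal_node a b)) hp
      1).intervalIntegrable 0 (2 * Real.pi)

theorem ext_cauchyTr {a b ρ : ℝ} (hab : a ≤ b) (ha : |a| ≤ ρ) (hb : |b| ≤ ρ) {w : ℝ → ℂ}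
    (hw : Continuous w) : Ext ρ (cauchyTr a b w) :=
  Ext.of_at fun z hz => (hasDerivAt_cauchyTr hab hw (by
    rintro x hx rfl
    rw [norm_real, Real.norm_eq_abs] at hz
    have := abs_le_max_abs_abs hx.1 hx.2
    have := max_le ha hb
    linarith)).differentiableAt

theorem gro_cauchyTr {a b : ℝ} (hab : a ≤ b) {w : ℝ → ℂ} (hw : Continuous w) :
    Gro (-1) (cauchyTr a b w) := by
  obtain ⟨C, hC⟩ := isCompact_uIcc (a := (0 : ℝ)) (b := 2 * Real.pi)
    |>.exists_bound_of_continuousOn hw.continuousOn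
  set ρ := max |a| |b| with hρ
  have hρ0 : 0 ≤ ρ := (abs_nonneg a).trans (le_max_left _ _)
  refine Gro.of_bound (C * 2 * (2 * Real.pi)) (2 * ρ) fun p hp => ?_
  have hp0 : 0 < ‖p‖ := by linarith
  have h1 : ∀ θ ∈ Set.uIoc 0 (2 * Real.pi), ‖w θ * (p - node a b θ)⁻¹‖ ≤ C * (2 / ‖p‖) := by
    intro θ hθ
    have hn : ‖(node a b θ : ℂ)‖ ≤ ρ := by
      rw [norm_real, Real.norm_eq_abs]
      exact abs_le_max_abs_abs (node_mem hab θ).1 (node_mem hab θ).2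
    have hn2 := norm_sub_norm_le p (node a b θ)
    have hw1 := hC θ (Set.uIoc_subset_uIcc hθ)
    rw [norm_mul, norm_inv]
    refine mul_le_mul hw1 ?_ (by positivity) ((norm_nonneg _).trans hw1)
    rw [inv_le_comm₀ (by linarith) (by positivity), inv_div]
    linarith
  have h2 := intervalIntegral.norm_integral_le_of_norm_le_const h1
  unfold cauchyTr
  refine h2.trans (le_of_eq ?_)
  rw [zpow_neg_one, sub_zero, abs_of_pos (by positivity)]
  field_simp

/-- The Cauchy transform is the symbol of integration against the density, which makes periods
accessible to contour arguments. Powers are lowered by `mul_cauchyTr`; for exponent zero, the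
transform minus its leading term `∫ w / z` is `O(z ^ (-2))`. -/
theorem res_eval_mul_cauchyTr {a b r : ℝ} (hab : a ≤ b) (ha : |a| < r) (hb : |b| < r) {w : ℝ → ℂ}
    (hw : Continuous w) (P : ℂ[X]) :
    res r (fun z => P.eval z * cauchyTr a b w z) =
      ∫ θ in (0 : ℝ)..2 * Real.pi, w θ * P.eval (node a b θ : ℂ) := by
  set ρ := max |a| |b| with hρ
  have hρ0 : 0 ≤ ρ := (abs_nonneg a).trans (le_max_left _ _)
  have hρr : ρ < r := max_lt ha hb
  have hr0 : 0 < r := hρ0.trans_lt hρr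
  have hoff : ∀ z : ℂ, ρ < ‖z‖ → ∀ x ∈ Set.Icc a b, (x : ℂ) ≠ z := by
    rintro z hz x hx rfl
    rw [norm_real, Real.norm_eq_abs] at hz
    have := abs_le_max_abs_abs hx.1 hx.2
    linarith
  have hext : ∀ {w : ℝ → ℂ}, Continuous w → Ext ρ (cauchyTr a b w) := fun hw =>
    ext_cauchyTr hab (le_max_left _ _) (le_max_right _ _) hw
  induction P using Polynomial.induction_on' generalizing w with
  | add P R hP hR =>
    simp only [eval_add, add_mul, mul_add]
    rw [res_add hr0.le (((ext_eval ρ P).mul (hext hw)).continuousOn_sphere hρr)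
      (((ext_eval ρ R).mul (hext hw)).continuousOn_sphere hρr), hP hw, hR hw,
      intervalIntegral.integral_add]
    · exact (hw.mul (P.continuous.comp (continuous_ofReal_node a b))).intervalIntegrable _ _
    · exact (hw.mul (R.continuous.comp (continuous_ofReal_node a b))).intervalIntegrable _ _
  | monomial n c =>
    simp only [eval_monomial, mul_assoc, mul_left_comm _ c, res_const_mul,
      intervalIntegral.integral_const_mul]
    congr 1
    induction n generalizing w with
    | zero =>
      simp only [pow_zero, one_mul, mul_one]
      have hw' := hw.fun_mul (continuous_ofReal_node a b)
      have e0 : Ext ρ fun z : ℂ => (z - 0)⁻¹ := ext_inv_sub (by simpa using hρ0)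
      have h1 := res_eq_zero_of_gro (e0.mul (hext hw'))
        ((gro_inv_sub 0).mul (gro_cauchyTr hab hw') (by norm_num)) hρ0 hρr
      rw [res_congr hr0.le (g := fun z => (z - 0)⁻¹ * cauchyTr a b w z * z -
        (∫ θ in (0 : ℝ)..2 * Real.pi, w θ) * (z - 0)⁻¹)] at h1
      · rw [res_sub hr0.le, res_const_mul, res_inv_sub (by simpa using hr0), mul_one,
          sub_eq_zero] at h1
        · rw [← h1]
          refine res_congr hr0.le fun z hz => ?_
          have : z ≠ 0 := norm_pos_iff.1 (by rw [hz]; exact hr0)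
          field_simp
          simp
        · exact ((e0.mul (hext hw)).mul
            (ext_of_differentiable differentiable_id)).continuousOn_sphere hρr
        · exact (e0.const_mul _).continuousOn_sphere hρr
      · intro z hz
        have h2 := mul_cauchyTr hab hw (hoff z (by rwa [hz]))
        rw [sub_zero]
        linear_combination -z⁻¹ * h2
    | succ n ih =>
      have h1 : ∀ z, ‖z‖ = r → z ^ (n + 1) * cauchyTr a b w z =
          (∫ θ in (0 : ℝ)..2 * Real.pi, w θ) * (X ^ n : ℂ[X]).eval z +
            z ^ n * cauchyTr a b (fun θ => w θ * node a b θ) z := fun z hz => by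
        have h2 := mul_cauchyTr hab hw (hoff z (by rwa [hz]))
        rw [eval_pow, eval_X]
        linear_combination z ^ n * h2
      rw [res_congr hr0.le h1, res_add hr0.le, res_const_mul, ih (hw.fun_mul (continuous_ofReal_node a b)),
        res_eq_zero_of_differentiable hr0.le fun z _ => (X ^ n : ℂ[X]).differentiable z]
      · simp [pow_succ', mul_assoc]
      · exact ((ext_eval ρ _).const_mul _).continuousOn_sphere hρr
      · have := (ext_eval ρ (X ^ n)).mul (hext (hw.fun_mul (continuous_ofReal_node a b)))
        simp only [eval_pow, eval_X] at this
        exact this.continuousOn_sphere hρr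

/-! ### Periods and the matrix `Q` -/

theorem hi_lt_lo {μ : BranchPoints g} (hμ : StrictMono μ) {i k : Fin (g + 1)} (h : i < k) :
    hi μ i < lo μ k := by
  have hv : i.val < k.val := h
  exact hμ (Fin.lt_def.2 (by show 2 * i.val + 1 < 2 * k.val; omega))

/-- The product of the square roots of the other cuts. -/
def coSqrt (μ : BranchPoints g) (k : Fin (g + 1)) (z : ℂ) : ℂ :=
  ∏ i ∈ Finset.univ.erase k, cutSqrt (lo μ i) (hi μ i) z

/-- `z` lies on no cut other than the `k`-th. -/
def CoOff (μ : BranchPoints g) (k : Fin (g + 1)) (z : ℂ) : Prop :=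
  ∀ i ≠ k, ∀ x ∈ Set.Icc (lo μ i) (hi μ i), (x : ℂ) ≠ z

theorem ytilde_eq_mul_coSqrt (μ : BranchPoints g) (k : Fin (g + 1)) (z : ℂ) :
    ytilde μ z = cutSqrt (lo μ k) (hi μ k) z * coSqrt μ k z :=
  (Finset.mul_prod_erase _ _ (Finset.mem_univ k)).symm

theorem coSqrt_ne_zero {μ : BranchPoints g} (hμ : StrictMono μ) {k : Fin (g + 1)} {z : ℂ}
    (hz : CoOff μ k z) : coSqrt μ k z ≠ 0 :=
  Finset.prod_ne_zero_iff.2 fun i hi =>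
    cutSqrt_ne_zero (lo_le_hi hμ i).le (hz i (Finset.ne_of_mem_erase hi))

theorem differentiableAt_coSqrt {μ : BranchPoints g} (hμ : StrictMono μ) {k : Fin (g + 1)} {z : ℂ}
    (hz : CoOff μ k z) : DifferentiableAt ℂ (coSqrt μ k) z := by
  unfold coSqrt
  exact DifferentiableAt.fun_finsetProd fun i hi =>
    differentiableAt_cutSqrt (lo_le_hi hμ i).le (hz i (Finset.ne_of_mem_erase hi))

theorem coSqrt_conj {μ : BranchPoints g} (hμ : StrictMono μ) {k : Fin (g + 1)} {z : ℂ}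
    (hz : CoOff μ k z) : coSqrt μ k (starRingEnd ℂ z) = starRingEnd ℂ (coSqrt μ k z) := by
  unfold coSqrt
  rw [map_prod]
  exact Finset.prod_congr rfl fun i hi =>
    cutSqrt_conj (lo_le_hi hμ i).le (hz i (Finset.ne_of_mem_erase hi))

theorem coOff_of_mem {μ : BranchPoints g} (hμ : StrictMono μ) {k : Fin (g + 1)} {x : ℝ}
    (hx : x ∈ Set.Icc (lo μ k) (hi μ k)) : CoOff μ k x := by
  intro i hi t ht h
  have h' : t = x := ofReal_injective h
  subst h'
  rcases lt_or_gt_of_ne hi with h | h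
  · linarith [hi_lt_lo hμ h, ht.2, hx.1]
  · linarith [hi_lt_lo hμ h, ht.1, hx.2]

/-- The node of the `k`-th cut at angle `θ`. -/
abbrev cutNode (μ : BranchPoints g) (k : Fin (g + 1)) (θ : ℝ) : ℝ := node (lo μ k) (hi μ k) θ

theorem cutNode_mem {μ : BranchPoints g} (hμ : StrictMono μ) (k : Fin (g + 1)) (θ : ℝ) :
    cutNode μ k θ ∈ Set.Icc (lo μ k) (hi μ k) := node_mem (lo_le_hi hμ k).le θ

/-- The density of `dz / ytilde` on the `k`-th cut. -/
def weight (μ : BranchPoints g) (k : Fin (g + 1)) (θ : ℝ) : ℂ := I * (coSqrt μ k (cutNode μ k θ))⁻¹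

theorem continuous_coSqrt_cutNode {μ : BranchPoints g} (hμ : StrictMono μ) (k : Fin (g + 1)) :
    Continuous fun θ => coSqrt μ k (cutNode μ k θ) :=
  continuous_iff_continuousAt.2 fun θ =>
    (differentiableAt_coSqrt hμ (coOff_of_mem hμ (cutNode_mem hμ k θ))).continuousAt.comp
      (f := fun θ => (cutNode μ k θ : ℂ)) (continuous_ofReal_node _ _).continuousAt

theorem continuous_weight {μ : BranchPoints g} (hμ : StrictMono μ) (k : Fin (g + 1)) :
    Continuous (weight μ k) :=
  continuous_const.mul ((continuous_coSqrt_cutNode hμ k).inv₀ fun θ =>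
    coSqrt_ne_zero hμ (coOff_of_mem hμ (cutNode_mem hμ k θ)))

/-- The contour around `[l, r]` encircles the `k`-th cut and no other one. -/
def Encircles (μ : BranchPoints g) (k : Fin (g + 1)) (l r : ℝ) : Prop :=
  l < lo μ k ∧ hi μ k < r ∧ ∀ i ≠ k, hi μ i < l ∨ r < lo μ i

theorem encircles_points {μ : BranchPoints g} (hμ : StrictMono μ) (j : Fin g) :
    Encircles μ j.castSucc (leftPoint μ j) (rightPoint μ j) := by
  have hjs : j.castSucc < j.succ := Fin.castSucc_lt_succ
  have hR := hi_lt_lo hμ hjs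
  have hL : leftPoint μ j < lo μ j.castSucc := by
    unfold leftPoint
    split_ifs with h
    · have : j.castSucc = 0 := Fin.ext (by simpa using h)
      rw [this]; linarith
    · have : hi μ ⟨j.val - 1, by omega⟩ < lo μ j.castSucc :=
        hi_lt_lo hμ (Fin.lt_def.2 (by simp; omega))
      linarith
  refine ⟨hL, by unfold rightPoint; linarith, fun i hi0 => ?_⟩
  rcases lt_or_gt_of_ne hi0 with h | h
  · left
    have hv : i.val < j.val := h
    have h0 : j.val ≠ 0 := by omega
    have h1 : hi μ i ≤ hi μ ⟨j.val - 1, by omega⟩ :=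
      hμ.monotone (Fin.le_def.2 (by simp; omega))
    have h2 : hi μ ⟨j.val - 1, by omega⟩ < lo μ j.castSucc :=
      hi_lt_lo hμ (Fin.lt_def.2 (by simp; omega))
    unfold leftPoint
    rw [dif_neg h0]
    linarith
  · right
    have hv : j.val < i.val := h
    have h1 : lo μ j.succ ≤ lo μ i := hμ.monotone (Fin.le_def.2 (by simp; omega))
    unfold rightPoint
    linarith

theorem Encircles.le {μ : BranchPoints g} (hμ : StrictMono μ) {k : Fin (g + 1)} {l r : ℝ}
    (h : Encircles μ k l r) : l ≤ r := by linarith [h.1, h.2.1, lo_le_hi hμ k]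

theorem Encircles.coOff {μ : BranchPoints g} {k : Fin (g + 1)} {l r : ℝ}
    (h : Encircles μ k l r) {z : ℂ} (hz : z.re ∈ Set.Icc l r) : CoOff μ k z := by
  rintro i hi x hx rfl
  rw [ofReal_re] at hz
  rcases h.2.2 i hi with h | h
  · linarith [hx.2, hz.1]
  · linarith [hx.1, hz.2]

theorem Encircles.mem_offCuts {μ : BranchPoints g} {k : Fin (g + 1)} {l r : ℝ}
    (h : Encircles μ k l r) {z : ℂ} (hz : z ∈ rectBoundary l r) : z ∈ offCuts μ := by
  rw [MultiCut.mem_offCuts]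
  intro i
  by_cases hi : i = k
  · subst hi
    rintro x hx rfl
    obtain ⟨-, -, h3⟩ := hz
    simp at h3
    rcases h3 with h3 | h3 <;> linarith [hx.1, hx.2, h.1, h.2.1]
  · exact h.coOff hz.1 i hi

/-- A rectangle chosen for `μ` can be kept fixed while the branch points move. Periods are
differentiated over such fixed contours, although `leftPoint` and `rightPoint` depend on the branch
points. -/
theorem eventually_encircles {μ : BranchPoints g} {k : Fin (g + 1)} {l r : ℝ}
    (h : Encircles μ k l r) : ∀ᶠ μ' in 𝓝 μ, Encircles (μ' : BranchPoints g) k l r := by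
  have hlo : ∀ i, Continuous fun μ' : BranchPoints g => lo μ' i := fun i => continuous_apply _
  have hhi : ∀ i, Continuous fun μ' : BranchPoints g => hi μ' i := fun i => continuous_apply _
  refine ((hlo k).continuousAt.eventually (lt_mem_nhds h.1)).and
    (((hhi k).continuousAt.eventually (gt_mem_nhds h.2.1)).and ?_)
  rw [eventually_all]
  intro i
  by_cases hi : i = k
  · exact Eventually.of_forall fun _ h => absurd hi h
  rcases h.2.2 i hi with h | h
  · exact ((hhi i).continuousAt.eventually (gt_mem_nhds h)).mono fun _ h _ => Or.inl h
  · exact ((hlo i).continuousAt.eventually (lt_mem_nhds h)).mono fun _ h _ => Or.inr h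

theorem rect_div_ytilde {μ : BranchPoints g} (hμ : StrictMono μ) {k : Fin (g + 1)} {l r : ℝ}
    (h : Encircles μ k l r) {φ : ℂ → ℂ}
    (hφ : DifferentiableOn ℂ φ (Set.Icc l r ×ℂ Set.Icc (-1) 1)) :
    rectIntegral l r (fun z => φ z * (ytilde μ z)⁻¹) =
      ∫ θ in (0 : ℝ)..2 * Real.pi, weight μ k θ * φ (cutNode μ k θ) := by
  have h1 := rect_div_cutSqrt (lo_le_hi hμ k) h.1 h.2.1 (G := fun z => φ z * (coSqrt μ k z)⁻¹)
    (hφ.mul fun z hz => ((differentiableAt_coSqrt hμ (h.coOff hz.1)).inv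
      (coSqrt_ne_zero hμ (h.coOff hz.1))).differentiableWithinAt)
  rw [← intervalIntegral.integral_const_mul] at h1
  calc _ = rectIntegral l r
        (fun z => φ z * (coSqrt μ k z)⁻¹ / cutSqrt (lo μ k) (hi μ k) z) :=
        congrArg _ (funext fun z => by rw [ytilde_eq_mul_coSqrt μ k, mul_inv]; ring)
    _ = _ := h1
    _ = _ := intervalIntegral.integral_congr fun θ _ => by simp only [weight]; ring

/-- The period of `P dz / ytilde` around the `k`-th cut. -/
def per {μ : BranchPoints g} (hμ : StrictMono μ) (k : Fin (g + 1)) : ℂ[X] →ₗ[ℂ] ℂ where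
  toFun P := ∫ θ in (0 : ℝ)..2 * Real.pi, weight μ k θ * P.eval (cutNode μ k θ : ℂ)
  map_add' P R := by
    simp only [eval_add, mul_add]
    exact intervalIntegral.integral_add
      (((continuous_weight hμ k).mul
        (P.continuous.comp (continuous_ofReal_node _ _))).intervalIntegrable _ _)
      (((continuous_weight hμ k).mul
        (R.continuous.comp (continuous_ofReal_node _ _))).intervalIntegrable _ _)
  map_smul' c P := by
    simp only [eval_smul, smul_eq_mul, mul_left_comm _ c, intervalIntegral.integral_const_mul,
      RingHom.id_apply]

theorem per_apply {μ : BranchPoints g} (hμ : StrictMono μ) (k : Fin (g + 1)) (P : ℂ[X]) :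
    per hμ k P = ∫ θ in (0 : ℝ)..2 * Real.pi, weight μ k θ * P.eval (cutNode μ k θ : ℂ) := rfl

theorem rect_eval_div_ytilde {μ : BranchPoints g} (hμ : StrictMono μ) {k : Fin (g + 1)} {l r : ℝ}
    (h : Encircles μ k l r) (P : ℂ[X]) :
    rectIntegral l r (fun z => P.eval z * (ytilde μ z)⁻¹) = per hμ k P :=
  rect_div_ytilde hμ h P.differentiable.differentiableOn

theorem aPeriod_eval_div {μ : BranchPoints g} (hμ : StrictMono μ) (j : Fin g) (P : ℂ[X]) :
    aPeriod μ j (fun z => P.eval z * (ytilde μ z)⁻¹) = per hμ j.castSucc P :=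
  rect_eval_div_ytilde hμ (encircles_points hμ j) P

theorem Q_apply {μ : BranchPoints g} (hμ : StrictMono μ) (j i : Fin g) :
    Q μ j i = per hμ j.castSucc (X ^ i.val) := by
  rw [← aPeriod_eval_div hμ]
  simp [Q, div_eq_mul_inv]

/-- The real part of `Q / I`. -/
def realQ (μ : BranchPoints g) : Matrix (Fin g) (Fin g) ℝ :=
  Matrix.of fun j i => ∫ θ in (0 : ℝ)..2 * Real.pi,
    (coSqrt μ j.castSucc (cutNode μ j.castSucc θ)).re⁻¹ * cutNode μ j.castSucc θ ^ i.val

theorem coSqrt_cutNode_real {μ : BranchPoints g} (hμ : StrictMono μ) (k : Fin (g + 1)) (θ : ℝ) :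
    ((coSqrt μ k (cutNode μ k θ)).re : ℂ) = coSqrt μ k (cutNode μ k θ) := by
  rw [← conj_eq_iff_re, ← coSqrt_conj hμ (coOff_of_mem hμ (cutNode_mem hμ k θ)), conj_ofReal]

theorem coSqrt_cutNode_re_ne_zero {μ : BranchPoints g} (hμ : StrictMono μ) (k : Fin (g + 1))
    (θ : ℝ) : (coSqrt μ k (cutNode μ k θ)).re ≠ 0 := by
  rw [← ofReal_ne_zero, coSqrt_cutNode_real hμ]
  exact coSqrt_ne_zero hμ (coOff_of_mem hμ (cutNode_mem hμ k θ))

/-- On a cut the square roots of the other cuts are real, and the remaining factor contributes `I`.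
As `I ^ 12 = 1`, the twelfth power of `det Q` is that of a real determinant. -/
theorem Q_eq_smul {μ : BranchPoints g} (hμ : StrictMono μ) :
    Q μ = I • (realQ μ).map (algebraMap ℝ ℂ) := by
  ext j i
  rw [Q_apply hμ, per_apply]
  simp only [realQ, Matrix.smul_apply, Matrix.map_apply, Matrix.of_apply, smul_eq_mul, coe_algebraMap,
    eval_pow, eval_X]
  rw [← intervalIntegral.integral_ofReal, ← intervalIntegral.integral_const_mul]
  refine intervalIntegral.integral_congr fun θ _ => ?_
  simp only [weight]
  push_cast
  rw [coSqrt_cutNode_real hμ]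
  ring

/-- Rolle's theorem for the primitive. -/
theorem exists_eq_zero_of_integral_eq_zero {F : ℝ → ℝ} (hF : Continuous F) {a b : ℝ} (hab : a < b)
    (h : ∫ t in a..b, F t = 0) : ∃ t, F t = 0 := by
  obtain ⟨t, -, ht⟩ := exists_hasDerivAt_eq_zero (f := fun x => ∫ t in a..x, F t) (f' := F) hab
    (continuousOn_of_forall_continuousAt fun x _ =>
      (hF.integral_hasStrictDerivAt a x).hasDerivAt.continuousAt) (by simp [h])
    fun x _ => (hF.integral_hasStrictDerivAt a x).hasDerivAt
  exact ⟨t, ht⟩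

/-- A null vector is a polynomial of degree less than `g` whose weighted integral over each of the
`g` cuts vanishes. Each integrand has a zero and the weight has none, so the polynomial vanishes
somewhere on each cut; the cuts are disjoint, which gives `g` distinct roots. -/
theorem det_realQ_ne_zero {μ : BranchPoints g} (hμ : StrictMono μ) : (realQ μ).det ≠ 0 := by
  intro h0
  obtain ⟨v, hv, hv0⟩ := Matrix.exists_mulVec_eq_zero_iff.2 h0
  set h : ℝ[X] := ∑ i : Fin g, C (v i) * X ^ i.val with hdef
  have hx : ∀ j : Fin g, ∃ x ∈ Set.Icc (lo μ j.castSucc) (hi μ j.castSucc), h.eval x = 0 := by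
    intro j
    have hc : Continuous fun θ => (coSqrt μ j.castSucc (cutNode μ j.castSucc θ)).re⁻¹ :=
      (continuous_re.comp (continuous_coSqrt_cutNode hμ _)).inv₀
        fun θ => coSqrt_cutNode_re_ne_zero hμ _ θ
    have hn := continuous_node (lo μ j.castSucc) (hi μ j.castSucc)
    have h1 : ∫ θ in (0 : ℝ)..2 * Real.pi, (coSqrt μ j.castSucc (cutNode μ j.castSucc θ)).re⁻¹ *
        h.eval (cutNode μ j.castSucc θ) = 0 := by
      have h2 := congrFun hv0 j
      simp only [Matrix.mulVec, dotProduct, realQ, Matrix.of_apply, Pi.zero_apply] at h2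
      refine Eq.trans ?_ h2
      rw [Finset.sum_congr rfl fun i _ => (intervalIntegral.integral_mul_const (v i)
        fun θ => (coSqrt μ j.castSucc (cutNode μ j.castSucc θ)).re⁻¹ *
          cutNode μ j.castSucc θ ^ i.val).symm, ← intervalIntegral.integral_finsetSum]
      · refine intervalIntegral.integral_congr fun θ _ => ?_
        simp only [hdef, eval_finsetSum, eval_mul, eval_C, eval_pow, eval_X]
        rw [Finset.mul_sum]
        exact Finset.sum_congr rfl fun i _ => by ring
      · exact fun i _ => ((hc.mul (hn.pow _)).mul continuous_const).intervalIntegrable _ _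
    obtain ⟨θ, hθ⟩ := exists_eq_zero_of_integral_eq_zero (hc.mul (h.continuous.comp hn))
      Real.two_pi_pos h1
    refine ⟨_, cutNode_mem hμ j.castSucc θ, ?_⟩
    exact (mul_eq_zero.1 hθ).resolve_left (inv_ne_zero (coSqrt_cutNode_re_ne_zero hμ _ θ))
  choose x hxm hx0 using hx
  have hinj : Function.Injective x := by
    intro i j hij
    by_contra hne
    refine coOff_of_mem hμ (hxm j) i.castSucc (fun h => hne (Fin.castSucc_injective _ h)) (x i)
      (hxm i) (by rw [hij])
  have hg : 0 < g := by
    rcases Nat.eq_zero_or_pos g with rfl | h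
    · exact absurd (Subsingleton.elim v 0) hv
    · exact h
  have hz : h = 0 := by
    refine eq_zero_of_natDegree_lt_card_of_eval_eq_zero h hinj hx0 ?_
    rw [Fintype.card_fin]
    refine lt_of_le_of_lt (natDegree_sum_le_of_forall_le (n := g - 1) _ _ fun i _ => ?_)
      (show g - 1 < g by omega)
    exact (natDegree_C_mul_X_pow_le _ _).trans (by omega)
  refine hv (funext fun i => ?_)
  have := congrArg (fun P => P.coeff i.val) hz
  simpa [hdef, finsetSum_coeff, coeff_C_mul_X_pow, Fin.val_inj] using this

theorem det_Q {μ : BranchPoints g} (hμ : StrictMono μ) : (Q μ).det = I ^ g * ((realQ μ).det : ℂ) := by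
  rw [Q_eq_smul hμ, Matrix.det_smul, Fintype.card_fin]
  congr 1
  exact ((algebraMap ℝ ℂ).map_det _).symm

theorem det_Q_ne_zero {μ : BranchPoints g} (hμ : StrictMono μ) : (Q μ).det ≠ 0 := by
  rw [det_Q hμ]
  exact mul_ne_zero (pow_ne_zero _ I_ne_zero) (ofReal_ne_zero.2 (det_realQ_ne_zero hμ))

theorem det_Q_pow {μ : BranchPoints g} (hμ : StrictMono μ) :
    (Q μ).det ^ 12 = (((realQ μ).det ^ 12 : ℝ) : ℂ) := by
  rw [det_Q hμ, mul_pow, ← pow_mul, mul_comm g 12, pow_mul,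
    show (I ^ 12 : ℂ) = (I ^ 4) ^ 3 by ring, I_pow_four]
  push_cast; ring

/-- A polynomial of degree less than `g` all of whose periods vanish is zero. -/
theorem eq_zero_of_per {μ : BranchPoints g} (hμ : StrictMono μ) {P : ℂ[X]} (hd : P.degree < g)
    (h : ∀ k : Fin g, per hμ k.castSucc P = 0) : P = 0 := by
  have hP : P = ∑ i : Fin g, P.coeff i.val • X ^ i.val := by
    ext m
    simp only [finsetSum_coeff, coeff_smul, coeff_X_pow, smul_eq_mul, mul_ite, mul_one, mul_zero]
    by_cases hm : m < g
    · rw [Finset.sum_eq_single ⟨m, hm⟩ (fun i _ hi => if_neg fun h => hi (Fin.ext h.symm))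
        (by simp)]
      simp
    · rw [Finset.sum_eq_zero fun i _ => if_neg (by omega)]
      exact coeff_eq_zero_of_degree_lt (hd.trans_le (by exact_mod_cast not_lt.1 hm))
  have h1 : (Q μ).mulVec (fun i => P.coeff i.val) = 0 := by
    funext k
    rw [Pi.zero_apply, ← h k]
    conv_rhs => rw [hP]
    simp only [map_sum, map_smul, Matrix.mulVec, dotProduct, Q_apply hμ, smul_eq_mul]
    exact Finset.sum_congr rfl fun i _ => mul_comm _ _
  have h2 : (fun i : Fin g => P.coeff i.val) = 0 := by
    by_contra hne
    exact det_Q_ne_zero hμ (Matrix.exists_mulVec_eq_zero_iff.1 ⟨_, hne, h1⟩)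
  rw [hP]
  refine Finset.sum_eq_zero fun i _ => ?_
  rw [congrFun h2 i]; simp

/-! ### Exact differentials on the cuts and the kernel of the curve -/

/-- The product of `(X - μ_α)` over the ends of the other cuts. -/
def coT (μ : BranchPoints g) (k : Fin (g + 1)) : ℂ[X] :=
  ∏ i ∈ Finset.univ.erase k, ((X - C (lo μ i : ℂ)) * (X - C (hi μ i : ℂ)))

theorem T_eq_mul_coT (μ : BranchPoints g) (k : Fin (g + 1)) :
    T μ = (X - C (lo μ k : ℂ)) * (X - C (hi μ k : ℂ)) * coT μ k := by
  rw [T, prod_branchPoints, coT, Finset.mul_prod_erase Finset.univ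
    (fun i => (X - C (lo μ i : ℂ)) * (X - C (hi μ i : ℂ))) (Finset.mem_univ k)]
  rfl

theorem coSqrt_sq (μ : BranchPoints g) (k : Fin (g + 1)) (z : ℂ) :
    coSqrt μ k z ^ 2 = (coT μ k).eval z := by
  rw [coSqrt, coT, eval_prod, ← Finset.prod_pow]
  exact Finset.prod_congr rfl fun i _ => by simp [cutSqrt_sq]

theorem hasDerivAt_coSqrt {μ : BranchPoints g} (hμ : StrictMono μ) {k : Fin (g + 1)} {z : ℂ}
    (hz : CoOff μ k z) :
    HasDerivAt (coSqrt μ k) ((derivative (coT μ k)).eval z / (2 * coSqrt μ k z)) z := by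
  have h1 := (differentiableAt_coSqrt hμ hz).hasDerivAt
  have h2 := h1.pow 2
  have h3 : HasDerivAt (coSqrt μ k ^ 2) ((derivative (coT μ k)).eval z) z := by
    have : (coSqrt μ k ^ 2) = fun z => (coT μ k).eval z := funext fun z => coSqrt_sq μ k z
    rw [this]; exact (coT μ k).hasDerivAt z
  have h4 := h2.unique h3
  have h0 := coSqrt_ne_zero hμ hz
  have h5 : deriv (coSqrt μ k) z = (derivative (coT μ k)).eval z / (2 * coSqrt μ k z) := by
    rw [eq_div_iff (by simpa using h0), ← h4]
    norm_num
    ring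
  rw [← h5]; exact h1

/-- `ytilde (ytilde φ)'` is exact on each cut. -/
theorem integral_weight_exact {μ : BranchPoints g} (hμ : StrictMono μ) (k : Fin (g + 1))
    {φ φ' : ℂ → ℂ} (h : ∀ x ∈ Set.Icc (lo μ k) (hi μ k), HasDerivAt φ (φ' x) x)
    (hc : Continuous fun θ => φ' (cutNode μ k θ)) :
    ∫ θ in (0 : ℝ)..2 * Real.pi, weight μ k θ *
      (1 / 2 * (derivative (T μ)).eval (cutNode μ k θ : ℂ) * φ (cutNode μ k θ) +
        (T μ).eval (cutNode μ k θ : ℂ) * φ' (cutNode μ k θ)) = 0 := by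
  have hab := lo_le_hi hμ k
  set c : ℝ := (hi μ k - lo μ k) / 2 with hcdef
  have hc0 : (c : ℂ) ≠ 0 := ofReal_ne_zero.2 (by rw [hcdef]; linarith)
  have hφc : Continuous fun θ => φ (cutNode μ k θ) := continuous_iff_continuousAt.2 fun θ =>
    (h _ (cutNode_mem hμ k θ)).continuousAt.comp (f := fun θ => (cutNode μ k θ : ℂ))
      (continuous_ofReal_node _ _).continuousAt
  have hpc : ∀ P : ℂ[X], Continuous fun θ => P.eval (cutNode μ k θ : ℂ) := fun P =>
    P.continuous.comp (continuous_ofReal_node _ _)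
  have hcont : Continuous fun θ => weight μ k θ *
      (1 / 2 * (derivative (T μ)).eval (cutNode μ k θ : ℂ) * φ (cutNode μ k θ) +
        (T μ).eval (cutNode μ k θ : ℂ) * φ' (cutNode μ k θ)) :=
    (continuous_weight hμ k).mul (((continuous_const.mul (hpc _)).mul hφc).add ((hpc _).mul hc))
  have hn : ∀ θ : ℝ, HasDerivAt (fun θ => (cutNode μ k θ : ℂ)) (-(c * Complex.sin θ)) θ := fun θ => by
    have := ((Real.hasDerivAt_cos θ).const_mul c).const_add ((lo μ k + hi μ k) / 2)
    have := this.ofReal_comp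
    rw [mul_neg] at this
    refine this.congr_of_eventuallyEq (Eventually.of_forall fun t => ?_) |>.congr_deriv ?_
    · simp only [node, hcdef]
    · push_cast; rfl
  -- The primitive is `ytilde φ`: along the cut, `ytilde` equals `I c sin θ` times `coSqrt`. It
  -- vanishes at both `0` and `2π` because of the sine.
  have hd : ∀ θ : ℝ, HasDerivAt (fun θ : ℝ => I * c * (Complex.sin θ * (coSqrt μ k (cutNode μ k θ) *
      φ (cutNode μ k θ)))) (weight μ k θ *
      (1 / 2 * (derivative (T μ)).eval (cutNode μ k θ : ℂ) * φ (cutNode μ k θ) +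
        (T μ).eval (cutNode μ k θ : ℂ) * φ' (cutNode μ k θ))) θ := fun θ => by
    have hmem := cutNode_mem hμ k θ
    have hoff := coOff_of_mem hμ hmem
    have h0 := coSqrt_ne_zero hμ hoff
    have hsq := coSqrt_sq μ k (cutNode μ k θ)
    have d1 := ((hasDerivAt_coSqrt hμ hoff).mul (h _ hmem)).comp θ (hn θ)
    have d2 := ((Complex.hasDerivAt_sin (θ : ℂ)).comp_ofReal.mul d1).const_mul (I * c)
    refine HasDerivAt.congr_deriv d2 ?_
    have e1 : (T μ).eval (cutNode μ k θ : ℂ) = -(c * Complex.sin θ) ^ 2 *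
        (coT μ k).eval (cutNode μ k θ : ℂ) := by
      rw [T_eq_mul_coT μ k]
      simp only [eval_mul, eval_sub, eval_X, eval_C]
      have : ((cutNode μ k θ : ℂ) - lo μ k) * (cutNode μ k θ - hi μ k) =
          -(c * Complex.sin θ) ^ 2 := by
        have h1 := Complex.sin_sq_add_cos_sq (θ : ℂ)
        simp only [node, hcdef]
        push_cast
        linear_combination (((hi μ k : ℂ) - lo μ k) ^ 2 / 4) * h1
      rw [this]
    have e2 : (derivative (T μ)).eval (cutNode μ k θ : ℂ) = -(c * Complex.sin θ) ^ 2 *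
        (derivative (coT μ k)).eval (cutNode μ k θ : ℂ) +
          2 * c * Complex.cos θ * (coT μ k).eval (cutNode μ k θ : ℂ) := by
      rw [T_eq_mul_coT μ k]
      simp only [derivative_mul, derivative_sub, derivative_X, derivative_C, sub_zero, eval_mul,
        eval_sub, eval_X, eval_C, eval_add, one_mul, mul_one]
      have h1 := Complex.sin_sq_add_cos_sq (θ : ℂ)
      simp only [node, hcdef]
      push_cast
      linear_combination (((hi μ k : ℂ) - lo μ k) ^ 2 / 4 *
        (derivative (coT μ k)).eval ((((lo μ k : ℂ) + hi μ k) / 2 +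
          ((hi μ k : ℂ) - lo μ k) / 2 * Complex.cos θ))) * h1
    rw [e1, e2, ← hsq, weight]
    simp only [Function.comp_def, Pi.mul_apply]
    generalize coSqrt μ k (cutNode μ k θ) = E at *
    field_simp
    ring
  rw [intervalIntegral.integral_eq_sub_of_hasDerivAt (fun θ _ => hd θ)
    (hcont.intervalIntegrable _ _)]
  have : Complex.sin (((2 * Real.pi : ℝ)) : ℂ) = 0 := by
    rw [← ofReal_sin, Real.sin_two_pi, ofReal_zero]
  rw [this]
  simp

/-- The difference quotient of `P` at `q` as a polynomial. -/
theorem sub_C_eval_eq_quo (q : ℂ) {N : ℕ} {P : ℂ[X]} (h : P.natDegree ≤ N) :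
    P - C (P.eval q) = (X - C q) * ∑ i ∈ Finset.range N, C ((quo i P).eval q) * X ^ i := by
  refine Polynomial.funext fun x => ?_
  simp only [eval_sub, eval_C, eval_mul, eval_X, eval_finsetSum, eval_pow]
  rw [eval_sub_eval_eq_quo x q N P h]
  congr 1
  exact Finset.sum_congr rfl fun i _ => mul_comm _ _

theorem sum_quo_eval {N : ℕ} {P : ℂ[X]} (h : P.natDegree ≤ N) (q : ℂ) :
    ∑ i ∈ Finset.range N, (quo i P).eval q * q ^ i = (derivative P).eval q := by
  have := congrArg (fun R => (derivative R).eval q) (sub_C_eval_eq_quo q h)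
  simp only [derivative_sub, derivative_C, sub_zero, derivative_mul, derivative_X, eval_add,
    eval_mul, one_mul, eval_sub, eval_X, eval_C, sub_self, zero_mul, add_zero, eval_finsetSum,
    eval_pow] at this
  exact this.symm

/-- Differentiating the difference quotient at the diagonal gives half of the second derivative. -/
theorem sum_quo_eval_deriv {N : ℕ} {P : ℂ[X]} (h : P.natDegree ≤ N) (q : ℂ) :
    ∑ i ∈ Finset.range N, (quo i P).eval q * (i * q ^ (i - 1)) =
      (derivative (derivative P)).eval q / 2 := by
  have := congrArg (fun R => (derivative (derivative R)).eval q) (sub_C_eval_eq_quo q h)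
  simp only [derivative_sub, derivative_C, sub_zero, derivative_mul, derivative_X, eval_add,
    eval_mul, one_mul, eval_sub, eval_X, eval_C, sub_self, zero_mul, add_zero, eval_finsetSum,
    eval_pow, derivative_add, derivative_sum, derivative_X_pow, zero_add] at this
  rw [this]
  ring

/-- The coefficient of `p ^ i` in
`((p - q) (T'(p) + T'(q)) / 2 - (T(p) - T(q))) / (p - q) ^ 2`, as a polynomial in `q`. -/
def kerCoeff (μ : BranchPoints g) (i : ℕ) : ℂ[X] :=
  C (1 / 2) * quo i (derivative (T μ)) -
    ∑ m ∈ Finset.range (2 * (g + 1)), quo m (T μ) * quo i (X ^ m)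

/-- The symmetric polynomial kernel attached to the curve. -/
def ker (μ : BranchPoints g) (p q : ℂ) : ℂ :=
  ∑ i ∈ Finset.range (2 * (g + 1)), p ^ i * (kerCoeff μ i).eval q

theorem ker_mul (μ : BranchPoints g) (p q : ℂ) :
    (p - q) ^ 2 * ker μ p q = 1 / 2 * (p - q) *
      ((derivative (T μ)).eval p + (derivative (T μ)).eval q) -
      ((T μ).eval p - (T μ).eval q) := by
  have hT := (degree_T μ).le
  -- For `x ≠ q` this is `N(x) = T'(x) / 2 - (T(x) - T(q)) / (x - q)`, with `N(q) = -T'(q) / 2`, and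
  -- `ker` is its difference quotient at `q`. The numerator thus vanishes to second order on the
  -- diagonal.
  set N : ℂ[X] := C (1 / 2) * derivative (T μ) -
    ∑ m ∈ Finset.range (2 * (g + 1)), C ((quo m (T μ)).eval q) * X ^ m with hN
  have hNd : N.natDegree ≤ 2 * (g + 1) := by
    refine (natDegree_sub_le _ _).trans (max_le ?_ ?_)
    · exact (natDegree_C_mul_le _ _).trans ((natDegree_derivative_le _).trans (by omega))
    · refine natDegree_sum_le_of_forall_le _ _ fun m hm => ?_
      exact (natDegree_C_mul_X_pow_le _ _).trans (by simp at hm; omega)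
  have hsum : ∀ i (s : Finset ℕ) (f : ℕ → ℂ[X]), quo i (∑ m ∈ s, f m) = ∑ m ∈ s, quo i (f m) := by
    intro i s f
    ext n
    simp [coeff_quo, finsetSum_coeff]
  have hsub : ∀ i (P R : ℂ[X]), quo i (P - R) = quo i P - quo i R := by
    intro i P R
    ext n
    simp [coeff_quo]
  have h1 : ker μ p q = ∑ i ∈ Finset.range (2 * (g + 1)), p ^ i * (quo i N).eval q := by
    refine Finset.sum_congr rfl fun i _ => ?_
    congr 1
    rw [hN, kerCoeff, hsub, hsum]
    simp only [quo_C_mul, eval_sub, eval_mul, eval_C, eval_finsetSum]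
  have h2 := eval_sub_eval_eq_quo p q _ N hNd
  rw [← h1] at h2
  have h3 := eval_sub_eval_eq_quo p q _ (T μ) hT
  have h4 := sum_quo_eval hT q
  simp only [hN, eval_sub, eval_mul, eval_C, eval_finsetSum, eval_pow, eval_X] at h2
  rw [h4] at h2
  have h5 : ∑ i ∈ Finset.range (2 * (g + 1)), (quo i (T μ)).eval q * p ^ i =
      ∑ i ∈ Finset.range (2 * (g + 1)), p ^ i * (quo i (T μ)).eval q :=
    Finset.sum_congr rfl fun i _ => mul_comm _ _
  rw [h5] at h2
  linear_combination (-(p - q)) * h2 + h3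

/-- The Cauchy transform of `dz / ytilde` on the `k`-th cut. -/
def cutFn (μ : BranchPoints g) (k : Fin (g + 1)) : ℂ → ℂ :=
  cauchyTr (lo μ k) (hi μ k) (weight μ k)

/-- The polynomial `ytilde (ytilde cutFn)'`. -/
def cutPoly {μ : BranchPoints g} (hμ : StrictMono μ) (k : Fin (g + 1)) : ℂ[X] :=
  ∑ i ∈ Finset.range (2 * (g + 1)), C (per hμ k (kerCoeff μ i)) * X ^ i

theorem cutPoly_eval {μ : BranchPoints g} (hμ : StrictMono μ) (k : Fin (g + 1)) (p : ℂ) :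
    (cutPoly hμ k).eval p =
      ∫ θ in (0 : ℝ)..2 * Real.pi, weight μ k θ * ker μ p (cutNode μ k θ) := by
  unfold cutPoly ker
  simp only [eval_finsetSum, eval_mul, eval_C, eval_pow, eval_X, per_apply, Finset.mul_sum]
  rw [intervalIntegral.integral_finsetSum]
  · refine Finset.sum_congr rfl fun i _ => ?_
    rw [← intervalIntegral.integral_mul_const]
    exact intervalIntegral.integral_congr fun θ _ => by ring
  · exact fun i _ => ((continuous_weight hμ k).mul (continuous_const.mul
      ((kerCoeff μ i).continuous.comp (continuous_ofReal_node _ _)))).intervalIntegrable _ _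

theorem hasDerivAt_cutFn {μ : BranchPoints g} (hμ : StrictMono μ) (k : Fin (g + 1)) {p : ℂ}
    (hp : ∀ x ∈ Set.Icc (lo μ k) (hi μ k), (x : ℂ) ≠ p) :
    HasDerivAt (cutFn μ k)
      (∫ θ in (0 : ℝ)..2 * Real.pi, weight μ k θ * -((p - cutNode μ k θ) ^ 2)⁻¹) p :=
  hasDerivAt_cauchyTr (lo_le_hi hμ k).le (continuous_weight hμ k) hp

/-- The right side is an integral over the cut with a double pole at `p`. Subtracting the exact form
with `φ q = 1 / (p - q)` turns its integrand into the polynomial kernel `ker`. -/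
theorem cutPoly_eq {μ : BranchPoints g} (hμ : StrictMono μ) (k : Fin (g + 1)) {p : ℂ}
    (hp : ∀ x ∈ Set.Icc (lo μ k) (hi μ k), (x : ℂ) ≠ p) :
    (cutPoly hμ k).eval p = 1 / 2 * (derivative (T μ)).eval p * cutFn μ k p +
      (T μ).eval p * deriv (cutFn μ k) p := by
  have hne : ∀ θ, p - (cutNode μ k θ : ℂ) ≠ 0 := sub_node_ne_zero (lo_le_hi hμ k).le hp
  have ex := integral_weight_exact hμ k (φ := fun q => (p - q)⁻¹) (φ' := fun q => ((p - q) ^ 2)⁻¹)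
    (fun x hx => by
      have h1 : HasDerivAt (fun q : ℂ => p - q) (-1) (x : ℂ) := (hasDerivAt_id _).const_sub p
      have h2 := h1.fun_inv (sub_ne_zero.2 (hp x hx).symm)
      rwa [neg_neg, one_div] at h2)
    (((continuous_const.sub (continuous_ofReal_node _ _)).pow 2).inv₀ fun θ =>
      pow_ne_zero _ (hne θ))
  have hk := fun j => continuous_cauchy_kernel (lo_le_hi hμ k).le (continuous_weight hμ k) hp j
  have hk1 : Continuous fun θ => weight μ k θ * (p - cutNode μ k θ)⁻¹ := by simpa using hk 1
  have hpc : ∀ P : ℂ[X], Continuous fun θ => P.eval (cutNode μ k θ : ℂ) := fun P =>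
    P.continuous.comp (continuous_ofReal_node _ _)
  rw [(hasDerivAt_cutFn hμ k hp).deriv, cutPoly_eval, cutFn, cauchyTr,
    ← intervalIntegral.integral_const_mul, ← intervalIntegral.integral_const_mul,
    ← intervalIntegral.integral_add, ← sub_eq_zero, ← intervalIntegral.integral_sub, ← ex]
  · refine intervalIntegral.integral_congr fun θ _ => ?_
    have h1 := ker_mul μ p (cutNode μ k θ)
    have h0 := hne θ
    field_simp
    linear_combination (2 * weight μ k θ) * h1
  · have hc : Continuous fun θ => weight μ k θ * ker μ p (cutNode μ k θ) := by
      unfold ker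
      exact (continuous_weight hμ k).mul (continuous_finsetSum _ fun i _ =>
        continuous_const.mul (hpc _))
    exact hc.intervalIntegrable _ _
  · refine (Continuous.add (continuous_const.mul hk1) (continuous_const.mul ?_)).intervalIntegrable _ _
    simpa only [mul_neg] using (hk 2).fun_neg
  · exact (continuous_const.mul hk1).intervalIntegrable _ _
  · refine (continuous_const.mul ?_).intervalIntegrable _ _
    simpa only [mul_neg] using (hk 2).fun_neg

theorem abs_lo_hi_le {μ : BranchPoints g} {ρ : ℝ} (hρ : ∀ α, |μ α| ≤ ρ) (k : Fin (g + 1)) :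
    |lo μ k| ≤ ρ ∧ |hi μ k| ≤ ρ := ⟨hρ _, hρ _⟩

theorem ext_cutFn {μ : BranchPoints g} (hμ : StrictMono μ) {ρ : ℝ} (hρ : ∀ α, |μ α| ≤ ρ)
    (k : Fin (g + 1)) : Ext ρ (cutFn μ k) :=
  ext_cauchyTr (lo_le_hi hμ k).le (abs_lo_hi_le hρ k).1 (abs_lo_hi_le hρ k).2 (continuous_weight hμ k)

theorem gro_cutFn {μ : BranchPoints g} (hμ : StrictMono μ) (k : Fin (g + 1)) :
    Gro (-1) (cutFn μ k) := gro_cauchyTr (lo_le_hi hμ k).le (continuous_weight hμ k)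

theorem res_eval_mul_cutFn {μ : BranchPoints g} (hμ : StrictMono μ) {r : ℝ} (hr : ∀ α, |μ α| < r)
    (k : Fin (g + 1)) (P : ℂ[X]) : res r (fun z => P.eval z * cutFn μ k z) = per hμ k P :=
  res_eval_mul_cauchyTr (lo_le_hi hμ k).le (hr _) (hr _) (continuous_weight hμ k) P

/-! ### Projecting out the periods -/

/-- The polynomial of degree less than `g` with the same periods. -/
def proj {μ : BranchPoints g} (hμ : StrictMono μ) (f : ℂ[X]) : ℂ[X] :=
  ∑ i : Fin g, C (∑ k : Fin g, (Q μ)⁻¹ i k * per hμ k.castSucc f) * X ^ i.val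

theorem degree_proj {μ : BranchPoints g} (hμ : StrictMono μ) (f : ℂ[X]) :
    (proj hμ f).degree < g := by
  refine (degree_sum_le _ _).trans_lt ((Finset.sup_lt_iff (WithBot.bot_lt_coe g)).2 fun i _ => ?_)
  exact (degree_C_mul_X_pow_le _ _).trans_lt (WithBot.coe_lt_coe.2 i.isLt)

theorem coeff_proj {μ : BranchPoints g} (hμ : StrictMono μ) (f : ℂ[X]) (i : Fin g) :
    (proj hμ f).coeff i.val = ∑ k : Fin g, (Q μ)⁻¹ i k * per hμ k.castSucc f := by
  simp only [proj, finsetSum_coeff, coeff_C_mul_X_pow, Fin.val_inj]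
  simp

theorem isUnit_det_Q {μ : BranchPoints g} (hμ : StrictMono μ) : IsUnit (Q μ).det :=
  (det_Q_ne_zero hμ).isUnit

theorem per_proj {μ : BranchPoints g} (hμ : StrictMono μ) (f : ℂ[X]) (m : Fin g) :
    per hμ m.castSucc (proj hμ f) = per hμ m.castSucc f := by
  have h1 : ∀ i : Fin g, per hμ m.castSucc
      (C (∑ k : Fin g, (Q μ)⁻¹ i k * per hμ k.castSucc f) * X ^ i.val) =
      Q μ m i * ∑ k : Fin g, (Q μ)⁻¹ i k * per hμ k.castSucc f := fun i => by
    rw [← smul_eq_C_mul, map_smul, Q_apply hμ, smul_eq_mul, mul_comm]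
  rw [proj, map_sum, Finset.sum_congr rfl fun i _ => h1 i]
  have h2 := congrFun (congrArg (fun A : Matrix (Fin g) (Fin g) ℂ =>
    A.mulVec fun k => per hμ k.castSucc f) (Matrix.mul_nonsing_inv (Q μ) (isUnit_det_Q hμ))) m
  simp only [← Matrix.mulVec_mulVec, Matrix.one_mulVec] at h2
  exact h2

theorem proj_eq_self {μ : BranchPoints g} (hμ : StrictMono μ) {f : ℂ[X]} (h : f.degree < g) :
    proj hμ f = f := by
  refine sub_eq_zero.1 (eq_zero_of_per hμ ?_ fun k => ?_)
  · exact (degree_sub_le _ _).trans_lt (max_lt (degree_proj hμ f) h)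
  · rw [map_sub, per_proj, sub_self]

/-- The combination of the `cutFn` that represents `f ↦ ∑ c i * (proj f).coeff i`. -/
def corr (μ : BranchPoints g) (c : Fin g → ℂ) (z : ℂ) : ℂ :=
  ∑ k : Fin g, (∑ i, c i * (Q μ)⁻¹ i k) * cutFn μ k.castSucc z

/-- The polynomial `ytilde (ytilde (corr c))'`. -/
def corrPoly {μ : BranchPoints g} (hμ : StrictMono μ) (c : Fin g → ℂ) : ℂ[X] :=
  ∑ k : Fin g, C (∑ i, c i * (Q μ)⁻¹ i k) * cutPoly hμ k.castSucc

theorem differentiableAt_corr {μ : BranchPoints g} (hμ : StrictMono μ) (c : Fin g → ℂ) {z : ℂ}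
    (hz : z ∈ offCuts μ) : DifferentiableAt ℂ (corr μ c) z := by
  unfold corr
  exact DifferentiableAt.fun_sum fun k _ =>
    ((hasDerivAt_cutFn hμ _ (mem_offCuts.1 hz _)).differentiableAt).const_mul _

theorem corrPoly_eq {μ : BranchPoints g} (hμ : StrictMono μ) (c : Fin g → ℂ) {p : ℂ}
    (hp : p ∈ offCuts μ) :
    (corrPoly hμ c).eval p = 1 / 2 * (derivative (T μ)).eval p * corr μ c p +
      (T μ).eval p * deriv (corr μ c) p := by
  have hd : HasDerivAt (corr μ c) (∑ k : Fin g, (∑ i, c i * (Q μ)⁻¹ i k) *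
      deriv (cutFn μ k.castSucc) p) p := by
    unfold corr
    exact HasDerivAt.fun_sum fun k _ =>
      ((hasDerivAt_cutFn hμ _ (mem_offCuts.1 hp _)).differentiableAt).hasDerivAt.const_mul _
  rw [hd.deriv, corrPoly, corr, eval_finsetSum, Finset.mul_sum, Finset.mul_sum,
    ← Finset.sum_add_distrib]
  refine Finset.sum_congr rfl fun k _ => ?_
  rw [eval_mul, eval_C, cutPoly_eq hμ _ (mem_offCuts.1 hp _)]
  ring

theorem ext_corr {μ : BranchPoints g} (hμ : StrictMono μ) {ρ : ℝ} (hρ : ∀ α, |μ α| ≤ ρ)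
    (c : Fin g → ℂ) : Ext ρ (corr μ c) := Ext.sum fun _ _ => (ext_cutFn hμ hρ _).const_mul _

theorem gro_corr {μ : BranchPoints g} (hμ : StrictMono μ) (c : Fin g → ℂ) :
    Gro (-1) (corr μ c) := Gro.sum fun _ _ => (gro_cutFn hμ _).const_mul _

theorem res_eval_mul_corr {μ : BranchPoints g} (hμ : StrictMono μ) {r : ℝ} (hr : ∀ α, |μ α| < r)
    (c : Fin g → ℂ) (f : ℂ[X]) :
    res r (fun z => f.eval z * corr μ c z) = ∑ i : Fin g, c i * (proj hμ f).coeff i.val := by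
  obtain ⟨ρ, h0, h1, h2⟩ := exists_inner_radius hr
  simp only [corr, Finset.mul_sum, coeff_proj]
  rw [res_sum (h0.trans h2.le), Finset.sum_comm]
  · refine Finset.sum_congr rfl fun k _ => ?_
    simp only [mul_left_comm _ (∑ i, c i * (Q μ)⁻¹ i k), res_const_mul, res_eval_mul_cutFn hμ hr]
    rw [Finset.sum_mul]
    exact Finset.sum_congr rfl fun i _ => by ring
  · exact fun k _ => ((ext_eval ρ f).mul ((ext_cutFn hμ h1 _).const_mul _)).continuousOn_sphere h2

/-- The polynomial with vanishing periods such that `hpoly j / ytilde = z ^ j + O(z ^ (-2))`. -/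
def hpoly {μ : BranchPoints g} (hμ : StrictMono μ) (j : ℕ) : ℂ[X] :=
  epoly μ j - proj hμ (epoly μ j)

theorem per_hpoly {μ : BranchPoints g} (hμ : StrictMono μ) (j : ℕ) (k : Fin g) :
    per hμ k.castSucc (hpoly hμ j) = 0 := by rw [hpoly, map_sub, per_proj, sub_self]

theorem gro_hpoly {μ : BranchPoints g} (hμ : StrictMono μ) (j : ℕ) :
    Gro (-2) fun p => (hpoly hμ j).eval p * (ytilde μ p)⁻¹ - p ^ j := by
  have h1 : Gro (-2) fun p => (p ^ j * ytilde μ p - (epoly μ j).eval p) * (ytilde μ p)⁻¹ :=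
    ((gro_epoly hμ j).mul (gro_ytilde_inv μ) rfl).mono (by omega)
  have h2 : Gro (-2) fun p => (proj hμ (epoly μ j)).eval p * (ytilde μ p)⁻¹ :=
    ((gro_eval_of_degree_lt (degree_proj hμ (epoly μ j))).mul (gro_ytilde_inv μ) rfl).mono (by omega)
  refine (h1.neg.sub h2).congr (1 + ∑ β, |μ β|) fun z hz => ?_
  have h0 := ytilde_ne_zero hμ (mem_offCuts_of_norm fun α => (abs_lt_rad μ α).trans hz)
  rw [hpoly, eval_sub]
  field_simp
  ring

/-- The difference divided by `ytilde` is `O(z ^ (-2))`, so the difference has degree less than `g`,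
and its periods vanish. Every variation of `y` is identified through this lemma. -/
theorem eq_of_gro_of_per {μ : BranchPoints g} (hμ : StrictMono μ) {P R : ℂ[X]} {s : ℂ → ℂ}
    (hP : Gro (-2) fun p => P.eval p * (ytilde μ p)⁻¹ - s p)
    (hR : Gro (-2) fun p => R.eval p * (ytilde μ p)⁻¹ - s p)
    (h : ∀ k : Fin g, per hμ k.castSucc P = per hμ k.castSucc R) : P = R := by
  refine sub_eq_zero.1 (eq_zero_of_per hμ (degree_lt_of_gro ?_) fun k => ?_)
  · refine (((hP.sub hR).mul (gro_ytilde μ) (m := g - 1) (by ring))).congr (1 + ∑ β, |μ β|)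
      fun z hz => ?_
    have h0 := ytilde_ne_zero hμ (mem_offCuts_of_norm fun α => (abs_lt_rad μ α).trans hz)
    rw [eval_sub]
    field_simp
    ring
  · rw [map_sub, h, sub_self]

/-- The moments of an exterior function. -/
def momentVec (g : ℕ) (r : ℝ) (lam : ℂ → ℂ) (i : Fin g) : ℂ := res r fun z => z ^ i.val * lam z

theorem res_proj_mul {μ : BranchPoints g} (hμ : StrictMono μ) {ρ r : ℝ} (h0 : 0 ≤ ρ) (hr : ρ < r)
    {lam : ℂ → ℂ} (hl : Ext ρ lam) (f : ℂ[X]) :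
    res r (fun z => (proj hμ f).eval z * lam z) =
      ∑ i : Fin g, momentVec g r lam i * (proj hμ f).coeff i.val := by
  have h1 : ∀ z, (proj hμ f).eval z * lam z =
      ∑ i : Fin g, (proj hμ f).coeff i.val * (z ^ i.val * lam z) := fun z => by
    simp only [coeff_proj]
    rw [proj, eval_finsetSum, Finset.sum_mul]
    refine Finset.sum_congr rfl fun i _ => ?_
    rw [eval_mul, eval_C, eval_pow, eval_X, mul_assoc]
  simp only [h1]
  rw [res_sum (h0.trans hr.le)]
  · refine Finset.sum_congr rfl fun i _ => ?_
    rw [res_const_mul, mul_comm, momentVec]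
  · intro i _
    have := (ext_eval ρ (X ^ i.val)).mul hl
    simp only [eval_pow, eval_X] at this
    exact (this.const_mul _).continuousOn_sphere hr

/-- The exterior function that represents a functional after the periods are projected out. -/
def lamCorr (μ : BranchPoints g) (c : Fin g → ℂ) (lam : ℂ → ℂ) (z : ℂ) : ℂ := lam z - corr μ c z

theorem ext_lamCorr {μ : BranchPoints g} (hμ : StrictMono μ) {ρ : ℝ} (hρ : ∀ α, |μ α| ≤ ρ)
    (c : Fin g → ℂ) {lam : ℂ → ℂ} (hl : Ext ρ lam) : Ext ρ (lamCorr μ c lam) :=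
  hl.sub (ext_corr hμ hρ c)

theorem gro_lamCorr {μ : BranchPoints g} (hμ : StrictMono μ) (c : Fin g → ℂ) {lam : ℂ → ℂ}
    (hg : Gro (-1) lam) : Gro (-1) (lamCorr μ c lam) := hg.sub (gro_corr hμ c)

/-- Subtracting `corr` from the symbol is the adjoint of subtracting `proj` from the polynomial. -/
theorem res_mul_lamCorr {μ : BranchPoints g} (hμ : StrictMono μ) {ρ r : ℝ} (h0 : 0 ≤ ρ)
    (hρ : ∀ α, |μ α| ≤ ρ) (hr : ρ < r) {lam : ℂ → ℂ} (hl : Ext ρ lam) (f : ℂ[X]) :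
    res r (fun z => f.eval z * lamCorr μ (momentVec g r lam) lam z) =
      res r (fun z => (f - proj hμ f).eval z * lam z) := by
  simp only [lamCorr, mul_sub, eval_sub, sub_mul]
  rw [res_sub (h0.trans hr.le), res_sub (h0.trans hr.le), res_proj_mul hμ h0 hr hl,
    res_eval_mul_corr hμ fun α => (hρ α).trans_lt hr]
  · exact ((ext_eval ρ f).mul hl).continuousOn_sphere hr
  · exact ((ext_eval ρ _).mul hl).continuousOn_sphere hr
  · exact ((ext_eval ρ f).mul hl).continuousOn_sphere hr
  · exact ((ext_eval ρ f).mul (ext_corr hμ hρ _)).continuousOn_sphere hr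

/-- `ytilde` times the corrected representing function is `const + O(1/z)`. -/
theorem exists_gro_ytilde_mul_lamCorr {μ : BranchPoints g} (hμ : StrictMono μ) {ρ r : ℝ}
    (h0 : 0 ≤ ρ) (hρ : ∀ α, |μ α| ≤ ρ) (hr : ρ < r) {lam : ℂ → ℂ} (hl : Ext ρ lam)
    (hg : Gro (-1) lam) :
    ∃ c : ℂ, Gro (-1) fun z => ytilde μ z * lamCorr μ (momentVec g r lam) lam z - c := by
  set L := lamCorr μ (momentVec g r lam) lam with hL
  have hLe := ext_lamCorr hμ hρ (momentVec g r lam) hl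
  have hLg := gro_lamCorr hμ (momentVec g r lam) hg
  have hφ : Ext ρ fun z => (ytilde μ z)⁻¹ * L z := (ext_ytilde_inv hμ hρ).mul hLe
  have hφg : Gro (-1) fun z => (ytilde μ z)⁻¹ * L z :=
    ((gro_ytilde_inv_one μ).mul hLg (m := -2) (by norm_num)).mono (by norm_num)
  have h1 := gro_polPart_remainder hφ hφg h0 hr (T μ) 0 (by simp)
  -- The coefficient of order `l ≥ 1` pairs the corrected symbol with `quo l (epoly μ 0)`. The
  -- projection fixes that polynomial, so the coefficient vanishes and only the constant is left.
  have h2 : polPart r (fun z => (ytilde μ z)⁻¹ * L z) (T μ) =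
      C ((polPart r (fun z => (ytilde μ z)⁻¹ * L z) (T μ)).coeff 0) := by
    ext l
    rw [coeff_C]
    split_ifs with hl0
    · rw [hl0]
    rw [coeff_polPart]
    simp only [← mul_assoc]
    rw [← res_pol_mul hμ h0 hρ hr hLe hLg, res_mul_lamCorr hμ h0 hρ hr hl, pol_quo,
      show pol μ (T μ) = epoly μ 0 by simp [epoly],
      proj_eq_self hμ (degree_quo_epoly hμ (Nat.one_le_iff_ne_zero.2 hl0)), sub_self]
    simp [res, circleIntegral]
  refine ⟨(polPart r (fun z => (ytilde μ z)⁻¹ * L z) (T μ)).coeff 0,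
    Gro.congr ρ (h1.mono (by simp)) fun z hz => ?_⟩
  have h3 := T_mul_inv hμ (mem_offCuts_of_norm fun α => (hρ α).trans_lt hz)
  rw [h2, eval_C, ← mul_assoc, h3, coeff_C_zero]

/-- The generating function behind every loop insertion. Passing the projection and the polynomial
part to the symbol turns `res (hpoly j * lam)` into the moment `res (z ^ j * ytilde * lamCorr)`. By
`hasSum_res` these moments sum to a double-pole integral, which is a derivative by the exterior
Cauchy formula once the constant at infinity is removed. -/
theorem hasSum_res_hpoly {μ : BranchPoints g} (hμ : StrictMono μ) {ρ r : ℝ} (h0 : 0 ≤ ρ)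
    (hρ : ∀ α, |μ α| ≤ ρ) (hr : ρ < r) {lam : ℂ → ℂ} (hl : Ext ρ lam) (hg : Gro (-1) lam) {p : ℂ}
    (hp : r < ‖p‖) :
    HasSum (fun j : ℕ => -((j : ℂ) / p ^ (j + 1) *
        res r fun z => (hpoly hμ (j - 1)).eval z * lam z))
      (deriv (fun z => ytilde μ z * lamCorr μ (momentVec g r lam) lam z) p) := by
  have hr0 : 0 < r := h0.trans_lt hr
  set L := lamCorr μ (momentVec g r lam) lam with hL
  have hLe := ext_lamCorr hμ hρ (momentVec g r lam) hl
  have hLg := gro_lamCorr hμ (momentVec g r lam) hg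
  have hF : Ext ρ fun z => ytilde μ z * L z := (ext_ytilde hμ hρ).mul hLe
  obtain ⟨c, hc⟩ := exists_gro_ytilde_mul_lamCorr hμ h0 hρ hr hl hg
  have hw : Ext ρ fun z => ytilde μ z * L z - c :=
    hF.sub (ext_of_differentiable (differentiable_const c))
  have h1 := exterior_cauchy_deriv hw hc h0 hr hp
  have h2 := hasSum_res hr0 (hF.continuousOn_sphere hr) hp
  have h3 : res r (fun z => -(ytilde μ z * L z) / (p - z) ^ 2) =
      deriv (fun z => ytilde μ z * L z) p := by
    have h4 := res_inv_sub_outer hr0.le hp (Q := C c) 2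
    rw [deriv_sub_const] at h1
    rw [← h1, ← sub_zero (res r fun z => -(ytilde μ z * L z - c) / (p - z) ^ 2), ← h4, ← res_sub hr0.le]
    · refine res_congr hr0.le fun z _ => ?_
      rw [eval_C]; ring
    · refine ContinuousOn.div (hw.continuousOn_sphere hr).neg (by fun_prop) fun z hz => ?_
      refine pow_ne_zero _ (sub_ne_zero.2 ?_)
      rintro rfl
      simp at hz; linarith
    · refine ContinuousOn.div (by fun_prop) (by fun_prop) fun z hz => ?_
      refine pow_ne_zero _ (sub_ne_zero.2 ?_)
      rintro rfl
      simp at hz; linarith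
  rw [h3] at h2
  refine h2.congr_fun fun j => ?_
  congr 2
  rw [hpoly, ← res_mul_lamCorr hμ h0 hρ hr hl, ← hL, epoly, res_pol_mul hμ h0 hρ hr hLe hLg]
  refine res_congr hr0.le fun z hz => ?_
  rw [eval_mul, mul_assoc ((X ^ (j - 1)).eval z),
    T_mul_inv hμ (mem_offCuts_of_norm fun α => (hρ α).trans_lt (by rw [hz]; exact hr))]
  simp only [eval_pow, eval_X, mul_assoc, hL]

/-- Cauchy's estimate on the disc of radius `‖p‖ / 2` about `p`, on which norms lie between `‖p‖ /
2` and `3‖p‖ / 2`; the maximum in the constant covers both signs of `k`. -/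
theorem Gro.deriv {ρ : ℝ} {w : ℂ → ℂ} (hw : Ext ρ w) {k : ℤ} (h : Gro k w) :
    Gro (k - 1) (deriv w) := by
  obtain ⟨C, R, hC, hR, hb⟩ := h.exists_bound
  refine Gro.of_bound (2 * C * max ((3 / 2) ^ k) ((1 / 2) ^ k)) (2 * max R |ρ|) fun p hp => ?_
  have hm1 := le_max_left R |ρ|
  have hm2 := le_max_right R |ρ|
  have hρ := le_abs_self ρ
  have hp0 : 0 < ‖p‖ := by linarith
  have hnorm : ∀ z ∈ Metric.closedBall p (‖p‖ / 2), ‖p‖ / 2 ≤ ‖z‖ ∧ ‖z‖ ≤ 3 / 2 * ‖p‖ := by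
    intro z hz
    rw [mem_closedBall_iff_norm] at hz
    have h1 := norm_sub_norm_le p z
    have h2 := norm_sub_norm_le z p
    rw [norm_sub_rev] at h1
    constructor <;> linarith
  have hd : DiffContOnCl ℂ w (Metric.ball p (‖p‖ / 2)) := by
    refine DifferentiableOn.diffContOnCl_ball (U := Metric.closedBall p (‖p‖ / 2)) ?_ le_rfl
    exact DifferentiableOn.mono hw fun z hz => by
      have := (hnorm z hz).1
      show ρ < ‖z‖
      linarith
  have hpk : (0 : ℝ) < ‖p‖ ^ k := zpow_pos hp0 k
  have key := Complex.norm_deriv_le_of_forall_mem_sphere_norm_le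
    (C := C * (max ((3 / 2) ^ k) ((1 / 2) ^ k) * ‖p‖ ^ k)) (half_pos hp0) hd fun z hz => by
    have hz' := hnorm z (Metric.sphere_subset_closedBall hz)
    refine (hb z (by linarith)).trans (mul_le_mul_of_nonneg_left ?_ hC.le)
    rcases le_or_gt 0 k with hk | hk
    · refine le_trans ?_ (mul_le_mul_of_nonneg_right (le_max_left _ _) hpk.le)
      rw [← mul_zpow]
      exact zpow_le_zpow_left₀ hk (norm_nonneg _) hz'.2
    · refine le_trans ?_ (mul_le_mul_of_nonneg_right (le_max_right _ _) hpk.le)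
      rw [← mul_zpow]
      obtain ⟨n, rfl⟩ : ∃ n : ℕ, k = -n := ⟨k.natAbs, by omega⟩
      rw [zpow_neg, zpow_neg, zpow_natCast, zpow_natCast]
      refine inv_anti₀ (by positivity) (pow_le_pow_left₀ (by positivity) ?_ n)
      linarith [hz'.1]
  refine key.trans (le_of_eq ?_)
  rw [zpow_sub_one₀ hp0.ne']
  field_simp

/-! ### The loop insertion of `W0` at coinciding points -/

theorem corr_eq_sum (μ : BranchPoints g) (c : Fin g → ℂ) (z : ℂ) :
    corr μ c z = ∑ i, c i * corr μ (Pi.single i 1) z := by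
  have h : ∀ i, corr μ (Pi.single i 1) z = ∑ k : Fin g, (Q μ)⁻¹ i k * cutFn μ k.castSucc z :=
    fun i => by
      refine Finset.sum_congr rfl fun k _ => ?_
      rw [Finset.sum_eq_single i] <;> simp +contextual
  simp only [h, Finset.mul_sum]
  rw [Finset.sum_comm]
  unfold corr
  refine Finset.sum_congr rfl fun k _ => ?_
  rw [Finset.sum_mul]
  exact Finset.sum_congr rfl fun i _ => by ring

theorem corrPoly_eq_sum {μ : BranchPoints g} (hμ : StrictMono μ) (c : Fin g → ℂ) :
    corrPoly hμ c = ∑ i, C (c i) * corrPoly hμ (Pi.single i 1) := by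
  have h : ∀ i, corrPoly hμ (Pi.single i 1) =
      ∑ k : Fin g, C ((Q μ)⁻¹ i k) * cutPoly hμ k.castSucc := fun i => by
    refine Finset.sum_congr rfl fun k _ => ?_
    rw [Finset.sum_eq_single i] <;> simp +contextual
  simp only [h, Finset.mul_sum]
  rw [Finset.sum_comm]
  unfold corrPoly
  refine Finset.sum_congr rfl fun k _ => ?_
  rw [map_sum, Finset.sum_mul]
  exact Finset.sum_congr rfl fun i _ => by rw [C_mul]; ring

/-- The kernel `∑ q ^ i (Q⁻¹) i k g_k(p)` on the diagonal. -/
def diagPoly {μ : BranchPoints g} (hμ : StrictMono μ) : ℂ[X] :=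
  ∑ i : Fin g, X ^ i.val * corrPoly hμ (Pi.single i 1)

theorem diagPoly_eval {μ : BranchPoints g} (hμ : StrictMono μ) (p : ℂ) :
    (diagPoly hμ).eval p = (corrPoly hμ fun i => p ^ i.val).eval p := by
  rw [corrPoly_eq_sum, diagPoly, eval_finsetSum, eval_finsetSum]
  exact Finset.sum_congr rfl fun i _ => by simp

/-- The polynomial part of `ytilde * corr`. -/
def corrPart {μ : BranchPoints g} (c : Fin g → ℂ) : ℂ[X] :=
  polPart (1 + ∑ β, |μ β|) (fun z => (ytilde μ z)⁻¹ * corr μ c z) (T μ)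

theorem gro_corrPart {μ : BranchPoints g} (hμ : StrictMono μ) (c : Fin g → ℂ) :
    Gro (-1) fun z => ytilde μ z * corr μ c z - (corrPart (μ := μ) c).eval z := by
  obtain ⟨ρ, h0, h1, h2⟩ := exists_inner_radius (abs_lt_rad μ)
  have h3 := gro_polPart_remainder ((ext_ytilde_inv hμ h1).mul (ext_corr hμ h1 c))
    (((gro_ytilde_inv_one μ).mul (gro_corr hμ c) (m := -2) (by norm_num)).mono (by norm_num))
    h0 h2 (T μ) 0 (by simp)
  refine (h3.mono (by simp)).congr ρ fun z hz => ?_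
  rw [← mul_assoc, T_mul_inv hμ (mem_offCuts_of_norm fun α => (h1 α).trans_lt hz), corrPart]

theorem coeff_corrPart {μ : BranchPoints g} (hμ : StrictMono μ) (i : Fin g) (l : ℕ) :
    (corrPart (μ := μ) (Pi.single i 1)).coeff l =
      (proj hμ (quo l (epoly μ 0))).coeff i.val := by
  obtain ⟨ρ, h0, h1, h2⟩ := exists_inner_radius (abs_lt_rad μ)
  rw [corrPart, coeff_polPart]
  simp only [← mul_assoc]
  rw [← res_pol_mul hμ h0 h1 h2 (ext_corr hμ h1 _) (gro_corr hμ _),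
    res_eval_mul_corr hμ (abs_lt_rad μ), pol_quo, show pol μ (T μ) = epoly μ 0 by simp [epoly],
    Finset.sum_eq_single i] <;> simp +contextual

theorem natDegree_epoly_zero {μ : BranchPoints g} : (epoly μ 0).natDegree ≤ 2 * (g + 1) := by
  rw [natDegree_le_iff_coeff_eq_zero]
  intro m hm
  rw [epoly, pol, coeff_polPart, quo_eq_zero (by simpa [degree_T] using hm.le)]
  simp [res, circleIntegral]

/-- The term `l = 0` is killed by differentiation, and for `l ≥ 1` the projection fixes `quo l
(epoly μ 0)`. So the projection disappears and the diagonal difference quotient of `epoly μ 0`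
remains. -/
theorem sum_corrPart {μ : BranchPoints g} (hμ : StrictMono μ) (p : ℂ) :
    ∑ i : Fin g, p ^ i.val * (derivative (corrPart (μ := μ) (Pi.single i 1))).eval p =
      (derivative (derivative (epoly μ 0))).eval p / 2 := by
  rw [← sum_quo_eval_deriv natDegree_epoly_zero]
  have h1 : ∀ i : Fin g, (corrPart (μ := μ) (Pi.single i 1)).natDegree < 2 * (g + 1) + 1 := by
    intro i
    rw [corrPart, polPart]
    refine Nat.lt_succ_of_le (natDegree_sum_le_of_forall_le _ _ fun l hl => ?_)
    rw [Finset.mem_range, degree_T] at hl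
    exact (natDegree_C_mul_X_pow_le _ _).trans hl.le
  have h2 : ∀ i : Fin g, (derivative (corrPart (μ := μ) (Pi.single i 1))).eval p =
      ∑ l ∈ Finset.range (2 * (g + 1)),
        (proj hμ (quo l (epoly μ 0))).coeff i.val * (l * p ^ (l - 1)) := fun i => by
    rw [derivative_eval, sum_over_range' _ _ _ (h1 i)]
    · rw [Finset.sum_range_succ, coeff_corrPart hμ, quo_eq_zero natDegree_epoly_zero]
      rw [show proj hμ (0 : ℂ[X]) = 0 by simp [proj]]
      simp only [coeff_zero, zero_mul, add_zero]
      exact Finset.sum_congr rfl fun l _ => by rw [coeff_corrPart hμ]; ring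
    · simp
  simp only [h2, Finset.mul_sum]
  rw [Finset.sum_comm]
  refine Finset.sum_congr rfl fun l _ => ?_
  rcases Nat.eq_zero_or_pos l with rfl | hl
  · simp
  · have hd := degree_quo_epoly hμ (Nat.succ_le_of_lt hl)
    rw [proj_eq_self hμ hd]
    have h3 : (quo l (epoly μ 0)).eval p = ∑ i : Fin g, (quo l (epoly μ 0)).coeff i.val * p ^ i.val := by
      by_cases hq : quo l (epoly μ 0) = 0
      · simp [hq]
      · rw [eval_eq_sum_range' ((natDegree_lt_iff_degree_lt hq).2 hd) p, Finset.sum_range]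
    rw [h3, Finset.sum_mul]
    exact Finset.sum_congr rfl fun i _ => by ring

/-- The loop insertion of the planar loop mean at coinciding points. -/
def W00 {μ : BranchPoints g} (hμ : StrictMono μ) (p : ℂ) : ℂ :=
  ((derivative (T μ)).eval p ^ 2 / 16 - (derivative (derivative (T μ))).eval p * (T μ).eval p / 8 +
    (diagPoly hμ).eval p * (T μ).eval p / 2) / (T μ).eval p ^ 2

/-- `2 ytilde W00` as a sum of decaying terms. -/
theorem W00_eq {μ : BranchPoints g} (hμ : StrictMono μ) {ρ : ℝ} (hρ : ∀ α, |μ α| ≤ ρ) {p : ℂ}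
    (hp : ρ < ‖p‖) :
    -(1 / 2) * deriv (deriv fun z => ytilde μ z - (epoly μ 0).eval z) p +
      ∑ i : Fin g, p ^ i.val * deriv (fun z => ytilde μ z * corr μ (Pi.single i 1) z -
        (corrPart (μ := μ) (Pi.single i 1)).eval z) p = 2 * ytilde μ p * W00 hμ p := by
  have hoff : ∀ z : ℂ, ρ < ‖z‖ → z ∈ offCuts μ := fun z hz =>
    mem_offCuts_of_norm fun α => (hρ α).trans_lt hz
  have hpo := hoff p hp
  have hy0 := ytilde_ne_zero hμ hpo
  have hdy := hasDerivAt_ytilde hμ hpo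
  have e1 : deriv (deriv fun z => ytilde μ z - (epoly μ 0).eval z) p =
      ((derivative (derivative (T μ))).eval p * (2 * ytilde μ p) - (derivative (T μ)).eval p *
        (2 * ((derivative (T μ)).eval p / (2 * ytilde μ p)))) / (2 * ytilde μ p) ^ 2 -
        (derivative (derivative (epoly μ 0))).eval p := by
    have h1 : deriv (fun z => ytilde μ z - (epoly μ 0).eval z) =ᶠ[𝓝 p] fun z =>
        (derivative (T μ)).eval z / (2 * ytilde μ z) - (derivative (epoly μ 0)).eval z := by
      filter_upwards [(isOpen_offCuts μ).mem_nhds hpo] with z hz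
      exact ((hasDerivAt_ytilde hμ hz).sub (Polynomial.hasDerivAt _ z)).deriv
    rw [h1.deriv_eq]
    exact (((Polynomial.hasDerivAt (derivative (T μ)) p).div (hdy.const_mul 2)
      (by simpa using hy0)).sub (Polynomial.hasDerivAt (derivative (epoly μ 0)) p)).deriv
  have e2 : ∀ i : Fin g, deriv (fun z => ytilde μ z * corr μ (Pi.single i 1) z -
        (corrPart (μ := μ) (Pi.single i 1)).eval z) p =
      (corrPoly hμ (Pi.single i 1)).eval p / ytilde μ p -
        (derivative (corrPart (μ := μ) (Pi.single i 1))).eval p := fun i => by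
    rw [((hdy.fun_mul (differentiableAt_corr hμ _ hpo).hasDerivAt).fun_sub (Polynomial.hasDerivAt _ p)).deriv,
      corrPoly_eq hμ _ hpo, ← ytilde_sq]
    field_simp
  have e3 : ∑ i : Fin g, p ^ i.val * ((corrPoly hμ (Pi.single i 1)).eval p / ytilde μ p -
        (derivative (corrPart (μ := μ) (Pi.single i 1))).eval p) =
      (diagPoly hμ).eval p / ytilde μ p - (derivative (derivative (epoly μ 0))).eval p / 2 := by
    rw [← sum_corrPart hμ, diagPoly, eval_finsetSum, Finset.sum_div, ← Finset.sum_sub_distrib]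
    exact Finset.sum_congr rfl fun i _ => by rw [eval_mul, eval_pow, eval_X]; ring
  simp only [e2]
  rw [e1, e3, W00, ← ytilde_sq]
  field_simp
  ring

/-- The rational formula hides the decay. By `W00_eq`, `2 ytilde W00` is built from derivatives of
`O(1/z)` functions with weights `p ^ i`, `i < g`, which the factor `1 / ytilde` absorbs. -/
theorem gro_W00 {μ : BranchPoints g} (hμ : StrictMono μ) : Gro (-1) (W00 hμ) := by
  obtain ⟨ρ, h0, h1, h2⟩ := exists_inner_radius (abs_lt_rad μ)
  have hw : Ext ρ fun z => ytilde μ z - (epoly μ 0).eval z := (ext_ytilde hμ h1).sub (ext_eval ρ _)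
  have hwg : Gro (-1) fun z => ytilde μ z - (epoly μ 0).eval z := by simpa using gro_epoly hμ 0
  have g1 : Gro (g - 1) (deriv (deriv fun z => ytilde μ z - (epoly μ 0).eval z)) :=
    (Gro.deriv hw.deriv (Gro.deriv hw hwg)).mono (by omega)
  have g2 : ∀ i : Fin g, Gro (g - 1) fun p => p ^ i.val *
      deriv (fun z => ytilde μ z * corr μ (Pi.single i 1) z -
        (corrPart (μ := μ) (Pi.single i 1)).eval z) p := fun i =>
    ((gro_pow i.val).mul (Gro.deriv (((ext_ytilde hμ h1).mul (ext_corr hμ h1 _)).sub (ext_eval ρ _))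
      (gro_corrPart hμ _)) rfl).mono (by have := i.isLt; omega)
  have g3 := (((g1.const_mul (-(1 / 2))).add (Gro.sum (s := Finset.univ) fun i _ => g2 i)).mul
    ((gro_ytilde_inv μ).const_mul (1 / 2)) rfl).mono (show _ ≤ (-1 : ℤ) by omega)
  refine g3.congr ρ fun z hz => ?_
  have hy0 := ytilde_ne_zero hμ (mem_offCuts_of_norm fun α => (h1 α).trans_lt hz)
  rw [W00_eq hμ h1 hz]
  field_simp

/-- The summands are the coupling derivatives of `W0` at `p`. They are moments in `z` of one
function depending on `p`, so `hasSum_res` sums them. -/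
theorem hasSum_W00 {μ : BranchPoints g} (hμ : StrictMono μ) {p : ℂ} (hp : ∀ α, |μ α| < ‖p‖) :
    HasSum (fun j : ℕ => -((j : ℂ) / p ^ (j + 1) *
        (1 / 2 * (p ^ (j - 1) - (hpoly hμ (j - 1)).eval p / ytilde μ p)))) (W00 hμ p) := by
  obtain ⟨ρ, h0, h1, h2⟩ := exists_inner_radius hp
  obtain ⟨r, hr, hrp⟩ := exists_between h2
  have hr0 : 0 < r := h0.trans_lt hr
  have hrμ : ∀ α, |μ α| < r := fun α => (h1 α).trans_lt hr
  have hy0 := ytilde_ne_zero hμ (mem_offCuts_of_norm hp)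
  have hpz : ∀ z : ℂ, z ∈ Metric.sphere (0 : ℂ) r → p - z ≠ 0 := fun z hz => sub_ne_zero.2 (by
    rintro rfl; simp at hz; linarith)
  have hdiv : ∀ {f : ℂ → ℂ} (k : ℕ), Ext ρ f →
      ContinuousOn (fun z => f z / (p - z) ^ k) (Metric.sphere 0 r) := fun k hf =>
    (hf.continuousOn_sphere hr).div (by fun_prop) fun z hz => pow_ne_zero _ (hpz z hz)
  have hdiv1 : ∀ {f : ℂ → ℂ}, Ext ρ f →
      ContinuousOn (fun z => f z / (p - z)) (Metric.sphere 0 r) := fun hf => by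
    simpa using hdiv 1 hf
  have hy := ext_ytilde hμ h1
  have hc := fun c => ext_corr hμ h1 (g := g) c
  set c : Fin g → ℂ := fun i => p ^ i.val with hcdef
  have hFc : ContinuousOn (fun z => ytilde μ z / (p - z) + ytilde μ z * corr μ c z)
      (Metric.sphere 0 r) := (hdiv1 hy).add ((hy.mul (hc c)).continuousOn_sphere hr)
  have hX : ∀ (j : ℕ) {f : ℂ → ℂ}, Ext ρ f → Ext ρ fun z => z ^ j * f z := fun j f hf => by
    simpa using (ext_eval ρ (X ^ j)).mul hf
  -- The kernel `1 / (p - z)` accounts for the removed polynomial part, and `corr` with the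
  -- coefficients `c i = p ^ i` for evaluating the projection at `p`.
  have hA : ∀ j, p ^ j * ytilde μ p - (hpoly hμ j).eval p =
      res r fun z => z ^ j * (ytilde μ z / (p - z) + ytilde μ z * corr μ c z) := fun j => by
    have a1 := polPart_remainder (ext_ytilde_inv hμ h1) (gro_ytilde_inv_one μ) h0 hr hrp (X ^ j * T μ)
    rw [← pol_eq_polPart hμ hrμ, eval_mul, mul_assoc, T_mul_inv hμ (mem_offCuts_of_norm hp)] at a1
    have a2 := res_eval_mul_corr hμ hrμ c (epoly μ j)
    have a3 : ∑ i : Fin g, c i * (proj hμ (epoly μ j)).coeff i.val =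
        (proj hμ (epoly μ j)).eval p := by
      conv_rhs => rw [proj]
      rw [eval_finsetSum]
      exact Finset.sum_congr rfl fun i _ => by
        rw [eval_mul, eval_C, eval_pow, eval_X, coeff_proj, mul_comm]
    rw [a3, epoly, res_pol_mul hμ h0 h1 hr (hc c) (gro_corr hμ c)] at a2
    have hT : ∀ z, ‖z‖ = r → (X ^ j * T μ).eval z * (ytilde μ z)⁻¹ = z ^ j * ytilde μ z := by
      intro z hz
      rw [eval_mul, mul_assoc, T_mul_inv hμ (mem_offCuts_of_norm fun α => by rw [hz]; exact hrμ α),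
        eval_pow, eval_X]
    rw [res_congr hr0.le (g := fun z => z ^ j * ytilde μ z / (p - z)) fun z hz => by
      rw [hT z hz]] at a1
    rw [res_congr hr0.le (g := fun z => z ^ j * ytilde μ z * corr μ c z) fun z hz => by
      rw [hT z hz]] at a2
    rw [eval_pow, eval_X] at a1
    rw [hpoly, eval_sub, epoly, ← a2, sub_sub_eq_add_sub, add_sub_right_comm, a1,
      ← res_add hr0.le (hdiv1 (hX j hy)) (((hX j hy).mul (hc c)).continuousOn_sphere hr)]
    exact res_congr hr0.le fun z _ => by ring
  have hB := hasSum_res hr0 hFc hrp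
  have hw : Ext ρ fun z => ytilde μ z - (epoly μ 0).eval z := hy.sub (ext_eval ρ _)
  have hwg : Gro (-1) fun z => ytilde μ z - (epoly μ 0).eval z := by simpa using gro_epoly hμ 0
  have hwi : ∀ i : Fin g, Ext ρ fun z => ytilde μ z * corr μ (Pi.single i 1) z -
      (corrPart (μ := μ) (Pi.single i 1)).eval z := fun i => (hy.mul (hc _)).sub (ext_eval ρ _)
  -- The triple pole gives a second derivative of `ytilde`, the double poles give first derivatives
  -- of `ytilde * corr`. Subtracting polynomial parts, which changes no integral, makes the exterior
  -- Cauchy formulas applicable.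
  have hC : res r (fun z => -(ytilde μ z / (p - z) + ytilde μ z * corr μ c z) / (p - z) ^ 2) =
      2 * ytilde μ p * W00 hμ p := by
    rw [← W00_eq hμ h1 h2]
    have c1 := exterior_cauchy_deriv_deriv hw hwg h0 hr hrp
    have c2 := fun i => exterior_cauchy_deriv (hwi i) (gro_corrPart hμ (Pi.single i 1)) h0 hr hrp
    have c3 := res_inv_sub_outer hr0.le hrp (Q := -epoly μ 0) 3
    have c4 := fun i : Fin g => res_inv_sub_outer hr0.le hrp
      (Q := -corrPart (μ := μ) (Pi.single i 1)) 2
    simp only [← c2]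
    rw [show -(1 / 2) * deriv (deriv fun z => ytilde μ z - (epoly μ 0).eval z) p =
      -res r (fun z => (ytilde μ z - (epoly μ 0).eval z) / (p - z) ^ 3) by rw [c1]; ring,
      ← res_neg, ← add_zero (res r fun z => -((ytilde μ z - (epoly μ 0).eval z) / (p - z) ^ 3)),
      ← c3, ← res_add hr0.le]
    · rw [Finset.sum_congr rfl fun i _ => show p ^ i.val * res r (fun z => -(ytilde μ z *
          corr μ (Pi.single i 1) z - (corrPart (μ := μ) (Pi.single i 1)).eval z) / (p - z) ^ 2) =
          res r (fun z => p ^ i.val * (-(ytilde μ z * corr μ (Pi.single i 1) z) / (p - z) ^ 2)) by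
        rw [res_const_mul]
        congr 1
        rw [← add_zero (res r fun z => -(ytilde μ z * corr μ (Pi.single i 1) z -
          (corrPart (μ := μ) (Pi.single i 1)).eval z) / (p - z) ^ 2), ← c4 i, ← res_add hr0.le]
        · exact res_congr hr0.le fun z _ => by rw [eval_neg]; ring
        · have := hdiv 2 ((hwi i).const_mul (-1))
          simpa only [neg_one_mul] using this
        · exact hdiv 2 (ext_eval ρ _)]
      rw [← res_sum hr0.le, ← res_add hr0.le]
      · refine res_congr hr0.le fun z hz => ?_
        have := hpz z (by simpa using hz)
        rw [corr_eq_sum μ c, eval_neg, Finset.mul_sum, neg_add, add_div]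
        congr 1
        · field_simp
          ring
        · rw [← Finset.sum_neg_distrib, Finset.sum_div]
          exact Finset.sum_congr rfl fun i _ => by rw [hcdef]; ring
      · have h5 := (hdiv 3 (hw.const_mul (-1))).add (hdiv 3 (ext_eval ρ (-epoly μ 0)))
        refine h5.congr fun z _ => ?_
        simp only [Pi.add_apply]
        ring
      · refine continuousOn_finsetSum _ fun i _ => ?_
        have := hdiv 2 ((hy.mul (hc (Pi.single i 1))).const_mul (-p ^ i.val))
        exact this.congr fun z _ => by ring
      · intro i _
        have := hdiv 2 ((hy.mul (hc (Pi.single i 1))).const_mul (-p ^ i.val))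
        exact this.congr fun z _ => by ring
    · exact (hdiv 3 (hw.const_mul (-1))).congr fun z _ => by ring
    · exact hdiv 3 (ext_eval ρ (-epoly μ 0))
  rw [hC] at hB
  have hD := hB.mul_left (2 * ytilde μ p)⁻¹
  rw [inv_mul_cancel_left₀ (by simpa using hy0)] at hD
  refine hD.congr_fun fun j => ?_
  rw [← hA]
  field_simp

/-! ### A square real system written with complex values -/

/-- The implicit function theorem for a square system of real equations with a real parameter. -/
theorem exists_implicit_curve {ι E : Type*} [Fintype ι] [NormedAddCommGroup E] [NormedSpace ℝ E]
    [FiniteDimensional ℝ E] {f : ι → ℝ × E → ℂ} {D : ι → ℝ × E →L[ℝ] ℂ} {x : E}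
    (hf : ∀ i, HasStrictFDerivAt (f i) (D i) (0, x))
    (hreal : ∀ i, ∀ᶠ q in 𝓝 ((0 : ℝ), x), ((f i q).re : ℂ) = f i q)
    (hcard : Fintype.card ι = Module.finrank ℝ E)
    (hinj : ∀ v, (∀ i, D i (0, v) = 0) → v = 0) :
    ∃ v : E, (∀ i, D i (1, v) = 0) ∧
      (∃ γ : ℝ → E, γ 0 = x ∧ ContinuousAt γ 0 ∧
        ∀ᶠ ε in 𝓝 (0 : ℝ), ∀ i, f i (ε, γ ε) = f i (0, x)) ∧
      ∀ γ : ℝ → E, γ 0 = x → ContinuousAt γ 0 →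
        (∀ᶠ ε in 𝓝 (0 : ℝ), ∀ i, f i (ε, γ ε) = f i (0, x)) → HasDerivAt γ v 0 := by
  have hcomplete : CompleteSpace E := FiniteDimensional.complete ℝ E
  let F : ℝ × E → ι → ℝ := fun q i => (f i q).re
  let DF : ℝ × E →L[ℝ] (ι → ℝ) := ContinuousLinearMap.pi fun i => reCLM.comp (D i)
  have hF : HasStrictFDerivAt F DF (0, x) :=
    hasStrictFDerivAt_pi.2 fun i => reCLM.hasStrictFDerivAt.comp (0, x) (hf i)
  -- Derivatives of real-valued functions are real, so passing to real parts loses no information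
  -- about the kernel.
  have hDre : ∀ i w, ((D i w).re : ℂ) = D i w := fun i w => by
    have h1 : HasFDerivAt (fun q => ((f i q).re : ℂ)) (ofRealCLM.comp (reCLM.comp (D i))) (0, x) :=
      ofRealCLM.hasFDerivAt.comp (0, x) (reCLM.hasFDerivAt.comp (0, x) (hf i).hasFDerivAt)
    have h2 := h1.congr_of_eventuallyEq ((hreal i).mono fun q hq => hq.symm)
    have h3 := h2.unique (hf i).hasFDerivAt
    exact congrArg (fun A : ℝ × E →L[ℝ] ℂ => A w) h3
  have hinv : (DF ∘L .inr ℝ ℝ E).IsInvertible := by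
    have hi : Function.Injective (DF ∘L .inr ℝ ℝ E) := by
      rw [injective_iff_map_eq_zero]
      intro v hv
      refine hinj v fun i => ?_
      have := congrFun hv i
      have h2 : (D i (0, v)).re = 0 := this
      rw [← hDre, h2, ofReal_zero]
    have hfr : Module.finrank ℝ E = Module.finrank ℝ (ι → ℝ) := by
      rw [← hcard, Module.finrank_fintype_fun_eq_card]
    let e := LinearEquiv.ofInjectiveOfFinrankEq (DF ∘L .inr ℝ ℝ E).toLinearMap hi hfr
    exact ⟨e.toContinuousLinearEquiv, by ext; rfl⟩
  let ψ := hF.implicitFunctionOfProdDomain hinv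
  have hψ := (hF.hasStrictFDerivAt_implicitFunctionOfProdDomain hinv).hasFDerivAt.hasDerivAt
  set v := (-(DF ∘L .inr ℝ ℝ E).inverse ∘L (DF ∘L .inl ℝ ℝ E)) 1 with hv
  have hiff := hF.eventually_apply_eq_iff_implicitFunctionOfProdDomain hinv
  have hψ0 : ψ 0 = x := hiff.self_of_nhds.1 rfl
  have hback : ∀ γ : ℝ → E, γ 0 = x → ContinuousAt γ 0 →
      (∀ᶠ ε in 𝓝 (0 : ℝ), ∀ i, ((f i (ε, γ ε)).re : ℂ) = f i (ε, γ ε)) := fun γ h0 hc => by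
    have ht : Tendsto (fun ε => (ε, γ ε)) (𝓝 (0 : ℝ)) (𝓝 ((0 : ℝ), x)) := by
      have : ContinuousAt (fun ε => (ε, γ ε)) (0 : ℝ) := continuousAt_id.prodMk hc
      rw [← h0]; exact this
    rw [eventually_all]
    exact fun i => ht.eventually (hreal i)
  have hψe : ∀ᶠ ε in 𝓝 (0 : ℝ), ∀ i, f i (ε, ψ ε) = f i (0, x) := by
    filter_upwards [hF.eventually_apply_implicitFunctionOfProdDomain hinv,
      hback ψ hψ0 hψ.continuousAt] with ε h1 h2 i
    rw [← h2 i, ← (hreal i).self_of_nhds]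
    exact congrArg _ (congrFun h1 i)
  refine ⟨v, fun i => ?_, ⟨ψ, hψ0, hψ.continuousAt, hψe⟩, fun γ h0 hc he => ?_⟩
  · have h1 : HasDerivAt (fun ε : ℝ => (ε, ψ ε)) (1, v) 0 := (hasDerivAt_id 0).prodMk hψ
    have h2 : HasFDerivAt (f i) (D i) ((fun ε : ℝ => (ε, ψ ε)) 0) := by
      simp only [hψ0]; exact (hf i).hasFDerivAt
    have h3 := h2.comp_hasDerivAt (0 : ℝ) h1
    have h4 : HasDerivAt (f i ∘ fun ε => (ε, ψ ε)) 0 0 :=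
      (hasDerivAt_const (0 : ℝ) (f i (0, x))).congr_of_eventuallyEq (hψe.mono fun ε h => h i)
    exact h3.unique h4
  · refine hψ.congr_of_eventuallyEq ?_
    have ht : Tendsto (fun ε => (ε, γ ε)) (𝓝 (0 : ℝ)) (𝓝 ((0 : ℝ), x)) := by
      have : ContinuousAt (fun ε => (ε, γ ε)) (0 : ℝ) := continuousAt_id.prodMk hc
      rw [← h0]; exact this
    filter_upwards [ht.eventually hiff, he] with ε h1 h2
    exact (h1.1 (funext fun i => congrArg re (h2 i))).symm

/-! ### First variations of `M`, `y` and the periods -/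

theorem hasStrictFDerivAt_rect {μ : BranchPoints g} (hμ : StrictMono μ) {k : Fin (g + 1)} (s : ℤ)
    {l r : ℝ} (h : Encircles μ k l r) {F : ℂ → ℂ} (hF : Continuous F) :
    ∃ D : BranchPoints g →L[ℝ] ℂ,
      HasStrictFDerivAt (fun μ' : BranchPoints g => rectIntegral l r fun z => F z * ytilde μ' z ^ s)
        D μ ∧
      ∀ v, D v = rectIntegral l r fun z => F z * (-(s / 2) * ytilde μ z ^ s * logVar μ v z) := by
  have hi := fun i : Fin 4 => hasStrictFDerivAt_ytilde_integral hμ s (a := sideLeft l i)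
    (b := sideRight r i) (z := side l r i) (φ := fun t => F (side l r i t)) (continuous_side l r i)
    (hF.comp (continuous_side l r i)) fun t ht => h.mem_offCuts (side_mem (h.le hμ) i ht)
  choose D h1 h2 using hi
  refine ⟨∑ i, sideCoeff i • D i, ?_, fun v => ?_⟩
  · simp only [rectIntegral_eq_sum]
    exact HasStrictFDerivAt.fun_sum fun i _ => (h1 i).const_mul (sideCoeff i)
  · simp only [rectIntegral_eq_sum, sum_apply, smul_apply, h2, smul_eq_mul]

theorem hasStrictFDerivAt_res_pencil {μ : BranchPoints g} (hμ : StrictMono μ) {r : ℝ}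
    (hr : ∀ α, |μ α| < r) (A B : ℂ[X]) :
    ∃ D : ℝ × BranchPoints g →L[ℝ] ℂ,
      HasStrictFDerivAt (fun q : ℝ × BranchPoints g =>
        res r (fun z => A.eval z * (ytilde q.2 z)⁻¹) +
          q.1 * res r (fun z => B.eval z * (ytilde q.2 z)⁻¹)) D (0, μ) ∧
      ∀ s v, D (s, v) = res r (fun z => A.eval z * (1 / 2 * ((ytilde μ z)⁻¹ * logVar μ v z))) +
        s * res r (fun z => B.eval z * (ytilde μ z)⁻¹) := by
  obtain ⟨DA, hA, hA'⟩ := hasStrictFDerivAt_res hμ (-1) hr A.continuous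
  obtain ⟨DB, hB, -⟩ := hasStrictFDerivAt_res hμ (-1) hr B.continuous
  simp only [zpow_neg_one] at hA hB hA'
  have h2 : HasStrictFDerivAt (fun q : ℝ × BranchPoints g => q.2) (.snd ℝ ℝ (BranchPoints g)) (0, μ) :=
    hasStrictFDerivAt_snd
  have h1 : HasStrictFDerivAt (fun q : ℝ × BranchPoints g => (q.1 : ℂ))
      (ofRealCLM.comp (.fst ℝ ℝ (BranchPoints g))) (0, μ) :=
    ofRealCLM.hasStrictFDerivAt.comp _ hasStrictFDerivAt_fst
  have hA2 := HasStrictFDerivAt.comp (0, μ) (g := fun μ' : BranchPoints g => res r fun z =>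
    A.eval z * (ytilde μ' z)⁻¹) hA h2
  have hB2 := HasStrictFDerivAt.comp (0, μ) (g := fun μ' : BranchPoints g => res r fun z =>
    B.eval z * (ytilde μ' z)⁻¹) hB h2
  refine ⟨_, hA2.add (h1.mul hB2), fun s v => ?_⟩
  simp only [add_apply, smul_apply, ContinuousLinearMap.comp_apply, ContinuousLinearMap.coe_snd',
    ContinuousLinearMap.coe_fst', ofRealCLM_apply, smul_eq_mul, hA']
  rw [ofReal_zero, zero_mul, zero_add, mul_comm (s : ℂ)]
  congr 1
  refine congrArg _ (funext fun z => ?_)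
  push_cast
  ring

/-- `∏_{α ≠ β} (X - μ_α)`. -/
def Tsub (μ : BranchPoints g) (β : Fin (2 * (g + 1))) : ℂ[X] :=
  ∏ α ∈ Finset.univ.erase β, (X - C (μ α : ℂ))

theorem mul_Tsub (μ : BranchPoints g) (β : Fin (2 * (g + 1))) :
    (X - C (μ β : ℂ)) * Tsub μ β = T μ :=
  Finset.mul_prod_erase Finset.univ (fun α => (X - C (μ α : ℂ))) (Finset.mem_univ β)

theorem Tsub_eval_of_ne (μ : BranchPoints g) {α β : Fin (2 * (g + 1))} (h : α ≠ β) :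
    (Tsub μ α).eval (μ β : ℂ) = 0 := by
  rw [Tsub, eval_prod]
  exact Finset.prod_eq_zero (Finset.mem_erase.2 ⟨h.symm, Finset.mem_univ β⟩) (by simp)

theorem derivative_T_eval (μ : BranchPoints g) (β : Fin (2 * (g + 1))) :
    (derivative (T μ)).eval (μ β : ℂ) = (Tsub μ β).eval (μ β : ℂ) := by
  rw [← mul_Tsub μ β]; simp

theorem derivative_T_eval_ne_zero {μ : BranchPoints g} (hμ : StrictMono μ)
    (β : Fin (2 * (g + 1))) : (derivative (T μ)).eval (μ β : ℂ) ≠ 0 := by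
  rw [derivative_T_eval, Tsub, eval_prod]
  refine Finset.prod_ne_zero_iff.2 fun α hα => ?_
  rw [eval_sub, eval_X, eval_C, ← ofReal_sub, ofReal_ne_zero, sub_ne_zero]
  exact fun h => (Finset.ne_of_mem_erase hα) (hμ.injective h).symm

/-- `-2 ytilde` times the variation of `ytilde` in the direction `v`. -/
def varT (μ : BranchPoints g) (v : BranchPoints g) : ℂ[X] := ∑ β, C (v β : ℂ) * Tsub μ β

theorem varT_eval {μ : BranchPoints g} (hμ : StrictMono μ) (v : BranchPoints g) {z : ℂ}
    (hz : z ∈ offCuts μ) : (varT μ v).eval z = (T μ).eval z * logVar μ v z := by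
  rw [varT, logVar, eval_finsetSum, Finset.mul_sum]
  refine Finset.sum_congr rfl fun β _ => ?_
  have h0 := sub_ne_zero_of_mem_offCuts hμ hz β
  rw [← mul_Tsub μ β, eval_mul, eval_mul, eval_sub, eval_X, eval_C, eval_C]
  field_simp

theorem varT_eval_branch (μ v : BranchPoints g) (β : Fin (2 * (g + 1))) :
    (varT μ v).eval (μ β : ℂ) = v β * (derivative (T μ)).eval (μ β : ℂ) := by
  rw [varT, eval_finsetSum, Finset.sum_eq_single β, eval_mul, eval_C, derivative_T_eval]
  · intro α _ h
    rw [eval_mul, Tsub_eval_of_ne μ h, mul_zero]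
  · simp

theorem ext_logVar {μ : BranchPoints g} {ρ : ℝ} (hρ : ∀ α, |μ α| ≤ ρ) (v : BranchPoints g) :
    Ext ρ (logVar μ v) := Ext.sum fun α _ => (ext_inv_sub (by simpa using hρ α)).const_mul _

theorem gro_logVar (μ v : BranchPoints g) : Gro (-1) (logVar μ v) :=
  Gro.sum fun _ _ => (gro_inv_sub _).const_mul _

/-- The variation of `M` in the direction `v` when `V'` varies by `s B`. -/
def deltaM (μ : BranchPoints g) (A B : ℂ[X]) (s : ℂ) (v : BranchPoints g) : ℂ[X] :=
  C s * pol μ B + polPart (1 + ∑ β, |μ β|) (fun z => 1 / 2 * ((ytilde μ z)⁻¹ * logVar μ v z)) A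

/-- `ytilde` times the variation of `y`. -/
def deltaY (μ : BranchPoints g) (A B : ℂ[X]) (s : ℂ) (v : BranchPoints g) : ℂ[X] :=
  T μ * deltaM μ A B s v - C (1 / 2) * (pol μ A * varT μ v)

theorem coeff_deltaM {μ : BranchPoints g} (hμ : StrictMono μ) {r : ℝ} (hr : ∀ α, |μ α| < r)
    (A B : ℂ[X]) (s : ℂ) (v : BranchPoints g) (l : ℕ) :
    (deltaM μ A B s v).coeff l =
      res r (fun z => (quo l A).eval z * (1 / 2 * ((ytilde μ z)⁻¹ * logVar μ v z))) +
        s * res r (fun z => (quo l B).eval z * (ytilde μ z)⁻¹) := by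
  obtain ⟨ρ, h0, h1, h2⟩ := exists_inner_radius (r := min r (1 + ∑ β, |μ β|))
    fun α => lt_min (hr α) (abs_lt_rad μ α)
  rw [deltaM, pol_eq_polPart hμ hr, polPart_eq_of_ext
    (((ext_ytilde_inv hμ h1).mul (ext_logVar h1 v)).const_mul _) h0
    (h2.trans_le (min_le_right _ _)) (h2.trans_le (min_le_left _ _)), coeff_add, coeff_C_mul,
    coeff_polPart, coeff_polPart, add_comm]

/-- Along a variation that preserves the planar equations, `y` varies by `s B + O(1/z²)`. -/
theorem gro_deltaY {μ : BranchPoints g} (hμ : StrictMono μ) {A B : ℂ[X]} {s : ℂ}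
    {v : BranchPoints g}
    (hA : ∀ k < g + 1, res (1 + ∑ β, |μ β|) (fun z => z ^ k * (A.eval z * (ytilde μ z)⁻¹)) = 0)
    (hv : ∀ k < g + 2, res (1 + ∑ β, |μ β|) (fun z => (X ^ k * A).eval z *
      (1 / 2 * ((ytilde μ z)⁻¹ * logVar μ v z))) +
      s * res (1 + ∑ β, |μ β|) (fun z => (X ^ k * B).eval z * (ytilde μ z)⁻¹) = 0) :
    Gro (-2) fun p => (deltaY μ A B s v).eval p * (ytilde μ p)⁻¹ - s * B.eval p := by
  obtain ⟨ρ, h0, h1, h2⟩ := exists_inner_radius (abs_lt_rad μ)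
  set R := 1 + ∑ β, |μ β| with hR
  have hR0 : 0 < R := rad_pos μ
  have e1 := ext_ytilde_inv hμ h1
  have e2 : Ext ρ fun z => 1 / 2 * ((ytilde μ z)⁻¹ * logVar μ v z) :=
    (e1.mul (ext_logVar h1 v)).const_mul _
  have g2 : Gro (-1) fun z => 1 / 2 * ((ytilde μ z)⁻¹ * logVar μ v z) :=
    (((gro_ytilde_inv_one μ).mul (gro_logVar μ v) (m := -2) (by norm_num)).const_mul _).mono
      (by norm_num)
  -- The varied planar equations kill `g + 2` moments; multiplication by `ytilde`, of order `g + 1`,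
  -- leaves `O(z ^ (-2))`.
  have key : Gro (-1 - (g + 2 : ℕ)) fun p => res R fun z =>
      (A.eval z * (1 / 2 * ((ytilde μ z)⁻¹ * logVar μ v z)) + s * (B.eval z * (ytilde μ z)⁻¹)) /
        (p - z) := by
    refine gro_res_div_of_moments hR0 ?_ _ fun k hk => ?_
    · exact (((ext_eval ρ A).mul e2).add (((ext_eval ρ B).mul e1).const_mul s)).continuousOn_sphere h2
    · rw [← hv k hk, ← res_const_mul, ← res_add hR0.le]
      · exact res_congr hR0.le fun z _ => by rw [eval_mul, eval_mul, eval_pow, eval_X]; ring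
      · exact ((ext_eval ρ _).mul e2).continuousOn_sphere h2
      · exact (((ext_eval ρ _).mul e1).const_mul s).continuousOn_sphere h2
  have rem := gro_pol_remainder hμ A (g + 1) hA
  have t1 := key.mul (gro_ytilde μ) (m := -2) (by push_cast; ring)
  -- The original `g + 1` vanishing moments make the remainder times `ytilde` of order `-1`, and
  -- `logVar` supplies another order.
  have t2 : Gro (-2) fun p => 1 / 2 * ((A.eval p * (ytilde μ p)⁻¹ - (pol μ A).eval p) *
      ytilde μ p * logVar μ v p) :=
    ((rem.mul (gro_ytilde μ) (m := -1) (by push_cast; ring)).mul (gro_logVar μ v)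
      (m := -2) (by norm_num)).const_mul _
  refine (t2.sub t1).congr R fun p hp => ?_
  have hoff : p ∈ offCuts μ := mem_offCuts_of_norm fun α => (abs_lt_rad μ α).trans hp
  have hy0 := ytilde_ne_zero hμ hoff
  have r1 := polPart_remainder e2 g2 h0 h2 hp A
  have r2 := polPart_remainder e1 (gro_ytilde_inv_one μ) h0 h2 hp B
  have hpz : ∀ z : ℂ, z ∈ Metric.sphere (0 : ℂ) R → p - z ≠ 0 := fun z hz => sub_ne_zero.2 (by
    rintro rfl; simp at hz; linarith)
  have r3 : res R (fun z => (A.eval z * (1 / 2 * ((ytilde μ z)⁻¹ * logVar μ v z)) +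
      s * (B.eval z * (ytilde μ z)⁻¹)) / (p - z)) =
      A.eval p * (1 / 2 * ((ytilde μ p)⁻¹ * logVar μ v p)) + s * (B.eval p * (ytilde μ p)⁻¹) -
        (deltaM μ A B s v).eval p := by
    rw [deltaM, eval_add, eval_mul, eval_C, pol, ← hR,
      show ∀ a b c d : ℂ, a + s * b - (s * c + d) = (a - d) + s * (b - c) by intros; ring, r1, r2,
      ← res_const_mul, ← res_add hR0.le]
    · exact res_congr hR0.le fun z _ => by ring
    · exact (((ext_eval ρ A).mul e2).continuousOn_sphere h2).div (by fun_prop) hpz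
    · exact ((((ext_eval ρ B).mul e1).continuousOn_sphere h2).div (by fun_prop) hpz).const_smul s
  rw [r3, deltaY, eval_sub, eval_mul, eval_mul, eval_C, eval_mul, varT_eval hμ v hoff, ← ytilde_sq]
  field_simp
  ring

theorem eval_eq_sum_of_coeff {P : ℂ[X]} {N : ℕ} (h : ∀ l, N ≤ l → P.coeff l = 0) (z : ℂ) :
    P.eval z = ∑ l ∈ Finset.range N, P.coeff l * z ^ l := by
  have hd : P.natDegree < N + 1 :=
    Nat.lt_succ_of_le (natDegree_le_iff_coeff_eq_zero.2 fun m hm => h m hm.le)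
  rw [eval_eq_sum_range' hd, Finset.sum_range_succ, h N le_rfl, zero_mul, add_zero]

/-- The weight is `I` times a real function. Hence periods of real polynomials are imaginary and
filling fractions are real, as the real implicit function theorem requires. -/
theorem conj_per {μ : BranchPoints g} (hμ : StrictMono μ) (k : Fin (g + 1)) {P : ℂ[X]}
    (hP : IsRealPoly P) : starRingEnd ℂ (per hμ k P) = -per hμ k P := by
  rw [per_apply, ← intervalIntegral.intervalIntegral_conj, ← intervalIntegral.integral_neg]
  refine intervalIntegral.integral_congr fun θ _ => ?_
  simp only [weight, map_mul, map_inv₀, conj_I, ← hP.eval_conj, conj_ofReal,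
    ← coSqrt_conj hμ (coOff_of_mem hμ (cutNode_mem hμ k θ))]
  ring

theorem dVpoly_shift (V : ℝ[X]) {j : ℕ} (hj : 1 ≤ j) (ε : ℝ) :
    dVpoly (shift V j ε) = dVpoly V + C (ε : ℂ) * X ^ (j - 1) := by
  have : (j : ℝ) ≠ 0 := by exact_mod_cast (by omega : j ≠ 0)
  rw [dVpoly, shift, derivative_add, derivative_monomial, div_mul_cancel₀ _ this, Polynomial.map_add,
    map_monomial, ← C_mul_X_pow_eq_monomial]
  rfl

theorem coeff_Mpoly_shift {V : ℝ[X]} {j : ℕ} (hj : 1 ≤ j) (ε : ℝ) {μ : BranchPoints g}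
    (hμ : StrictMono μ) {r : ℝ} (hr : ∀ α, |μ α| < r) (l : ℕ) :
    (Mpoly (shift V j ε) μ).coeff l =
      res r (fun z => (quo l (dVpoly V)).eval z * (ytilde μ z)⁻¹) +
        ε * res r (fun z => (quo l (X ^ (j - 1))).eval z * (ytilde μ z)⁻¹) := by
  rw [Mpoly, dVpoly_shift V hj, pol_add hμ, pol_C_mul, coeff_add, coeff_C_mul, pol_eq_polPart hμ hr,
    pol_eq_polPart hμ hr, coeff_polPart, coeff_polPart]

/-- A common bound for the degrees of `V'` and `x ^ (j - 1)`. -/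
def degBound (V : ℝ[X]) (j : ℕ) : ℕ := max (dVpoly V).natDegree (j - 1)

theorem quo_eq_zero_of_degBound (V : ℝ[X]) (j : ℕ) {l : ℕ} (hl : degBound V j ≤ l) :
    quo l (dVpoly V) = 0 ∧ quo l (X ^ (j - 1) : ℂ[X]) = 0 :=
  ⟨quo_eq_zero ((le_max_left _ _).trans hl),
    quo_eq_zero (by rw [natDegree_X_pow]; exact (le_max_right _ _).trans hl)⟩

theorem res_zero_mul (r : ℝ) (f : ℂ → ℂ) : res r (fun z => (0 : ℂ[X]).eval z * f z) = 0 := by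
  simp [res, circleIntegral]

theorem coeff_Mpoly_shift_eq_zero {V : ℝ[X]} {j : ℕ} (hj : 1 ≤ j) (ε : ℝ) {μ : BranchPoints g}
    (hμ : StrictMono μ) {l : ℕ} (hl : degBound V j ≤ l) : (Mpoly (shift V j ε) μ).coeff l = 0 := by
  obtain ⟨h1, h2⟩ := quo_eq_zero_of_degBound V j hl
  rw [coeff_Mpoly_shift hj ε hμ (abs_lt_rad μ), h1, h2, res_zero_mul]
  ring

theorem coeff_deltaM_eq_zero {V : ℝ[X]} {j : ℕ} {μ : BranchPoints g} (hμ : StrictMono μ) (s : ℂ)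
    (v : BranchPoints g) {l : ℕ} (hl : degBound V j ≤ l) :
    (deltaM μ (dVpoly V) (X ^ (j - 1)) s v).coeff l = 0 := by
  obtain ⟨h1, h2⟩ := quo_eq_zero_of_degBound V j hl
  rw [coeff_deltaM hμ (abs_lt_rad μ), h1, h2, res_zero_mul, res_zero_mul]
  ring

theorem continuousOn_rect {μ : BranchPoints g} {k : Fin (g + 1)} {l r : ℝ} (h : Encircles μ k l r)
    {f : ℂ → ℂ} (hf : ∀ z ∈ offCuts μ, ContinuousAt f z) : ContinuousOn f (rectBoundary l r) :=
  fun z hz => (hf z (h.mem_offCuts hz)).continuousWithinAt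

theorem continuousAt_logVar {μ : BranchPoints g} (hμ : StrictMono μ) (v : BranchPoints g) {z : ℂ}
    (hz : z ∈ offCuts μ) : ContinuousAt (logVar μ v) z := by
  unfold logVar
  refine tendsto_finsetSum _ fun α _ => ?_
  exact continuousAt_const.mul ((continuousAt_id.sub continuousAt_const).inv₀
    (sub_ne_zero_of_mem_offCuts hμ hz α))

/-- The periods of `y` for the couplings shifted by `ε`, near a given set of branch points. -/
def periodPencil (V : ℝ[X]) (j : ℕ) (R l r : ℝ) (q : ℝ × BranchPoints g) : ℂ :=
  ∑ m ∈ Finset.range (degBound V j),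
    (res R (fun z => (quo m (dVpoly V)).eval z * (ytilde q.2 z)⁻¹) +
      q.1 * res R (fun z => (quo m (X ^ (j - 1))).eval z * (ytilde q.2 z)⁻¹)) *
    rectIntegral l r (fun z => z ^ m * ytilde q.2 z ^ (1 : ℤ))

theorem periodPencil_eq {V : ℝ[X]} {j : ℕ} (hj : 1 ≤ j) (ε : ℝ) {μ : BranchPoints g}
    (hμ : StrictMono μ) {R : ℝ} (hR : ∀ α, |μ α| < R) {k : Fin (g + 1)} {l r : ℝ}
    (h : Encircles μ k l r) :
    periodPencil V j R l r (ε, μ) = per hμ k (Mpoly (shift V j ε) μ * T μ) := by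
  rw [← rect_eval_div_ytilde hμ h, periodPencil]
  simp only [← coeff_Mpoly_shift hj ε hμ hR, ← rect_const_mul]
  rw [← rect_sum (h.le hμ)]
  · refine rect_congr (h.le hμ) fun z hz => ?_
    rw [eval_mul, mul_assoc, T_mul_inv hμ (h.mem_offCuts hz),
      eval_eq_sum_of_coeff (fun l hl => coeff_Mpoly_shift_eq_zero hj ε hμ hl), Finset.sum_mul]
    exact Finset.sum_congr rfl fun m _ => by rw [zpow_one]; ring
  · intro m _
    refine continuousOn_rect h fun z hz => ?_
    have := (differentiableAt_ytilde hμ hz).continuousAt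
    simp only [zpow_one]
    fun_prop

/-- A product rule: the period of `y` is a finite sum of coefficients of `M` times fixed-contour
integrals of `z ^ m ytilde`, each differentiable in coupling and branch points jointly. The two
groups of terms reassemble into `deltaY / ytilde`. -/
theorem hasStrictFDerivAt_periodPencil {V : ℝ[X]} {j : ℕ} {μ : BranchPoints g}
    (hμ : StrictMono μ) {R : ℝ} (hR : ∀ α, |μ α| < R) {k : Fin (g + 1)} {l r : ℝ}
    (h : Encircles μ k l r) :
    ∃ D : ℝ × BranchPoints g →L[ℝ] ℂ,
      HasStrictFDerivAt (periodPencil V j R l r) D (0, μ) ∧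
      ∀ (s : ℝ) v, D (s, v) = per hμ k (deltaY μ (dVpoly V) (X ^ (j - 1)) s v) := by
  choose D1 h1 h1' using fun m : ℕ =>
    hasStrictFDerivAt_res_pencil hμ hR (quo m (dVpoly V)) (quo m (X ^ (j - 1)))
  choose D2 h2 h2' using fun m : ℕ =>
    hasStrictFDerivAt_rect hμ 1 h (F := fun z => z ^ m) (continuous_pow m)
  have hs : HasStrictFDerivAt (fun q : ℝ × BranchPoints g => q.2) (.snd ℝ ℝ (BranchPoints g)) (0, μ) :=
    hasStrictFDerivAt_snd
  have h3 := fun m => HasStrictFDerivAt.comp (0, μ) (g := fun μ' : BranchPoints g =>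
    rectIntegral l r fun z => z ^ m * ytilde μ' z ^ (1 : ℤ)) (h2 m) hs
  refine ⟨_, HasStrictFDerivAt.fun_sum fun m _ => (h1 m).mul (h3 m), fun s v => ?_⟩
  have hcy : ∀ z ∈ offCuts μ, ContinuousAt (ytilde μ) z := fun z hz =>
    (differentiableAt_ytilde hμ hz).continuousAt
  simp only [sum_apply, add_apply, smul_apply, ContinuousLinearMap.comp_apply,
    ContinuousLinearMap.coe_snd', smul_eq_mul, h1', h2',
    ← coeff_deltaM hμ hR, ofReal_zero, zero_mul, add_zero]
  rw [← rect_eval_div_ytilde hμ h]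
  have hM : ∀ m, res R (fun z => (quo m (dVpoly V)).eval z * (ytilde μ z)⁻¹) =
      (Mpoly V μ).coeff m := fun m => by
    rw [Mpoly, pol_eq_polPart hμ hR, coeff_polPart]
  simp only [hM]
  have e1 : ∀ m, (Mpoly V μ).coeff m * rectIntegral l r (fun z => z ^ m *
        (-(((1 : ℤ) : ℂ) / 2) * ytilde μ z ^ (1 : ℤ) * logVar μ v z)) +
      rectIntegral l r (fun z => z ^ m * ytilde μ z ^ (1 : ℤ)) *
        (deltaM μ (dVpoly V) (X ^ (j - 1)) s v).coeff m =
      rectIntegral l r (fun z => (Mpoly V μ).coeff m * (z ^ m * (-(1 / 2) * ytilde μ z *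
        logVar μ v z)) + (deltaM μ (dVpoly V) (X ^ (j - 1)) s v).coeff m * (z ^ m * ytilde μ z)) := by
    intro m
    rw [rect_add (h.le hμ), rect_const_mul, rect_const_mul]
    · simp only [zpow_one, Int.cast_one]; ring
    · refine continuousOn_rect h fun z hz => ?_
      have := hcy z hz
      have := continuousAt_logVar hμ v hz
      fun_prop
    · refine continuousOn_rect h fun z hz => ?_
      have := hcy z hz
      fun_prop
  rw [Finset.sum_congr rfl fun m _ => e1 m, ← rect_sum (h.le hμ)]
  · refine rect_congr (h.le hμ) fun z hz => ?_
    have hoff := h.mem_offCuts hz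
    have hy0 := ytilde_ne_zero hμ hoff
    have hM0 : ∀ l, degBound V j ≤ l → (Mpoly V μ).coeff l = 0 := fun l hl => by
      rw [← hM l, (quo_eq_zero_of_degBound V j hl).1, res_zero_mul]
    rw [deltaY, eval_sub, eval_mul, eval_mul, eval_C, eval_mul, varT_eval hμ v hoff, ← ytilde_sq,
      eval_eq_sum_of_coeff (fun l hl => coeff_deltaM_eq_zero hμ s v hl),
      show pol μ (dVpoly V) = Mpoly V μ from rfl, eval_eq_sum_of_coeff hM0]
    rw [Finset.sum_add_distrib]
    have a1 : ∀ m, (Mpoly V μ).coeff m * (z ^ m * (-(1 / 2) * ytilde μ z * logVar μ v z)) =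
      (Mpoly V μ).coeff m * z ^ m * (-(1 / 2) * ytilde μ z * logVar μ v z) := fun m => by ring
    have a2 : ∀ m, (deltaM μ (dVpoly V) (X ^ (j - 1)) s v).coeff m * (z ^ m * ytilde μ z) =
      (deltaM μ (dVpoly V) (X ^ (j - 1)) s v).coeff m * z ^ m * ytilde μ z := fun m => by ring
    simp only [a1, a2, ← Finset.sum_mul]
    field_simp
    ring
  · intro m _
    refine continuousOn_rect h fun z hz => ?_
    have := hcy z hz
    have := continuousAt_logVar hμ v hz
    fun_prop

/-- `T` vanishes at branch points, so only the motion of the branch point itself is seen. Where `M`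
does not vanish, the variation of `y` therefore determines the velocities. -/
theorem deltaY_eval_branch (μ : BranchPoints g) (V : ℝ[X]) (B : ℂ[X]) (s : ℂ) (v : BranchPoints g)
    (β : Fin (2 * (g + 1))) :
    (deltaY μ (dVpoly V) B s v).eval (μ β : ℂ) =
      -(1 / 2) * (Mpoly V μ).eval (μ β : ℂ) * v β * (derivative (T μ)).eval (μ β : ℂ) := by
  rw [deltaY, eval_sub, eval_mul, eval_mul, eval_T_branch, eval_C, eval_mul, varT_eval_branch,
    show pol μ (dVpoly V) = Mpoly V μ from rfl]
  ring

/-! ### Deformations at fixed filling fractions -/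

/-- The rectangles around the cuts of `μ` serve for nearby branch points. -/
structure Near (μ : BranchPoints g) (R : ℝ) (μ' : BranchPoints g) : Prop where
  mono : StrictMono μ'
  lt : ∀ α, |μ' α| < R
  encircles : ∀ i : Fin g, Encircles μ' i.castSucc (leftPoint μ i) (rightPoint μ i)

theorem eventually_near {μ : BranchPoints g} (hμ : StrictMono μ) {R : ℝ} (hR : ∀ α, |μ α| < R) :
    ∀ᶠ μ' in 𝓝 μ, Near μ R μ' := by
  have h2 : ∀ᶠ μ' : BranchPoints g in 𝓝 μ, ∀ α, |μ' α| < R := by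
    rw [eventually_all]
    intro α
    have : Continuous fun μ' : BranchPoints g => |μ' α| := by fun_prop
    exact this.continuousAt.eventually (gt_mem_nhds (hR α))
  have h3 : ∀ᶠ μ' : BranchPoints g in 𝓝 μ, ∀ i : Fin g,
      Encircles μ' i.castSucc (leftPoint μ i) (rightPoint μ i) := by
    rw [eventually_all]
    exact fun i => eventually_encircles (encircles_points hμ i)
  filter_upwards [eventually_strictMono hμ, h2, h3] with μ' a b c
  exact ⟨a, b, c⟩

theorem filling_eq {V : ℝ[X]} {μ : BranchPoints g} (hμ : StrictMono μ) (i : Fin g) :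
    filling V μ i = (4 * (Real.pi : ℂ) * I)⁻¹ * per hμ i.castSucc (Mpoly V μ * T μ) := by
  rw [filling, ← aPeriod_eval_div hμ]
  congr 1
  unfold aPeriod
  have h := encircles_points hμ i
  refine rect_congr (h.le hμ) fun z hz => ?_
  rw [y, M_eq hμ, eval_mul, mul_assoc, T_mul_inv hμ (h.mem_offCuts hz)]

theorem conj_filling {V : ℝ[X]} {μ : BranchPoints g} (hμ : StrictMono μ) (i : Fin g) :
    starRingEnd ℂ (filling V μ i) = filling V μ i := by
  rw [filling_eq hμ, map_mul, conj_per hμ _ ((isRealPoly_Mpoly hμ V).mul (isRealPoly_T μ)), map_inv₀,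
    map_mul, map_mul, conj_I, conj_ofReal, map_ofNat,
    show (4 * (Real.pi : ℂ) * -I) = -(4 * Real.pi * I) by ring, inv_neg]
  ring

/-- The planar moments and filling fractions for couplings shifted by `ε`. -/
def planarSystem (V : ℝ[X]) (j : ℕ) (μ : BranchPoints g) :
    Fin (g + 2) ⊕ Fin g → ℝ × BranchPoints g → ℂ :=
  Sum.elim (fun k q => res (1 + ∑ β, |μ β|) (fun z => (X ^ k.val * dVpoly V).eval z *
      (ytilde q.2 z)⁻¹) + q.1 * res (1 + ∑ β, |μ β|) (fun z => (X ^ k.val * X ^ (j - 1)).eval z *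
      (ytilde q.2 z)⁻¹))
    fun i q => (4 * (Real.pi : ℂ) * I)⁻¹ *
      periodPencil V j (1 + ∑ β, |μ β|) (leftPoint μ i) (rightPoint μ i) q

theorem planarSystem_inl {V : ℝ[X]} {j : ℕ} (hj : 1 ≤ j) {μ μ' : BranchPoints g}
    (h : Near μ (1 + ∑ β, |μ β|) μ') (ε : ℝ) (k : Fin (g + 2)) :
    planarSystem V j μ (Sum.inl k) (ε, μ') = planarMoment (shift V j ε) μ' k := by
  have hR0 := rad_pos μ
  rw [planarMoment_eq_res h.mono k h.lt, dVpoly_shift V hj, planarSystem, Sum.elim_inl,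
    ← res_const_mul, ← res_add hR0.le]
  · exact res_congr hR0.le fun z _ => by simp only [eval_mul, eval_add, eval_pow, eval_X, eval_C]; ring
  · exact (Polynomial.continuous _).continuousOn.mul (continuousOn_ytilde_inv h.mono h.lt)
  · exact continuousOn_const.mul
      ((Polynomial.continuous _).continuousOn.mul (continuousOn_ytilde_inv h.mono h.lt))

theorem planarSystem_inr {V : ℝ[X]} {j : ℕ} (hj : 1 ≤ j) {μ μ' : BranchPoints g}
    (h : Near μ (1 + ∑ β, |μ β|) μ') (ε : ℝ) (i : Fin g) :
    planarSystem V j μ (Sum.inr i) (ε, μ') = filling (shift V j ε) μ' i := by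
  rw [filling_eq h.mono, planarSystem, Sum.elim_inr, periodPencil_eq hj ε h.mono h.lt (h.encircles i)]

theorem shift_zero (V : ℝ[X]) (j : ℕ) : shift V j 0 = V := by simp [shift]

/-- `planarSystem` uses contours fixed at `μ`; nearby, its values agree with those over the moving
contours of the definitions. Strict monotonicity holds automatically close to `μ`. -/
theorem isDeformation_iff {V : ℝ[X]} {j : ℕ} (hj : 1 ≤ j) {μ : BranchPoints g}
    (hμ : IsPlanarSolution V μ) {γ : ℝ → BranchPoints g} :
    IsDeformation V μ j γ ↔ γ 0 = μ ∧ ContinuousAt γ 0 ∧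
      ∀ᶠ ε in 𝓝 (0 : ℝ), ∀ i, planarSystem V j μ i (ε, γ ε) = planarSystem V j μ i (0, μ) := by
  unfold IsDeformation
  refine and_congr_right fun h0 => and_congr_right fun hc => ?_
  have hnear := eventually_near hμ.1 (abs_lt_rad μ)
  have hγ : ∀ᶠ ε in 𝓝 (0 : ℝ), Near μ (1 + ∑ β, |μ β|) (γ ε) := by
    refine hc.eventually ?_
    rw [h0]; exact hnear
  have h00 := hnear.self_of_nhds
  refine eventually_congr ?_
  filter_upwards [hγ] with ε hε
  rw [isPlanarSolution_iff, Sum.forall]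
  have hp := (isPlanarSolution_iff.1 hμ).2
  constructor
  · rintro ⟨⟨-, h1⟩, h2⟩
    refine ⟨fun k => ?_, fun i => ?_⟩
    · rw [planarSystem_inl hj hε, planarSystem_inl hj h00, h1 _ (by omega), shift_zero,
        hp _ (by omega)]
    · rw [planarSystem_inr hj hε, planarSystem_inr hj h00, h2, shift_zero]
  · rintro ⟨h1, h2⟩
    refine ⟨⟨hε.mono, fun k hk => ?_⟩, fun i => ?_⟩
    · have := h1 ⟨k, by omega⟩
      rw [planarSystem_inl hj hε, planarSystem_inl hj h00, shift_zero] at this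
      rw [this, hp k hk]
    · have := h2 i
      rwa [planarSystem_inr hj hε, planarSystem_inr hj h00, shift_zero] at this

/-- Regular planar solutions deform uniquely when a coupling varies at fixed filling fractions. -/
theorem exists_velocity {V : ℝ[X]} {j : ℕ} (hj : 1 ≤ j) {μ : BranchPoints g}
    (hμ : IsPlanarSolution V μ) (hreg : IsRegular V μ) :
    ∃ v : BranchPoints g, deltaY μ (dVpoly V) (X ^ (j - 1)) 1 v = hpoly hμ.1 (j - 1) ∧
      (∃ γ, IsDeformation V μ j γ) ∧ ∀ γ, IsDeformation V μ j γ → HasDerivAt γ v 0 := by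
  have hm := hμ.1
  have hR := abs_lt_rad μ
  have hp := (isPlanarSolution_iff.1 hμ).2
  choose D1 h1 h1' using fun k : Fin (g + 2) =>
    hasStrictFDerivAt_res_pencil hm hR (X ^ k.val * dVpoly V) (X ^ k.val * X ^ (j - 1))
  choose D2 h2 h2' using fun i : Fin g =>
    hasStrictFDerivAt_periodPencil (V := V) (j := j) hm hR (encircles_points hm i)
  have hA : ∀ k < g + 1, res (1 + ∑ β, |μ β|)
      (fun z => z ^ k * ((dVpoly V).eval z * (ytilde μ z)⁻¹)) = 0 := fun k hk => by
    have := hp k (by omega)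
    rwa [if_neg (by omega)] at this
  have hpi : (4 * (Real.pi : ℂ) * I)⁻¹ ≠ 0 := by simp [Real.pi_ne_zero]
  let D : Fin (g + 2) ⊕ Fin g → ℝ × BranchPoints g →L[ℝ] ℂ :=
    Sum.elim D1 fun i => (4 * (Real.pi : ℂ) * I)⁻¹ • D2 i
  -- A tangent vector killed by the linearized system produces a variation of `y` with prescribed
  -- asymptotics and no periods; `eq_of_gro_of_per` leaves a single candidate.
  have hker : ∀ (s : ℝ) (v : BranchPoints g), (∀ i, D i (s, v) = 0) →
      deltaY μ (dVpoly V) (X ^ (j - 1)) s v = C (s : ℂ) * hpoly hm (j - 1) := by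
    intro s v hD
    refine eq_of_gro_of_per hm (s := fun p => s * (X ^ (j - 1) : ℂ[X]).eval p) ?_ ?_ fun k => ?_
    · exact gro_deltaY hm hA fun k hk => by
        rw [← h1' ⟨k, hk⟩]; exact hD (Sum.inl ⟨k, hk⟩)
    · refine ((gro_hpoly hm (j - 1)).const_mul (s : ℂ)).congr 0 fun z _ => ?_
      rw [eval_mul, eval_C, eval_pow, eval_X]; ring
    · have := hD (Sum.inr k)
      have h3 : (4 * (Real.pi : ℂ) * I)⁻¹ * D2 k (s, v) = 0 := this
      rw [← h2', (mul_eq_zero.1 h3).resolve_left hpi, ← smul_eq_C_mul, map_smul, per_hpoly, smul_zero]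
  have hf : ∀ i, HasStrictFDerivAt (planarSystem V j μ i) (D i) (0, μ) := by
    rintro (k | i)
    · exact h1 k
    · exact (h2 i).const_mul _
  have hreal : ∀ i, ∀ᶠ q in 𝓝 ((0 : ℝ), μ),
      ((planarSystem V j μ i q).re : ℂ) = planarSystem V j μ i q := by
    have hnear : ∀ᶠ q : ℝ × BranchPoints g in 𝓝 (0, μ), Near μ (1 + ∑ β, |μ β|) q.2 :=
      continuousAt_snd.eventually (eventually_near hm hR)
    rintro (k | i)
    · filter_upwards [hnear] with q hq
      rw [show q = (q.1, q.2) from rfl, planarSystem_inl hj hq]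
      exact planarMoment_real hq.mono _
    · filter_upwards [hnear] with q hq
      rw [show q = (q.1, q.2) from rfl, planarSystem_inr hj hq, ← conj_eq_iff_re]
      exact conj_filling hq.mono i
  -- With the coupling fixed, `y` does not vary to first order, and evaluation at a branch point,
  -- where `M` and `T'` do not vanish, gives zero velocity.
  have hinj : ∀ v, (∀ i, D i (0, v) = 0) → v = 0 := by
    intro v hv
    have h3 := hker 0 v hv
    rw [ofReal_zero, C_0, zero_mul] at h3
    funext β
    have h4 := deltaY_eval_branch μ V (X ^ (j - 1)) 0 v β
    rw [h3, eval_zero, ← M_eq hm] at h4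
    have h5 := hreg β
    have h6 := derivative_T_eval_ne_zero hm β
    have h7 : (v β : ℂ) = 0 := by
      by_contra h8
      exact absurd h4.symm (mul_ne_zero (mul_ne_zero (mul_ne_zero (by norm_num) h5) h8) h6)
    exact_mod_cast h7
  -- The system is square: `g + 2` planar moments and `g` filling fractions for `2 (g + 1)` branch
  -- points.
  obtain ⟨v, hv, ⟨γ, hγ⟩, huniq⟩ := exists_implicit_curve hf hreal (by simp; omega) hinj
  refine ⟨v, ?_, ⟨γ, (isDeformation_iff hj hμ).2 hγ⟩, fun γ hγ => ?_⟩
  · have := hker 1 v hv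
    rwa [ofReal_one, C_1, one_mul] at this
  · obtain ⟨a, b, c⟩ := (isDeformation_iff hj hμ).1 hγ
    exact huniq γ a b c

/-! ### Derivatives of moments, `W0` and `Q` along a deformation -/

theorem derivative_eval_eq_sum_of_coeff {P : ℂ[X]} {N : ℕ} (h : ∀ l, N ≤ l → P.coeff l = 0) (z : ℂ) :
    (derivative P).eval z = ∑ l ∈ Finset.range N, P.coeff l * (l * z ^ (l - 1)) := by
  have hd : P.natDegree < N + 1 :=
    Nat.lt_succ_of_le (natDegree_le_iff_coeff_eq_zero.2 fun m hm => h m hm.le)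
  rw [derivative_eval, sum_over_range' _ (fun n => by simp) _ hd, Finset.sum_range_succ, h N le_rfl,
    zero_mul, zero_mul, add_zero]
  exact Finset.sum_congr rfl fun _ _ => mul_assoc _ _ _

theorem hasDerivAt_eval_pencil {P : ℝ → ℂ[X]} {P' : ℂ[X]} {N : ℕ}
    (hN : ∀ ε l, N ≤ l → (P ε).coeff l = 0)
    (hc : ∀ l, HasDerivAt (fun ε => (P ε).coeff l) (P'.coeff l) 0) {a : ℝ → ℂ} {a' : ℂ}
    (ha : HasDerivAt a a' 0) :
    HasDerivAt (fun ε => (P ε).eval (a ε)) (P'.eval (a 0) + (derivative (P 0)).eval (a 0) * a') 0 := by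
  have hN' : ∀ l, N ≤ l → P'.coeff l = 0 := fun l hl => by
    refine (hc l).unique ?_
    simp only [hN _ l hl]
    exact hasDerivAt_const _ _
  simp only [fun ε => eval_eq_sum_of_coeff (hN ε) (a ε)]
  rw [eval_eq_sum_of_coeff hN', derivative_eval_eq_sum_of_coeff (hN 0), Finset.sum_mul,
    ← Finset.sum_add_distrib]
  refine HasDerivAt.fun_sum fun l _ => ?_
  refine ((hc l).fun_mul (ha.fun_pow l)).congr_deriv ?_
  ring

theorem hasDerivAt_hasseDeriv_pencil {P : ℝ → ℂ[X]} {P' : ℂ[X]} {N : ℕ}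
    (hN : ∀ ε l, N ≤ l → (P ε).coeff l = 0)
    (hc : ∀ l, HasDerivAt (fun ε => (P ε).coeff l) (P'.coeff l) 0) {a : ℝ → ℂ} {a' : ℂ}
    (ha : HasDerivAt a a' 0) (k : ℕ) :
    HasDerivAt (fun ε => (hasseDeriv k (P ε)).eval (a ε))
      ((hasseDeriv k P').eval (a 0) + (derivative (hasseDeriv k (P 0))).eval (a 0) * a') 0 := by
  refine hasDerivAt_eval_pencil (P := fun ε => hasseDeriv k (P ε)) (N := N) (fun ε l hl => ?_)
    (fun l => ?_) ha
  · rw [hasseDeriv_coeff, hN ε _ (by omega), mul_zero]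
  · simp only [hasseDeriv_coeff]
    exact (hc _).const_mul _

section Deformation

variable {V : ℝ[X]} {j : ℕ} {μ v : BranchPoints g} {γ : ℝ → BranchPoints g}

theorem eventually_near_curve (hμ : StrictMono μ) (h0 : γ 0 = μ) (hγ : HasDerivAt γ v 0) :
    ∀ᶠ ε in 𝓝 (0 : ℝ), Near μ (1 + ∑ β, |μ β|) (γ ε) := by
  refine hγ.continuousAt.eventually ?_
  rw [h0]; exact eventually_near hμ (abs_lt_rad μ)

theorem hasDerivAt_ofReal_curve (hγ : HasDerivAt γ v 0) (α : Fin (2 * (g + 1))) :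
    HasDerivAt (fun ε => (γ ε α : ℂ)) (v α) 0 := (hasDerivAt_pi.1 hγ α).ofReal_comp

theorem hasDerivAt_comp_curve {f : BranchPoints g → ℂ} {D : BranchPoints g →L[ℝ] ℂ}
    (hf : HasFDerivAt f D μ) (h0 : γ 0 = μ) (hγ : HasDerivAt γ v 0) :
    HasDerivAt (fun ε => f (γ ε)) (D v) 0 := by
  rw [← h0] at hf
  exact hf.comp_hasDerivAt (0 : ℝ) hγ

/-- A regularized pencil, equal to `M` for nearby strictly increasing branch points. -/
def Mpencil (V : ℝ[X]) (j : ℕ) (μ : BranchPoints g) (γ : ℝ → BranchPoints g) (ε : ℝ) : ℂ[X] :=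
  polPart (1 + ∑ β, |μ β|) (fun z => (ytilde (γ ε) z)⁻¹) (dVpoly V) +
    C (ε : ℂ) * polPart (1 + ∑ β, |μ β|) (fun z => (ytilde (γ ε) z)⁻¹) (X ^ (j - 1))

theorem coeff_Mpencil (ε : ℝ) (l : ℕ) : (Mpencil V j μ γ ε).coeff l =
    res (1 + ∑ β, |μ β|) (fun z => (quo l (dVpoly V)).eval z * (ytilde (γ ε) z)⁻¹) +
      ε * res (1 + ∑ β, |μ β|) (fun z => (quo l (X ^ (j - 1))).eval z * (ytilde (γ ε) z)⁻¹) := by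
  rw [Mpencil, coeff_add, coeff_C_mul, coeff_polPart, coeff_polPart]

theorem Mpencil_eq (hj : 1 ≤ j) {ε : ℝ} (h : Near μ (1 + ∑ β, |μ β|) (γ ε)) :
    Mpencil V j μ γ ε = Mpoly (shift V j ε) (γ ε) :=
  Polynomial.ext fun l => by rw [coeff_Mpencil, coeff_Mpoly_shift hj ε h.mono h.lt]

theorem coeff_Mpencil_eq_zero (ε : ℝ) {l : ℕ} (hl : degBound V j ≤ l) :
    (Mpencil V j μ γ ε).coeff l = 0 := by
  obtain ⟨h1, h2⟩ := quo_eq_zero_of_degBound V j hl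
  rw [coeff_Mpencil, h1, h2, res_zero_mul]
  ring

theorem hasDerivAt_coeff_Mpencil (hμ : StrictMono μ) (h0 : γ 0 = μ) (hγ : HasDerivAt γ v 0) (l : ℕ) :
    HasDerivAt (fun ε => (Mpencil V j μ γ ε).coeff l)
      ((deltaM μ (dVpoly V) (X ^ (j - 1)) 1 v).coeff l) 0 := by
  obtain ⟨D, hD, hD'⟩ := hasStrictFDerivAt_res_pencil hμ (abs_lt_rad μ) (quo l (dVpoly V))
    (quo l (X ^ (j - 1)))
  have h1 : HasDerivAt (fun ε : ℝ => (ε, γ ε)) (1, v) 0 := (hasDerivAt_id 0).prodMk hγ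
  have h2 := hD.hasFDerivAt
  rw [← h0] at h2
  have h3 := h2.comp_hasDerivAt (0 : ℝ) h1
  rw [h0, hD', ofReal_one, ← coeff_deltaM hμ (abs_lt_rad μ)] at h3
  simp only [coeff_Mpencil]
  exact h3

theorem hasDerivAt_hasseDeriv_Mpoly (hj : 1 ≤ j) (hμ : StrictMono μ) (h0 : γ 0 = μ)
    (hγ : HasDerivAt γ v 0) (k : ℕ) {a : ℝ → ℂ} {a' : ℂ} (ha : HasDerivAt a a' 0) :
    HasDerivAt (fun ε => (hasseDeriv k (Mpoly (shift V j ε) (γ ε))).eval (a ε))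
      ((hasseDeriv k (deltaM μ (dVpoly V) (X ^ (j - 1)) 1 v)).eval (a 0) +
        (derivative (hasseDeriv k (Mpoly V μ))).eval (a 0) * a') 0 := by
  have hn := eventually_near_curve hμ h0 hγ
  have h := hasDerivAt_hasseDeriv_pencil (P := Mpencil V j μ γ)
    (fun ε l hl => coeff_Mpencil_eq_zero ε hl) (hasDerivAt_coeff_Mpencil hμ h0 hγ) ha k
  rw [Mpencil_eq hj hn.self_of_nhds, h0, shift_zero] at h
  refine h.congr_of_eventuallyEq ?_
  filter_upwards [hn] with ε hε
  rw [Mpencil_eq hj hε]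

theorem hasDerivAt_moment (hj : 1 ≤ j) (hμ : StrictMono μ) (h0 : γ 0 = μ)
    (hγ : HasDerivAt γ v 0) (α : Fin (2 * (g + 1))) (k : ℕ) :
    HasDerivAt (fun ε => moment (shift V j ε) (γ ε) α (k + 1))
      ((hasseDeriv k (deltaM μ (dVpoly V) (X ^ (j - 1)) 1 v)).eval (μ α : ℂ) +
        (derivative (hasseDeriv k (Mpoly V μ))).eval (μ α : ℂ) * v α) 0 := by
  have h := hasDerivAt_hasseDeriv_Mpoly (V := V) hj hμ h0 hγ k (hasDerivAt_ofReal_curve hγ α)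
  rw [h0] at h
  refine h.congr_of_eventuallyEq ?_
  filter_upwards [eventually_near_curve hμ h0 hγ] with ε hε
  rw [moment_eq hε.mono]

theorem hasDerivAt_ytilde_curve (hμ : StrictMono μ) (h0 : γ 0 = μ)
    (hγ : HasDerivAt γ v 0) {p : ℂ} (hp : p ∈ offCuts μ) :
    HasDerivAt (fun ε => ytilde (γ ε) p) (-(1 / 2) * ytilde μ p * logVar μ v p) 0 := by
  refine (hasDerivAt_comp_curve (hasLogFDerivAt_ytilde hμ hp) h0 hγ).congr_deriv ?_
  simp only [smul_apply, sum_apply, ContinuousLinearMap.comp_apply, ContinuousLinearMap.proj_apply,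
    ofRealCLM_apply, smul_eq_mul, logVar]
  rw [Finset.mul_sum, Finset.mul_sum]
  exact Finset.sum_congr rfl fun α _ => by ring

theorem hasDerivAt_W0 (hj : 1 ≤ j) (hμ : StrictMono μ) (h0 : γ 0 = μ)
    (hγ : HasDerivAt γ v 0) {p : ℂ} (hp : p ∈ offCuts μ) :
    HasDerivAt (fun ε => W0 (shift V j ε) (γ ε) p)
      (1 / 2 * (p ^ (j - 1) - (deltaY μ (dVpoly V) (X ^ (j - 1)) 1 v).eval p / ytilde μ p)) 0 := by
  have hn := eventually_near_curve hμ h0 hγ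
  have h1 := hasDerivAt_hasseDeriv_Mpoly (V := V) hj hμ h0 hγ 0 (hasDerivAt_const (0 : ℝ) p)
  have h2 := hasDerivAt_ytilde_curve hμ h0 hγ hp
  have h3 : HasDerivAt (fun ε : ℝ => (dVpoly V).eval p + (ε : ℂ) * p ^ (j - 1)) (p ^ (j - 1)) 0 := by
    simpa using ((hasDerivAt_id (0 : ℝ)).ofReal_comp.mul_const (p ^ (j - 1))).const_add
      ((dVpoly V).eval p)
  have h4 := (h3.fun_sub (h1.fun_mul h2)).div_const 2
  refine (h4.congr_of_eventuallyEq ?_).congr_deriv ?_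
  · filter_upwards [hn] with ε hε
    rw [W0, y, M_eq hε.mono, dV_eq, dVpoly_shift V hj, hasseDeriv_zero']
    simp
  · have hy0 := ytilde_ne_zero hμ hp
    simp only [hasseDeriv_zero', h0, shift_zero, mul_zero, add_zero]
    rw [deltaY, eval_sub, eval_mul, eval_mul, eval_C, eval_mul, varT_eval hμ v hp, ← ytilde_sq,
      show pol μ (dVpoly V) = Mpoly V μ from rfl]
    field_simp
    ring

theorem hasDerivAt_Q (hμ : StrictMono μ) (h0 : γ 0 = μ) (hγ : HasDerivAt γ v 0) (k i : Fin g) :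
    HasDerivAt (fun ε => Q (γ ε) k i)
      (aPeriod μ k fun z => z ^ i.val * (1 / 2 * (ytilde μ z)⁻¹ * logVar μ v z)) 0 := by
  obtain ⟨D, hD, hD'⟩ := hasStrictFDerivAt_rect hμ (-1) (encircles_points hμ k)
    (F := fun z => z ^ i.val) (continuous_pow _)
  have h := hasDerivAt_comp_curve hD.hasFDerivAt h0 hγ
  rw [hD'] at h
  refine (h.congr_of_eventuallyEq ?_).congr_deriv ?_
  · filter_upwards [eventually_near_curve hμ h0 hγ] with ε hε
    rw [Q_apply hε.mono, ← rect_eval_div_ytilde hε.mono (hε.encircles k)]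
    simp
  · unfold aPeriod
    norm_num

end Deformation

/-! ### The logarithmic variation of `det Q` -/

theorem hasDerivAt_det {n : Type*} [Fintype n] [DecidableEq n] {A : ℝ → Matrix n n ℂ}
    {A' : Matrix n n ℂ} {x : ℝ} (h : ∀ i k, HasDerivAt (fun ε => A ε i k) (A' i k) x)
    (hdet : (A x).det ≠ 0) :
    HasDerivAt (fun ε => (A ε).det) ((A x).det * ∑ k, ∑ i, A' k i * (A x)⁻¹ i k) x := by
  have h1 : HasDerivAt (fun ε => (A ε).det)
      (∑ i, ((A x).updateCol i fun k => A' k i).det) x := by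
    simp only [Matrix.det_apply]
    rw [Finset.sum_comm]
    refine HasDerivAt.fun_sum fun σ _ => ?_
    have := (HasDerivAt.fun_finsetProd (u := Finset.univ) fun i _ => h (σ i) i)
    have h2 := this.const_smul (Equiv.Perm.sign σ)
    refine h2.congr_deriv ?_
    rw [Finset.smul_sum]
    refine Finset.sum_congr rfl fun i _ => ?_
    congr 1
    rw [← Finset.mul_prod_erase Finset.univ _ (Finset.mem_univ i), Matrix.updateCol_self, smul_eq_mul,
      mul_comm]
    congr 1
    exact Finset.prod_congr rfl fun k hk => by rw [Matrix.updateCol_ne (Finset.ne_of_mem_erase hk)]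
  -- Cramer's rule expresses the determinants with one column replaced through the adjugate, giving
  -- Jacobi's formula.
  refine h1.congr_deriv ?_
  simp only [← Matrix.cramer_apply, Matrix.cramer_eq_adjugate_mulVec, Matrix.inv_def,
    Ring.inverse_eq_inv', Matrix.mulVec, dotProduct, Matrix.smul_apply, smul_eq_mul]
  rw [Finset.sum_comm, Finset.mul_sum]
  refine Finset.sum_congr rfl fun k _ => ?_
  rw [Finset.mul_sum]
  refine Finset.sum_congr rfl fun i _ => ?_
  field_simp

theorem differentiable_ker (μ : BranchPoints g) (p : ℂ) : Differentiable ℂ (ker μ p) := by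
  unfold ker
  fun_prop

/-- With `p` a branch point `a`, `T(a) = 0` and `ker / ytilde` is a multiple of `1 / ((z - a)
ytilde)` plus the derivative of `ytilde / (a - z)`, which integrates to zero around the contour. -/
theorem cutPoly_eval_branch {μ : BranchPoints g} (hμ : StrictMono μ) (k : Fin g)
    (β : Fin (2 * (g + 1))) :
    (cutPoly hμ k.castSucc).eval (μ β : ℂ) = -(1 / 2) * (derivative (T μ)).eval (μ β : ℂ) *
      aPeriod μ k fun z => (z - μ β)⁻¹ * (ytilde μ z)⁻¹ := by
  have h := encircles_points hμ k
  rw [cutPoly_eval, ← rect_div_ytilde hμ h (φ := ker μ (μ β : ℂ))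
    (differentiable_ker μ _).differentiableOn, aPeriod]
  set a : ℂ := (μ β : ℂ) with ha
  have hsub : ∀ z ∈ rectBoundary (leftPoint μ k) (rightPoint μ k), z - a ≠ 0 := fun z hz =>
    sub_ne_zero_of_mem_offCuts hμ (h.mem_offCuts hz) β
  let G' : ℂ → ℂ := fun z => (derivative (T μ)).eval z / (2 * ytilde μ z) * (a - z)⁻¹ +
    ytilde μ z * ((a - z) ^ 2)⁻¹
  have hG : ∀ z ∈ rectBoundary (leftPoint μ k) (rightPoint μ k),
      HasDerivAt (fun z => ytilde μ z * (a - z)⁻¹) (G' z) z := fun z hz => by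
    have h0 : a - z ≠ 0 := by rw [← neg_sub]; exact neg_ne_zero.2 (hsub z hz)
    have h1 : HasDerivAt (fun z => (a - z)⁻¹) ((a - z) ^ 2)⁻¹ z := by
      have := ((hasDerivAt_id z).const_sub a).fun_inv h0
      refine this.congr_deriv ?_
      simp [div_eq_mul_inv]
    exact (hasDerivAt_ytilde hμ (h.mem_offCuts hz)).fun_mul h1
  have hcy : ∀ z ∈ offCuts μ, ContinuousAt (ytilde μ) z := fun z hz =>
    (differentiableAt_ytilde hμ hz).continuousAt
  have hGc : ContinuousOn G' (rectBoundary (leftPoint μ k) (rightPoint μ k)) := by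
    refine continuousOn_rect h fun z hz => ?_
    have h0 : a - z ≠ 0 := by
      rw [← neg_sub]; exact neg_ne_zero.2 (sub_ne_zero_of_mem_offCuts hμ hz β)
    have := hcy z hz
    have h2 : 2 * ytilde μ z ≠ 0 := mul_ne_zero two_ne_zero (ytilde_ne_zero hμ hz)
    have h3 : (a - z) ^ 2 ≠ 0 := pow_ne_zero 2 h0
    have c1 : ContinuousAt (fun z => (derivative (T μ)).eval z / (2 * ytilde μ z)) z :=
      ((derivative (T μ)).continuous.continuousAt).div (by fun_prop) h2
    have c2 : ContinuousAt (fun z => (a - z)⁻¹) z :=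
      (by fun_prop : ContinuousAt (fun z => a - z) z).inv₀ h0
    have c3 : ContinuousAt (fun z => ((a - z) ^ 2)⁻¹) z :=
      (by fun_prop : ContinuousAt (fun z => (a - z) ^ 2) z).inv₀ h3
    exact (c1.mul c2).add (this.mul c3)
  have e : ∀ z ∈ rectBoundary (leftPoint μ k) (rightPoint μ k), ker μ a z * (ytilde μ z)⁻¹ =
      -(1 / 2) * (derivative (T μ)).eval a * ((z - a)⁻¹ * (ytilde μ z)⁻¹) + G' z := fun z hz => by
    have h0 := hsub z hz
    have h0' : a - z ≠ 0 := by rw [← neg_sub]; exact neg_ne_zero.2 h0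
    have hy0 := ytilde_ne_zero hμ (h.mem_offCuts hz)
    have hk := ker_mul μ a z
    rw [ha, eval_T_branch, ← ha, ← ytilde_sq] at hk
    have hk' : ker μ a z = (1 / 2 * (a - z) *
      ((derivative (T μ)).eval a + (derivative (T μ)).eval z) - (0 - ytilde μ z ^ 2)) /
        (a - z) ^ 2 := by rw [← hk]; field_simp
    rw [hk', show (z - a)⁻¹ = -(a - z)⁻¹ by rw [← inv_neg, neg_sub]]
    simp only [G']
    field_simp
    ring
  rw [rect_congr (h.le hμ) e, rect_add (h.le hμ) _ hGc, rect_const_mul, rect_deriv (h.le hμ) hG hGc,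
    add_zero]
  refine continuousOn_rect h fun z hz => ?_
  have h0 := sub_ne_zero_of_mem_offCuts hμ hz β
  exact continuousAt_const.mul (((by fun_prop : ContinuousAt (fun z => z - a) z).inv₀ h0).mul
    ((hcy z hz).inv₀ (ytilde_ne_zero hμ hz)))

/-- The variation of `log det Q` in the direction of the branch point `μ β` is half of this. -/
def qvar {μ : BranchPoints g} (hμ : StrictMono μ) (β : Fin (2 * (g + 1))) : ℂ :=
  -2 * (diagPoly hμ).eval (μ β : ℂ) / (derivative (T μ)).eval (μ β : ℂ)

theorem continuousAt_inv_sub_mul_inv {μ : BranchPoints g} (hμ : StrictMono μ)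
    (β : Fin (2 * (g + 1))) {z : ℂ} (hz : z ∈ offCuts μ) :
    ContinuousAt (fun z : ℂ => (z - μ β)⁻¹ * (ytilde μ z)⁻¹) z :=
  ((by fun_prop : ContinuousAt (fun z => z - (μ β : ℂ)) z).inv₀
    (sub_ne_zero_of_mem_offCuts hμ hz β)).mul
    ((differentiableAt_ytilde hμ hz).continuousAt.inv₀ (ytilde_ne_zero hμ hz))

theorem sum_aPeriod_mul_Q_inv {μ : BranchPoints g} (hμ : StrictMono μ) (β : Fin (2 * (g + 1))) :
    ∑ k, ∑ i : Fin g, aPeriod μ k (fun z => z ^ i.val * ((z - μ β)⁻¹ * (ytilde μ z)⁻¹)) *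
      (Q μ)⁻¹ i k = qvar hμ β := by
  have hT := derivative_T_eval_ne_zero hμ β
  -- Division of `z ^ i` by `z - μ β`: the remainder is the constant `(μ β) ^ i`, and the quotient
  -- contributes an ordinary period.
  have e1 : ∀ k i : Fin g, aPeriod μ k (fun z => z ^ i.val * ((z - μ β)⁻¹ * (ytilde μ z)⁻¹)) =
      (μ β : ℂ) ^ i.val * aPeriod μ k (fun z => (z - μ β)⁻¹ * (ytilde μ z)⁻¹) +
      per hμ k.castSucc (∑ m ∈ Finset.range i.val,
        C ((quo m (X ^ i.val)).eval (μ β : ℂ)) * X ^ m) := fun k i => by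
    have h := encircles_points hμ k
    rw [← aPeriod_eval_div hμ, aPeriod, aPeriod, aPeriod, ← rect_const_mul, ← rect_add (h.le hμ)]
    · refine rect_congr (h.le hμ) fun z hz => ?_
      have h0 := sub_ne_zero_of_mem_offCuts hμ (h.mem_offCuts hz) β
      have := congrArg (eval z) (sub_C_eval_eq_quo (μ β : ℂ) (natDegree_X_pow_le (R := ℂ) i.val))
      rw [eval_sub, eval_pow, eval_X, eval_C, eval_pow, eval_X, eval_mul, eval_sub, eval_X,
        eval_C] at this
      rw [show z ^ i.val = (μ β : ℂ) ^ i.val + (z ^ i.val - (μ β : ℂ) ^ i.val) by ring, this]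
      field_simp
    · exact continuousOn_rect h fun z hz =>
        continuousAt_const.mul (continuousAt_inv_sub_mul_inv hμ β hz)
    · exact continuousOn_rect h fun z hz => (Polynomial.continuous _).continuousAt.mul
        ((differentiableAt_ytilde hμ hz).continuousAt.inv₀ (ytilde_ne_zero hμ hz))
  -- The quotient has degree less than `i`, so it is its own projection and its coefficient of order
  -- `i` is zero. It drops out of the trace.
  have e2 : ∀ i : Fin g, ∑ k : Fin g, (Q μ)⁻¹ i k * per hμ k.castSucc (∑ m ∈ Finset.range i.val,
        C ((quo m (X ^ i.val)).eval (μ β : ℂ)) * X ^ m) = 0 := fun i => by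
    have hd : (∑ m ∈ Finset.range i.val, C ((quo m (X ^ i.val)).eval (μ β : ℂ)) * X ^ m : ℂ[X]).degree
        < i.val := by
      refine (degree_sum_le _ _).trans_lt ((Finset.sup_lt_iff (WithBot.bot_lt_coe _)).2 fun m hm => ?_)
      exact (degree_C_mul_X_pow_le _ _).trans_lt (by exact_mod_cast Finset.mem_range.1 hm)
    rw [← coeff_proj, proj_eq_self hμ (hd.trans (by exact_mod_cast i.2)), coeff_eq_zero_of_degree_lt hd]
  have e3 : ∀ k : Fin g, aPeriod μ k (fun z => (z - μ β)⁻¹ * (ytilde μ z)⁻¹) =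
      -2 / (derivative (T μ)).eval (μ β : ℂ) * (cutPoly hμ k.castSucc).eval (μ β : ℂ) := fun k => by
    rw [cutPoly_eval_branch]; field_simp
  rw [Finset.sum_comm]
  simp only [e1, add_mul, Finset.sum_add_distrib]
  simp only [mul_comm (per hμ _ _), e2, Finset.sum_const_zero, add_zero, e3]
  rw [qvar, diagPoly_eval, corrPoly, eval_finsetSum, Finset.sum_comm, Finset.mul_sum, Finset.sum_div]
  refine Finset.sum_congr rfl fun k _ => ?_
  rw [eval_mul, eval_C, Finset.sum_mul, Finset.mul_sum, Finset.sum_div]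
  exact Finset.sum_congr rfl fun i _ => by ring

theorem sum_varQ_mul_Q_inv {μ : BranchPoints g} (hμ : StrictMono μ) (v : BranchPoints g) :
    ∑ k, ∑ i : Fin g, aPeriod μ k (fun z => z ^ i.val * (1 / 2 * (ytilde μ z)⁻¹ * logVar μ v z)) *
      (Q μ)⁻¹ i k = 1 / 2 * ∑ β, v β * qvar hμ β := by
  have e : ∀ k i : Fin g, aPeriod μ k (fun z => z ^ i.val * (1 / 2 * (ytilde μ z)⁻¹ * logVar μ v z)) =
      1 / 2 * ∑ β, v β * aPeriod μ k (fun z => z ^ i.val * ((z - μ β)⁻¹ * (ytilde μ z)⁻¹)) :=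
    fun k i => by
    have h := encircles_points hμ k
    simp only [aPeriod, ← rect_const_mul]
    rw [← rect_sum (h.le hμ), ← rect_const_mul]
    · congr 1
      funext z
      rw [logVar, Finset.mul_sum, Finset.mul_sum, Finset.mul_sum]
      exact Finset.sum_congr rfl fun β _ => by ring
    · exact fun β _ => continuousOn_rect h fun z hz => continuousAt_const.mul
        ((continuous_pow _).continuousAt.mul (continuousAt_inv_sub_mul_inv hμ β hz))
  simp only [e, ← sum_aPeriod_mul_Q_inv hμ, Finset.mul_sum, Finset.sum_mul]
  rw [Finset.sum_comm]
  rw [(Finset.sum_congr rfl fun k _ => Finset.sum_comm :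
    (∑ i : Fin g, ∑ k : Fin g, ∑ β, _ : ℂ) = ∑ i : Fin g, ∑ β, ∑ k : Fin g, _)]
  rw [Finset.sum_comm]
  refine Finset.sum_congr rfl fun β _ => ?_
  rw [Finset.sum_comm]
  exact Finset.sum_congr rfl fun k _ => Finset.sum_congr rfl fun i _ => by ring

/-! ### The variation of `F1` -/

/-- `f` has logarithmic derivative `ℓ` at `x`. -/
def HasLogDerivAt (f : ℝ → ℂ) (ℓ : ℂ) (x : ℝ) : Prop := HasDerivAt f (f x * ℓ) x

theorem HasLogDerivAt.of_hasDerivAt {f : ℝ → ℂ} {f' : ℂ} {x : ℝ} (h : HasDerivAt f f' x)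
    (h0 : f x ≠ 0) : HasLogDerivAt f (f' / f x) x :=
  HasDerivAt.congr_deriv h (by field_simp)

theorem HasLogDerivAt.mul {f₁ f₂ : ℝ → ℂ} {ℓ₁ ℓ₂ : ℂ} {x : ℝ} (h₁ : HasLogDerivAt f₁ ℓ₁ x)
    (h₂ : HasLogDerivAt f₂ ℓ₂ x) : HasLogDerivAt (fun x => f₁ x * f₂ x) (ℓ₁ + ℓ₂) x :=
  (HasDerivAt.fun_mul h₁ h₂).congr_deriv (by ring)

theorem HasLogDerivAt.prod {ι : Type*} (s : Finset ι) {f : ι → ℝ → ℂ} {ℓ : ι → ℂ} {x : ℝ}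
    (h : ∀ i ∈ s, HasLogDerivAt (f i) (ℓ i) x) :
    HasLogDerivAt (fun x => ∏ i ∈ s, f i x) (∑ i ∈ s, ℓ i) x := by
  classical
  induction s using Finset.induction_on with
  | empty => simpa [HasLogDerivAt] using hasDerivAt_const x (1 : ℂ)
  | insert a s ha ih =>
    simp only [Finset.prod_insert ha, Finset.sum_insert ha]
    exact (h a (by simp)).mul (ih fun i hi => h i (by simp [hi]))

theorem HasLogDerivAt.pow {f : ℝ → ℂ} {ℓ : ℂ} {x : ℝ} (h : HasLogDerivAt f ℓ x) (n : ℕ) :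
    HasLogDerivAt (fun x => f x ^ n) (n * ℓ) x := by
  have := HasLogDerivAt.prod (Finset.range n) (f := fun _ => f) (ℓ := fun _ => ℓ) fun _ _ => h
  simpa using this

/-- A real-valued argument stays on one side of zero locally. On the negative axis, the branch cut
of the logarithm, `log f = log (-f) + πi` along the curve, so differentiability persists. -/
theorem HasLogDerivAt.log {f : ℝ → ℂ} {ℓ : ℂ} {x : ℝ} (h : HasLogDerivAt f ℓ x) (h0 : f x ≠ 0)
    (hr : ∀ᶠ t in 𝓝 x, ((f t).re : ℂ) = f t) : HasDerivAt (fun t => Complex.log (f t)) ℓ x := by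
  have hre := hr.self_of_nhds
  have hcont : ContinuousAt (fun t => (f t).re) x :=
    continuous_re.continuousAt.comp (HasDerivAt.continuousAt h)
  have hx : (f x).re ≠ 0 := fun h => h0 (by rw [← hre, h, ofReal_zero])
  rcases lt_or_gt_of_ne hx with hneg | hpos
  · have h1 : HasDerivAt (fun t => -f t) (-(f x * ℓ)) x := HasDerivAt.fun_neg h
    have h2 := (h1.clog_real (Or.inl (by simpa using hneg))).add_const (Real.pi * I)
    refine (h2.congr_of_eventuallyEq ?_).congr_deriv (by field_simp)
    filter_upwards [hr, hcont.eventually (gt_mem_nhds hneg)] with t ht1 ht2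
    have h3 : Complex.log ((f t).re : ℂ) = Complex.log (-((f t).re : ℂ)) + Real.pi * I := by
      rw [← ofReal_neg, ← ofReal_log (neg_nonneg.2 ht2.le), Real.log_neg_eq_log, Complex.log,
        norm_real, Real.norm_eq_abs, Real.log_abs, arg_ofReal_of_neg ht2]
    rwa [ht1] at h3
  · exact (HasDerivAt.clog_real h (Or.inl hpos)).congr_deriv (by field_simp)

theorem derivative_Tsub_eval (μ : BranchPoints g) (hμ : StrictMono μ) (α : Fin (2 * (g + 1))) :
    (derivative (Tsub μ α)).eval (μ α : ℂ) = (derivative (T μ)).eval (μ α : ℂ) *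
      ∑ β ∈ Finset.univ.erase α, ((μ α : ℂ) - μ β)⁻¹ := by
  rw [derivative_T_eval, Tsub, derivative_prod_finset, eval_finsetSum, Finset.mul_sum]
  refine Finset.sum_congr rfl fun β hβ => ?_
  have h0 : (μ α : ℂ) - μ β ≠ 0 := by
    rw [← ofReal_sub, ofReal_ne_zero, sub_ne_zero]
    exact fun h => (Finset.ne_of_mem_erase hβ) (hμ.injective h).symm
  rw [← Finset.mul_prod_erase _ _ hβ]
  simp only [derivative_sub, derivative_X, derivative_C, sub_zero, mul_one, eval_mul, eval_sub,
    eval_X, eval_C]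
  field_simp

theorem derivative_Tsub_eval_of_ne (μ : BranchPoints g) (hμ : StrictMono μ)
    {α β : Fin (2 * (g + 1))} (hne : β ≠ α) :
    (derivative (Tsub μ β)).eval (μ α : ℂ) =
      (derivative (T μ)).eval (μ α : ℂ) * ((μ α : ℂ) - μ β)⁻¹ := by
  have h0 : (μ α : ℂ) - μ β ≠ 0 := by
    rw [← ofReal_sub, ofReal_ne_zero, sub_ne_zero]
    exact fun h => hne (hμ.injective h).symm
  rw [← mul_Tsub μ β, derivative_mul]
  simp only [derivative_sub, derivative_X, derivative_C, sub_zero, one_mul, eval_mul, eval_sub,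
    eval_X, eval_C, eval_add, Tsub_eval_of_ne μ hne, zero_add]
  field_simp

theorem derivative_two_T_eval (μ : BranchPoints g) (hμ : StrictMono μ) (α : Fin (2 * (g + 1))) :
    (derivative (derivative (T μ))).eval (μ α : ℂ) = 2 * ((derivative (T μ)).eval (μ α : ℂ) *
      ∑ β ∈ Finset.univ.erase α, ((μ α : ℂ) - μ β)⁻¹) := by
  rw [← derivative_Tsub_eval μ hμ, ← mul_Tsub μ α]
  simp
  ring

theorem derivative_varT_eval (μ : BranchPoints g) (hμ : StrictMono μ) (v : BranchPoints g)
    (α : Fin (2 * (g + 1))) :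
    (derivative (varT μ v)).eval (μ α : ℂ) = (derivative (T μ)).eval (μ α : ℂ) *
      (v α * ∑ β ∈ Finset.univ.erase α, ((μ α : ℂ) - μ β)⁻¹ +
        ∑ β ∈ Finset.univ.erase α, v β * ((μ α : ℂ) - μ β)⁻¹) := by
  rw [varT, derivative_sum, eval_finsetSum, ← Finset.add_sum_erase _ _ (Finset.mem_univ α)]
  simp only [derivative_C_mul, eval_mul, eval_C]
  rw [derivative_Tsub_eval μ hμ, mul_add ((derivative (T μ)).eval (μ α : ℂ))]
  congr 1
  · ring
  · rw [Finset.mul_sum]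
    refine Finset.sum_congr rfl fun β hβ => ?_
    rw [derivative_Tsub_eval_of_ne μ hμ (Finset.ne_of_mem_erase hβ)]
    ring

/-- Each unordered pair occurs twice in the product of the derivatives `T'(μ_α)`, so their squares
multiply to the fourth power of the Vandermonde product. -/
theorem vdm_pow_four (μ : BranchPoints g) : vdm μ ^ 4 = ∏ α, (Tsub μ α).eval (μ α : ℂ) ^ 2 := by
  have h := Finset.prod_prod_Ioi_mul_eq_prod_prod_off_diag
    (fun α β : Fin (2 * (g + 1)) => ((μ α : ℂ) - μ β) ^ 2)
  have e : ∏ α, (Tsub μ α).eval (μ α : ℂ) ^ 2 =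
      ∏ α, ∏ β ∈ ({α}ᶜ : Finset (Fin (2 * (g + 1)))), ((μ β : ℂ) - μ α) ^ 2 := by
    refine Finset.prod_congr rfl fun α _ => ?_
    rw [Tsub, eval_prod, ← Finset.prod_pow, Finset.compl_singleton]
    refine Finset.prod_congr rfl fun β _ => ?_
    simp only [eval_sub, eval_X, eval_C]
    ring
  rw [e, ← h, vdm, ← Finset.prod_pow]
  refine Finset.prod_congr rfl fun α _ => ?_
  rw [← Finset.prod_pow]
  exact Finset.prod_congr rfl fun β _ => by ring

theorem logArg_eq {V : ℝ[X]} {μ : BranchPoints g} (hμ : StrictMono μ) :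
    logArg V μ = (∏ α, (Mpoly V μ).eval (μ α : ℂ)) * (∏ α, (Tsub μ α).eval (μ α : ℂ) ^ 2) *
      (Q μ).det ^ 12 := by
  rw [logArg, vdm_pow_four]
  simp only [M_eq hμ]

theorem Tsub_eval_self (μ : BranchPoints g) (α : Fin (2 * (g + 1))) :
    (Tsub μ α).eval (μ α : ℂ) = ∏ β ∈ Finset.univ.erase α, ((μ α : ℂ) - μ β) := by
  simp [Tsub, eval_prod]

theorem logArg_eq_ofReal {V : ℝ[X]} {μ : BranchPoints g} (hμ : StrictMono μ) :
    logArg V μ = (((∏ α, ((Mpoly V μ).eval (μ α : ℂ)).re) *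
      (∏ α, (∏ β ∈ Finset.univ.erase α, (μ α - μ β)) ^ 2) * (realQ μ).det ^ 12 : ℝ) : ℂ) := by
  rw [logArg_eq hμ, det_Q_pow hμ]
  simp only [Tsub_eval_self]
  push_cast
  congr 2
  exact Finset.prod_congr rfl fun α _ => ((isRealPoly_Mpoly hμ V).eval_ofReal _).symm

theorem logArg_ne_zero {V : ℝ[X]} {μ : BranchPoints g} (hμ : StrictMono μ) (hreg : IsRegular V μ) :
    logArg V μ ≠ 0 := by
  rw [logArg_eq hμ]
  refine mul_ne_zero (mul_ne_zero ?_ ?_) (pow_ne_zero _ (det_Q_ne_zero hμ))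
  · exact Finset.prod_ne_zero_iff.2 fun α _ => by rw [← M_eq hμ]; exact hreg α
  · exact Finset.prod_ne_zero_iff.2 fun α _ => pow_ne_zero _ (by
      rw [← derivative_T_eval]; exact derivative_T_eval_ne_zero hμ α)

/-- The coefficients of the loop mean at the branch points. -/
def cF (V : ℝ[X]) (μ : BranchPoints g) (α : Fin (2 * (g + 1))) : ℂ :=
  -(1 / 24) / ((Mpoly V μ).eval (μ α : ℂ) * (derivative (T μ)).eval (μ α : ℂ))

/-- The ratio of the simple to the double pole of the loop mean at the branch points. -/
def sF (V : ℝ[X]) {μ : BranchPoints g} (hμ : StrictMono μ) (α : Fin (2 * (g + 1))) : ℂ :=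
  3 * (derivative (Mpoly V μ)).eval (μ α : ℂ) / (Mpoly V μ).eval (μ α : ℂ) +
    4 * (derivative (derivative (T μ))).eval (μ α : ℂ) / (derivative (T μ)).eval (μ α : ℂ) +
    12 * qvar hμ α

/-- The sum of the inverse distances of a branch point to the other ones. -/
def invDist (μ : BranchPoints g) (α : Fin (2 * (g + 1))) : ℂ :=
  ∑ β ∈ Finset.univ.erase α, ((μ α : ℂ) - μ β)⁻¹

theorem sum_erase_mul_inv (μ v : BranchPoints g) :
    ∑ α, ∑ β ∈ Finset.univ.erase α, (v β : ℂ) * ((μ α : ℂ) - μ β)⁻¹ =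
      -∑ α, v α * invDist μ α := by
  simp only [invDist, Finset.mul_sum]
  rw [Finset.sum_comm' (t' := Finset.univ) (s' := fun β => Finset.univ.erase β)
    (by intro x y; simp [eq_comm]), ← Finset.sum_neg_distrib]
  refine Finset.sum_congr rfl fun β _ => ?_
  rw [← Finset.sum_neg_distrib]
  refine Finset.sum_congr rfl fun α _ => ?_
  rw [← neg_sub (μ β : ℂ), inv_neg, mul_neg]

theorem sum_ratio (μ v : BranchPoints g) :
    ∑ α, ∑ β ∈ Finset.univ.erase α, ((v α : ℂ) - v β) / ((μ α : ℂ) - μ β) =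
      2 * ∑ α, v α * invDist μ α := by
  have e : ∀ α, ∑ β ∈ Finset.univ.erase α, ((v α : ℂ) - v β) / ((μ α : ℂ) - μ β) =
      v α * invDist μ α - ∑ β ∈ Finset.univ.erase α, (v β : ℂ) * ((μ α : ℂ) - μ β)⁻¹ := fun α => by
    rw [invDist, Finset.mul_sum, ← Finset.sum_sub_distrib]
    exact Finset.sum_congr rfl fun β _ => by ring
  simp only [e, Finset.sum_sub_distrib, sum_erase_mul_inv]
  ring

/-- The variation of `F1` in terms of the variations of `μ α` and `M (μ α)`. -/
theorem hasDerivAt_F1 {V : ℝ[X]} {j : ℕ} {μ v : BranchPoints g} {γ : ℝ → BranchPoints g}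
    (hj : 1 ≤ j) (hμ : StrictMono μ) (hreg : IsRegular V μ) (h0 : γ 0 = μ)
    (hγ : HasDerivAt γ v 0) :
    HasDerivAt (fun ε => F1 (shift V j ε) (γ ε))
      ((∑ α, -(1 / 24) * (4 * invDist μ α + 6 * qvar hμ α) * v α) +
        ∑ α, -(1 / 24) / (Mpoly V μ).eval (μ α : ℂ) *
          ((deltaM μ (dVpoly V) (X ^ (j - 1)) 1 v).eval (μ α : ℂ) +
            (derivative (Mpoly V μ)).eval (μ α : ℂ) * v α)) 0 := by
  have hn := eventually_near_curve hμ h0 hγ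
  set δM := deltaM μ (dVpoly V) (X ^ (j - 1)) 1 v with hδM
  have hM0 : ∀ α, (Mpoly V μ).eval (μ α : ℂ) ≠ 0 := fun α => by rw [← M_eq hμ]; exact hreg α
  have hT0 := derivative_T_eval_ne_zero hμ
  have l1 : ∀ α, HasLogDerivAt (fun ε => (Mpoly (shift V j ε) (γ ε)).eval (γ ε α : ℂ))
      ((δM.eval (μ α : ℂ) + (derivative (Mpoly V μ)).eval (μ α : ℂ) * v α) /
        (Mpoly V μ).eval (μ α : ℂ)) 0 := fun α => by
    have h1 := hasDerivAt_hasseDeriv_Mpoly (V := V) hj hμ h0 hγ 0 (hasDerivAt_ofReal_curve hγ α)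
    simp only [hasseDeriv_zero', h0] at h1
    have h2 := HasLogDerivAt.of_hasDerivAt h1 (by rw [h0, shift_zero]; exact hM0 α)
    simp only [h0, shift_zero] at h2
    exact h2
  have l2 : ∀ α, HasLogDerivAt (fun ε => (Tsub (γ ε) α).eval (γ ε α : ℂ))
      (∑ β ∈ Finset.univ.erase α, (v α - v β) / ((μ α : ℂ) - μ β)) 0 := fun α => by
    simp only [Tsub_eval_self]
    refine HasLogDerivAt.prod _ fun β hβ => ?_
    have h1 := (hasDerivAt_ofReal_curve hγ α).fun_sub (hasDerivAt_ofReal_curve hγ β)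
    have h2 := HasLogDerivAt.of_hasDerivAt h1 (by
      rw [h0, ← ofReal_sub, ofReal_ne_zero, sub_ne_zero]
      exact fun h => (Finset.ne_of_mem_erase hβ) (hμ.injective h).symm)
    simp only [h0] at h2
    exact h2
  have l3 : HasLogDerivAt (fun ε => (Q (γ ε)).det) (1 / 2 * ∑ β, v β * qvar hμ β) 0 := by
    have := hasDerivAt_det (A := fun ε => Q (γ ε)) (fun k i => hasDerivAt_Q hμ h0 hγ k i)
      (by rw [h0]; exact det_Q_ne_zero hμ)
    simp only [h0] at this
    rw [sum_varQ_mul_Q_inv hμ] at this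
    unfold HasLogDerivAt
    simp only [h0]
    exact this
  have l4 := ((HasLogDerivAt.prod Finset.univ fun α _ => l1 α).mul
    (HasLogDerivAt.prod Finset.univ fun α _ => (l2 α).pow 2)).mul (l3.pow 12)
  have hC : ∀ᶠ ε in 𝓝 (0 : ℝ), logArg (shift V j ε) (γ ε) =
      (∏ α, (Mpoly (shift V j ε) (γ ε)).eval (γ ε α : ℂ)) *
        (∏ α, (Tsub (γ ε) α).eval (γ ε α : ℂ) ^ 2) * (Q (γ ε)).det ^ 12 :=
    hn.mono fun ε hε => logArg_eq hε.mono
  have l5 := (l4.log (by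
      rw [← hC.self_of_nhds, h0, shift_zero]
      exact logArg_ne_zero hμ hreg) (by
      filter_upwards [hn] with ε hε
      rw [← logArg_eq hε.mono, logArg_eq_ofReal hε.mono, ofReal_re])).congr_of_eventuallyEq
    (hC.mono fun ε hε => congrArg Complex.log hε)
  refine (l5.const_mul (-(1 / 24 : ℂ))).congr_deriv ?_
  rw [← Finset.mul_sum, sum_ratio]
  push_cast
  rw [mul_add, mul_add, add_comm, ← add_assoc]
  simp only [Finset.mul_sum]
  rw [← Finset.sum_add_distrib, ← Finset.sum_add_distrib, ← Finset.sum_add_distrib]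
  exact Finset.sum_congr rfl fun α _ => by ring

/-- The variation of `F1` in terms of the variation of `y`. -/
theorem F1_variation_eq {V : ℝ[X]} {μ : BranchPoints g} (hμ : StrictMono μ) (hreg : IsRegular V μ)
    (B : ℂ[X]) (s : ℂ) (v : BranchPoints g) :
    (∑ α, -(1 / 24) * (4 * invDist μ α + 6 * qvar hμ α) * v α) +
        ∑ α, -(1 / 24) / (Mpoly V μ).eval (μ α : ℂ) *
          ((deltaM μ (dVpoly V) B s v).eval (μ α : ℂ) +
            (derivative (Mpoly V μ)).eval (μ α : ℂ) * v α) =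
      ∑ α, cF V μ α * ((derivative (deltaY μ (dVpoly V) B s v)).eval (μ α : ℂ) -
        sF V hμ α * (deltaY μ (dVpoly V) B s v).eval (μ α : ℂ)) := by
  have hT0 := derivative_T_eval_ne_zero hμ
  have hM0 : ∀ α, (Mpoly V μ).eval (μ α : ℂ) ≠ 0 := fun α => by rw [← M_eq hμ]; exact hreg α
  set τ : Fin (2 * (g + 1)) → ℂ := fun α => ∑ β ∈ Finset.univ.erase α, v β * ((μ α : ℂ) - μ β)⁻¹
    with hτ
  set δM := deltaM μ (dVpoly V) B s v with hδM
  set h := deltaY μ (dVpoly V) B s v with hh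
  -- The velocity is recovered from the value of `h` at the branch point.
  have hv : ∀ α, (v α : ℂ) = -2 * h.eval (μ α : ℂ) /
      ((Mpoly V μ).eval (μ α : ℂ) * (derivative (T μ)).eval (μ α : ℂ)) := fun α => by
    rw [hh, deltaY_eval_branch]
    have := hM0 α
    have := hT0 α
    field_simp
  -- The first derivative of `deltaY` at a branch point gives the variation of `M` there, up to
  -- terms in the velocities.
  have hδ : ∀ α, δM.eval (μ α : ℂ) = (derivative h).eval (μ α : ℂ) /
      (derivative (T μ)).eval (μ α : ℂ) + 1 / 2 * (derivative (Mpoly V μ)).eval (μ α : ℂ) * v α +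
      1 / 2 * (Mpoly V μ).eval (μ α : ℂ) * (v α * invDist μ α + τ α) := fun α => by
    have := hT0 α
    rw [hh, deltaY, ← hδM, show pol μ (dVpoly V) = Mpoly V μ from rfl, derivative_sub,
      derivative_mul, derivative_C_mul, derivative_mul]
    simp only [eval_sub, eval_add, eval_mul, eval_C, eval_T_branch, varT_eval_branch,
      derivative_varT_eval μ hμ]
    rw [show (∑ β ∈ Finset.univ.erase α, ((μ α : ℂ) - μ β)⁻¹) = invDist μ α from rfl,
      show (∑ β ∈ Finset.univ.erase α, (v β : ℂ) * ((μ α : ℂ) - μ β)⁻¹) = τ α from rfl]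
    field_simp
    ring
  -- The two sides agree summand by summand only up to `(v α * invDist μ α + τ α) / 48`. The
  -- antisymmetry of `1 / (μ_α - μ_β)` makes these terms cancel in the sum.
  have hstau : ∑ α, τ α = -∑ α, v α * invDist μ α := sum_erase_mul_inv μ v
  have e2 : ∀ α, cF V μ α * ((derivative h).eval (μ α : ℂ) - sF V hμ α * h.eval (μ α : ℂ)) =
      -(1 / 24) * (4 * invDist μ α + 6 * qvar hμ α) * v α + -(1 / 24) / (Mpoly V μ).eval (μ α : ℂ) *
          (δM.eval (μ α : ℂ) + (derivative (Mpoly V μ)).eval (μ α : ℂ) * v α) +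
        1 / 48 * (v α * invDist μ α + τ α) := fun α => by
    have := hT0 α
    have := hM0 α
    rw [hδ, cF, sF, derivative_two_T_eval μ hμ, show (∑ β ∈ Finset.univ.erase α,
      ((μ α : ℂ) - μ β)⁻¹) = invDist μ α from rfl, hv α]
    field_simp
    ring
  simp only [e2, Finset.sum_add_distrib, ← Finset.mul_sum, hstau]
  ring

/-! ### Sign of the argument of the logarithm -/

theorem cutSqrt_of_mem_Ioo {a b x : ℝ} (hx : x ∈ Set.Ioo a b) :
    ∃ s : ℝ, 0 < s ∧ cutSqrt a b x = I * s := by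
  have h1 : 0 < x - a := sub_pos.2 hx.1
  have h2 : x - b < 0 := sub_neg.2 hx.2
  have h3 : (x - b) / (x - a) < 0 := div_neg_of_neg_of_pos h2 h1
  refine ⟨(x - a) * (-((x - b) / (x - a))) ^ (1 / 2 : ℝ),
    mul_pos h1 (Real.rpow_pos_of_pos (neg_pos.2 h3) _), ?_⟩
  have e1 : ((x : ℂ) - b) / (x - a) = (((x - b) / (x - a) : ℝ) : ℂ) := by push_cast; rfl
  rw [cutSqrt, e1, ofReal_cpow_of_nonpos h3.le, show (Real.pi : ℂ) * I * (1 / 2) = Real.pi / 2 * I by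
    ring, exp_pi_div_two_mul_I, ← ofReal_neg, show (1 / 2 : ℂ) = ((1 / 2 : ℝ) : ℂ) by push_cast; rfl,
    ← ofReal_cpow (neg_pos.2 h3).le]
  push_cast
  ring

theorem coSqrt_real {μ : BranchPoints g} (hμ : StrictMono μ) (k : Fin (g + 1)) {x : ℝ}
    (hx : x ∈ Set.Icc (lo μ k) (hi μ k)) : ((coSqrt μ k x).re : ℂ) = coSqrt μ k x := by
  rw [← conj_eq_iff_re, ← coSqrt_conj hμ (coOff_of_mem hμ hx), conj_ofReal]

/-- Inside the cut the density is a positive function times `M * coSqrt`, so this product is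
nonnegative, also at the ends by continuity. There it is nonzero, and `coSqrt`, having no zero on
the cut, has the same sign at both ends; hence so has `M`. -/
theorem Mpoly_lo_mul_hi_pos {V : ℝ[X]} {μ : BranchPoints g} (hμ : StrictMono μ)
    (hreg : IsRegular V μ) (k : Fin (g + 1)) (hρ : ∀ s ∈ support μ, 0 ≤ density V μ s) :
    0 < ((Mpoly V μ).eval (lo μ k : ℂ)).re * ((Mpoly V μ).eval (hi μ k : ℂ)).re := by
  have hlt := lo_le_hi hμ k
  set F : ℝ → ℝ := fun x => ((Mpoly V μ).eval (x : ℂ)).re with hF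
  set E : ℝ → ℝ := fun x => (coSqrt μ k x).re with hE
  have hFr := fun x : ℝ => (isRealPoly_Mpoly hμ V).eval_ofReal x
  have hFc : Continuous F := by
    have : Continuous fun x : ℝ => (Mpoly V μ).eval (x : ℂ) :=
      (Mpoly V μ).continuous.comp continuous_ofReal
    exact continuous_re.comp this
  have hEc : ContinuousOn E (Set.Icc (lo μ k) (hi μ k)) := fun x hx => by
    have h1 : ContinuousAt (fun x : ℝ => coSqrt μ k x) x :=
      ContinuousAt.comp (f := fun x : ℝ => (x : ℂ))
        (differentiableAt_coSqrt hμ (coOff_of_mem hμ hx)).continuousAt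
        continuous_ofReal.continuousAt
    exact (continuous_re.continuousAt.comp h1).continuousWithinAt
  have hE0 : ∀ x ∈ Set.Icc (lo μ k) (hi μ k), E x ≠ 0 := fun x hx h0 => by
    refine coSqrt_ne_zero hμ (coOff_of_mem hμ hx) ?_
    rw [← coSqrt_real hμ k hx]
    exact_mod_cast h0
  have hFE : ∀ x ∈ Set.Ioo (lo μ k) (hi μ k), F x * E x ∈ Set.Ici (0 : ℝ) := fun x hx => by
    obtain ⟨s, hs, hcut⟩ := cutSqrt_of_mem_Ioo hx
    have h1 := hρ x (Set.mem_iUnion.2 ⟨k, Set.Ioo_subset_Icc_self hx⟩)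
    have h2 : y V μ x = ((F x * E x * s : ℝ) : ℂ) * I := by
      rw [y, M_eq hμ, ytilde_eq_mul_coSqrt μ k, hcut, ← hFr, ← coSqrt_real hμ k
        (Set.Ioo_subset_Icc_self hx)]
      push_cast
      ring
    rw [density, h2, im_ofReal_mul, I_im, mul_one] at h1
    have h3 : 0 ≤ F x * E x * s := by
      by_contra hneg
      exact absurd h1 (not_le.2 (div_neg_of_neg_of_pos (not_le.1 hneg) Real.two_pi_pos))
    exact nonneg_of_mul_nonneg_left h3 hs
  have hcl : ∀ x ∈ Set.Icc (lo μ k) (hi μ k), 0 ≤ F x * E x := by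
    have h1 : Set.MapsTo (fun x => F x * E x) (Set.Ioo (lo μ k) (hi μ k)) (Set.Ici 0) := hFE
    have h2 := h1.closure_of_continuousOn (by
      rw [closure_Ioo hlt.ne]; exact hFc.continuousOn.mul hEc)
    rw [closure_Ioo hlt.ne, closure_Ici] at h2
    exact h2
  have hl : lo μ k ∈ Set.Icc (lo μ k) (hi μ k) := Set.left_mem_Icc.2 hlt.le
  have hr : hi μ k ∈ Set.Icc (lo μ k) (hi μ k) := Set.right_mem_Icc.2 hlt.le
  have hEE : 0 < E (lo μ k) * E (hi μ k) := by
    by_contra hneg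
    have h0 : (0 : ℝ) ∈ Set.uIcc (E (lo μ k)) (E (hi μ k)) := by
      rw [Set.mem_uIcc]
      rcases mul_nonpos_iff.1 (not_lt.1 hneg) with h | h
      · exact Or.inr ⟨h.2, h.1⟩
      · exact Or.inl ⟨h.1, h.2⟩
    have h1 := intermediate_value_uIcc (by rwa [Set.uIcc_of_le hlt.le]) h0
    rw [Set.uIcc_of_le hlt.le] at h1
    obtain ⟨x, hx, hx0⟩ := h1
    exact hE0 x hx hx0
  have hM0 : ∀ α, F (μ α) ≠ 0 := fun α h => hreg α (by
    rw [M_eq hμ, ← hFr]; exact_mod_cast h)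
  have h1 : 0 < F (lo μ k) * E (lo μ k) :=
    (hcl _ hl).lt_of_ne' (mul_ne_zero (hM0 _) (hE0 _ hl))
  have h2 : 0 < F (hi μ k) * E (hi μ k) :=
    (hcl _ hr).lt_of_ne' (mul_ne_zero (hM0 _) (hE0 _ hr))
  have h3 : 0 < (F (lo μ k) * F (hi μ k)) * (E (lo μ k) * E (hi μ k)) := by
    have := mul_pos h1 h2
    linarith [this, (by ring : (F (lo μ k) * E (lo μ k)) * (F (hi μ k) * E (hi μ k)) =
      (F (lo μ k) * F (hi μ k)) * (E (lo μ k) * E (hi μ k)))]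
  exact pos_of_mul_pos_left h3 hEE.le

theorem exists_logArg {V : ℝ[X]} {μ : BranchPoints g} (hμ : StrictMono μ) (hreg : IsRegular V μ) :
    ∃ x : ℝ, logArg V μ = (x : ℂ) ∧ x ≠ 0 ∧ ((∀ s ∈ support μ, 0 ≤ density V μ s) → 0 < x) := by
  refine ⟨_, logArg_eq_ofReal hμ, fun h => logArg_ne_zero hμ hreg ?_, fun hρ => ?_⟩
  · rw [logArg_eq_ofReal hμ, h, ofReal_zero]
  · refine mul_pos (mul_pos ?_ ?_) ?_
    · rw [prod_branchPoints]
      exact Finset.prod_pos fun k _ => Mpoly_lo_mul_hi_pos hμ hreg k hρ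
    · refine Finset.prod_pos fun α _ => ?_
      have : (∏ β ∈ Finset.univ.erase α, (μ α - μ β)) ≠ 0 := Finset.prod_ne_zero_iff.2 fun β hβ =>
        sub_ne_zero.2 fun h => (Finset.ne_of_mem_erase hβ) (hμ.injective h).symm
      positivity
    · have := det_realQ_ne_zero hμ
      positivity

/-! ### The mean attached to a symbol -/

theorem ext_of_differentiableOn {μ : BranchPoints g} {ρ : ℝ} (hρ : ∀ α, |μ α| ≤ ρ) {f : ℂ → ℂ}
    (h : DifferentiableOn ℂ f (offCuts μ)) : Ext ρ f :=
  h.mono fun _ hz => mem_offCuts_of_norm fun α => (hρ α).trans_lt hz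

/-- The loop insertion of the functional `h ↦ res (h lam)` of the variation `h`. -/
def meanOf (μ : BranchPoints g) (lam : ℂ → ℂ) : ℂ → ℂ :=
  deriv fun z => ytilde μ z * lamCorr μ (momentVec g (1 + ∑ β, |μ β|) lam) lam z

section Mean

variable {μ : BranchPoints g} {lam : ℂ → ℂ}

theorem hasSum_meanOf (hμ : StrictMono μ) (hl : DifferentiableOn ℂ lam (offCuts μ))
    (hg : Gro (-1) lam) {p : ℂ} (hp : ∀ α, |μ α| < ‖p‖) :
    HasSum (fun j : ℕ => -((j : ℂ) / p ^ (j + 1) *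
      res (1 + ∑ β, |μ β|) fun z => (hpoly hμ (j - 1)).eval z * lam z)) (meanOf μ lam p) := by
  obtain ⟨ρ, h0, h1, h2⟩ := exists_inner_radius (r := min ‖p‖ (1 + ∑ β, |μ β|))
    fun α => lt_min (hp α) (abs_lt_rad μ α)
  obtain ⟨r, hr, hrp⟩ := exists_between (h2.trans_le (min_le_left _ _))
  have hR := h2.trans_le (min_le_right _ _)
  have he := ext_of_differentiableOn h1 hl
  have h := hasSum_res_hpoly hμ h0 h1 hr he hg hrp
  have e1 : momentVec g r lam = momentVec g (1 + ∑ β, |μ β|) lam := funext fun i =>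
    res_eq_of_ext ((ext_of_differentiable (by fun_prop)).mul he) h0 hr hR
  rw [e1] at h
  refine h.congr_fun fun j => ?_
  rw [res_eq_of_ext ((ext_eval ρ (hpoly hμ (j - 1))).mul he) h0 hr hR]

theorem differentiableOn_lamCorr (hμ : StrictMono μ) (hl : DifferentiableOn ℂ lam (offCuts μ))
    (c : Fin g → ℂ) : DifferentiableOn ℂ (fun z => ytilde μ z * lamCorr μ c lam z) (offCuts μ) :=
  fun z hz => (differentiableAt_ytilde hμ hz).differentiableWithinAt.mul
    ((hl z hz).sub (differentiableAt_corr hμ c hz).differentiableWithinAt)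

theorem differentiableOn_meanOf (hμ : StrictMono μ) (hl : DifferentiableOn ℂ lam (offCuts μ)) :
    DifferentiableOn ℂ (meanOf μ lam) (offCuts μ) :=
  (differentiableOn_lamCorr hμ hl _).deriv (isOpen_offCuts μ)

theorem gro_meanOf (hμ : StrictMono μ) (hl : DifferentiableOn ℂ lam (offCuts μ))
    (hg : Gro (-1) lam) : Gro (-2) (meanOf μ lam) := by
  obtain ⟨ρ, h0, h1, h2⟩ := exists_inner_radius (abs_lt_rad μ)
  obtain ⟨c, hc⟩ := exists_gro_ytilde_mul_lamCorr hμ h0 h1 h2 (ext_of_differentiableOn h1 hl) hg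
  have he := (ext_of_differentiableOn h1 (differentiableOn_lamCorr hμ hl
    (momentVec g (1 + ∑ β, |μ β|) lam))).sub (ext_of_differentiable (differentiable_const c))
  refine (Gro.deriv he hc).congr 0 fun z _ => ?_
  rw [deriv_sub_const_fun, meanOf]

theorem hasDerivAt_div_T_pow (hμ : StrictMono μ) (U : ℂ[X]) (m : ℕ) {p : ℂ} (hp : p ∈ offCuts μ) :
    HasDerivAt (fun z => U.eval z / (T μ).eval z ^ m)
      (((derivative U).eval p * (T μ).eval p - m * (U.eval p * (derivative (T μ)).eval p)) /
        (T μ).eval p ^ (m + 1)) p := by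
  have h0 := eval_T_ne_zero hμ hp
  refine ((U.hasDerivAt p).fun_div (((T μ).hasDerivAt p).fun_pow m) (pow_ne_zero m h0)).congr_deriv ?_
  rcases m with _ | m
  · simp
    field_simp
  · rw [Nat.add_sub_cancel]
    field_simp
    ring

/-- Since `ytilde * ytilde' = T' / 2`, multiplication by `ytilde` makes the mean of a rational
symbol rational, and `corr` contributes only the polynomial `corrPoly`. The factor `1/2 - m` governs
the leading poles at the branch points. -/
theorem ytilde_mul_meanOf (hμ : StrictMono μ) {U : ℂ[X]} {m : ℕ}
    (h : ∀ z ∈ offCuts μ, lam z = U.eval z / (T μ).eval z ^ m) {p : ℂ} (hp : p ∈ offCuts μ) :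
    ytilde μ p * meanOf μ lam p =
      ((derivative U).eval p * (T μ).eval p + (1 / 2 - m) * (U.eval p * (derivative (T μ)).eval p)) /
        (T μ).eval p ^ m - (corrPoly hμ (momentVec g (1 + ∑ β, |μ β|) lam)).eval p := by
  set c := momentVec g (1 + ∑ β, |μ β|) lam with hc
  have h0 := eval_T_ne_zero hμ hp
  have hy0 := ytilde_ne_zero hμ hp
  have h1 : HasDerivAt lam _ p := (hasDerivAt_div_T_pow hμ U m hp).congr_of_eventuallyEq
    (((isOpen_offCuts μ).mem_nhds hp |> Filter.Eventually.mono) fun z hz => h z hz)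
  have h2 := (hasDerivAt_ytilde hμ hp).fun_mul
    (h1.fun_sub (differentiableAt_corr hμ c hp).hasDerivAt)
  rw [show meanOf μ lam p = _ from h2.deriv, corrPoly_eq hμ c hp, h p hp]
  have hsq := ytilde_sq μ p
  rw [mul_add, ← mul_assoc, ← mul_assoc, ← sq, hsq]
  field_simp
  ring

theorem dvd_sq_of_eval {N : ℂ[X]} {a : ℂ} (h0 : N.eval a = 0) (h1 : (derivative N).eval a = 0) :
    (X - C a) ^ 2 ∣ N := by
  obtain ⟨N1, rfl⟩ := dvd_iff_isRoot.2 h0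
  rw [derivative_mul] at h1
  simp at h1
  obtain ⟨N2, rfl⟩ := dvd_iff_isRoot.2 h1
  exact ⟨N2, by ring⟩

theorem T_sq_dvd (hμ : StrictMono μ) {N : ℂ[X]}
    (h : ∀ α, N.eval (μ α : ℂ) = 0 ∧ (derivative N).eval (μ α : ℂ) = 0) : T μ ^ 2 ∣ N := by
  rw [T, ← Finset.prod_pow]
  refine Finset.prod_dvd_of_coprime (fun α _ β _ hne => ?_) fun α _ => dvd_sq_of_eval (h α).1 (h α).2
  exact (isCoprime_X_sub_C_of_isUnit_sub (by
    rw [isUnit_iff_ne_zero, ← ofReal_sub, ofReal_ne_zero, sub_ne_zero]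
    exact fun h => hne (hμ.injective h))).pow

theorem T_dvd (hμ : StrictMono μ) {N : ℂ[X]} (h : ∀ α, N.eval (μ α : ℂ) = 0) : T μ ∣ N := by
  rw [T]
  refine Finset.prod_dvd_of_coprime (fun α _ β _ hne => ?_) fun α _ => dvd_iff_isRoot.2 (h α)
  exact isCoprime_X_sub_C_of_isUnit_sub (by
    rw [isUnit_iff_ne_zero, ← ofReal_sub, ofReal_ne_zero, sub_ne_zero]
    exact fun h => hne (hμ.injective h))

end Mean

/-! ### The explicit loop mean and its loop equation -/

section Existence

variable {V : ℝ[X]} {μ : BranchPoints g}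

/-- The symbol of the genus-one loop mean. -/
def lamF (V : ℝ[X]) {μ : BranchPoints g} (hμ : StrictMono μ) (z : ℂ) : ℂ :=
  ∑ α, cF V μ α * (((z - μ α) ^ 2)⁻¹ - sF V hμ α * ((z - μ α) ^ 1)⁻¹)

/-- The numerator of `lamF`. -/
def numF (V : ℝ[X]) {μ : BranchPoints g} (hμ : StrictMono μ) : ℂ[X] :=
  ∑ α, C (cF V μ α) * (Tsub μ α ^ 2 * (1 - C (sF V hμ α) * (X - C (μ α : ℂ))))

theorem lamF_eq (V : ℝ[X]) (hμ : StrictMono μ) {z : ℂ} (hz : z ∈ offCuts μ) :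
    lamF V hμ z = (numF V hμ).eval z / (T μ).eval z ^ 2 := by
  rw [lamF, numF, eval_finsetSum, Finset.sum_div]
  refine Finset.sum_congr rfl fun α _ => ?_
  have h0 := sub_ne_zero_of_mem_offCuts hμ hz α
  have h1 := eval_T_ne_zero hμ hz
  have hT : (T μ).eval z = (z - μ α) * (Tsub μ α).eval z := by
    rw [← mul_Tsub μ α, eval_mul, eval_sub, eval_X, eval_C]
  rw [hT] at h1 ⊢
  have h2 := right_ne_zero_of_mul h1
  simp only [eval_mul, eval_C, eval_sub, eval_one, eval_X, eval_pow]
  field_simp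

theorem differentiableOn_lamF (V : ℝ[X]) (hμ : StrictMono μ) :
    DifferentiableOn ℂ (lamF V hμ) (offCuts μ) := fun _ hz =>
  (((hasDerivAt_div_T_pow hμ (numF V hμ) 2 hz).congr_of_eventuallyEq
    ((Filter.Eventually.mono ((isOpen_offCuts μ).mem_nhds hz)) fun _ hw =>
      lamF_eq V hμ hw)).differentiableAt).differentiableWithinAt

theorem gro_lamF (V : ℝ[X]) (hμ : StrictMono μ) : Gro (-1) (lamF V hμ) :=
  Gro.sum fun α _ => (((gro_inv_sub_pow (μ α : ℂ) 2).mono (by norm_num)).sub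
    ((gro_inv_sub_pow (μ α : ℂ) 1).const_mul _)).const_mul _

theorem res_mul_lamF (V : ℝ[X]) (hμ : StrictMono μ) (P : ℂ[X]) :
    res (1 + ∑ β, |μ β|) (fun z => P.eval z * lamF V hμ z) =
      ∑ α, cF V μ α * ((derivative P).eval (μ α : ℂ) - sF V hμ α * P.eval (μ α : ℂ)) := by
  have hR := rad_pos μ
  obtain ⟨ρ, h0, h1, h2⟩ := exists_inner_radius (abs_lt_rad μ)
  have hc : ∀ (α : Fin (2 * (g + 1))) (l : ℕ), ContinuousOn (fun z => P.eval z * ((z - μ α) ^ l)⁻¹)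
      (Metric.sphere 0 (1 + ∑ β, |μ β|)) := fun α l =>
    ((ext_eval ρ P).mul (ext_inv_sub_pow (by simpa using h1 α) l)).continuousOn_sphere h2
  have e : ∀ z, P.eval z * lamF V hμ z = ∑ α, cF V μ α * (P.eval z * ((z - μ α) ^ (1 + 1))⁻¹ -
      sF V hμ α * (P.eval z * ((z - μ α) ^ (0 + 1))⁻¹)) := fun z => by
    rw [lamF, Finset.mul_sum]
    exact Finset.sum_congr rfl fun α _ => by ring
  simp only [e]
  rw [res_sum hR.le]
  swap
  · exact fun α _ => continuousOn_const.mul ((hc α _).sub (continuousOn_const.mul (hc α _)))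
  refine Finset.sum_congr rfl fun α _ => ?_
  have ha : ‖(μ α : ℂ)‖ < 1 + ∑ β, |μ β| := by simpa using abs_lt_rad μ α
  have hc' : ContinuousOn (fun z => sF V hμ α * (P.eval z * ((z - μ α) ^ (0 + 1))⁻¹))
      (Metric.sphere 0 (1 + ∑ β, |μ β|)) := continuousOn_const.mul (hc α _)
  rw [res_const_mul, res_sub hR.le (hc α _) hc', res_const_mul,
    res_eval_div_pow ha, res_eval_div_pow ha, hasseDeriv_one', hasseDeriv_zero']

theorem diagPoly_eval_branch (hμ : StrictMono μ) (α : Fin (2 * (g + 1))) :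
    (diagPoly hμ).eval (μ α : ℂ) = -(1 / 2) * qvar hμ α * (derivative (T μ)).eval (μ α : ℂ) := by
  have := derivative_T_eval_ne_zero hμ α
  rw [qvar]
  field_simp

theorem numF_eval_branch (V : ℝ[X]) (hμ : StrictMono μ) (α : Fin (2 * (g + 1))) :
    (numF V hμ).eval (μ α : ℂ) = cF V μ α * (derivative (T μ)).eval (μ α : ℂ) ^ 2 := by
  rw [numF, eval_finsetSum, Finset.sum_eq_single α]
  · simp [derivative_T_eval]
  · intro β _ h
    simp [Tsub_eval_of_ne μ h]
  · simp

theorem derivative_numF_eval_branch (V : ℝ[X]) (hμ : StrictMono μ) (α : Fin (2 * (g + 1))) :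
    (derivative (numF V hμ)).eval (μ α : ℂ) = cF V μ α * ((derivative (T μ)).eval (μ α : ℂ) *
      (derivative (derivative (T μ))).eval (μ α : ℂ) -
        sF V hμ α * (derivative (T μ)).eval (μ α : ℂ) ^ 2) := by
  rw [numF, derivative_sum, eval_finsetSum, Finset.sum_eq_single α]
  · rw [derivative_two_T_eval μ hμ, ← derivative_Tsub_eval μ hμ]
    simp only [derivative_mul, derivative_C, derivative_pow, derivative_sub, derivative_one,
      derivative_X, eval_add, eval_mul, eval_C, eval_sub, eval_one, eval_X, eval_pow, eval_zero,
      derivative_T_eval]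
    ring
  · intro β _ h
    simp [Tsub_eval_of_ne μ h, derivative_pow]
  · simp

/-- Cancellation of all poles in `M ytilde W - W00`, whose common denominator is `T ^ 2`. Vanishing
to second order at each branch point gives two conditions per point, matching the coefficients of
the double and the simple pole of `lamF`. -/
theorem T_sq_dvd_loop (hμ : StrictMono μ) (hreg : IsRegular V μ) :
    T μ ^ 2 ∣ Mpoly V μ * (derivative (numF V hμ) * T μ -
      C (3 / 2) * (numF V hμ * derivative (T μ))) - (C (1 / 16) * derivative (T μ) ^ 2 -
        C (1 / 8) * (derivative (derivative (T μ)) * T μ) + C (1 / 2) * (diagPoly hμ * T μ)) := by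
  refine T_sq_dvd hμ fun α => ?_
  have hM0 : (Mpoly V μ).eval (μ α : ℂ) ≠ 0 := by rw [← M_eq hμ]; exact hreg α
  have hT0 := derivative_T_eval_ne_zero hμ α
  have hc : cF V μ α = -(1 / 24) /
    ((Mpoly V μ).eval (μ α : ℂ) * (derivative (T μ)).eval (μ α : ℂ)) := rfl
  -- The values give `-(3/2) M c T' ^ 3 = T' ^ 2 / 16`, that is `c = -1 / (24 M T')`; this is the
  -- source of the constant in `F1`. The first derivatives match the ratio `sF`, where `diagPoly`
  -- enters through `qvar`.
  constructor
  · simp only [eval_sub, eval_add, eval_mul, eval_C, eval_pow, eval_T_branch, numF_eval_branch, hc]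
    field_simp
    ring
  · simp only [derivative_sub, derivative_add, derivative_mul, derivative_C, derivative_pow]
    simp only [eval_sub, eval_add, eval_mul, eval_C, eval_pow, eval_T_branch, numF_eval_branch, hc,
      derivative_numF_eval_branch, diagPoly_eval_branch, sF, eval_zero]
    simp
    field_simp
    ring

theorem gro_W0 (hμ : IsPlanarSolution V μ) : Gro (-1) (W0 V μ) := by
  have hp := (isPlanarSolution_iff.1 hμ).2
  have rem := gro_pol_remainder hμ.1 (dVpoly V) (g + 1) fun k hk => by
    have := hp k (by omega)
    rwa [if_neg (by omega)] at this
  refine ((rem.mul (gro_ytilde μ) (m := -1) (by push_cast; ring)).const_mul (1 / 2)).congr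
    (1 + ∑ β, |μ β|) fun z hz => ?_
  have hoff : z ∈ offCuts μ := mem_offCuts_of_norm fun α => (abs_lt_rad μ α).trans hz
  have hy0 := ytilde_ne_zero hμ.1 hoff
  rw [W0, y, M_eq hμ.1, dV_eq, show pol μ (dVpoly V) = Mpoly V μ from rfl]
  field_simp

theorem loopOp_eq {W : ℂ → ℂ} (hW : DifferentiableOn ℂ W (offCuts μ)) (hg : Gro (-2) W) {p : ℂ} {r : ℝ}
    (hr : ∀ α, |μ α| < r) (hp : r < ‖p‖) :
    loopOp V r W p = (dVpoly V).eval p * W p -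
      (polPart (1 + ∑ β, |μ β|) W (dVpoly V)).eval p := by
  obtain ⟨ρ, h0, h1, h2⟩ := exists_inner_radius (r := min r (1 + ∑ β, |μ β|))
    fun α => lt_min (hr α) (abs_lt_rad μ α)
  have he := ext_of_differentiableOn h1 hW
  have hρr := h2.trans_le (min_le_left _ _)
  rw [polPart_eq_of_ext he h0 (h2.trans_le (min_le_right _ _)) hρr,
    polPart_remainder he (hg.mono (by norm_num)) h0 hρr hp]
  refine res_congr (h0.trans hρr.le) fun z _ => ?_
  rw [dV_eq]
  ring

/-- The genus-one loop equation for the explicit loop mean. -/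
theorem loop_meanOf_lamF (hμ : IsPlanarSolution V μ) (hreg : IsRegular V μ) {p : ℂ} {r : ℝ}
    (hr : ∀ α, |μ α| < r) (hp : r < ‖p‖) :
    loopOp V r (meanOf μ (lamF V hμ.1)) p - 2 * W0 V μ p * meanOf μ (lamF V hμ.1) p = W00 hμ.1 p := by
  have hm := hμ.1
  set W := meanOf μ (lamF V hμ.1) with hW
  have hWd := differentiableOn_meanOf hm (differentiableOn_lamF V hm)
  have hWg := gro_meanOf hm (differentiableOn_lamF V hm) (gro_lamF V hm)
  obtain ⟨S, hS⟩ := T_sq_dvd_loop hm hreg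
  set c := corrPoly hm (momentVec g (1 + ∑ β, |μ β|) (lamF V hm)) with hc
  -- Dividing the divisibility by `T ^ 2` shows that the loop equation holds up to a polynomial.
  have key : ∀ z ∈ offCuts μ, (Mpoly V μ).eval z * (ytilde μ z * W z) =
      W00 hm z + (S - Mpoly V μ * c).eval z := fun z hz => by
    have h0 := eval_T_ne_zero hm hz
    have h1 := congrArg (eval z) hS
    simp only [eval_sub, eval_add, eval_mul, eval_C, eval_pow] at h1
    rw [hW, ytilde_mul_meanOf hm (fun z hz => lamF_eq V hm hz) hz, W00, ← hc, eval_sub, eval_mul]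
    have h2 : S.eval z = (T μ).eval z ^ 2 * S.eval z / (T μ).eval z ^ 2 := by field_simp
    rw [h2, ← h1]
    push_cast
    field_simp
    ring
  -- The difference of the two polynomials is `O(1/z)`: the remainder of `V' W`, the product `W0 *
  -- W` and `W00` all decay.
  have hR : S - Mpoly V μ * c = polPart (1 + ∑ β, |μ β|) W (dVpoly V) := by
    rw [← sub_eq_zero]
    refine eq_zero_of_gro_neg ?_
    obtain ⟨ρ, h0, h1, h2⟩ := exists_inner_radius (abs_lt_rad μ)
    have g1 := gro_polPart_remainder (ext_of_differentiableOn h1 hWd) (hWg.mono (by norm_num)) h0 h2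
      (dVpoly V) 0 (by simp)
    have g2 : Gro (-1) fun z => 2 * (W0 V μ z * W z) :=
      (((gro_W0 hμ).mul hWg (m := -3) (by norm_num)).const_mul 2).mono (by norm_num)
    refine ((Gro.sub (k := -1) (by simpa using g1) g2).sub (gro_W00 hm)).congr (1 + ∑ β, |μ β|)
      fun z hz => ?_
    have hoff : z ∈ offCuts μ := mem_offCuts_of_norm fun α => (abs_lt_rad μ α).trans hz
    have h3 := key z hoff
    rw [eval_sub, ← sub_eq_iff_eq_add'.2 h3, W0, y, M_eq hm, dV_eq]
    ring
  have hoff : p ∈ offCuts μ := mem_offCuts_of_norm fun α => (hr α).trans hp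
  have h3 := key p hoff
  rw [hR] at h3
  rw [loopOp_eq hWd hWg hr hp, W0, y, M_eq hm, dV_eq]
  linear_combination h3

end Existence

/-! ### Coupling derivatives and loop insertions -/

section Insertion

variable {V : ℝ[X]} {μ : BranchPoints g} {Φ : ℝ[X] → BranchPoints g → ℂ}

theorem HasCouplingDeriv.unique {j : ℕ} {d d' : ℂ} (h : HasCouplingDeriv Φ V μ j d)
    (h' : HasCouplingDeriv Φ V μ j d') : d = d' := by
  obtain ⟨⟨γ, hγ⟩, h1⟩ := h
  exact (h1 γ hγ).unique (h'.2 γ hγ)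

/-- For `j ≥ 1` the coupling derivatives are unique because a deformation exists; the unconstrained
entry `d 0` is multiplied by zero. -/
theorem hasLoopInsertion_iff {d : ℕ → ℂ} (hd : ∀ j, 1 ≤ j → HasCouplingDeriv Φ V μ j (d j))
    {p w : ℂ} :
    HasLoopInsertion Φ V μ p w ↔ HasSum (fun j : ℕ => -((j : ℂ) / p ^ (j + 1) * d j)) w := by
  refine ⟨fun ⟨d', h1, h2⟩ => h2.congr_fun fun j => ?_, fun h => ⟨d, hd, h⟩⟩
  rcases Nat.eq_zero_or_pos j with rfl | hj
  · simp
  · rw [(h1 j hj).unique (hd j hj)]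

theorem hasCouplingDeriv_W0 (hμ : IsPlanarSolution V μ) (hreg : IsRegular V μ) {p : ℂ}
    (hp : p ∈ offCuts μ) {j : ℕ} (hj : 1 ≤ j) :
    HasCouplingDeriv (fun V' μ' => W0 V' μ' p) V μ j
      (1 / 2 * (p ^ (j - 1) - (hpoly hμ.1 (j - 1)).eval p / ytilde μ p)) := by
  obtain ⟨v, hv, hex, hall⟩ := exists_velocity hj hμ hreg
  refine ⟨hex, fun γ hγ => ?_⟩
  rw [← hv]
  exact hasDerivAt_W0 hj hμ.1 hγ.1 (hall γ hγ) hp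

theorem hasCouplingDeriv_F1 (hμ : IsPlanarSolution V μ) (hreg : IsRegular V μ) {j : ℕ}
    (hj : 1 ≤ j) :
    HasCouplingDeriv F1 V μ j
      (res (1 + ∑ β, |μ β|) fun z => (hpoly hμ.1 (j - 1)).eval z * lamF V hμ.1 z) := by
  obtain ⟨v, hv, hex, hall⟩ := exists_velocity hj hμ hreg
  refine ⟨hex, fun γ hγ => ?_⟩
  rw [res_mul_lamF, ← hv, ← F1_variation_eq hμ.1 hreg]
  exact hasDerivAt_F1 hj hμ.1 hreg hγ.1 (hall γ hγ)

/-- A linear combination of the branch points and the moments. -/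
def momentSum {k : ℕ} (a : Fin (2 * (g + 1)) → ℂ) (b : Fin (2 * (g + 1)) → Fin k → ℂ) (V : ℝ[X])
    (μ : BranchPoints g) : ℂ :=
  (∑ α, a α * (μ α : ℂ)) + ∑ α, ∑ l, b α l * moment V μ α (l.val + 1)

theorem hasDerivAt_momentSum {k : ℕ} (a : Fin (2 * (g + 1)) → ℂ) (b : Fin (2 * (g + 1)) → Fin k → ℂ)
    {j : ℕ} (hj : 1 ≤ j) (hμ : StrictMono μ) {γ : ℝ → BranchPoints g} {v : BranchPoints g}
    (h0 : γ 0 = μ) (hγ : HasDerivAt γ v 0) :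
    HasDerivAt (fun ε => momentSum a b (shift V j ε) (γ ε))
      ((∑ α, a α * v α) + ∑ α, ∑ l : Fin k, b α l *
        ((hasseDeriv l.val (deltaM μ (dVpoly V) (X ^ (j - 1)) 1 v)).eval (μ α : ℂ) +
          (derivative (hasseDeriv l.val (Mpoly V μ))).eval (μ α : ℂ) * v α)) 0 :=
  (HasDerivAt.fun_sum fun α _ => (hasDerivAt_ofReal_curve hγ α).const_mul (a α)).fun_add
    (HasDerivAt.fun_sum fun α _ => HasDerivAt.fun_sum fun l _ =>
      (hasDerivAt_moment hj hμ h0 hγ α l).const_mul (b α l))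

/-- `F1` varies like a linear combination of the branch points and the first moments. -/
theorem hasCouplingDeriv_momentSum_F1 (hμ : IsPlanarSolution V μ) (hreg : IsRegular V μ) {j : ℕ}
    (hj : 1 ≤ j) :
    HasCouplingDeriv (momentSum (fun α => -(1 / 24) * (4 * invDist μ α + 6 * qvar hμ.1 α))
        fun α (_ : Fin 1) => -(1 / 24) / (Mpoly V μ).eval (μ α : ℂ)) V μ j
      (res (1 + ∑ β, |μ β|) fun z => (hpoly hμ.1 (j - 1)).eval z * lamF V hμ.1 z) := by
  obtain ⟨v, hv, hex, hall⟩ := exists_velocity hj hμ hreg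
  refine ⟨hex, fun γ hγ => ?_⟩
  rw [res_mul_lamF, ← hv, ← F1_variation_eq hμ.1 hreg]
  refine (hasDerivAt_momentSum _ _ hj hμ.1 hγ.1 (hall γ hγ)).congr_deriv ?_
  simp

theorem isGenusOneLoopMean_meanOf (hμ : IsPlanarSolution V μ) (hreg : IsRegular V μ) :
    IsGenusOneLoopMean V μ (meanOf μ (lamF V hμ.1)) where
  holo := differentiableOn_meanOf hμ.1 (differentiableOn_lamF V hμ.1)
  decay := by
    have h := gro_meanOf hμ.1 (differentiableOn_lamF V hμ.1) (gro_lamF V hμ.1)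
    refine h.congr_right fun z => ?_
    rw [zpow_neg, one_div]
    norm_cast
  loop p r hr hp := by
    have hpμ : ∀ α, |μ α| < ‖p‖ := fun α => (hr α).trans hp
    rw [loop_meanOf_lamF hμ hreg hr hp, hasLoopInsertion_iff fun j hj =>
      hasCouplingDeriv_W0 hμ hreg (mem_offCuts_of_norm hpμ) hj]
    exact hasSum_W00 hμ.1 hpμ
  total := ⟨1, _, _, fun p hp => (hasLoopInsertion_iff fun j hj =>
    hasCouplingDeriv_momentSum_F1 hμ hreg hj).2
      (hasSum_meanOf hμ.1 (differentiableOn_lamF V hμ.1) (gro_lamF V hμ.1) hp)⟩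

theorem hasLoopInsertion_F1 (hμ : IsPlanarSolution V μ) (hreg : IsRegular V μ) {p : ℂ}
    (hp : ∀ α, |μ α| < ‖p‖) : HasLoopInsertion F1 V μ p (meanOf μ (lamF V hμ.1) p) :=
  (hasLoopInsertion_iff fun _ hj => hasCouplingDeriv_F1 hμ hreg hj).2
    (hasSum_meanOf hμ.1 (differentiableOn_lamF V hμ.1) (gro_lamF V hμ.1) hp)

end Insertion

/-! ### Rational symbols for derivatives of branch points and moments -/

section Representable

variable {V : ℝ[X]} {μ : BranchPoints g}

/-- The functional `d` of the variations `hpoly` is represented by a rational symbol with poles at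
the branch points only. -/
def Rep (hμ : StrictMono μ) (d : ℕ → ℂ) : Prop :=
  ∃ (m : ℕ) (U : ℂ[X]), Gro (-1) (fun z => U.eval z / (T μ).eval z ^ m) ∧
    ∀ i, d i = res (1 + ∑ β, |μ β|) fun z =>
      (hpoly hμ i).eval z * (U.eval z / (T μ).eval z ^ m)

theorem Rep.of_symbol (hμ : StrictMono μ) {d : ℕ → ℂ} {lam : ℂ → ℂ} {m : ℕ} {U : ℂ[X]}
    (h : ∀ z ∈ offCuts μ, lam z = U.eval z / (T μ).eval z ^ m) (hg : Gro (-1) lam)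
    (hd : ∀ i, d i = res (1 + ∑ β, |μ β|) fun z => (hpoly hμ i).eval z * lam z) : Rep hμ d := by
  refine ⟨m, U, hg.congr (1 + ∑ β, |μ β|) fun z hz =>
    h z (mem_offCuts_of_norm fun α => (abs_lt_rad μ α).trans hz), fun i => ?_⟩
  rw [hd]
  refine res_congr (rad_pos μ).le fun z hz => ?_
  rw [h z (mem_offCuts_of_norm fun α => (abs_lt_rad μ α).trans_eq hz.symm)]

theorem continuousOn_div_T_pow (hμ : StrictMono μ) (U : ℂ[X]) (m : ℕ) :
    ContinuousOn (fun z => U.eval z / (T μ).eval z ^ m) (Metric.sphere 0 (1 + ∑ β, |μ β|)) :=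
  fun z hz => (hasDerivAt_div_T_pow hμ U m (mem_offCuts_of_norm fun α =>
    (abs_lt_rad μ α).trans_eq (by simpa using hz.symm))).continuousAt.continuousWithinAt

theorem Rep.add {hμ : StrictMono μ} {d d' : ℕ → ℂ} (h : Rep hμ d) (h' : Rep hμ d') :
    Rep hμ fun i => d i + d' i := by
  obtain ⟨m, U, hU, hd⟩ := h
  obtain ⟨m', U', hU', hd'⟩ := h'
  refine Rep.of_symbol hμ (lam := fun z => U.eval z / (T μ).eval z ^ m +
    U'.eval z / (T μ).eval z ^ m') (m := m + m') (U := U * T μ ^ m' + U' * T μ ^ m)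
    (fun z hz => ?_) (hU.add hU') fun i => ?_
  · have := eval_T_ne_zero hμ hz
    simp only [eval_add, eval_mul, eval_pow]
    field_simp
    ring
  · rw [hd, hd', ← res_add (rad_pos μ).le]
    · exact res_congr (rad_pos μ).le fun z _ => by ring
    · exact (Polynomial.continuous _).continuousOn.mul (continuousOn_div_T_pow hμ U m)
    · exact (Polynomial.continuous _).continuousOn.mul (continuousOn_div_T_pow hμ U' m')

theorem Rep.const_mul {hμ : StrictMono μ} {d : ℕ → ℂ} (c : ℂ) (h : Rep hμ d) :
    Rep hμ fun i => c * d i := by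
  obtain ⟨m, U, hU, hd⟩ := h
  refine Rep.of_symbol hμ (lam := fun z => c * (U.eval z / (T μ).eval z ^ m)) (m := m)
    (U := C c * U) (fun z _ => ?_) (hU.const_mul c) fun i => ?_
  · rw [eval_mul, eval_C]; ring
  · rw [hd, ← res_const_mul]
    exact res_congr (rad_pos μ).le fun z _ => by ring

theorem Rep.zero (hμ : StrictMono μ) : Rep hμ fun _ => 0 := by
  have h : Gro (-1) fun _ => 0 := by simpa using (gro_inv_sub 0).const_mul 0
  exact Rep.of_symbol hμ (m := 0) (U := 0) (by simp) h fun i => by simp [res, circleIntegral]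

theorem Rep.sum {hμ : StrictMono μ} {ι : Type*} (s : Finset ι) {d : ι → ℕ → ℂ}
    (h : ∀ x ∈ s, Rep hμ (d x)) : Rep hμ fun i => ∑ x ∈ s, d x i := by
  classical
  induction s using Finset.induction_on with
  | empty => simpa using Rep.zero hμ
  | insert a s ha ih =>
    simp only [Finset.sum_insert ha]
    exact (h a (by simp)).add (ih fun x hx => h x (by simp [hx]))

theorem rep_hasseDeriv (hμ : StrictMono μ) (l : ℕ) (β : Fin (2 * (g + 1))) :
    Rep hμ fun i => (hasseDeriv l (hpoly hμ i)).eval (μ β : ℂ) := by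
  refine Rep.of_symbol hμ (lam := fun z => ((z - μ β) ^ (l + 1))⁻¹) (m := l + 1)
    (U := Tsub μ β ^ (l + 1)) (fun z hz => ?_) ((gro_inv_sub_pow _ _).mono (by push_cast; omega))
    fun i => (res_eval_div_pow (by simpa using abs_lt_rad μ β) _ _).symm
  have hT : (T μ).eval z = (z - μ β) * (Tsub μ β).eval z := by
    rw [← mul_Tsub μ β, eval_mul, eval_sub, eval_X, eval_C]
  have h1 := eval_T_ne_zero hμ hz
  rw [hT] at h1
  rw [hT, eval_pow, mul_pow, mul_comm, div_mul_eq_div_div,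
    div_self (pow_ne_zero _ (right_ne_zero_of_mul h1)), one_div]

/-- `deltaY_eval_branch` solved for the velocity: a multiple of the value of `h` at the branch
point. -/
theorem rep_velocity (hμ : StrictMono μ) (hreg : IsRegular V μ) {v : ℕ → BranchPoints g}
    (hv : ∀ i, deltaY μ (dVpoly V) (X ^ i) 1 (v i) = hpoly hμ i) (β : Fin (2 * (g + 1))) :
    Rep hμ fun i => (v i β : ℂ) := by
  have h := (rep_hasseDeriv hμ 0 β).const_mul
    (-2 / ((Mpoly V μ).eval (μ β : ℂ) * (derivative (T μ)).eval (μ β : ℂ)))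
  have hM0 : (Mpoly V μ).eval (μ β : ℂ) ≠ 0 := by rw [← M_eq hμ]; exact hreg β
  have hT0 := derivative_T_eval_ne_zero hμ β
  convert h using 2 with i
  rw [hasseDeriv_zero', ← hv i, deltaY_eval_branch]
  field_simp

/-- Dividing the definition of `deltaY` by `T` gives `deltaM = h / T + M * varT / (2 T)`. The first
term is a functional of `h` with symbol `1 / ((z - μ_α) ^ (l + 1) T)`, the second is linear in the
velocities, which are already representable. -/
theorem rep_deltaM (hμ : StrictMono μ) (hreg : IsRegular V μ) {v : ℕ → BranchPoints g}
    (hv : ∀ i, deltaY μ (dVpoly V) (X ^ i) 1 (v i) = hpoly hμ i) (l : ℕ) (α : Fin (2 * (g + 1))) :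
    Rep hμ fun i => (hasseDeriv l (deltaM μ (dVpoly V) (X ^ i) 1 (v i))).eval (μ α : ℂ) := by
  obtain ⟨ρ, h0, h1, h2⟩ := exists_inner_radius (abs_lt_rad μ)
  have hR := rad_pos μ
  set R := 1 + ∑ β, |μ β| with hRdef
  set w : ℂ → ℂ := fun z => ((z - μ α) ^ (l + 1))⁻¹ * ((ytilde μ z)⁻¹ * (ytilde μ z)⁻¹) with hw
  have ew : Ext ρ w := (ext_inv_sub_pow (by simpa using h1 α) _).mul
    ((ext_ytilde_inv hμ h1).mul (ext_ytilde_inv hμ h1))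
  have gw : Gro (-1) w := ((gro_inv_sub_pow _ (l + 1)).mul
    ((gro_ytilde_inv_one μ).mul (gro_ytilde_inv_one μ) (m := -2) (by norm_num))
    (m := -(l + 1 : ℕ) + -2) rfl).mono (by push_cast; omega)
  have r1 : Rep hμ fun i => res R fun z => (hpoly hμ i).eval z * w z := by
    refine Rep.of_symbol hμ (m := l + 2) (U := Tsub μ α ^ (l + 1)) (fun z hz => ?_) gw fun i => rfl
    have hT : (T μ).eval z = (z - μ α) * (Tsub μ α).eval z := by
      rw [← mul_Tsub μ α, eval_mul, eval_sub, eval_X, eval_C]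
    have h1 := eval_T_ne_zero hμ hz
    have hs : (ytilde μ z)⁻¹ * (ytilde μ z)⁻¹ = ((T μ).eval z)⁻¹ := by
      rw [← mul_inv, ← sq, ytilde_sq]
    simp only [hw]
    rw [hs, hT, eval_pow, mul_pow]
    rw [hT] at h1
    have h3 := right_ne_zero_of_mul h1
    have h4 := left_ne_zero_of_mul h1
    field_simp
    ring
  have r2 : Rep hμ fun i => ∑ β, res R (fun z => (1 / 2 * (Mpoly V μ).eval z *
      (Tsub μ β).eval z) * w z) * v i β :=
    Rep.sum _ fun β _ => (rep_velocity hμ hreg hv β).const_mul _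
  convert r1.add r2 using 2 with i
  have hc : ∀ f : ℂ → ℂ, Ext ρ f → ContinuousOn f (Metric.sphere 0 R) := fun f hf =>
    hf.continuousOn_sphere h2
  rw [← res_eval_div_pow (r := R) (by simpa using abs_lt_rad μ α)]
  have e1 : ∀ β, res R (fun z => (1 / 2 * (Mpoly V μ).eval z * (Tsub μ β).eval z) * w z) * v i β =
      res R fun z => v i β * ((1 / 2 * (Mpoly V μ).eval z * (Tsub μ β).eval z) * w z) := fun β => by
    rw [res_const_mul, mul_comm]
  have ex : ∀ β, Ext ρ fun z => v i β * ((1 / 2 * (Mpoly V μ).eval z * (Tsub μ β).eval z) * w z) :=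
    fun β => ((((ext_eval ρ (Mpoly V μ)).const_mul (1 / 2)).mul (ext_eval ρ (Tsub μ β))).mul
      ew).const_mul _
  simp only [e1]
  rw [← res_sum hR.le fun β _ => hc _ (ex β), ← res_add hR.le (hc _ ((ext_eval ρ _).mul ew))
    (hc _ (Ext.sum fun β _ => ex β))]
  refine res_congr hR.le fun z hz => ?_
  have hoff : z ∈ offCuts μ := mem_offCuts_of_norm fun α => (abs_lt_rad μ α).trans_eq hz.symm
  have hy0 := ytilde_ne_zero hμ hoff
  have hz0 := sub_ne_zero_of_mem_offCuts hμ hoff α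
  have e2 : ∑ β, (v i β : ℂ) * ((1 / 2 * (Mpoly V μ).eval z * (Tsub μ β).eval z) * w z) =
      1 / 2 * (Mpoly V μ).eval z * w z * (varT μ (v i)).eval z := by
    rw [varT, eval_finsetSum, Finset.mul_sum]
    refine Finset.sum_congr rfl fun β _ => ?_
    rw [eval_mul, eval_C]
    ring
  rw [e2, ← hv i, deltaY, eval_sub, eval_mul, eval_mul, eval_C, eval_mul, ← ytilde_sq,
    show pol μ (dVpoly V) = Mpoly V μ from rfl]
  simp only [hw]
  field_simp
  ring

theorem exists_rep_momentSum (hμ : IsPlanarSolution V μ) (hreg : IsRegular V μ) {k : ℕ}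
    (a : Fin (2 * (g + 1)) → ℂ) (b : Fin (2 * (g + 1)) → Fin k → ℂ) :
    ∃ d : ℕ → ℂ, Rep hμ.1 d ∧
      ∀ j, 1 ≤ j → HasCouplingDeriv (momentSum a b) V μ j (d (j - 1)) := by
  choose v hv hex hall using fun i : ℕ => exists_velocity (j := i + 1) (by omega) hμ hreg
  simp only [Nat.add_sub_cancel] at hv
  refine ⟨fun i => (∑ α, a α * v i α) + ∑ α, ∑ l : Fin k, b α l *
        ((hasseDeriv l.val (deltaM μ (dVpoly V) (X ^ i) 1 (v i))).eval (μ α : ℂ) +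
          (derivative (hasseDeriv l.val (Mpoly V μ))).eval (μ α : ℂ) * v i α), ?_, fun j hj => ?_⟩
  · have hvel := rep_velocity hμ.1 hreg hv
    exact (Rep.sum _ fun α _ => (hvel α).const_mul _).add
      (Rep.sum _ fun α _ => Rep.sum _ fun l _ =>
        ((rep_deltaM hμ.1 hreg hv l α).add ((hvel α).const_mul _)).const_mul _)
  · obtain ⟨i, rfl⟩ : ∃ i, j = i + 1 := ⟨j - 1, by omega⟩
    refine ⟨hex i, fun γ hγ => ?_⟩
    have := hasDerivAt_momentSum (V := V) a b hj hμ.1 hγ.1 (hall i γ hγ)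
    simp only [Nat.add_sub_cancel] at this ⊢
    exact this

end Representable

/-! ### Uniqueness of the loop mean -/

section Uniqueness

variable {V : ℝ[X]} {μ : BranchPoints g}

/-- A symbol whose loop insertion solves the homogeneous loop equation vanishes. -/
theorem symbol_eq_zero (hμ : StrictMono μ) (hreg : IsRegular V μ) (m : ℕ) :
    ∀ U S : ℂ[X], Gro (-1) (fun z => U.eval z / (T μ).eval z ^ m) →
      Mpoly V μ * (derivative U * T μ + C (1 / 2 - m : ℂ) * (U * derivative (T μ))) = T μ ^ m * S →
      U = 0 := by
  induction m with
  | zero => exact fun U S h _ => eq_zero_of_gro_neg (by simpa using h)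
  | succ m ih =>
    intro U S hg h
    -- At a branch point the equation reduces to `(1/2 - (m + 1)) M U T' = 0`. A half-integer is not
    -- zero, so `U` vanishes there and one factor `T` cancels from the symbol.
    obtain ⟨U', rfl⟩ : T μ ∣ U := T_dvd hμ fun α => by
      have h1 := congrArg (eval (μ α : ℂ)) h
      have hM0 : (Mpoly V μ).eval (μ α : ℂ) ≠ 0 := by rw [← M_eq hμ]; exact hreg α
      have hT0 := derivative_T_eval_ne_zero hμ α
      have hm : (1 / 2 - (m + 1 : ℕ) : ℂ) ≠ 0 := by
        intro h
        have h2 : (1 : ℂ) = ((2 * (m + 1) : ℕ) : ℂ) := by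
          push_cast at h ⊢
          linear_combination 2 * h
        have h3 : 1 = 2 * (m + 1) := by exact_mod_cast h2
        omega
      simp only [eval_mul, eval_add, eval_pow, eval_T_branch, eval_C, mul_zero, zero_add,
        zero_pow (Nat.succ_ne_zero m), zero_mul, mul_eq_zero, hM0, hm, hT0, false_or, or_false] at h1
      exact h1
    have hT : T μ ≠ 0 := (monic_T μ).ne_zero
    rw [ih U' S ?_ ?_, mul_zero]
    · refine hg.congr (1 + ∑ β, |μ β|) fun z hz => ?_
      have h0 := eval_T_ne_zero hμ (mem_offCuts_of_norm fun α => (abs_lt_rad μ α).trans hz)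
      rw [eval_mul]
      field_simp
      ring
    · refine mul_left_cancel₀ hT ?_
      rw [← mul_assoc (T μ) (T μ ^ m), ← pow_succ', ← h, derivative_mul]
      have : C (1 / 2 - (m + 1 : ℕ) : ℂ) = C (1 / 2 - m : ℂ) - 1 := by
        rw [← C_1, ← C_sub]; congr 1; push_cast; ring
      rw [this]
      ring

theorem meanOf_zero (μ : BranchPoints g) (p : ℂ) : meanOf μ (fun _ => 0) p = 0 := by
  have h1 : momentVec g (1 + ∑ β, |μ β|) (fun _ => 0) = 0 := by
    funext i
    simp [momentVec, res, circleIntegral]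
  rw [meanOf, h1]
  simp [lamCorr, corr]

/-- The identity theorem is applied in the open upper and lower half planes, which are convex, avoid
the cuts and reach infinity. Real points off the cuts follow by density and continuity. -/
theorem eqOn_offCuts {f f' : ℂ → ℂ} (hf : DifferentiableOn ℂ f (offCuts μ))
    (hf' : DifferentiableOn ℂ f' (offCuts μ)) {R : ℝ} (h : ∀ z, R < ‖z‖ → f z = f' z) :
    Set.EqOn f f' (offCuts μ) := by
  have hsub : ∀ z : ℂ, z.im ≠ 0 → z ∈ offCuts μ := fun z hz => by
    rw [mem_offCuts]
    rintro i x - rfl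
    exact hz (ofReal_im x)
  have key : ∀ S : Set ℂ, IsOpen S → Convex ℝ S → (∀ z ∈ S, z.im ≠ 0) →
      (∃ z ∈ S, R < ‖z‖) → Set.EqOn f f' S := by
    rintro S ho hc hS ⟨z, hz, hzR⟩
    refine ((hf.mono fun z hz => hsub z (hS z hz)).analyticOnNhd
      ho).eqOn_of_preconnected_of_eventuallyEq
      ((hf'.mono fun z hz => hsub z (hS z hz)).analyticOnNhd ho) hc.isPreconnected hz ?_
    exact Filter.Eventually.mono ((isOpen_ext R).mem_nhds hzR) h
  have hn : R < |R| + 1 := by linarith [le_abs_self R]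
  have hpos : 0 < |R| + 1 := by positivity
  have hup := key {z | 0 < z.im} (isOpen_lt continuous_const continuous_im)
    (convex_halfSpace_im_gt 0) (fun z hz => (ne_of_gt hz))
    ⟨((|R| + 1 : ℝ) : ℂ) * I, by rwa [Set.mem_ofPred_eq, im_ofReal_mul, I_im, mul_one],
      by rwa [norm_mul, norm_I, mul_one, norm_real, Real.norm_of_nonneg hpos.le]⟩
  have hdown := key {z | z.im < 0} (isOpen_lt continuous_im continuous_const)
    (convex_halfSpace_im_lt 0) (fun z hz => (ne_of_lt hz))
    ⟨-(((|R| + 1 : ℝ) : ℂ) * I),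
      by rwa [Set.mem_ofPred_eq, neg_im, im_ofReal_mul, I_im, mul_one, neg_lt_zero],
      by rwa [norm_neg, norm_mul, norm_I, mul_one, norm_real, Real.norm_of_nonneg hpos.le]⟩
  have hd : Dense {z : ℂ | z.im ≠ 0} := (dense_compl_singleton (0 : ℝ)).preimage isOpenMap_im
  refine Set.EqOn.of_subset_closure (s := offCuts μ ∩ {z : ℂ | z.im ≠ 0}) ?_ hf.continuousOn
    hf'.continuousOn Set.inter_subset_left (hd.open_subset_closure_inter (isOpen_offCuts μ))
  rintro z ⟨-, hz⟩
  rcases lt_or_gt_of_ne hz with h1 | h1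
  · exact hdown h1
  · exact hup h1

/-- The `total` clause makes the difference from the explicit mean equal to `meanOf λ` with a
rational symbol. Both loop equations have the same right side, so `M ytilde (meanOf λ)` is a
polynomial, and `symbol_eq_zero` applies. -/
theorem IsGenusOneLoopMean.eqOn (hμ : IsPlanarSolution V μ) (hreg : IsRegular V μ) {W : ℂ → ℂ}
    (hW : IsGenusOneLoopMean V μ W) : Set.EqOn W (meanOf μ (lamF V hμ.1)) (offCuts μ) := by
  have hm := hμ.1
  set W₁ := meanOf μ (lamF V hm) with hW₁
  have hlF := differentiableOn_lamF V hm
  have hWd := differentiableOn_meanOf hm hlF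
  have hWg := gro_meanOf hm hlF (gro_lamF V hm)
  have hWg' : Gro (-2) W := hW.decay.congr_right fun z => by
    rw [zpow_neg, one_div]; norm_cast
  obtain ⟨k, a, b, htot⟩ := hW.total
  obtain ⟨d, hd, hdΦ⟩ := exists_rep_momentSum hμ hreg a b
  have hF : Rep hm fun i => res (1 + ∑ β, |μ β|) fun z => (hpoly hm i).eval z * lamF V hm z :=
    Rep.of_symbol hm (fun z hz => lamF_eq V hm hz) (gro_lamF V hm) fun _ => rfl
  obtain ⟨m, U, hU, hUd⟩ := hd.add (hF.const_mul (-1))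
  set lam : ℂ → ℂ := fun z => U.eval z / (T μ).eval z ^ m with hlam
  have hlam_d : DifferentiableOn ℂ lam (offCuts μ) := fun z hz =>
    (hasDerivAt_div_T_pow hm U m hz).differentiableAt.differentiableWithinAt
  have hdiff : ∀ p : ℂ, (∀ α, |μ α| < ‖p‖) → W p - W₁ p = meanOf μ lam p := fun p hp => by
    have s1 := (hasLoopInsertion_iff hdΦ).1 (htot p hp)
    have s2 := hasSum_meanOf hm hlF (gro_lamF V hm) hp
    refine (s1.sub s2).unique ((hasSum_meanOf hm hlam_d hU hp).congr_fun fun j => ?_)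
    rw [← hUd]
    ring
  set S := polPart (1 + ∑ β, |μ β|) W (dVpoly V) - polPart (1 + ∑ β, |μ β|) W₁ (dVpoly V) with hS
  have hloop : ∀ p : ℂ, (∀ α, |μ α| < ‖p‖) →
      (Mpoly V μ).eval p * (ytilde μ p * meanOf μ lam p) = S.eval p := fun p hp => by
    obtain ⟨ρ, h0, h1, h2⟩ := exists_inner_radius hp
    obtain ⟨r, hr1, hr2⟩ := exists_between h2
    have hr : ∀ α, |μ α| < r := fun α => (h1 α).trans_lt hr1
    have e1 := loop_meanOf_lamF hμ hreg hr hr2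
    have e2 := ((hasLoopInsertion_iff fun j hj => hasCouplingDeriv_W0 hμ hreg
      (mem_offCuts_of_norm hp) hj).1 (hW.loop p r hr hr2)).unique (hasSum_W00 hm hp)
    rw [loopOp_eq hWd hWg hr hr2] at e1
    rw [loopOp_eq hW.holo hWg' hr hr2] at e2
    rw [W0, y, M_eq hm, dV_eq] at e1 e2
    rw [← hdiff p hp, hS, eval_sub]
    linear_combination e2 - e1
  -- Clearing the denominator `T ^ m` gives an identity of polynomials; it holds near infinity,
  -- hence everywhere.
  have hU0 : U = 0 := by
    refine symbol_eq_zero hm hreg m U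
      (S + Mpoly V μ * corrPoly hm (momentVec g (1 + ∑ β, |μ β|) lam)) hU ?_
    rw [← sub_eq_zero]
    refine eq_zero_of_gro_neg (((gro_inv_sub 0).const_mul 0).congr (1 + ∑ β, |μ β|) fun z hz => ?_)
    have hz' : ∀ α, |μ α| < ‖z‖ := fun α => (abs_lt_rad μ α).trans hz
    have hoff := mem_offCuts_of_norm hz'
    have h0 := pow_ne_zero m (eval_T_ne_zero hm hoff)
    have e := hloop z hz'
    rw [ytilde_mul_meanOf hm (fun _ _ => rfl) hoff] at e
    simp only [eval_sub, eval_add, eval_mul, eval_C, eval_pow]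
    rw [← e]
    field_simp
    ring
  have hlam0 : lam = fun _ => 0 := by
    funext z
    simp [hlam, hU0]
  refine eqOn_offCuts hW.holo hWd (R := 1 + ∑ β, |μ β|) fun z hz => ?_
  rw [← sub_eq_zero, hdiff z fun α => (abs_lt_rad μ α).trans hz, hlam0, meanOf_zero]

end Uniqueness

/-! ### Uniqueness of the free energy -/

theorem shift_shift (V : ℝ[X]) (j : ℕ) (ε ε' : ℝ) : shift (shift V j ε) j ε' = shift V j (ε + ε') := by
  rw [shift, shift, shift, add_assoc, ← map_add, add_div]

/-- A genus-one free energy has the same derivatives in the couplings as `F1`. -/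
theorem IsGenusOneFreeEnergyAt.exists_hasCouplingDeriv {V : ℝ[X]} {μ : BranchPoints g}
    (hμ : IsPlanarSolution V μ) (hreg : IsRegular V μ) {G : ℝ[X] → BranchPoints g → ℂ}
    (hG : IsGenusOneFreeEnergyAt G V μ) {j : ℕ} (hj : 1 ≤ j) :
    ∃ d, HasCouplingDeriv G V μ j d ∧ HasCouplingDeriv F1 V μ j d := by
  obtain ⟨W, hW, hGW⟩ := hG
  have heq := hW.eqOn hμ hreg
  have hR : ∀ α, |μ α| < ‖((1 + ∑ β, |μ β| : ℝ) : ℂ)‖ := fun α => by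
    rw [norm_real, Real.norm_of_nonneg (rad_pos μ).le]
    exact abs_lt_rad μ α
  obtain ⟨d, hd, -⟩ := hGW _ hR
  set e : ℕ → ℂ := fun j =>
    res (1 + ∑ β, |μ β|) fun z => (hpoly hμ.1 (j - 1)).eval z * lamF V hμ.1 z with he
  have hF : ∀ j, 1 ≤ j → HasCouplingDeriv F1 V μ j (e j) := fun j hj => hasCouplingDeriv_F1 hμ hreg hj
  -- Reindexing by `k = j + 1` gives a power series in `1/p` with zero sum. Its coefficient at `k =
  -- j + 1` is `-j` times the difference of the two coupling derivatives.
  have hsum : ∀ p : ℂ, 1 + ∑ β, |μ β| < ‖p‖ →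
      HasSum (fun k => ((if k = 0 then 0 else -((k - 1 : ℕ) : ℂ) * (d (k - 1) - e (k - 1))) : ℂ) *
        (p ^ k)⁻¹) 0 := fun p hp => by
    have hp' : ∀ α, |μ α| < ‖p‖ := fun α => (abs_lt_rad μ α).trans hp
    have s1 := (hasLoopInsertion_iff hd).1 (hGW p hp')
    have s2 := (hasLoopInsertion_iff hF).1 (hasLoopInsertion_F1 hμ hreg hp')
    have s3 := s1.sub s2
    rw [heq (mem_offCuts_of_norm hp'), sub_self] at s3
    refine (hasSum_nat_add_iff' 1).1 ?_
    rw [Finset.sum_range_one, if_pos rfl, zero_mul, sub_zero]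
    refine s3.congr_fun fun k => ?_
    rw [if_neg (Nat.succ_ne_zero k), Nat.add_sub_cancel]
    ring
  have h0 := coeff_eq_zero_of_hasSum hsum (j + 1)
  rw [if_neg (Nat.succ_ne_zero j), Nat.add_sub_cancel, mul_eq_zero, neg_eq_zero, Nat.cast_eq_zero] at h0
  have hde : d j = e j := sub_eq_zero.1 (h0.resolve_left (by omega))
  exact ⟨d j, hd j hj, hde ▸ hF j hj⟩

/-- Every point of the family serves as a new base point, and there both functions have the same
derivative in `t_j`. -/
theorem freeEnergy_sub_F1_const {V : ℝ[X]} {μ : BranchPoints g}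
    {G : ℝ[X] → BranchPoints g → ℂ} {j : ℕ} {a b : ℝ} {γ : ℝ → BranchPoints g} (hj : 1 ≤ j)
    (ha : a < 0) (hb : 0 < b) (h0 : γ 0 = μ) (hc : ContinuousOn γ (Set.Ioo a b))
    (h : ∀ ε ∈ Set.Ioo a b, IsPlanarSolution (shift V j ε) (γ ε) ∧ IsRegular (shift V j ε) (γ ε) ∧
      (∀ i, filling (shift V j ε) (γ ε) i = filling V μ i) ∧
      IsGenusOneFreeEnergyAt G (shift V j ε) (γ ε)) :
    ∀ ε ∈ Set.Ioo a b, G (shift V j ε) (γ ε) - F1 (shift V j ε) (γ ε) = G V μ - F1 V μ := by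
  have hder : ∀ ε ∈ Set.Ioo a b,
      HasDerivAt (fun t => G (shift V j t) (γ t) - F1 (shift V j t) (γ t)) 0 ε := fun ε hε => by
    obtain ⟨hpl, hreg, hfill, hG⟩ := h ε hε
    obtain ⟨d, hd1, hd2⟩ := hG.exists_hasCouplingDeriv hpl hreg hj
    have hnhds := isOpen_Ioo.mem_nhds hε
    have htend : Tendsto (fun t : ℝ => ε + t) (𝓝 0) (𝓝 ε) := by
      have : Continuous fun t : ℝ => ε + t := by fun_prop
      simpa using this.tendsto 0
    -- Shifts of a coupling add, so the translated curve is a deformation of the solution at `ε`.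
    have hdef : IsDeformation (shift V j ε) (γ ε) j fun t => γ (ε + t) := by
      refine ⟨by simp, ?_, ?_⟩
      · have h1 : ContinuousAt γ ε := hc.continuousAt hnhds
        have h2 : Tendsto (fun t => γ (ε + t)) (𝓝 0) (𝓝 (γ ε)) := Tendsto.comp h1 htend
        simpa [ContinuousAt] using h2
      · filter_upwards [htend.eventually hnhds] with t ht
        rw [shift_shift]
        obtain ⟨h1, -, h2, -⟩ := h _ ht
        exact ⟨h1, fun i => (h2 i).trans (hfill i).symm⟩
    have h3 := (hd1.2 _ hdef).fun_sub (hd2.2 _ hdef)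
    rw [sub_self] at h3
    simp only [shift_shift] at h3
    have h4 : HasDerivAt (fun t : ℝ => t - ε) 1 ε := (hasDerivAt_id ε).sub_const ε
    have h5 := HasDerivAt.scomp_of_eq (h := fun t : ℝ => t - ε) ε h3 h4 (sub_self ε).symm
    simpa [Function.comp_def] using h5
  intro ε hε
  have hconst := isOpen_Ioo.is_const_of_deriv_eq_zero isPreconnected_Ioo
    (fun t ht => (hder t ht).differentiableAt.differentiableWithinAt)
    (fun t ht => (hder t ht).deriv) hε ⟨ha, hb⟩
  simpa only [h0, shift_zero] using hconst

end MultiCut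

end

theorem mainTheorem1 (g : ℕ) (V : Polynomial ℝ) (μ : MultiCut.BranchPoints g)
    (hμ : MultiCut.IsPlanarSolution V μ) (hreg : MultiCut.IsRegular V μ) :
    -- the argument of the logarithm is a nonzero real, positive if the density is nonnegative
    (∃ x : ℝ, MultiCut.logArg V μ = (x : ℂ) ∧ x ≠ 0 ∧
      ((∀ s ∈ MultiCut.support μ, 0 ≤ MultiCut.density V μ s) → 0 < x)) ∧
    -- the genus-one loop mean exists, is unique, and is the loop insertion of `F1`
    (∃ W : ℂ → ℂ, MultiCut.IsGenusOneLoopMean V μ W ∧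
      (∀ W' : ℂ → ℂ, MultiCut.IsGenusOneLoopMean V μ W' →
        Set.EqOn W' W (MultiCut.offCuts μ)) ∧
      ∀ p : ℂ, (∀ α, |μ α| < ‖p‖) →
        MultiCut.HasLoopInsertion MultiCut.F1 V μ p (W p)) ∧
    -- any other genus-one free energy differs from `F1` by a term that is independent of the
    -- couplings at fixed filling fractions
    (∀ (G : Polynomial ℝ → MultiCut.BranchPoints g → ℂ) (j : ℕ) (a b : ℝ)
      (γ : ℝ → MultiCut.BranchPoints g), 1 ≤ j → a < 0 → 0 < b → γ 0 = μ →
      ContinuousOn γ (Set.Ioo a b) →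
      (∀ ε ∈ Set.Ioo a b,
        MultiCut.IsPlanarSolution (MultiCut.shift V j ε) (γ ε) ∧
        MultiCut.IsRegular (MultiCut.shift V j ε) (γ ε) ∧
        (∀ i, MultiCut.filling (MultiCut.shift V j ε) (γ ε) i = MultiCut.filling V μ i) ∧
        MultiCut.IsGenusOneFreeEnergyAt G (MultiCut.shift V j ε) (γ ε)) →
      ∀ ε ∈ Set.Ioo a b,
        G (MultiCut.shift V j ε) (γ ε) - MultiCut.F1 (MultiCut.shift V j ε) (γ ε) =
          G V μ - MultiCut.F1 V μ) := by
  refine ⟨MultiCut.exists_logArg hμ.1 hreg, ⟨_, MultiCut.isGenusOneLoopMean_meanOf hμ hreg,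
    fun W' hW' => hW'.eqOn hμ hreg, fun p hp => MultiCut.hasLoopInsertion_F1 hμ hreg hp⟩, ?_⟩
  intro G j a b γ hj ha hb h0 hc h
  exact MultiCut.freeEnergy_sub_F1_const hj ha hb h0 hc h
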